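/- **Setting.** Let $d,J,N$ be natural numbers and let $\mathbf L(\mathbf k)$, $\mathbf k\in\mathbb R^d$, be Hermitian $2J\times 2J$ matrices with real eigenvalues $\omega_{n,\zeta}(\mathbf k)$ and unit eigenvectors $\mathbf g_{n,\zeta}(\mathbf k)$, $n=1,\dots,J$, $\zeta=\pm$; write $\omega_n=\omega_{n,+}$. The set $\sigma_{bc}$ of band-crossing points consists of the $\mathbf k$ with $\omega_{n+1,\zeta}(\mathbf k)=\omega_{n,\zeta}(\mathbf k)$ for some $n,\zeta$, or $\omega_{1,\pm}(\mathbf k)=0$ for one of the signs, or at which $\mathbf L$ is discontinuous. Assume that $\sigma_{bc}$ is closed, nowhere dense and Lebesgue null, that $\mathbf L$ is $C^\infty$ off $\sigma_{bc}$ and $\|\mathbf L(\mathbf k)\|\le C(1+|\mathbf k|^p)$, and that off $\sigma_{bc}$: $\omega_{J,+}\ge\dots\ge\omega_{1,+}\ge0\ge\omega_{1,-}\ge\dots\ge\omega_{J,-}$ and $\omega_{n,-\zeta}(-\mathbf k)=-\omega_{n,\zeta}(\mathbf k)$. Let $\mathfrak M\subset\{2,3,\dots\}$ be finite and $$\hat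 F(\hat{\mathbf U})(\mathbf k)=\sum_{m\in\mathfrak M}(2\pi)^{-(m-1)d}\int_{\mathbf k'+\dots+\mathbf k^{(m)}=\mathbf k}\chi^{(m)}(\mathbf k,\mathbf k',\dots,\mathbf k^{(m)})[\hat{\mathbf U}(\mathbf k'),\dots,\hat{\mathbf U}(\mathbf k^{(m)})]\,d\mathbf k'\cdots d\mathbf k^{(m-1)},$$ where the $m$-linear tensors $\chi^{(m)}$ are $C^\infty$ and bounded when none of the arguments is in $\sigma_{bc}$. For $\varrho>0$ and data $\hat{\mathbf h}\in L^1$ consider the integrated evolution equation in $C([0,\tau_*],L^1)$, $$\hat{\mathbf u}(\tau)=\int_0^\tau e^{i\tau'\mathbf L/\varrho}\hat F\big(e^{-i\tau'\mathbf L/\varrho}\hat{\mathbf u}(\tau')\big)\,d\tau'+\hat{\mathbf h}.\tag{1}$$ **Spectrum.** Let $S=\{(n_l,\mathbf k_{*l})\}_{l=1}^N$ consist of distinct pairs. For a string $\lambda=((\zeta_j,l_j))_{j\le m}$ put $\varkappa(\lambda)=\sum_j\zeta_j\mathbf k_{*l_j}$. Assume $\pm\mathbf k_{*l}\notin\sigma_{bc}$,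 $\varkappa(\lambda)\notin\sigma_{bc}$ for all strings of length $m\in\mathfrak M$, and that $S$ is resonance invariant: for such strings, $\zeta\omega_n(\zeta\varkappa(\lambda))=\sum_j\zeta_j\omega_{n_{l_j}}(\mathbf k_{*l_j})$ implies $(n,\zeta\varkappa(\lambda))\in S$. The eigenvectors $\mathbf g_{n_l,\zeta}$ are chosen measurable, and smooth near $\zeta\mathbf k_{*l}$. **Data.** Let $0<\epsilon<1$, $s>0$, $a>s/\epsilon$, and let $\Psi(\mathbf k,\mathbf c)=1$ if $|\mathbf k-\mathbf c|\le\beta^{1-\epsilon}$, and $0$ otherwise. For small $\beta>0$ let $\hat{\mathbf h}=\sum_l(\hat{\mathbf h}_{l,+}+\hat{\mathbf h}_{l,-}+\hat D_l)$ with $\|\hat D_l\|_{L^1}\le C'\beta^s$ and $$\hat{\mathbf h}_{l,\zeta}(\mathbf k)=\Psi(\mathbf k,\zeta\mathbf k_{*l})\,\beta^{-d}\hat H_{l,\zeta}\big(\beta^{-1}(\mathbf k-\zeta\mathbf k_{*l})\big)\,\mathbf g_{n_l,\zeta}(\mathbf k),$$ where the envelopes $\hat H_{l,\zeta}$, which may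 depend on $\beta$, satisfy $\int(1+|\eta|)^a|\hat H_{l,\zeta}(\eta)|\,d\eta\le R$. **Envelope system.** Fix $\mu\le3$ and $\nu\in\{0,1\}$. Let $\gamma_{\mu,l}(v)$ be the Taylor polynomial of order $\mu$ of $v\mapsto\omega_{n_l}(\mathbf k_{*l}+v)$ at $v=0$ and $\Lambda_{l,\vartheta}(\eta)=\vartheta\gamma_{\mu,l}(\vartheta\beta\eta)$. Let $\Lambda^m_{l,\vartheta}$ be the set of strings $\lambda$ of length $m$ with $\varkappa(\lambda)=\vartheta\mathbf k_{*l}$ and $\sum_j\zeta_j\omega_{n_{l_j}}(\mathbf k_{*l_j})=\vartheta\omega_{n_l}(\mathbf k_{*l})$, and for $\lambda\in\Lambda^m_{l,\vartheta}$ let $$Q_\lambda(\mathbf k,\vec k)=\mathbf g_{n_l,\vartheta}(\mathbf k)\cdot\chi^{(m)}(\mathbf k,\vec k)\big[\mathbf g_{n_{l_1},\zeta_1}(\mathbf k'),\dots,\mathbf g_{n_{l_m},\zeta_m}(\mathbf k^{(m)})\big].$$ Let $Q^{(0)}_\lambda$ be the value of $Q_\lambda$ at the centre $(\vartheta\mathbf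 k_{*l},(\zeta_j\mathbf k_{*l_j})_j)$, and $Q^{(1)}_\lambda(\vec\eta)=Q^{(0)}_\lambda+\sum_jq_\lambda^j\cdot\sin(\beta\eta^{(j)})$ (componentwise sine), where $\sum_jq^j_\lambda\cdot\eta^{(j)}$ is the differential of $Q_\lambda$ at the centre in the direction $(\sum_j\eta^{(j)},\vec\eta)$. The time-averaged nonlinearity is $$f_{l,\vartheta}(y)(\eta)=\sum_{m\in\mathfrak M}\sum_{\lambda\in\Lambda^m_{l,\vartheta}}(2\pi)^{-(m-1)d}\int_{\eta'+\dots+\eta^{(m)}=\eta}Q^{(\nu)}_\lambda(\vec\eta)\prod_jy_{l_j,\zeta_j}(\eta^{(j)})\,d\eta'\cdots d\eta^{(m-1)},$$ and the envelope system for the $2N$ scalar functions $\hat z_{l,\vartheta}\in C([0,\tau_*],L^1)$ is $$\hat z_{l,\vartheta}(\tau)=\int_0^\tau e^{i\tau'\Lambda_{l,\vartheta}/\varrho}f_{l,\vartheta}\big(e^{-i\tau'\Lambda/\varrho}\hat z(\tau')\big)\,d\tau'+\hat H_{l,\vartheta},\tag{2}$$ i.e. the system $\partial_\tau y_{l,\vartheta}=-\frac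 i\varrho\vartheta\gamma_{\mu,l}(-i\vartheta\beta\nabla)y_{l,\vartheta}+f_{l,\vartheta}(y)$ written for the Fourier transforms and the slow variables $\hat z=e^{i\tau\Lambda/\varrho}\hat y$. **Theorem.** 1. The nonlinearity is weakly universal: $f_{l,\vartheta}\big((e^{i\zeta\phi_{l'}t}y_{l',\zeta})\big)=e^{i\vartheta\phi_lt}f_{l,\vartheta}(y)$ for $\phi_l=\omega_{n_l}(\mathbf k_{*l})$ and all real $t$. If $\mathfrak M=\{3\}$, $\nu=0$ and $N=1$, then $f_\vartheta$ is the Fourier form of the NLS nonlinearity $b_\vartheta y_\vartheta^2y_{-\vartheta}$. If $\mathfrak M=\{3\}$, $\nu=0$, $N=2$ and $\mathbf k_{*2}=-\mathbf k_{*1}\ne0$, it is the Fourier form of the coupled-mode nonlinearity $f_{l,\vartheta}(y)=(b_{l,\vartheta}\,y_{l,\vartheta}y_{l,-\vartheta}+b'_{l,\vartheta}\,y_{l',\vartheta}y_{l',-\vartheta})y_{l,\vartheta}$, $l'\ne l$. The coefficients do not depend on $\beta$. 2. For every $R>0$ there is $\tau_*>0$, depending only on $R$ and on the equation and $S$, such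 that for all $s,\epsilon,a$ and all data as above and all $\mu\le3$, $\nu\le1$ there are $\beta_0>0$ and $C$, which do not depend on $\beta,\varrho$, such that for $0<\beta\le\beta_0$ and all $\varrho>0$: equation (1) and system (2) have unique solutions $\hat{\mathbf u}$ and $\hat z$ on $[0,\tau_*]$, and, with $$\hat{\mathbf u}_l=\sum_{\zeta=\pm}\Psi(\cdot,\zeta\mathbf k_{*l})\Pi_{n_l,\zeta}\hat{\mathbf u},\qquad \hat{\mathbf v}_l(\tau,\mathbf k)=\sum_{\zeta=\pm}\beta^{-d}\hat z_{l,\zeta}\big(\tau,\beta^{-1}(\mathbf k-\zeta\mathbf k_{*l})\big)\mathbf g_{n_l,\zeta}(\mathbf k),$$ where $\Pi_{n,\zeta}(\mathbf k)$ is the orthogonal projection onto the line of $\mathbf g_{n,\zeta}(\mathbf k)$, both $$\Big\|\hat{\mathbf u}-\sum_{l=1}^N\hat{\mathbf v}_l\Big\|_{C([0,\tau_*],L^1)}\quad\text{and}\quad\sum_{l=1}^N\big\|\hat{\mathbf u}_l-\hat{\mathbf v}_l\big\|_{C([0,\tau_*],L^1)}$$ are at most $$C\Big[\varrho+\frac{\beta^{(\mu+1)(1-\epsilon)}}{\varrho}+\beta^{(\nu+1)(1-\epsilon)}+\beta^s\Big].$$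 -/

import Mathlib

open MeasureTheory Set Filter Topology
open scoped ENNReal

noncomputable section

/-- The space `ℝ^d` of wavevectors. -/
abbrev Wavevec (d : ℕ) : Type := EuclideanSpace ℝ (Fin d)

/-- The space `ℂ^{2J}` of field amplitudes, with its Euclidean norm. -/
abbrev Field2J (J : ℕ) : Type := EuclideanSpace ℂ (Fin (2 * J))

/-- The Lebesgue space `L¹(ℝ^d; F)`. -/
abbrev LOne (d : ℕ) (F : Type) [NormedAddCommGroup F] : Type :=
  Lp F 1 (volume : Measure (Wavevec d))

/-- A sign `ζ = ±` as a real number. -/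
def sgn (ζ : ℤˣ) : ℝ := ((ζ : ℤ) : ℝ)

/-! ### The linear part -/

/-- Band-crossing points of the symbol `L` with dispersion relations `ω n ζ`
(the band with index `0 : Fin J` is the first band). -/
def bandCrossing {d J : ℕ} (L : Wavevec d → (Field2J J →L[ℂ] Field2J J))
    (ω : Fin J → ℤˣ → Wavevec d → ℝ) : Set (Wavevec d) :=
  {k | (∃ (n n' : Fin J) (ζ : ℤˣ), (n' : ℕ) = n + 1 ∧ ω n' ζ k = ω n ζ k) ∨
    ¬ ContinuousAt L k ∨
    ∃ (n : Fin J) (ζ : ℤˣ), (n : ℕ) = 0 ∧ ω n ζ k = 0}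

/-- Conditions on the linear part: `L k` is a Hermitian `2J × 2J` matrix (viewed as an operator on
`ℂ^{2J}`), with eigenvalues `ω n ζ k` and unit eigenvectors `g n ζ k`, smooth away from the
band-crossing set, and polynomially bounded. -/
structure LinearCondition {d J : ℕ} (L : Wavevec d → (Field2J J →L[ℂ] Field2J J))
    (ω : Fin J → ℤˣ → Wavevec d → ℝ) (g : Fin J → ℤˣ → Wavevec d → Field2J J) : Prop where
  hermitian : ∀ k, IsSelfAdjoint (L k)
  eigen : ∀ k ∉ bandCrossing L ω, ∀ n ζ, L k (g n ζ k) = (ω n ζ k : ℂ) • g n ζ k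
  unit : ∀ k ∉ bandCrossing L ω, ∀ n ζ, ‖g n ζ k‖ = 1
  nonneg : ∀ k ∉ bandCrossing L ω, ∀ n, 0 ≤ ω n 1 k
  nonpos : ∀ k ∉ bandCrossing L ω, ∀ n, ω n (-1) k ≤ 0
  ordered_pos : ∀ k ∉ bandCrossing L ω, Monotone fun n => ω n 1 k
  ordered_neg : ∀ k ∉ bandCrossing L ω, Antitone fun n => ω n (-1) k
  symm : ∀ k ∉ bandCrossing L ω, ∀ n ζ, ω n (-ζ) (-k) = -ω n ζ k
  crossing_closed : IsClosed (bandCrossing L ω)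
  crossing_nowhereDense : IsNowhereDense (bandCrossing L ω)
  crossing_null : volume (bandCrossing L ω) = 0
  smooth : ContDiffOn ℝ (⊤ : ℕ∞) L (bandCrossing L ω)ᶜ
  poly_bound : ∃ C > 0, ∃ p > 0, ∀ k, ‖L k‖ ≤ C * (1 + ‖k‖ ^ (p : ℝ))

/-! ### The nonlinear part -/

/-- The `m` frequencies `(q', …, q^{(m-1)}, k - q' - … - q^{(m-1)})` of a convolution. -/
def convFreqs {d : ℕ} (m : ℕ) (k : Wavevec d) (q : Fin (m - 1) → Wavevec d) :
    Fin m → Wavevec d :=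
  fun i => if h : (i : ℕ) < m - 1 then q ⟨i, h⟩ else k - ∑ j, q j

/-- The normalizing factor `(2π)^{-(m-1)d}` of an `m`-fold convolution. -/
def convFactor (d m : ℕ) : ℝ := ((2 * Real.pi) ^ ((m - 1) * d))⁻¹

/-- Conditions on the nonlinearity: finitely many degrees `m ≥ 2`, and `m`-linear susceptibilities
`χ m` which are smooth and bounded away from the set `σ` of band-crossing points. -/
structure NonlinearCondition {d J : ℕ} (σ : Set (Wavevec d)) (M : Finset ℕ)
    (χ : (m : ℕ) → Wavevec d → (Fin m → Wavevec d) →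
      ContinuousMultilinearMap ℂ (fun _ : Fin m => Field2J J) (Field2J J)) : Prop where
  two_le : ∀ m ∈ M, 2 ≤ m
  smooth : ∀ m ∈ M, ContDiffOn ℝ (⊤ : ℕ∞) (fun p : Wavevec d × (Fin m → Wavevec d) => χ m p.1 p.2)
    {p | p.1 ∉ σ ∧ ∀ i, p.2 i ∉ σ}
  bounded : ∃ C, ∀ m ∈ M, ∀ k κ, k ∉ σ → (∀ i, κ i ∉ σ) → ‖χ m k κ‖ ≤ C

/-- The polynomial nonlinearity `F̂(U)(k)`, a finite sum of `m`-fold convolutions. -/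
def nonlinearity {d J : ℕ} (M : Finset ℕ)
    (χ : (m : ℕ) → Wavevec d → (Fin m → Wavevec d) →
      ContinuousMultilinearMap ℂ (fun _ : Fin m => Field2J J) (Field2J J))
    (U : Wavevec d → Field2J J) (k : Wavevec d) : Field2J J :=
  ∑ m ∈ M, convFactor d m •
    ∫ q : Fin (m - 1) → Wavevec d,
      χ m k (convFreqs m k q) (fun i => U (convFreqs m k q i))

/-- The unitary propagator `e^{i t L(k)}`. -/
def propagator {d J : ℕ} (L : Wavevec d → (Field2J J →L[ℂ] Field2J J)) (t : ℝ) (k : Wavevec d) :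
    Field2J J →L[ℂ] Field2J J :=
  NormedSpace.exp ((Complex.I * (t : ℂ)) • L k)

/-- `u ∈ C([0,T], L¹)` solves the integrated evolution equation for the slow variable
`u(τ) = ∫₀^τ e^{iτ'L/ϱ} F̂(e^{-iτ'L/ϱ} u(τ')) dτ' + h`, where `G τ'` is the integrand. -/
def IsSolution {d J : ℕ} (L : Wavevec d → (Field2J J →L[ℂ] Field2J J)) (M : Finset ℕ)
    (χ : (m : ℕ) → Wavevec d → (Fin m → Wavevec d) →
      ContinuousMultilinearMap ℂ (fun _ : Fin m => Field2J J) (Field2J J))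
    (ϱ T : ℝ) (h : LOne d (Field2J J)) (u : ℝ → LOne d (Field2J J)) : Prop :=
  ContinuousOn u (Icc 0 T) ∧
  ∃ G : ℝ → LOne d (Field2J J), ContinuousOn G (Icc 0 T) ∧
    (∀ τ ∈ Icc 0 T, G τ =ᵐ[volume] fun k =>
      propagator L (τ / ϱ) k
        (nonlinearity M χ (fun k' => propagator L (-(τ / ϱ)) k' (u τ k')) k)) ∧
    ∀ τ ∈ Icc 0 T, u τ = (∫ t in (0 : ℝ)..τ, G t) + h

/-! ### The nk-spectrum -/

/-- Resonance invariance of the `nk`-spectrum `{(n l, κ l)}`: whenever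
`ζ ω_{n₀}(ζ ϰ) = ∑ⱼ ζⱼ ω_{n_{lⱼ}}(κ_{lⱼ})` with `ϰ = ∑ⱼ ζⱼ κ_{lⱼ}`,
the pair `(n₀, ζ ϰ)` belongs to the spectrum. Here `ω_n = ω_{n,+}`. -/
def ResonanceInvariant {d J N : ℕ} (ω : Fin J → ℤˣ → Wavevec d → ℝ) (M : Finset ℕ)
    (n : Fin N → Fin J) (κ : Fin N → Wavevec d) : Prop :=
  ∀ m ∈ M, ∀ (ζ : ℤˣ) (n₀ : Fin J) (lam : Fin m → Fin N × ℤˣ),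
    -(sgn ζ * ω n₀ 1 (sgn ζ • ∑ j, sgn (lam j).2 • κ (lam j).1)) +
        ∑ j, sgn (lam j).2 * ω (n (lam j).1) 1 (κ (lam j).1) = 0 →
      ∃ l, n l = n₀ ∧ κ l = sgn ζ • ∑ j, sgn (lam j).2 • κ (lam j).1

/-- Standing assumptions on the `nk`-spectrum `S = {(n l, κ l)}` of the initial data: its elements
are distinct, it and its output `k`-spectrum avoid band-crossing points, it is resonance invariant,
and the (measurable) eigenvectors are chosen to depend smoothly on `k` near the points `±κ l`. -/
structure SpectrumCondition {d J N : ℕ} (L : Wavevec d → (Field2J J →L[ℂ] Field2J J))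
    (ω : Fin J → ℤˣ → Wavevec d → ℝ) (g : Fin J → ℤˣ → Wavevec d → Field2J J) (M : Finset ℕ)
    (n : Fin N → Fin J) (κ : Fin N → Wavevec d) : Prop where
  distinct : Function.Injective fun l => (n l, κ l)
  noncrossing : ∀ l (ζ : ℤˣ), sgn ζ • κ l ∉ bandCrossing L ω
  output_noncrossing : ∀ m ∈ M, ∀ lam : Fin m → Fin N × ℤˣ,
    ∑ j, sgn (lam j).2 • κ (lam j).1 ∉ bandCrossing L ω
  resonance : ResonanceInvariant ω M n κ
  eigenvector_meas : ∀ l ζ, AEStronglyMeasurable (g (n l) ζ) volume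
  eigenvector_smooth : ∀ l ζ, ContDiffAt ℝ (⊤ : ℕ∞) (g (n l) ζ) (sgn ζ • κ l)

/-! ### Wavepacket initial data -/

/-- The cutoff `Ψ(k, c) = Ψ(β^{-(1-ε)} (k - c))`, where `Ψ` is the indicator of the unit ball. -/
def cutoff {d : ℕ} (β ε : ℝ) (c k : Wavevec d) : ℝ :=
  if ‖(β ^ (1 - ε))⁻¹ • (k - c)‖ ≤ 1 then 1 else 0

/-- `β^{-d} f(β^{-1}(k - c))`. -/
def rescale {d : ℕ} (β : ℝ) (c : Wavevec d) (f : Wavevec d → ℂ) (k : Wavevec d) : ℂ :=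
  (((β ^ d)⁻¹ : ℝ) : ℂ) * f (β⁻¹ • (k - c))

/-- The norm of the weighted space `L^{1,a}`. -/
def weightedNorm {d : ℕ} (a : ℝ) (f : Wavevec d → ℂ) : ℝ≥0∞ :=
  ∫⁻ η, ENNReal.ofReal ((1 + ‖η‖) ^ a) * ‖f η‖ₑ

/-- The multi-wavepacket initial data `h(β) = ∑_l (h_{l,+} + h_{l,-} + D_l)`: the parts `h_{l,ζ}`
are equal to `β^{-d} H_{l,ζ}(β^{-1}(k - ζ κ_l)) g_{n_l,ζ}(k)` for `|k - ζ κ_l| ≤ β^{1-ε}` and vanish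
elsewhere, the envelopes `H_{l,ζ}` (which may depend on `β`) are bounded by `R` in `L^{1,a}`
uniformly in `β`, and the tails satisfy `‖D_l‖ ≤ C' β^s` in `L¹`. -/
def IsWavepacketData {d J N : ℕ} (g : Fin J → ℤˣ → Wavevec d → Field2J J)
    (n : Fin N → Fin J) (κ : Fin N → Wavevec d) (s ε a R : ℝ)
    (H : ℝ → Fin N → ℤˣ → LOne d ℂ) (h : ℝ → LOne d (Field2J J)) : Prop :=
  ∃ β₁ > 0, ∃ (D : ℝ → Fin N → LOne d (Field2J J)) (C' : ℝ), ∀ β, 0 < β → β < β₁ →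
    (∀ l ζ, weightedNorm a (H β l ζ) ≤ ENNReal.ofReal R) ∧
    (∀ l, ‖D β l‖ ≤ C' * β ^ s) ∧
    h β =ᵐ[volume] fun k => ∑ l, ((∑ ζ : ℤˣ, cutoff β ε (sgn ζ • κ l) k •
      rescale β (sgn ζ • κ l) (H β l ζ) k • g (n l) ζ k) + D β l k)

/-! ### The envelope system -/

/-- The Taylor polynomial of order `μ` of `f` at `c`, evaluated at the increment `v`. -/
def taylorPoly {d : ℕ} (μ : ℕ) (f : Wavevec d → ℝ) (c v : Wavevec d) : ℝ :=
  ∑ j ∈ Finset.range (μ + 1), ((j.factorial : ℝ))⁻¹ * iteratedFDeriv ℝ j f c (fun _ => v)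

/-- The polynomial dispersion `ϑ γ_μ(κ_l, n_l, ϑ β η)` of the component `(l, ϑ)`, where `γ_μ` is the
Taylor polynomial of `ω_{n_l}` at `κ_l`. It is the symbol of the differential operator
`ϑ γ_μ(κ_l, n_l, -i ϑ β ∇)` of order at most `μ`. -/
def envelopeSymbol {d J N : ℕ} (ω : Fin J → ℤˣ → Wavevec d → ℝ) (n : Fin N → Fin J)
    (κ : Fin N → Wavevec d) (μ : ℕ) (β : ℝ) (l : Fin N) (ϑ : ℤˣ) (η : Wavevec d) : ℝ :=
  sgn ϑ * taylorPoly μ (ω (n l) 1) (κ l) ((sgn ϑ * β) • η)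

open Classical in
/-- The strings `λ` in resonance with the component `(l, ϑ)`: `∑ⱼ ζⱼ κ_{lⱼ} = ϑ κ_l` and
`∑ⱼ ζⱼ ω_{n_{lⱼ}}(κ_{lⱼ}) = ϑ ω_{n_l}(κ_l)`. These are the terms which survive time averaging. -/
def resonantStrings {d J N : ℕ} (ω : Fin J → ℤˣ → Wavevec d → ℝ) (n : Fin N → Fin J)
    (κ : Fin N → Wavevec d) (l : Fin N) (ϑ : ℤˣ) (m : ℕ) : Finset (Fin m → Fin N × ℤˣ) :=
  Finset.univ.filter fun lam =>
    ∑ j, sgn (lam j).2 • κ (lam j).1 = sgn ϑ • κ l ∧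
    ∑ j, sgn (lam j).2 * ω (n (lam j).1) 1 (κ (lam j).1) = sgn ϑ * ω (n l) 1 (κ l)

/-- The scalar susceptibility
`Q(k, k', …) = g_{n_l,ϑ}(k) · χ^{(m)}(k, k', …)[g_{λ₁}(k'), …, g_{λ_m}(k^{(m)})]`. -/
def scalarSusceptibility {d J N : ℕ} (g : Fin J → ℤˣ → Wavevec d → Field2J J)
    (χ : (m : ℕ) → Wavevec d → (Fin m → Wavevec d) →
      ContinuousMultilinearMap ℂ (fun _ : Fin m => Field2J J) (Field2J J))
    (n : Fin N → Fin J) (l : Fin N) (ϑ : ℤˣ) {m : ℕ} (lam : Fin m → Fin N × ℤˣ)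
    (p : Wavevec d × (Fin m → Wavevec d)) : ℂ :=
  inner ℂ (g (n l) ϑ p.1) (χ m p.1 p.2 fun i => g (n (lam i).1) (lam i).2 (p.2 i))

/-- The approximation of order `ν ∈ {0, 1}` of `Q(ϑ κ_l + β η, …, ζᵢ κ_{lᵢ} + β η^{(i)}, …)` with
`η = ∑ᵢ η^{(i)}`: the value `Q(ϑ κ_l, …, ζᵢ κ_{lᵢ}, …)` at the centres, plus, if `ν = 1`, the sum of
`q^{j} · sin(β η^{(j)})` over `j`, where `∑ⱼ q^{j} · η^{(j)}` is the differential of `Q` there. -/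
def approxSusceptibility {d J N : ℕ} (g : Fin J → ℤˣ → Wavevec d → Field2J J)
    (χ : (m : ℕ) → Wavevec d → (Fin m → Wavevec d) →
      ContinuousMultilinearMap ℂ (fun _ : Fin m => Field2J J) (Field2J J))
    (n : Fin N → Fin J) (κ : Fin N → Wavevec d) (ν : ℕ) (β : ℝ) (l : Fin N) (ϑ : ℤˣ) {m : ℕ}
    (lam : Fin m → Fin N × ℤˣ) (η : Fin m → Wavevec d) : ℂ :=
  let centre : Wavevec d × (Fin m → Wavevec d) :=
    (sgn ϑ • κ l, fun i => sgn (lam i).2 • κ (lam i).1)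
  scalarSusceptibility g χ n l ϑ lam centre +
    if ν = 0 then 0 else ∑ j : Fin m, ∑ i : Fin d, (Real.sin (β * η j i) : ℂ) *
      fderiv ℝ (scalarSusceptibility g χ n l ϑ lam) centre
        (EuclideanSpace.single i 1, Pi.single j (EuclideanSpace.single i 1))

/-- The time-averaged nonlinearity of the envelope system, component `(l, ϑ)`, in Fourier form.
Multiplication of a factor by `sin(β η_i)` is a finite difference with step `β` in the direction
`e_i`, and the convolution is the Fourier transform of a product. -/
def envelopeNonlinearity {d J N : ℕ} (ω : Fin J → ℤˣ → Wavevec d → ℝ)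
    (g : Fin J → ℤˣ → Wavevec d → Field2J J) (M : Finset ℕ)
    (χ : (m : ℕ) → Wavevec d → (Fin m → Wavevec d) →
      ContinuousMultilinearMap ℂ (fun _ : Fin m => Field2J J) (Field2J J))
    (n : Fin N → Fin J) (κ : Fin N → Wavevec d) (ν : ℕ) (β : ℝ)
    (y : Fin N → ℤˣ → Wavevec d → ℂ) (l : Fin N) (ϑ : ℤˣ) (η : Wavevec d) : ℂ :=
  ∑ m ∈ M, ∑ lam ∈ resonantStrings ω n κ l ϑ m, (convFactor d m : ℂ) *
    ∫ q : Fin (m - 1) → Wavevec d,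
      approxSusceptibility g χ n κ ν β l ϑ lam (convFreqs m η q) *
        ∏ i, y (lam i).1 (lam i).2 (convFreqs m η q i)

/-- `z ∈ C([0,T], L¹)^{2N}` solves the envelope system, in the integrated form for the slow
variables `z = e^{iτΛ/ϱ} y`, with initial data `H`. Here `Λ` is the polynomial dispersion, and
`y_{l,ϑ}` are the Fourier transforms of the envelopes, governed by the system
`∂_τ y_{l,ϑ} = -(i/ϱ) ϑ γ_μ(κ_l, n_l, -iϑβ∇) y_{l,ϑ} + f_{l,ϑ}(y)` with `f` the time-averaged
nonlinearity. -/
def IsEnvelopeSolution {d J N : ℕ} (ω : Fin J → ℤˣ → Wavevec d → ℝ)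
    (g : Fin J → ℤˣ → Wavevec d → Field2J J) (M : Finset ℕ)
    (χ : (m : ℕ) → Wavevec d → (Fin m → Wavevec d) →
      ContinuousMultilinearMap ℂ (fun _ : Fin m => Field2J J) (Field2J J))
    (n : Fin N → Fin J) (κ : Fin N → Wavevec d) (μ ν : ℕ) (β ϱ T : ℝ)
    (H : Fin N → ℤˣ → LOne d ℂ) (z : Fin N → ℤˣ → ℝ → LOne d ℂ) : Prop :=
  ∀ l ϑ, ContinuousOn (z l ϑ) (Icc 0 T) ∧
  ∃ G : ℝ → LOne d ℂ, ContinuousOn G (Icc 0 T) ∧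
    (∀ τ ∈ Icc 0 T, G τ =ᵐ[volume] fun η =>
      Complex.exp (Complex.I * ((τ / ϱ * envelopeSymbol ω n κ μ β l ϑ η : ℝ) : ℂ)) *
        envelopeNonlinearity ω g M χ n κ ν β
          (fun l' ζ η' =>
            Complex.exp (-Complex.I * ((τ / ϱ * envelopeSymbol ω n κ μ β l' ζ η' : ℝ) : ℂ)) *
              z l' ζ τ η') l ϑ η) ∧
    ∀ τ ∈ Icc 0 T, z l ϑ τ = (∫ t in (0 : ℝ)..τ, G t) + H l ϑ

/-- A nonlinearity acting on `2N` amplitudes is weakly universal for the frequencies `φ`. -/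
def WeaklyUniversal {d N : ℕ} (φ : Fin N → ℝ)
    (f : (Fin N → ℤˣ → Wavevec d → ℂ) → Fin N → ℤˣ → Wavevec d → ℂ) : Prop :=
  ∀ (t : ℝ) (y : Fin N → ℤˣ → Wavevec d → ℂ) (l : Fin N) (ϑ : ℤˣ) (η : Wavevec d),
    f (fun l' ζ η' => Complex.exp (Complex.I * ((sgn ζ * φ l' * t : ℝ) : ℂ)) * y l' ζ η') l ϑ η =
      Complex.exp (Complex.I * ((sgn ϑ * φ l * t : ℝ) : ℂ)) * f y l ϑ η

/-- The normalized triple convolution: the Fourier transform of a product of three functions. -/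
def tripleConv {d : ℕ} (u v w : Wavevec d → ℂ) (η : Wavevec d) : ℂ :=
  (convFactor d 3 : ℂ) * ∫ q : Fin 2 → Wavevec d, u (q 0) * v (q 1) * w (η - q 0 - q 1)

/-! ### The approximation -/

/-- The norm of `C([0,T], L¹)`. -/
def normE {d J : ℕ} (T : ℝ) (f : ℝ → Wavevec d → Field2J J) : ℝ≥0∞ :=
  ⨆ τ ∈ Icc 0 T, ∫⁻ k, ‖f τ k‖ₑ

/-- The approximate wavepacket `∑_ζ β^{-d} z_{l,ζ}(τ, β^{-1}(k - ζ κ_l)) g_{n_l,ζ}(k)`. -/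
def envelopeWave {d J N : ℕ} (g : Fin J → ℤˣ → Wavevec d → Field2J J) (n : Fin N → Fin J)
    (κ : Fin N → Wavevec d) (β : ℝ) (z : Fin N → ℤˣ → ℝ → LOne d ℂ) (l : Fin N) (τ : ℝ)
    (k : Wavevec d) : Field2J J :=
  ∑ ζ : ℤˣ, rescale β (sgn ζ • κ l) (z l ζ τ) k • g (n l) ζ k

/-- The wavepacket component `u_l = ∑_ζ Ψ(k, ζ κ_l) Π_{n_l,ζ}(k) u` of a field, where
`Π_{n,ζ}(k)` is the orthogonal projection onto the line of `g_{n,ζ}(k)`. -/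
def wavepacketPart {d J N : ℕ} (g : Fin J → ℤˣ → Wavevec d → Field2J J) (n : Fin N → Fin J)
    (κ : Fin N → Wavevec d) (β ε : ℝ) (l : Fin N) (u : Wavevec d → Field2J J) (k : Wavevec d) :
    Field2J J :=
  ∑ ζ : ℤˣ, cutoff β ε (sgn ζ • κ l) k • (inner ℂ (g (n l) ζ k) (u k)) • g (n l) ζ k

/-- The error `ϱ + β^{(μ+1)(1-ε)}/ϱ + β^{(ν+1)(1-ε)} + β^s`. -/
def errorRate (μ ν : ℕ) (s ε β ϱ : ℝ) : ℝ :=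
  ϱ + β ^ (((μ : ℝ) + 1) * (1 - ε)) / ϱ + β ^ (((ν : ℝ) + 1) * (1 - ε)) + β ^ s

end

/-! The envelope solution, assembled into a field by `waveOp`, is treated as an approximate solution
of (1). In slow variables both equations read $x(t)=\int_0^t V(s,x(s))\,ds+h$ in a space of $L^1$
type, where $V$ is a polynomial map conjugated by a group of contractions
(`BallRegular.isRegularField`). Bounds and Lipschitz constants of $V$ on balls depend neither on
$\varrho$ nor on $\beta$, so Picard iteration works on a time $T$ determined by $R$, and
`gronwall_stability` reduces the approximation to smallness of the time integral of the residual.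
The residual itself need not be small, since it contains oscillating terms of order one.

Both fields are finite sums over strings $\lambda$ of fibre integrals of a kernel against the tensor
product of the rescaled envelopes (`fieldVF_waveOp`, `waveOp_envelopeVF`), so kernels are compared
string by string. Since modes are eigenvectors, the field kernel is $e^{i\tau A}w$ with
$\tau=t/\varrho$, where $w$ is the value of $\chi^{(m)}$ on the modes and $A(k)=L(\sum_j
k_j)-\sum_j\omega(k_j)$ is the detuning operator (`fieldKernel_eq_expI`). Let $P$ be the projection
onto the mode in resonance with $\lambda$, or $0$ if there is none. At the centre of the string,
resonance invariance and simplicity of the bands say that the range of $P$ is exactly the null space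
of $A$. Hence $A+P$ is invertible there (`isUnit_stringOp_center`) and, by continuity, nearby.

On the complement of $P$ the oscillation $e^{i\tau A}w$ has a bounded antiderivative in $\tau$, and
integration by parts in time gives $O(\varrho)$ (`norm_integral_oscillatory_le`). On the range of
$P$ the kernel is a scalar phase times $Q_\lambda$. At distance at most $r=\beta^{1-\epsilon}$ from
the centre, replacing the dispersion relations by Taylor polynomials costs
$|\tau|r^{\mu+1}\le(T/\varrho)\,r^{\mu+1}$, and replacing $Q_\lambda$ costs $r^{\nu+1}$
(`exists_kernel_bound`). Summation over strings gives `exists_residual_bound`.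

These estimates are local, so the envelopes are truncated to $|\eta|\le\beta^{-\epsilon}$. The loss
is $O(\beta^s)$, because the weighted norm of $L^{1,a}$ propagates by a linear Grönwall inequality
and $\epsilon a>s$ (`exists_tail_bound`). The separate components are recovered by cutoffs and
projections: different centres are eventually further apart than the cutoffs reach, and modes with a
common centre are orthogonal (`norm_cutoff_inner_sub_le`).

Weak universality holds because the phases along a resonant string multiply to the phase of the
output. The cubic normal forms follow from a count of signs, which the two resonance conditions and
the positivity of $\omega$ determine, together with the symmetry of the triple convolution
(`tripleConv_pattern`). -/

noncomputable section
set_option linter.unusedSectionVars false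

namespace Wavepacket

/-! ### Bounded operators and multipliers on $L^1$. -/

section Operators

variable {α β : Type*} [MeasurableSpace α] [MeasurableSpace β] {μ : Measure α} {ν : Measure β}
  {E F G : Type*} [NormedAddCommGroup E] [NormedSpace ℂ E] [NormedAddCommGroup F] [NormedSpace ℂ F]
  [NormedAddCommGroup G] [NormedSpace ℂ G]

/-- A map on functions which induces a bounded linear operator between `L¹` spaces. -/
structure IsL1Bounded (μ : Measure α) (ν : Measure β) (T : (α → E) → β → F) (C : ℝ) : Prop where
  integrable : ∀ f, Integrable f μ → Integrable (T f) ν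
  bound : ∀ f, Integrable f μ → ∫ x, ‖T f x‖ ∂ν ≤ C * ∫ x, ‖f x‖ ∂μ
  add : ∀ f g, Integrable f μ → Integrable g μ → T (f + g) =ᵐ[ν] T f + T g
  smul : ∀ (c : ℂ) f, Integrable f μ → T (c • f) =ᵐ[ν] c • T f

/-- The bound forces `T` to vanish almost everywhere on null functions, and additivity carries this
over to differences. This makes `T` well defined on classes. -/
theorem IsL1Bounded.congr {T : (α → E) → β → F} {C : ℝ} (h : IsL1Bounded μ ν T C) {f g : α → E}
    (hf : Integrable f μ) (hg : Integrable g μ) (hfg : f =ᵐ[μ] g) : T f =ᵐ[ν] T g := by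
  have h1 := h.add g (f - g) hg (hf.sub hg)
  have h0 := h.bound (f - g) (hf.sub hg)
  have hz : ∫ x, ‖(f - g) x‖ ∂μ = 0 := by
    rw [integral_eq_zero_iff_of_nonneg (fun _ => norm_nonneg _) (hf.sub hg).norm]
    filter_upwards [hfg] with x hx
    simp [hx]
  rw [hz, mul_zero] at h0
  have h2 := le_antisymm h0 (integral_nonneg fun _ => norm_nonneg _)
  rw [integral_eq_zero_iff_of_nonneg (fun _ => norm_nonneg _)
    (h.integrable _ (hf.sub hg)).norm] at h2
  have h3 : g + (f - g) = f := by simp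
  rw [h3] at h1
  filter_upwards [h1, h2] with x h1 h2
  have : T (f - g) x = 0 := by simpa using h2
  simp [h1, this]

/-- The bounded operator on `L¹` induced by a map on functions. -/
def l1Op (T : (α → E) → β → F) (C : ℝ) (h : IsL1Bounded μ ν T C) : Lp E 1 μ →L[ℂ] Lp F 1 ν :=
  LinearMap.mkContinuous
    { toFun := fun f => (h.integrable f (L1.integrable_coeFn f)).toL1 (T f)
      map_add' := by
        intro f g
        apply Lp.ext
        refine (Integrable.coeFn_toL1 _).trans ?_
        have hf := L1.integrable_coeFn f
        have hg := L1.integrable_coeFn g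
        have h1 := h.congr (L1.integrable_coeFn (f + g)) (hf.add hg) (Lp.coeFn_add f g)
        filter_upwards [h1, h.add _ _ hf hg, Integrable.coeFn_toL1 (h.integrable f hf),
          Integrable.coeFn_toL1 (h.integrable g hg), Lp.coeFn_add
            ((h.integrable f hf).toL1 (T f)) ((h.integrable g hg).toL1 (T g))] with x a b c d e
        rw [a, b, e, Pi.add_apply, Pi.add_apply, c, d]
      map_smul' := by
        intro r f
        apply Lp.ext
        refine (Integrable.coeFn_toL1 _).trans ?_
        have hf := L1.integrable_coeFn f
        have h1 := h.congr (L1.integrable_coeFn (r • f)) (hf.smul r) (Lp.coeFn_smul r f)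
        filter_upwards [h1, h.smul r _ hf, Integrable.coeFn_toL1 (h.integrable f hf),
          Lp.coeFn_smul r ((h.integrable f hf).toL1 (T f))] with x a b c e
        simp only [RingHom.id_apply]
        rw [a, b, e, Pi.smul_apply, Pi.smul_apply, c] }
    C (by
      intro f
      simp only [LinearMap.coe_mk, AddHom.coe_mk]
      rw [L1.norm_eq_integral_norm, L1.norm_eq_integral_norm]
      refine le_trans (le_of_eq ?_) (h.bound f (L1.integrable_coeFn f))
      refine integral_congr_ae ?_
      filter_upwards [Integrable.coeFn_toL1 (h.integrable f (L1.integrable_coeFn f))] with x hx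
      rw [hx])

theorem l1Op_coe {T : (α → E) → β → F} {C : ℝ} (h : IsL1Bounded μ ν T C) (f : Lp E 1 μ) :
    l1Op T C h f =ᵐ[ν] T f :=
  Integrable.coeFn_toL1 (h.integrable f (L1.integrable_coeFn f))

theorem norm_l1Op_apply_le {T : (α → E) → β → F} {C : ℝ} (h : IsL1Bounded μ ν T C) (f : Lp E 1 μ) :
    ‖l1Op T C h f‖ ≤ C * ‖f‖ := by
  rw [L1.norm_eq_integral_norm, L1.norm_eq_integral_norm]
  refine le_trans (le_of_eq ?_) (h.bound f (L1.integrable_coeFn f))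
  refine integral_congr_ae ?_
  filter_upwards [l1Op_coe h f] with x hx
  rw [hx]

theorem l1_norm_le_of_ae_le {f : Lp E 1 μ} {g : Lp F 1 μ} {C : ℝ}
    (h : ∀ᵐ x ∂μ, ‖f x‖ ≤ C * ‖g x‖) : ‖f‖ ≤ C * ‖g‖ := by
  rw [L1.norm_eq_integral_norm, L1.norm_eq_integral_norm, ← integral_const_mul]
  exact integral_mono_ae (L1.integrable_coeFn f).norm
    ((L1.integrable_coeFn g).norm.const_mul C) h

/-- Measurable and essentially bounded functions. -/
def EssBdd (φ : α → E) (μ : Measure α) : Prop :=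
  AEStronglyMeasurable φ μ ∧ ∃ C, ∀ᵐ x ∂μ, ‖φ x‖ ≤ C

theorem EssBdd.add {φ ψ : α → E} (h : EssBdd φ μ) (h' : EssBdd ψ μ) :
    EssBdd (fun x => φ x + ψ x) μ := by
  obtain ⟨h1, C, hC⟩ := h
  obtain ⟨h2, D, hD⟩ := h'
  refine ⟨h1.add h2, C + D, ?_⟩
  filter_upwards [hC, hD] with x a b
  exact (norm_add_le _ _).trans (add_le_add a b)

theorem EssBdd.sub {φ ψ : α → E} (h : EssBdd φ μ) (h' : EssBdd ψ μ) :
    EssBdd (fun x => φ x - ψ x) μ := by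
  obtain ⟨h1, C, hC⟩ := h
  obtain ⟨h2, D, hD⟩ := h'
  refine ⟨h1.sub h2, C + D, ?_⟩
  filter_upwards [hC, hD] with x a b
  exact (norm_sub_le _ _).trans (add_le_add a b)

theorem EssBdd.sum {ι : Type*} {s : Finset ι} {φ : ι → α → E} (h : ∀ i ∈ s, EssBdd (φ i) μ) :
    EssBdd (fun x => ∑ i ∈ s, φ i x) μ := by
  classical
  induction s using Finset.induction_on with
  | empty => exact ⟨by simpa using aestronglyMeasurable_const, 0, by simp⟩
  | insert a s ha ih =>
    have := (h a (by simp)).add (ih fun i hi => h i (by simp [hi]))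
    simpa [Finset.sum_insert ha] using this

theorem EssBdd.const_smul {φ : α → E} (h : EssBdd φ μ) (c : ℂ) :
    EssBdd (fun x => c • φ x) μ := by
  obtain ⟨h1, C, hC⟩ := h
  refine ⟨h1.const_smul c, ‖c‖ * C, ?_⟩
  filter_upwards [hC] with x a
  rw [norm_smul]
  gcongr

theorem EssBdd.clm_apply {φ : α → E →L[ℂ] F} {ψ : α → E} (h : EssBdd φ μ) (h' : EssBdd ψ μ) :
    EssBdd (fun x => φ x (ψ x)) μ := by
  obtain ⟨h1, C, hC⟩ := h
  obtain ⟨h2, D, hD⟩ := h'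
  refine ⟨(ContinuousLinearMap.apply ℂ F : E →L[ℂ] _).flip.aestronglyMeasurable_comp₂ h1 h2, C * D, ?_⟩
  filter_upwards [hC, hD] with x a b
  refine ((φ x).le_opNorm _).trans ?_
  have := norm_nonneg (φ x)
  gcongr
  linarith

theorem isL1Bounded_mul {φ : α → E →L[ℂ] F} (hφ : AEStronglyMeasurable φ μ) {C : ℝ}
    (hC : ∀ᵐ x ∂μ, ‖φ x‖ ≤ C) : IsL1Bounded μ μ (fun (f : α → E) x => φ x (f x)) C := by
  have hle : ∀ f : α → E, ∀ᵐ x ∂μ, ‖φ x (f x)‖ ≤ C * ‖f x‖ := fun f => by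
    filter_upwards [hC] with x hx
    exact ((φ x).le_opNorm _).trans (by gcongr)
  have hint : ∀ f, Integrable f μ → Integrable (fun x => φ x (f x)) μ := fun f hf =>
    (hf.norm.const_mul C).mono'
      ((ContinuousLinearMap.apply ℂ F : E →L[ℂ] _).flip.aestronglyMeasurable_comp₂ hφ hf.1) (hle f)
  refine ⟨hint, fun f hf => ?_, fun f g _ _ => ?_, fun c f _ => ?_⟩
  · rw [← integral_const_mul]
    exact integral_mono_ae (hint f hf).norm (hf.norm.const_mul C) (hle f)
  · exact Eventually.of_forall fun x => by simp
  · exact Eventually.of_forall fun x => by simp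

open Classical in
/-- Multiplication by a measurable, essentially bounded, operator-valued function on `L¹`. -/
def mulOp (μ : Measure α) (φ : α → E →L[ℂ] F) : Lp E 1 μ →L[ℂ] Lp F 1 μ :=
  -- The value `0` for other multipliers makes the operator total; the norm estimates below hold in
  -- both branches.
  if h : EssBdd φ μ then l1Op _ _ (isL1Bounded_mul h.1 h.2.choose_spec) else 0

theorem mulOp_coe {φ : α → E →L[ℂ] F} (h : EssBdd φ μ) (f : Lp E 1 μ) :
    mulOp μ φ f =ᵐ[μ] fun x => φ x (f x) := by
  rw [mulOp, dif_pos h]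
  exact l1Op_coe _ f

/-- The multiplier has to be controlled only where `f` lives. Kernels that are known only near the
centre of a string can thus act on truncated envelopes. -/
theorem norm_mulOp_apply_le_of_ae {φ : α → E →L[ℂ] F} {f : Lp E 1 μ} {C : ℝ} (hC0 : 0 ≤ C)
    (hC : ∀ᵐ x ∂μ, f x ≠ 0 → ‖φ x‖ ≤ C) : ‖mulOp μ φ f‖ ≤ C * ‖f‖ := by
  by_cases h : EssBdd φ μ
  · apply l1_norm_le_of_ae_le
    filter_upwards [mulOp_coe h f, hC] with x h1 h2
    rw [h1]
    by_cases hx : f x = 0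
    · simp [hx]
    · exact ((φ x).le_opNorm _).trans (by gcongr; exact h2 hx)
  · rw [mulOp, dif_neg h]
    simp only [zero_apply, norm_zero]
    positivity

theorem norm_mulOp_apply_le {φ : α → E →L[ℂ] F} {C : ℝ} (hC0 : 0 ≤ C)
    (hC : ∀ᵐ x ∂μ, ‖φ x‖ ≤ C) (f : Lp E 1 μ) : ‖mulOp μ φ f‖ ≤ C * ‖f‖ :=
  norm_mulOp_apply_le_of_ae hC0 (hC.mono fun _ h _ => h)

theorem norm_mulOp_le {φ : α → E →L[ℂ] F} {C : ℝ} (hC0 : 0 ≤ C)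
    (hC : ∀ᵐ x ∂μ, ‖φ x‖ ≤ C) : ‖mulOp μ φ‖ ≤ C :=
  ContinuousLinearMap.opNorm_le_bound _ hC0 (norm_mulOp_apply_le hC0 hC)

/-- Strong continuity of a family of multipliers. -/
theorem continuous_mulOp_apply {T : Type*} [TopologicalSpace T] [FirstCountableTopology T]
    {φ : T → α → E →L[ℂ] F} (hm : ∀ t, AEStronglyMeasurable (φ t) μ) {C : ℝ}
    (hC : ∀ t, ∀ᵐ x ∂μ, ‖φ t x‖ ≤ C) (hcont : ∀ᵐ x ∂μ, Continuous fun t => φ t x)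
    (f : Lp E 1 μ) : Continuous fun t => mulOp μ (φ t) f := by
  rw [continuous_iff_continuousAt]
  intro t₀
  have he : ∀ t, EssBdd (φ t) μ := fun t => ⟨hm t, C, hC t⟩
  rw [ContinuousAt, tendsto_iff_norm_sub_tendsto_zero]
  have heq : ∀ t, ‖mulOp μ (φ t) f - mulOp μ (φ t₀) f‖ = ∫ x, ‖φ t x (f x) - φ t₀ x (f x)‖ ∂μ := by
    intro t
    rw [L1.norm_eq_integral_norm]
    refine integral_congr_ae ?_
    filter_upwards [Lp.coeFn_sub (mulOp μ (φ t) f) (mulOp μ (φ t₀) f), mulOp_coe (he t) f,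
      mulOp_coe (he t₀) f] with x a b c
    rw [a, Pi.sub_apply, b, c]
  simp_rw [heq]
  have h0 : ∫ x, (0 : ℝ) ∂μ = 0 := by simp
  rw [← h0]
  refine tendsto_integral_filter_of_dominated_convergence (fun x => 2 * C * ‖f x‖) ?_ ?_
    ((L1.integrable_coeFn f).norm.const_mul _) ?_
  · refine Eventually.of_forall fun t => ?_
    have hf := (L1.integrable_coeFn f).1
    exact (((ContinuousLinearMap.apply ℂ F : E →L[ℂ] _).flip.aestronglyMeasurable_comp₂
      (hm t) hf).sub ((ContinuousLinearMap.apply ℂ F : E →L[ℂ] _).flip.aestronglyMeasurable_comp₂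
      (hm t₀) hf)).norm
  · refine Eventually.of_forall fun t => ?_
    filter_upwards [hC t, hC t₀] with x a b
    rw [norm_norm]
    have h1 : ‖φ t x (f x)‖ ≤ C * ‖f x‖ := ((φ t x).le_opNorm _).trans (by gcongr)
    have h2 : ‖φ t₀ x (f x)‖ ≤ C * ‖f x‖ := ((φ t₀ x).le_opNorm _).trans (by gcongr)
    have := norm_sub_le (φ t x (f x)) (φ t₀ x (f x))
    linarith
  · filter_upwards [hcont] with x hx
    have : Tendsto (fun t => φ t x (f x)) (𝓝 t₀) (𝓝 (φ t₀ x (f x))) :=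
      (hx.clm_apply continuous_const).tendsto t₀
    simpa using (this.sub_const (φ t₀ x (f x))).norm

/-- Norm differentiability of a family of multipliers with a uniform quadratic remainder. -/
theorem hasDerivAt_mulOp {φ φ' : ℝ → α → E →L[ℂ] F} (hφ : ∀ t, EssBdd (φ t) μ)
    (hφ' : ∀ t, EssBdd (φ' t) μ) {C : ℝ} (hC0 : 0 ≤ C)
    (hC : ∀ t s, ∀ᵐ x ∂μ, ‖φ s x - φ t x - (s - t) • φ' t x‖ ≤ C * |s - t| ^ 2) (t : ℝ) :
    HasDerivAt (fun t => mulOp μ (φ t)) (mulOp μ (φ' t)) t := by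
  rw [hasDerivAt_iff_isLittleO]
  -- The remainder is itself a multiplier, so the pointwise quadratic bound, uniform in `x`, passes
  -- to the operator norm.
  have hO : (fun s => mulOp μ (φ s) - mulOp μ (φ t) - (s - t) • mulOp μ (φ' t)) =O[𝓝 t]
      fun s => (s - t) ^ 2 := by
    refine Asymptotics.IsBigO.of_bound C (Eventually.of_forall fun s => ?_)
    have : mulOp μ (φ s) - mulOp μ (φ t) - (s - t) • mulOp μ (φ' t) =
        mulOp μ (fun x => φ s x - φ t x - ((s - t : ℝ) : ℂ) • φ' t x) := by
      ext1 f
      apply Lp.ext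
      have he := (((hφ s).sub (hφ t)).sub ((hφ' t).const_smul ((s - t : ℝ) : ℂ)))
      simp only [sub_apply, smul_apply]
      filter_upwards [mulOp_coe he f, mulOp_coe (hφ s) f, mulOp_coe (hφ t) f, mulOp_coe (hφ' t) f,
        Lp.coeFn_sub (mulOp μ (φ s) f - mulOp μ (φ t) f) ((s - t) • mulOp μ (φ' t) f),
        Lp.coeFn_sub (mulOp μ (φ s) f) (mulOp μ (φ t) f),
        Lp.coeFn_smul (s - t) (mulOp μ (φ' t) f)] with x a b c d e f' g'
      rw [a, e, Pi.sub_apply, f', Pi.sub_apply, g', Pi.smul_apply, b, c, d]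
      simp only [sub_apply, smul_apply, Complex.coe_smul]
    rw [this, norm_pow, Real.norm_eq_abs]
    refine norm_mulOp_le (by positivity) ?_
    filter_upwards [hC t s] with x hx
    rwa [Complex.coe_smul]
  refine hO.trans_isLittleO ?_
  have := (Asymptotics.isLittleO_pow_id (𝕜 := ℝ) (one_lt_two)).comp_tendsto
    (show Tendsto (fun s => s - t) (𝓝 t) (𝓝 0) by
      exact (continuous_id.sub continuous_const).tendsto' t 0 (sub_self t))
  exact this

end Operators

/-! ### Convolution as integration over fibres of constant total frequency. -/

section Fiber

variable {d : ℕ} {E F G : Type*} [NormedAddCommGroup E] [NormedSpace ℂ E]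
  [NormedAddCommGroup F] [NormedSpace ℂ F]

theorem sum_convFreqs {m : ℕ} (hm : 1 ≤ m) (k : Wavevec d) (q : Fin (m - 1) → Wavevec d) :
    ∑ j, convFreqs m k q j = k := by
  obtain ⟨p, rfl⟩ : ∃ p, m = p + 1 := ⟨m - 1, by omega⟩
  rw [Fin.sum_univ_castSucc]
  simp [convFreqs]

/-- Up to a reordering of coordinates this is the shear $(q,k)\mapsto(q,k-\sum_jq_j)$, a skew
product of translations. With Fubini it turns statements about all $m$ frequencies into statements
about almost every fibre. -/
theorem measurePreserving_convFreqs {m : ℕ} (hm : 1 ≤ m) :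
    MeasurePreserving (fun p : Wavevec d × (Fin (m - 1) → Wavevec d) => convFreqs m p.1 p.2)
      (volume.prod volume) volume := by
  obtain ⟨p, rfl⟩ : ∃ p, m = p + 1 := ⟨m - 1, by omega⟩
  have h1 : MeasurePreserving
      (fun x : (Fin p → Wavevec d) × Wavevec d => (x.1, x.2 - ∑ j, x.1 j))
      (volume.prod volume) (volume.prod volume) := by
    refine MeasurePreserving.skew_product (f := id)
      (g := fun (q : Fin p → Wavevec d) (k : Wavevec d) => k - ∑ j, q j)
      (MeasurePreserving.id _) ?_ ?_
    · fun_prop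
    · exact Eventually.of_forall fun q => (measurePreserving_sub_right volume (∑ j, q j)).map_eq
  have h2 := (volume_preserving_piFinSuccAbove (fun _ : Fin (p + 1) => Wavevec d)
    (Fin.last p)).symm
  have h3 := h2.comp (Measure.measurePreserving_swap.comp (h1.comp Measure.measurePreserving_swap))
  suffices h4 : (fun x : Wavevec d × (Fin p → Wavevec d) => convFreqs (p + 1) x.1 x.2) =
    ((MeasurableEquiv.piFinSuccAbove (fun _ : Fin (p + 1) => Wavevec d)
      (Fin.last p)).symm ∘ Prod.swap ∘ (fun x : (Fin p → Wavevec d) × Wavevec d =>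
        (x.1, x.2 - ∑ j, x.1 j)) ∘ Prod.swap) by
    rw [← h4] at h3
    exact h3
  funext x
  funext j
  simp only [Function.comp, Prod.swap]
  refine Fin.lastCases ?_ (fun i => ?_) j
  · simp [convFreqs, MeasurableEquiv.piFinSuccAbove]
  · simp [convFreqs, MeasurableEquiv.piFinSuccAbove]

theorem ae_ae_convFreqs {m : ℕ} (hm : 1 ≤ m) {P : (Fin m → Wavevec d) → Prop}
    (h : ∀ᵐ κ, P κ) : ∀ᵐ k : Wavevec d, ∀ᵐ q, P (convFreqs m k q) :=
  Measure.ae_ae_of_ae_prod ((measurePreserving_convFreqs hm).quasiMeasurePreserving.ae h)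

/-- In the coordinates `convFreqs` the sum is the first projection, so the preimage of a null set is
a null cylinder. Hence almost no tuple has its output frequency in a given null set, such as the set
of band crossings. -/
theorem quasiMeasurePreserving_sum {m : ℕ} (hm : 1 ≤ m) :
    Measure.QuasiMeasurePreserving (fun κ : Fin m → Wavevec d => ∑ j, κ j) volume volume := by
  refine ⟨by fun_prop, ?_⟩
  refine Measure.AbsolutelyContinuous.mk fun s hs h0 => ?_
  rw [Measure.map_apply (by fun_prop) hs,
    ← (measurePreserving_convFreqs hm).measure_preimage
      ((by fun_prop : Measurable fun κ : Fin m → Wavevec d => ∑ j, κ j) hs).nullMeasurableSet]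
  have : (fun p : Wavevec d × (Fin (m - 1) → Wavevec d) => convFreqs m p.1 p.2) ⁻¹'
      ((fun κ : Fin m → Wavevec d => ∑ j, κ j) ⁻¹' s) = s ×ˢ univ := by
    ext p
    simp [sum_convFreqs hm]
  rw [this, Measure.prod_prod, h0, zero_mul]

theorem ae_sum {m : ℕ} (hm : 1 ≤ m) {P : Wavevec d → Prop} (h : ∀ᵐ k, P k) :
    ∀ᵐ κ : Fin m → Wavevec d, P (∑ j, κ j) :=
  (quasiMeasurePreserving_sum hm).ae h

theorem quasiMeasurePreserving_apply {m : ℕ} (j : Fin m) :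
    Measure.QuasiMeasurePreserving (fun κ : Fin m → Wavevec d => κ j) volume volume :=
  Measure.quasiMeasurePreserving_eval (fun _ => volume) j

theorem ae_apply {m : ℕ} {P : Wavevec d → Prop} (h : ∀ᵐ k, P k) :
    ∀ᵐ κ : Fin m → Wavevec d, ∀ j, P (κ j) :=
  ae_all_iff.2 fun j => (quasiMeasurePreserving_apply j).ae h

variable [NormedSpace ℝ E]

theorem integrable_comp_convFreqs {m : ℕ} (hm : 1 ≤ m) {f : (Fin m → Wavevec d) → E}
    (hf : Integrable f) : Integrable
      (fun p : Wavevec d × (Fin (m - 1) → Wavevec d) => f (convFreqs m p.1 p.2))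
      (volume.prod volume) :=
  (measurePreserving_convFreqs hm).integrable_comp_of_integrable hf

/-- Fubini in the coordinates `convFreqs`; the constant is $1$ because these preserve volume. -/
theorem isL1Bounded_fiber {m : ℕ} (hm : 1 ≤ m) :
    IsL1Bounded volume volume (fun (f : (Fin m → Wavevec d) → E) (k : Wavevec d) =>
      ∫ q, f (convFreqs m k q)) 1 := by
  refine ⟨fun f hf => (integrable_comp_convFreqs hm hf).integral_prod_left, fun f hf => ?_,
    fun f g hf hg => ?_, fun c f hf => ?_⟩
  · have h1 := (integrable_comp_convFreqs hm hf)
    rw [one_mul]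
    calc ∫ k, ‖∫ q, f (convFreqs m k q)‖ ≤ ∫ k, ∫ q, ‖f (convFreqs m k q)‖ :=
          integral_mono h1.integral_prod_left.norm h1.norm.integral_prod_left
            fun k => norm_integral_le_integral_norm _
      _ = ∫ p : Wavevec d × (Fin (m - 1) → Wavevec d), ‖f (convFreqs m p.1 p.2)‖
            ∂(volume.prod volume) := (integral_prod _ h1.norm).symm
      _ = ∫ κ, ‖f κ‖ := by
        rw [← (measurePreserving_convFreqs hm).map_eq]
        rw [integral_map (measurePreserving_convFreqs hm).measurable.aemeasurable]
        rw [(measurePreserving_convFreqs hm).map_eq]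
        exact hf.1.norm
  · filter_upwards [(integrable_comp_convFreqs hm hf).prod_right_ae,
      (integrable_comp_convFreqs hm hg).prod_right_ae] with k h1 h2
    exact integral_add h1 h2
  · exact Eventually.of_forall fun k => integral_smul c _

/-- Integration of a function of `m` frequencies over the fibre `∑ κ = k`. -/
def fiberOp (d m : ℕ) (E : Type*) [NormedAddCommGroup E] [NormedSpace ℂ E] [NormedSpace ℝ E] :
    Lp E 1 (volume : Measure (Fin m → Wavevec d)) →L[ℂ] Lp E 1 (volume : Measure (Wavevec d)) :=
  if hm : 1 ≤ m then l1Op _ 1 (isL1Bounded_fiber hm) else 0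

theorem fiberOp_coe {m : ℕ} (hm : 1 ≤ m) (f : Lp E 1 (volume : Measure (Fin m → Wavevec d))) :
    fiberOp d m E f =ᵐ[volume] fun k => ∫ q, f (convFreqs m k q) := by
  rw [fiberOp, dif_pos hm]
  exact l1Op_coe _ f

theorem norm_fiberOp_apply_le {m : ℕ} (f : Lp E 1 (volume : Measure (Fin m → Wavevec d))) :
    ‖fiberOp d m E f‖ ≤ ‖f‖ := by
  by_cases hm : 1 ≤ m
  · rw [fiberOp, dif_pos hm]
    simpa using norm_l1Op_apply_le (isL1Bounded_fiber hm) f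
  · rw [fiberOp, dif_neg hm]
    simp

end Fiber

/-! ### Multilinear susceptibilities acting on tuples of $L^1$ functions. -/

section Tensor

variable {d : ℕ} {E F G : Type*} [NormedAddCommGroup E] [NormedSpace ℂ E]
  [NormedAddCommGroup F] [NormedSpace ℂ F] [NormedAddCommGroup G] [NormedSpace ℂ G]

/-- Joint continuity follows by splitting the increment into a change of the form at the moving
arguments and a change of the arguments at the fixed form. It is what makes
$\kappa\mapsto\chi(\kappa)[U_1(\kappa_1),\dots]$ measurable. -/
theorem continuous_multilinear_eval {m : ℕ} :
    Continuous fun p : ContinuousMultilinearMap ℂ (fun _ : Fin m => E) F × (Fin m → E) =>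
      p.1 p.2 := by
  rw [continuous_iff_continuousAt]
  rintro ⟨χ, v⟩
  rw [ContinuousAt, tendsto_iff_norm_sub_tendsto_zero]
  have h1 : Tendsto (fun p : ContinuousMultilinearMap ℂ (fun _ : Fin m => E) F × (Fin m → E) =>
      ‖p.1 - χ‖ * ∏ i, ‖p.2 i‖ + ‖χ p.2 - χ v‖) (𝓝 (χ, v))
      (𝓝 (‖χ - χ‖ * ∏ i, ‖v i‖ + ‖χ v - χ v‖)) := by
    have : Continuous (fun p : ContinuousMultilinearMap ℂ (fun _ : Fin m => E) F × (Fin m → E) =>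
      ‖p.1 - χ‖ * ∏ i, ‖p.2 i‖ + ‖χ p.2 - χ v‖) := by
      have := χ.cont
      fun_prop
    exact this.tendsto (χ, v)
  simp only [sub_self, norm_zero, zero_mul, add_zero] at h1
  refine squeeze_zero (fun _ => norm_nonneg _) (fun p => ?_) h1
  have : p.1 p.2 - χ v = (p.1 - χ) p.2 + (χ p.2 - χ v) := by
    simp
  simp only
  rw [this]
  exact (norm_add_le _ _).trans (by gcongr; exact (p.1 - χ).le_opNorm _)

theorem aestronglyMeasurable_multilinear_apply {α : Type*} [MeasurableSpace α] {μ : Measure α}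
    {m : ℕ} {χ : α → ContinuousMultilinearMap ℂ (fun _ : Fin m => E) F} {f : Fin m → α → E}
    (hχ : AEStronglyMeasurable χ μ) (hf : ∀ j, AEStronglyMeasurable (f j) μ) :
    AEStronglyMeasurable (fun x => χ x fun j => f j x) μ := by
  have h : AEStronglyMeasurable (fun x => fun j => f j x) μ := by
    have h1 : (fun x => fun j => f j x) = fun x => ∑ j, Pi.single (M := fun _ : Fin m => E) j (f j x) := by
      funext x
      exact (Finset.univ_sum_single fun j => f j x).symm
    rw [h1]
    exact Finset.aestronglyMeasurable_fun_sum _ fun j _ =>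
      (continuous_single j).comp_aestronglyMeasurable (hf j)
  exact continuous_multilinear_eval.comp_aestronglyMeasurable (hχ.prodMk h)

theorem integrable_prod_norm {m : ℕ} (U : Fin m → Lp E 1 (volume : Measure (Wavevec d))) :
    Integrable (fun κ : Fin m → Wavevec d => ∏ j, ‖U j (κ j)‖) :=
  Integrable.fintype_prod (f := fun j k => ‖U j k‖) fun j => (L1.integrable_coeFn (U j)).norm

theorem integral_prod_norm {m : ℕ} (U : Fin m → Lp E 1 (volume : Measure (Wavevec d))) :
    ∫ κ : Fin m → Wavevec d, ∏ j, ‖U j (κ j)‖ = ∏ j, ‖U j‖ := by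
  rw [volume_pi, integral_fintype_prod_eq_prod (f := fun j k => ‖U j k‖)]
  exact Finset.prod_congr rfl fun j _ => (L1.norm_eq_integral_norm (U j)).symm

theorem aestronglyMeasurable_tensor {m : ℕ}
    {χ : (Fin m → Wavevec d) → ContinuousMultilinearMap ℂ (fun _ : Fin m => E) F}
    (hχ : AEStronglyMeasurable χ) (U : Fin m → Lp E 1 (volume : Measure (Wavevec d))) :
    AEStronglyMeasurable (fun κ : Fin m → Wavevec d => χ κ fun j => U j (κ j)) volume :=
  aestronglyMeasurable_multilinear_apply hχ fun j =>
    (L1.integrable_coeFn (U j)).1.comp_quasiMeasurePreserving (quasiMeasurePreserving_apply j)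

theorem integrable_tensor {m : ℕ}
    {χ : (Fin m → Wavevec d) → ContinuousMultilinearMap ℂ (fun _ : Fin m => E) F}
    (hχ : EssBdd χ volume) (U : Fin m → Lp E 1 (volume : Measure (Wavevec d))) :
    Integrable (fun κ : Fin m → Wavevec d => χ κ fun j => U j (κ j)) := by
  obtain ⟨h1, C, hC⟩ := hχ
  refine ((integrable_prod_norm U).const_mul C).mono' (aestronglyMeasurable_tensor h1 U) ?_
  filter_upwards [hC] with κ hκ
  refine ((χ κ).le_opNorm _).trans ?_
  gcongr

/-- The bound of an essentially bounded multilinear susceptibility on `L¹`. -/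
theorem norm_toL1_tensor_le {m : ℕ}
    {χ : (Fin m → Wavevec d) → ContinuousMultilinearMap ℂ (fun _ : Fin m => E) F}
    (hχ : EssBdd χ volume) {C : ℝ} (hC : ∀ᵐ κ, ‖χ κ‖ ≤ C)
    (U : Fin m → Lp E 1 (volume : Measure (Wavevec d))) :
    ‖(integrable_tensor hχ U).toL1 _‖ ≤ C * ∏ j, ‖U j‖ := by
  rw [L1.norm_eq_integral_norm, ← integral_prod_norm, ← integral_const_mul]
  refine integral_mono_ae (L1.integrable_coeFn _).norm ((integrable_prod_norm U).const_mul C) ?_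
  filter_upwards [hC, Integrable.coeFn_toL1 (integrable_tensor hχ U)] with κ hκ h2
  rw [h2]
  refine ((χ κ).le_opNorm _).trans ?_
  gcongr

open Classical in
/-- The multilinear operator `(U₁, …, U_m) ↦ (κ ↦ χ(κ)[U₁(κ₁), …, U_m(κ_m)])` on `L¹`. -/
def tensorOp {m : ℕ}
    (χ : (Fin m → Wavevec d) → ContinuousMultilinearMap ℂ (fun _ : Fin m => E) F) :
    ContinuousMultilinearMap ℂ (fun _ : Fin m => Lp E 1 (volume : Measure (Wavevec d)))
      (Lp F 1 (volume : Measure (Fin m → Wavevec d))) :=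
  if h : EssBdd χ volume then
    MultilinearMap.mkContinuous
      { toFun := fun U => (integrable_tensor h U).toL1 _
        map_update_add' := by
          intro hd U i x y
          have : hd = instDecidableEqFin m := Subsingleton.elim _ _
          subst this
          apply Lp.ext
          filter_upwards [Integrable.coeFn_toL1 (integrable_tensor h (Function.update U i (x + y))),
            Integrable.coeFn_toL1 (integrable_tensor h (Function.update U i x)),
            Integrable.coeFn_toL1 (integrable_tensor h (Function.update U i y)),
            Lp.coeFn_add ((integrable_tensor h (Function.update U i x)).toL1 _)
              ((integrable_tensor h (Function.update U i y)).toL1 _),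
            (quasiMeasurePreserving_apply i).ae (Lp.coeFn_add x y)] with κ a b c e f
          rw [a, e, Pi.add_apply, b, c]
          have hu : ∀ z : Lp E 1 (volume : Measure (Wavevec d)),
              (fun j => (Function.update U i z) j (κ j)) =
                Function.update (fun j => U j (κ j)) i (z (κ i)) := by
            intro z
            funext j
            by_cases hj : j = i
            · subst hj; simp
            · simp [hj]
          rw [hu, hu, hu, f, Pi.add_apply, (χ κ).map_update_add]
        map_update_smul' := by
          intro hd U i c x
          have : hd = instDecidableEqFin m := Subsingleton.elim _ _
          subst this
          apply Lp.ext
          filter_upwards [Integrable.coeFn_toL1 (integrable_tensor h (Function.update U i (c • x))),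
            Integrable.coeFn_toL1 (integrable_tensor h (Function.update U i x)),
            Lp.coeFn_smul c ((integrable_tensor h (Function.update U i x)).toL1 _),
            (quasiMeasurePreserving_apply i).ae (Lp.coeFn_smul c x)] with κ a b e f
          rw [a, e, Pi.smul_apply, b]
          have hu : ∀ z : Lp E 1 (volume : Measure (Wavevec d)),
              (fun j => (Function.update U i z) j (κ j)) =
                Function.update (fun j => U j (κ j)) i (z (κ i)) := by
            intro z
            funext j
            by_cases hj : j = i
            · subst hj; simp
            · simp [hj]
          rw [hu, hu, f, Pi.smul_apply, (χ κ).map_update_smul] }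
      h.2.choose (norm_toL1_tensor_le h h.2.choose_spec)
  else 0

theorem tensorOp_coe {m : ℕ}
    {χ : (Fin m → Wavevec d) → ContinuousMultilinearMap ℂ (fun _ : Fin m => E) F}
    (h : EssBdd χ volume) (U : Fin m → Lp E 1 (volume : Measure (Wavevec d))) :
    tensorOp χ U =ᵐ[volume] fun κ => χ κ fun j => U j (κ j) := by
  rw [tensorOp, dif_pos h]
  exact Integrable.coeFn_toL1 (integrable_tensor h U)

theorem norm_tensorOp_apply_le {m : ℕ}
    {χ : (Fin m → Wavevec d) → ContinuousMultilinearMap ℂ (fun _ : Fin m => E) F}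
    {C : ℝ} (hC0 : 0 ≤ C) (hC : ∀ᵐ κ, ‖χ κ‖ ≤ C)
    (U : Fin m → Lp E 1 (volume : Measure (Wavevec d))) : ‖tensorOp χ U‖ ≤ C * ∏ j, ‖U j‖ := by
  by_cases h : EssBdd χ volume
  · rw [tensorOp, dif_pos h]
    exact norm_toL1_tensor_le h hC U
  · rw [tensorOp, dif_neg h]
    simp only [zero_apply, norm_zero]
    positivity

theorem norm_tensorOp_le {m : ℕ}
    {χ : (Fin m → Wavevec d) → ContinuousMultilinearMap ℂ (fun _ : Fin m => E) F}
    {C : ℝ} (hC0 : 0 ≤ C) (hC : ∀ᵐ κ, ‖χ κ‖ ≤ C) : ‖tensorOp χ‖ ≤ C :=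
  ContinuousMultilinearMap.opNorm_le_bound hC0 (norm_tensorOp_apply_le hC0 hC)

/-- The tensor product of scalar functions. -/
def tens (d m : ℕ) : ContinuousMultilinearMap ℂ
    (fun _ : Fin m => Lp ℂ 1 (volume : Measure (Wavevec d)))
      (Lp ℂ 1 (volume : Measure (Fin m → Wavevec d))) :=
  tensorOp fun _ => ContinuousMultilinearMap.mkPiAlgebra ℂ (Fin m) ℂ

theorem tens_coe {m : ℕ} (u : Fin m → Lp ℂ 1 (volume : Measure (Wavevec d))) :
    tens d m u =ᵐ[volume] fun κ => ∏ j, u j (κ j) := by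
  refine (tensorOp_coe ⟨aestronglyMeasurable_const, _, Eventually.of_forall fun _ => le_rfl⟩
    u).trans ?_
  exact Eventually.of_forall fun κ => by simp

theorem norm_tens_le {m : ℕ} : ‖tens d m‖ ≤ 1 := by
  refine norm_tensorOp_le zero_le_one (Eventually.of_forall fun _ => ?_)
  rw [ContinuousMultilinearMap.norm_mkPiAlgebra]

theorem norm_tens_apply_le {m : ℕ} (u : Fin m → Lp ℂ 1 (volume : Measure (Wavevec d))) :
    ‖tens d m u‖ ≤ ∏ j, ‖u j‖ := by
  simpa using ContinuousMultilinearMap.le_of_opNorm_le norm_tens_le u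

variable {α : Type*} [MeasurableSpace α] {μ : Measure α}

/-- Multiplication of scalar functions in `L¹` by a bounded vector-valued function. -/
def vMul (μ : Measure α) (φ : α → F) : Lp ℂ 1 μ →L[ℂ] Lp F 1 μ :=
  mulOp μ fun x => ContinuousLinearMap.toSpanSingleton ℂ (φ x)

theorem EssBdd.toSpanSingleton {φ : α → F} (h : EssBdd φ μ) :
    EssBdd (fun x => ContinuousLinearMap.toSpanSingleton ℂ (φ x)) μ := by
  obtain ⟨h1, C, hC⟩ := h
  refine ⟨?_, C, by simpa using hC⟩
  have : Continuous fun v : F => ContinuousLinearMap.toSpanSingleton ℂ v :=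
    (ContinuousLinearMap.toSpanSingletonCLE (𝕜 := ℂ) (E := F)).continuous
  exact this.comp_aestronglyMeasurable h1

theorem vMul_coe {φ : α → F} (h : EssBdd φ μ) (f : Lp ℂ 1 μ) :
    vMul μ φ f =ᵐ[μ] fun x => f x • φ x :=
  (mulOp_coe h.toSpanSingleton f).trans (Eventually.of_forall fun x => by simp)

theorem norm_vMul_apply_le_of_ae {φ : α → F} {f : Lp ℂ 1 μ} {C : ℝ} (hC0 : 0 ≤ C)
    (hC : ∀ᵐ x ∂μ, f x ≠ 0 → ‖φ x‖ ≤ C) : ‖vMul μ φ f‖ ≤ C * ‖f‖ :=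
  norm_mulOp_apply_le_of_ae hC0 (by simpa using hC)

theorem norm_vMul_apply_le {φ : α → F} {C : ℝ} (hC0 : 0 ≤ C) (hC : ∀ᵐ x ∂μ, ‖φ x‖ ≤ C)
    (f : Lp ℂ 1 μ) : ‖vMul μ φ f‖ ≤ C * ‖f‖ :=
  norm_vMul_apply_le_of_ae hC0 (hC.mono fun _ h _ => h)

theorem norm_vMul_le {φ : α → F} {C : ℝ} (hC0 : 0 ≤ C) (hC : ∀ᵐ x ∂μ, ‖φ x‖ ≤ C) :
    ‖vMul μ φ‖ ≤ C :=
  ContinuousLinearMap.opNorm_le_bound _ hC0 (norm_vMul_apply_le hC0 hC)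

theorem continuous_vMul_apply {T : Type*} [TopologicalSpace T] [FirstCountableTopology T]
    {φ : T → α → F} {C : ℝ} (hm : ∀ t, AEStronglyMeasurable (φ t) μ)
    (hC : ∀ t, ∀ᵐ x ∂μ, ‖φ t x‖ ≤ C) (hcont : ∀ᵐ x ∂μ, Continuous fun t => φ t x)
    (f : Lp ℂ 1 μ) : Continuous fun t => vMul μ (φ t) f := by
  have hc : Continuous fun v : F => ContinuousLinearMap.toSpanSingleton ℂ v :=
    (ContinuousLinearMap.toSpanSingletonCLE (𝕜 := ℂ) (E := F)).continuous
  refine continuous_mulOp_apply (C := C) (fun t => hc.comp_aestronglyMeasurable (hm t))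
    (fun t => by simpa using hC t) ?_ f
  filter_upwards [hcont] with x hx
  exact hc.comp hx

theorem hasDerivAt_vMul {φ φ' : ℝ → α → F} (hφ : ∀ t, EssBdd (φ t) μ)
    (hφ' : ∀ t, EssBdd (φ' t) μ) {C : ℝ} (hC0 : 0 ≤ C)
    (hC : ∀ t s, ∀ᵐ x ∂μ, ‖φ s x - φ t x - (s - t) • φ' t x‖ ≤ C * |s - t| ^ 2) (t : ℝ) :
    HasDerivAt (fun t => vMul μ (φ t)) (vMul μ (φ' t)) t := by
  refine hasDerivAt_mulOp (fun t => (hφ t).toSpanSingleton) (fun t => (hφ' t).toSpanSingleton)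
    hC0 (fun t s => ?_) t
  filter_upwards [hC t s] with x hx
  refine le_trans (le_of_eq ?_) hx
  rw [← ContinuousLinearMap.norm_toSpanSingleton (𝕜 := ℂ) (φ s x - φ t x - (s - t) • φ' t x)]
  congr 1
  ext
  simp

theorem mulOp_vMul {φ : α → F →L[ℂ] G} {ψ : α → F} (hφ : EssBdd φ μ) (hψ : EssBdd ψ μ)
    (f : Lp ℂ 1 μ) : mulOp μ φ (vMul μ ψ f) = vMul μ (fun x => φ x (ψ x)) f := by
  apply Lp.ext
  filter_upwards [mulOp_coe hφ (vMul μ ψ f), vMul_coe hψ f, vMul_coe (hφ.clm_apply hψ) f]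
    with x a b c
  rw [a, b, c, map_smul]

theorem vMul_sub {φ ψ : α → F} (hφ : EssBdd φ μ) (hψ : EssBdd ψ μ) (f : Lp ℂ 1 μ) :
    vMul μ (fun x => φ x - ψ x) f = vMul μ φ f - vMul μ ψ f := by
  apply Lp.ext
  filter_upwards [vMul_coe (hφ.sub hψ) f, vMul_coe hφ f, vMul_coe hψ f,
    Lp.coeFn_sub (vMul μ φ f) (vMul μ ψ f)] with x a b c e
  rw [a, e, Pi.sub_apply, b, c, smul_sub]

theorem vMul_sum {ι : Type*} {s : Finset ι} {φ : ι → α → F} (hφ : ∀ i ∈ s, EssBdd (φ i) μ)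
    (f : Lp ℂ 1 μ) : vMul μ (fun x => ∑ i ∈ s, φ i x) f = ∑ i ∈ s, vMul μ (φ i) f := by
  apply Lp.ext
  filter_upwards [vMul_coe (EssBdd.sum hφ) f, (Finset.eventually_all s).2 fun i hi =>
    vMul_coe (hφ i hi) f, Lp.coeFn_finsetSum s fun i => vMul μ (φ i) f] with x a b c
  rw [a, c, Finset.sum_apply, Finset.smul_sum]
  exact Finset.sum_congr rfl fun i hi => (b i hi).symm

end Tensor

/-! ### Commutation rules that collect all factors into one kernel. -/

section Compose

variable {d : ℕ} {E F G : Type*} [NormedAddCommGroup E] [NormedSpace ℂ E]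
  [NormedAddCommGroup F] [NormedSpace ℂ F] [NormedAddCommGroup G] [NormedSpace ℂ G]

theorem EssBdd.comp_quasi {α β : Type*} [MeasurableSpace α] [MeasurableSpace β] {μ : Measure α}
    {ν : Measure β} {φ : β → E} (h : EssBdd φ ν) {f : α → β}
    (hf : Measure.QuasiMeasurePreserving f μ ν) : EssBdd (fun x => φ (f x)) μ := by
  obtain ⟨h1, C, hC⟩ := h
  exact ⟨h1.comp_quasiMeasurePreserving hf, C, hf.ae hC⟩

theorem EssBdd.comp_sum {m : ℕ} (hm : 1 ≤ m) {φ : Wavevec d → E} (h : EssBdd φ volume) :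
    EssBdd (fun κ : Fin m → Wavevec d => φ (∑ j, κ j)) volume :=
  h.comp_quasi (quasiMeasurePreserving_sum hm)

theorem EssBdd.multilinear_apply {α : Type*} [MeasurableSpace α] {μ : Measure α} {m : ℕ}
    {χ : α → ContinuousMultilinearMap ℂ (fun _ : Fin m => E) F}
    (hχ : EssBdd χ μ) {φ : Fin m → α → E} (hφ : ∀ j, EssBdd (φ j) μ) :
    EssBdd (fun x => χ x fun j => φ j x) μ := by
  refine ⟨aestronglyMeasurable_multilinear_apply hχ.1 fun j => (hφ j).1, ?_⟩
  obtain ⟨C, hC⟩ := hχ.2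
  choose D hD using fun j => (hφ j).2
  refine ⟨C * ∏ j, D j, ?_⟩
  filter_upwards [hC, ae_all_iff.2 hD] with x a b
  refine ((χ x).le_opNorm _).trans ?_
  have : 0 ≤ C := (norm_nonneg _).trans a
  gcongr with j
  exact b j

/-- On a fibre the output frequency $\sum_j\kappa_j$ is constant, so a multiplier in that variable
passes under the integral. -/
theorem mulOp_fiberOp [NormedSpace ℝ E] [NormedSpace ℝ F] [CompleteSpace E] [CompleteSpace F]
    {m : ℕ} (hm : 1 ≤ m)
    {φ : Wavevec d → E →L[ℂ] F} (h : EssBdd φ volume)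
    (Φ : Lp E 1 (volume : Measure (Fin m → Wavevec d))) :
    mulOp volume φ (fiberOp d m E Φ) =
      fiberOp d m F (mulOp volume (fun κ : Fin m → Wavevec d => φ (∑ j, κ j)) Φ) := by
  apply Lp.ext
  filter_upwards [mulOp_coe h (fiberOp d m E Φ), fiberOp_coe hm Φ, fiberOp_coe hm
    (mulOp volume (fun κ : Fin m → Wavevec d => φ (∑ j, κ j)) Φ),
    ae_ae_convFreqs hm (mulOp_coe (h.comp_sum hm) Φ),
    (integrable_comp_convFreqs hm (L1.integrable_coeFn Φ)).prod_right_ae] with k a b c e f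
  rw [a, b, c, integral_congr_ae e]
  simp only [sum_convFreqs hm]
  exact ((φ k).integral_comp_comm f).symm

theorem vMul_fiberOp [NormedSpace ℝ F] [CompleteSpace F] {m : ℕ} (hm : 1 ≤ m)
    {φ : Wavevec d → F} (h : EssBdd φ volume)
    (Φ : Lp ℂ 1 (volume : Measure (Fin m → Wavevec d))) :
    vMul volume φ (fiberOp d m ℂ Φ) =
      fiberOp d m F (vMul volume (fun κ : Fin m → Wavevec d => φ (∑ j, κ j)) Φ) :=
  mulOp_fiberOp hm h.toSpanSingleton Φ

theorem vMul_vMul {α : Type*} [MeasurableSpace α] {μ : Measure α} {φ : α → F} {ψ : α → ℂ}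
    (hφ : EssBdd φ μ) (hψ : EssBdd ψ μ) (f : Lp ℂ 1 μ) :
    vMul μ φ (vMul μ ψ f) = vMul μ (fun x => ψ x • φ x) f := by
  rw [vMul, mulOp_vMul hφ.toSpanSingleton hψ]
  simp

theorem EssBdd.smul {α : Type*} [MeasurableSpace α] {μ : Measure α} {φ : α → F} {ψ : α → ℂ}
    (hψ : EssBdd ψ μ) (hφ : EssBdd φ μ) : EssBdd (fun x => ψ x • φ x) μ := by
  simpa using hφ.toSpanSingleton.clm_apply hψ

/-- Multilinearity pulls the scalar amplitudes out, leaving all vector structure in a kernel that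
multiplies a scalar tensor product. Every term of both equations is brought to this form. -/
theorem tensorOp_vMul {m : ℕ}
    {χ : (Fin m → Wavevec d) → ContinuousMultilinearMap ℂ (fun _ : Fin m => E) F}
    (hχ : EssBdd χ volume) {φ : Fin m → Wavevec d → E} (hφ : ∀ j, EssBdd (φ j) volume)
    (u : Fin m → Lp ℂ 1 (volume : Measure (Wavevec d))) :
    tensorOp χ (fun j => vMul volume (φ j) (u j)) =
      vMul volume (fun κ : Fin m → Wavevec d => χ κ fun j => φ j (κ j)) (tens d m u) := by
  apply Lp.ext
  filter_upwards [tensorOp_coe hχ (fun j => vMul volume (φ j) (u j)), tens_coe u,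
    vMul_coe (hχ.multilinear_apply fun j =>
      (hφ j).comp_quasi (quasiMeasurePreserving_apply j)) (tens d m u),
    ae_all_iff.2 fun j => (quasiMeasurePreserving_apply j).ae (vMul_coe (hφ j) (u j))]
    with κ a b c e
  rw [a, c, b]
  simp_rw [e]
  rw [ContinuousMultilinearMap.map_smul_univ]

theorem essBdd_const {α : Type*} [MeasurableSpace α] {μ : Measure α} (c : E) :
    EssBdd (fun _ : α => c) μ :=
  ⟨aestronglyMeasurable_const, _, Eventually.of_forall fun _ => le_rfl⟩

theorem tens_vMul {m : ℕ} {φ : Fin m → Wavevec d → ℂ} (hφ : ∀ j, EssBdd (φ j) volume)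
    (u : Fin m → Lp ℂ 1 (volume : Measure (Wavevec d))) :
    tens d m (fun j => vMul volume (φ j) (u j)) =
      vMul volume (fun κ : Fin m → Wavevec d => ∏ j, φ j (κ j)) (tens d m u) := by
  rw [tens, tensorOp_vMul (essBdd_const _) hφ]
  simp [tens]

end Compose

/-! ### Concentration of envelopes at a centre on the scale $\beta$. -/

section Rescale

variable {d : ℕ}

theorem quasiMeasurePreserving_rescale {β : ℝ} (hβ : 0 < β) (c : Wavevec d) :
    Measure.QuasiMeasurePreserving (fun k : Wavevec d => β⁻¹ • (k - c)) volume volume := by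
  refine ⟨by fun_prop, ?_⟩
  refine Measure.AbsolutelyContinuous.mk fun s hs h0 => ?_
  rw [Measure.map_apply (by fun_prop) hs]
  have h1 : (fun k : Wavevec d => β⁻¹ • (k - c)) ⁻¹' s =
      (fun k => k - c) ⁻¹' ((fun k => β⁻¹ • k) ⁻¹' s) := rfl
  rw [h1, (measurePreserving_sub_right volume c).measure_preimage
    ((by fun_prop : Measurable fun k : Wavevec d => β⁻¹ • k) hs).nullMeasurableSet,
    Measure.addHaar_preimage_smul _ (inv_ne_zero hβ.ne'), h0, mul_zero]

theorem integral_rescale {F : Type*} [NormedAddCommGroup F] [NormedSpace ℝ F] {β : ℝ} (hβ : 0 < β)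
    (c : Wavevec d) (f : Wavevec d → F) :
    ∫ k, f (β⁻¹ • (k - c)) = β ^ d • ∫ η, f η := by
  rw [integral_sub_right_eq_self (fun k => f (β⁻¹ • k)) c,
    Measure.integral_comp_inv_smul_of_nonneg _ _ hβ.le]
  simp

theorem integrable_rescale {f : Wavevec d → ℂ} {β : ℝ} (hβ : 0 < β) (c : Wavevec d)
    (hf : Integrable f) : Integrable (rescale β c f) := by
  refine Integrable.const_mul ?_ _
  exact ((hf.comp_smul (inv_ne_zero hβ.ne')).comp_sub_right c)

theorem integral_norm_rescale {β : ℝ} (hβ : 0 < β) (c : Wavevec d) (f : Wavevec d → ℂ) :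
    ∫ k, ‖rescale β c f k‖ = ∫ η, ‖f η‖ := by
  simp only [rescale, norm_mul]
  rw [integral_const_mul, integral_rescale hβ c fun η => ‖f η‖]
  have : (0 : ℝ) < β ^ d := by positivity
  rw [Complex.norm_real, Real.norm_of_nonneg (by positivity), smul_eq_mul, ← mul_assoc,
    inv_mul_cancel₀ this.ne', one_mul]

theorem isL1Bounded_rescale {β : ℝ} (hβ : 0 < β) (c : Wavevec d) :
    IsL1Bounded volume volume (rescale (d := d) β c) 1 :=
  ⟨fun _ hf => integrable_rescale hβ c hf, fun f _ => by rw [integral_norm_rescale hβ, one_mul],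
    fun f g _ _ => Eventually.of_forall fun k => by simp [rescale, mul_add],
    fun r f _ => Eventually.of_forall fun k => by simp [rescale]; ring⟩

/-- The `L¹` isometry `f ↦ β^{-d} f(β^{-1}(· - c))`. -/
def rescaleOp (β : ℝ) (c : Wavevec d) :
    Lp ℂ 1 (volume : Measure (Wavevec d)) →L[ℂ] Lp ℂ 1 (volume : Measure (Wavevec d)) :=
  if hβ : 0 < β then l1Op _ 1 (isL1Bounded_rescale hβ c) else 0

theorem rescaleOp_coe {β : ℝ} (hβ : 0 < β) (c : Wavevec d)
    (f : Lp ℂ 1 (volume : Measure (Wavevec d))) :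
    rescaleOp β c f =ᵐ[volume] rescale β c f := by
  rw [rescaleOp, dif_pos hβ]
  exact l1Op_coe _ f

theorem norm_rescaleOp_apply_le (β : ℝ) (c : Wavevec d)
    (f : Lp ℂ 1 (volume : Measure (Wavevec d))) : ‖rescaleOp β c f‖ ≤ ‖f‖ := by
  by_cases hβ : 0 < β
  · rw [rescaleOp, dif_pos hβ]
    simpa using norm_l1Op_apply_le (isL1Bounded_rescale hβ c) f
  · rw [rescaleOp, dif_neg hβ]
    simp

/-- Shifting each frequency by its centre shifts the output by the sum of the centres. Only $m-1$
frequencies are free on a fibre, hence the exponent of $\beta$. -/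
theorem integral_convFreqs_rescale {F : Type*} [NormedAddCommGroup F] [NormedSpace ℝ F] {m : ℕ}
    (hm : 1 ≤ m) {β : ℝ} (hβ : 0 < β) (c : Fin m → Wavevec d) (k : Wavevec d)
    (Ψ : (Fin m → Wavevec d) → F) :
    ∫ q, Ψ (fun j => β⁻¹ • (convFreqs m k q j - c j)) =
      β ^ ((m - 1) * d) • ∫ q, Ψ (convFreqs m (β⁻¹ • (k - ∑ j, c j)) q) := by
  obtain ⟨p, rfl⟩ : ∃ p, m = p + 1 := ⟨m - 1, by omega⟩
  have key : ∀ q : Fin p → Wavevec d, (fun j => β⁻¹ • (convFreqs (p + 1) k q j - c j)) =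
      convFreqs (p + 1) (β⁻¹ • (k - ∑ j, c j)) (β⁻¹ • (q - fun i => c i.castSucc)) := by
    intro q
    funext j
    refine Fin.lastCases ?_ (fun i => ?_) j
    · simp only [convFreqs, Fin.sum_univ_castSucc]
      simp only [Fin.val_last, add_tsub_cancel_right, lt_self_iff_false, dite_false, Pi.smul_apply,
        Pi.sub_apply, ← Finset.smul_sum, Finset.sum_sub_distrib]
      rw [← smul_sub]
      congr 1
      have e : (∑ i : Fin (p + 1 - 1), c (Fin.castSucc i)) = ∑ i : Fin p, c (Fin.castSucc i) := rfl
      rw [e]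
      abel
    · simp [convFreqs]
  have h1 : (∫ q : Fin p → Wavevec d, Ψ (fun j => β⁻¹ • (convFreqs (p + 1) k q j - c j))) =
      ∫ q : Fin p → Wavevec d, Ψ (convFreqs (p + 1) (β⁻¹ • (k - ∑ j, c j))
        (β⁻¹ • (q - fun i => c i.castSucc))) := by
    simp_rw [key]
  refine h1.trans ?_
  rw [integral_sub_right_eq_self (fun q : Fin p → Wavevec d =>
    Ψ (convFreqs (p + 1) (β⁻¹ • (k - ∑ j, c j)) (β⁻¹ • q))) (fun i => c i.castSucc),
    Measure.integral_comp_inv_smul_of_nonneg volume (fun q : Fin p → Wavevec d =>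
    Ψ (convFreqs (p + 1) (β⁻¹ • (k - ∑ j, c j)) q)) hβ.le, Module.finrank_pi_fintype]
  simp

theorem quasiMeasurePreserving_rescale_pi {m : ℕ} {β : ℝ} (hβ : 0 < β) (c : Fin m → Wavevec d) :
    Measure.QuasiMeasurePreserving
      (fun (κ : Fin m → Wavevec d) (j : Fin m) => β⁻¹ • (κ j - c j)) volume volume := by
  refine ⟨by fun_prop, ?_⟩
  refine Measure.AbsolutelyContinuous.mk fun s hs h0 => ?_
  rw [Measure.map_apply (by fun_prop) hs]
  have h1 : (fun (κ : Fin m → Wavevec d) (j : Fin m) => β⁻¹ • (κ j - c j)) ⁻¹' s =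
      (fun κ => κ - c) ⁻¹' ((fun κ => β⁻¹ • κ) ⁻¹' s) := rfl
  rw [h1, (measurePreserving_sub_right volume c).measure_preimage
    ((by fun_prop : Measurable fun k : Fin m → Wavevec d => β⁻¹ • k) hs).nullMeasurableSet,
    Measure.addHaar_preimage_smul _ (inv_ne_zero hβ.ne'), h0, mul_zero]

/-- Rescaling of a multilinear convolution. -/
theorem rescaleOp_fiberOp {m : ℕ} (hm : 1 ≤ m) {β : ℝ} (hβ : 0 < β) (c : Fin m → Wavevec d)
    {ψ : (Fin m → Wavevec d) → ℂ} (hψ : EssBdd ψ volume)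
    (u : Fin m → Lp ℂ 1 (volume : Measure (Wavevec d))) :
    rescaleOp β (∑ j, c j) (fiberOp d m ℂ (vMul volume ψ (tens d m u))) =
      fiberOp d m ℂ (vMul volume (fun κ : Fin m → Wavevec d => ψ fun j => β⁻¹ • (κ j - c j))
        (tens d m fun j => rescaleOp β (c j) (u j))) := by
  apply Lp.ext
  set Φ := vMul volume ψ (tens d m u)
  set w := fun j => rescaleOp β (c j) (u j)
  have hΦ : Φ =ᵐ[volume] fun κ => (∏ j, u j (κ j)) * ψ κ := by
    filter_upwards [vMul_coe hψ (tens d m u), tens_coe u] with κ a b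
    rw [a, b, smul_eq_mul]
  have hR : vMul volume (fun κ : Fin m → Wavevec d => ψ fun j => β⁻¹ • (κ j - c j)) (tens d m w)
      =ᵐ[volume] fun κ => (∏ j, rescale β (c j) (u j) (κ j)) *
        ψ fun j => β⁻¹ • (κ j - c j) := by
    filter_upwards [vMul_coe (hψ.comp_quasi (quasiMeasurePreserving_rescale_pi hβ c)) (tens d m w),
      tens_coe w, ae_all_iff.2 fun j => (quasiMeasurePreserving_apply j).ae
        (rescaleOp_coe hβ (c j) (u j))] with κ a b e
    rw [a, b, smul_eq_mul]
    congr 1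
    exact Finset.prod_congr rfl fun j _ => e j
  filter_upwards [rescaleOp_coe hβ (∑ j, c j) (fiberOp d m ℂ Φ),
    (quasiMeasurePreserving_rescale hβ (∑ j, c j)).ae (fiberOp_coe hm Φ), fiberOp_coe hm
      (vMul volume (fun κ : Fin m → Wavevec d => ψ fun j => β⁻¹ • (κ j - c j)) (tens d m w)),
    ae_ae_convFreqs hm hR, (quasiMeasurePreserving_rescale hβ (∑ j, c j)).ae
      (ae_ae_convFreqs hm hΦ)] with k a b e f g
  rw [a, e, integral_congr_ae f, rescale, b, integral_congr_ae g]
  -- The $m$ factors $\beta^{-d}$ of the rescaled functions and the Jacobian $\beta^{(m-1)d}$ leave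
  -- the single $\beta^{-d}$ of the rescaled output.
  have h := integral_convFreqs_rescale hm hβ c k
    (fun η => ((((β ^ d)⁻¹ : ℝ) : ℂ) ^ m) * ((∏ j, u j (η j)) * ψ η))
  have h2 : ∀ q, (∏ j, rescale β (c j) (u j) (convFreqs m k q j)) *
      ψ (fun j => β⁻¹ • (convFreqs m k q j - c j)) = (((β ^ d)⁻¹ : ℝ) : ℂ) ^ m *
      ((∏ j, u j (β⁻¹ • (convFreqs m k q j - c j))) *
        ψ (fun j => β⁻¹ • (convFreqs m k q j - c j))) := by
    intro q
    simp only [rescale, Finset.prod_mul_distrib, Finset.prod_const, Finset.card_univ,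
      Fintype.card_fin]
    ring
  simp_rw [h2]
  rw [h, integral_const_mul, Complex.real_smul, ← mul_assoc]
  congr 1
  obtain ⟨p, rfl⟩ : ∃ p, m = p + 1 := ⟨m - 1, by omega⟩
  push_cast
  have : (β : ℂ) ≠ 0 := by exact_mod_cast hβ.ne'
  rw [mul_comm p d, pow_mul, inv_pow, pow_succ]
  field_simp

end Rescale

/-! ### Simplicity of the spectrum away from band crossings. -/

section Bands

variable {d J : ℕ} {L : Wavevec d → (Field2J J →L[ℂ] Field2J J)}
  {ω : Fin J → ℤˣ → Wavevec d → ℝ} {g : Fin J → ℤˣ → Wavevec d → Field2J J}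

/-- A zero of the first band is a band-crossing point by definition, and the ordering transfers
positivity to the higher bands. -/
theorem omega_pos (hL : LinearCondition L ω g) {k : Wavevec d} (hk : k ∉ bandCrossing L ω)
    (n : Fin J) : 0 < ω n 1 k := by
  have h0 : 0 < J := n.pos
  have h1 : ω ⟨0, h0⟩ 1 k ≠ 0 := fun h => hk (Or.inr (Or.inr ⟨⟨0, h0⟩, 1, rfl, h⟩))
  exact lt_of_lt_of_le (lt_of_le_of_ne (hL.nonneg k hk _) h1.symm)
    (hL.ordered_pos k hk (show (⟨0, h0⟩ : Fin J) ≤ n from Nat.zero_le _))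

theorem omega_neg (hL : LinearCondition L ω g) {k : Wavevec d} (hk : k ∉ bandCrossing L ω)
    (n : Fin J) : ω n (-1) k < 0 := by
  have h0 : 0 < J := n.pos
  have h1 : ω ⟨0, h0⟩ (-1) k ≠ 0 := fun h => hk (Or.inr (Or.inr ⟨⟨0, h0⟩, -1, rfl, h⟩))
  exact lt_of_le_of_lt (hL.ordered_neg k hk (show (⟨0, h0⟩ : Fin J) ≤ n from Nat.zero_le _))
    (lt_of_le_of_ne (hL.nonpos k hk _) h1)

/-- Zero separates bands of opposite sign. For one sign, equality of two bands would by monotonicity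
squeeze two consecutive bands together, which is a crossing. -/
theorem omega_injective (hL : LinearCondition L ω g) {k : Wavevec d} (hk : k ∉ bandCrossing L ω)
    {n n' : Fin J} {ζ ζ' : ℤˣ} (h : ω n ζ k = ω n' ζ' k) : n = n' ∧ ζ = ζ' := by
  have hp := omega_pos hL hk
  have hn := omega_neg hL hk
  have key : ∀ ζ : ℤˣ, ∀ a b : Fin J, a < b → ω a ζ k ≠ ω b ζ k := by
    intro ζ a b hab he
    have hc : (a : ℕ) + 1 < J := by have := b.2; have : (a : ℕ) < b := hab; omega
    have hcb : (⟨a + 1, hc⟩ : Fin J) ≤ b := hab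
    have hac : a ≤ (⟨a + 1, hc⟩ : Fin J) := Nat.le_succ _
    refine hk (Or.inl ⟨a, ⟨a + 1, hc⟩, ζ, rfl, ?_⟩)
    rcases Int.units_eq_one_or ζ with rfl | rfl
    · exact le_antisymm ((hL.ordered_pos k hk hcb).trans he.ge) (hL.ordered_pos k hk hac)
    · exact le_antisymm (hL.ordered_neg k hk hac) (he.le.trans (hL.ordered_neg k hk hcb))
  have hζ : ζ = ζ' := by
    rcases Int.units_eq_one_or ζ with rfl | rfl <;> rcases Int.units_eq_one_or ζ' with rfl | rfl
    · rfl
    · exact absurd h ((hn n').trans (hp n)).ne'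
    · exact absurd h ((hn n).trans (hp n')).ne
    · rfl
  subst hζ
  refine ⟨?_, rfl⟩
  rcases lt_trichotomy n n' with h1 | h1 | h1
  · exact absurd h (key ζ _ _ h1)
  · exact h1
  · exact absurd h.symm (key ζ _ _ h1)

/-- This reduces both signs to the band $\omega_{n,+}$, in terms of which the resonance conditions
and the envelope dispersion are stated. -/
theorem omega_eq_sgn (hL : LinearCondition L ω g) {k : Wavevec d} (hk : k ∉ bandCrossing L ω)
    (n : Fin J) (ζ : ℤˣ) (hk' : sgn ζ • k ∉ bandCrossing L ω) :
    ω n ζ k = sgn ζ * ω n 1 (sgn ζ • k) := by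
  rcases Int.units_eq_one_or ζ with rfl | rfl
  · simp [sgn]
  · have := hL.symm k hk n (-1)
    simp [sgn] at this ⊢
    linarith

end Bands

/-! ### Weak universality and the cubic normal forms. -/

section Universality

variable {d J N : ℕ} {ω : Fin J → ℤˣ → Wavevec d → ℝ} {g : Fin J → ℤˣ → Wavevec d → Field2J J}
  {M : Finset ℕ}
  {χ : (m : ℕ) → Wavevec d → (Fin m → Wavevec d) →
      ContinuousMultilinearMap ℂ (fun _ : Fin m => Field2J J) (Field2J J)}
  {n : Fin N → Fin J} {κ : Fin N → Wavevec d}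

theorem mem_resonantStrings {l : Fin N} {ϑ : ℤˣ} {m : ℕ} {lam : Fin m → Fin N × ℤˣ} :
    lam ∈ resonantStrings ω n κ l ϑ m ↔
      ∑ j, sgn (lam j).2 • κ (lam j).1 = sgn ϑ • κ l ∧
      ∑ j, sgn (lam j).2 * ω (n (lam j).1) 1 (κ (lam j).1) = sgn ϑ * ω (n l) 1 (κ l) := by
  simp [resonantStrings]

/-- The exponents along a resonant string add up to that of the output by the frequency condition
alone, so a common phase leaves the integral. The susceptibility plays no role. -/
theorem weaklyUniversal_envelopeNonlinearity (ν : ℕ) (β : ℝ) :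
    WeaklyUniversal (fun l => ω (n l) 1 (κ l)) (envelopeNonlinearity ω g M χ n κ ν β) := by
  intro t y l ϑ η
  simp only [envelopeNonlinearity, Finset.mul_sum]
  refine Finset.sum_congr rfl fun m _ => Finset.sum_congr rfl fun lam hlam => ?_
  have h := (mem_resonantStrings.1 hlam).2
  have key : ∀ q, approxSusceptibility g χ n κ ν β l ϑ lam (convFreqs m η q) *
      ∏ x, (Complex.exp (Complex.I *
        ((sgn (lam x).2 * ω (n (lam x).1) 1 (κ (lam x).1) * t : ℝ) : ℂ)) *
          y (lam x).1 (lam x).2 (convFreqs m η q x)) =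
      Complex.exp (Complex.I * ((sgn ϑ * ω (n l) 1 (κ l) * t : ℝ) : ℂ)) *
        (approxSusceptibility g χ n κ ν β l ϑ lam (convFreqs m η q) *
          ∏ x, y (lam x).1 (lam x).2 (convFreqs m η q x)) := by
    intro q
    rw [Finset.prod_mul_distrib, ← Complex.exp_sum, ← Finset.mul_sum, ← Complex.ofReal_sum,
      ← Finset.sum_mul, h]
    ring
  simp_rw [key]
  rw [integral_const_mul, mul_left_comm]

theorem tripleConv_swap (u v w : Wavevec d → ℂ) (η : Wavevec d) :
    tripleConv u v w η = tripleConv v u w η := by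
  unfold tripleConv
  congr 1
  have h := volume_measurePreserving_piCongrLeft (fun _ : Fin 2 => Wavevec d) (Equiv.swap 0 1)
  rw [← h.integral_comp (MeasurableEquiv.measurableEmbedding _)]
  congr 1
  funext q
  have h0 : (MeasurableEquiv.piCongrLeft (fun _ : Fin 2 => Wavevec d) (Equiv.swap 0 1)) q 0 = q 1 :=
    Equiv.piCongrLeft_apply_apply (fun _ : Fin 2 => Wavevec d) (Equiv.swap 0 1) q 1
  have h1 : (MeasurableEquiv.piCongrLeft (fun _ : Fin 2 => Wavevec d) (Equiv.swap 0 1)) q 1 = q 0 :=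
    Equiv.piCongrLeft_apply_apply (fun _ : Fin 2 => Wavevec d) (Equiv.swap 0 1) q 0
  rw [h0, h1, sub_right_comm, mul_comm (u (q 1))]

/-- Exchanging the last two factors is the volume-preserving involution $(a,b)\mapsto(a,\eta-a-b)$.
Together with `tripleConv_swap` it generates all permutations of the factors. -/
theorem tripleConv_swap_right (u v w : Wavevec d → ℂ) (η : Wavevec d) :
    tripleConv u v w η = tripleConv u w v η := by
  unfold tripleConv
  congr 1
  have h1 : MeasurePreserving (fun x : Wavevec d × Wavevec d => (x.1, η - x.1 - x.2))
      (volume.prod volume) (volume.prod volume) := by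
    refine MeasurePreserving.skew_product (f := id)
      (g := fun (a b : Wavevec d) => η - a - b) (MeasurePreserving.id _) (by fun_prop) ?_
    exact Eventually.of_forall fun a => (Measure.measurePreserving_sub_left volume (η - a)).map_eq
  have hinv : Function.Involutive (fun x : Wavevec d × Wavevec d => (x.1, η - x.1 - x.2)) :=
    fun x => by simp
  let e := MeasurableEquiv.ofInvolutive _ hinv h1.measurable
  have h2 := volume_preserving_finTwoArrow (Wavevec d)
  have step : ∀ v w : Wavevec d → ℂ, (∫ q : Fin 2 → Wavevec d, u (q 0) * v (q 1) *
      w (η - q 0 - q 1)) = ∫ x : Wavevec d × Wavevec d, u x.1 * v x.2 * w (η - x.1 - x.2)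
        ∂(volume.prod volume) := by
    intro v w
    rw [← Measure.volume_eq_prod, ← h2.integral_comp (MeasurableEquiv.measurableEmbedding _)]
    rfl
  rw [step, step, ← h1.integral_comp e.measurableEmbedding]
  congr 1
  funext x
  simp only [sub_sub_cancel]
  ring

theorem integral_string_three (y : Fin N → ℤˣ → Wavevec d → ℂ) (l : Fin N) (ϑ : ℤˣ) (β : ℝ)
    (lam : Fin 3 → Fin N × ℤˣ) (η : Wavevec d) :
    (convFactor d 3 : ℂ) * ∫ q : Fin (3 - 1) → Wavevec d,
      approxSusceptibility g χ n κ 0 β l ϑ lam (convFreqs 3 η q) *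
        ∏ i, y (lam i).1 (lam i).2 (convFreqs 3 η q i) =
    scalarSusceptibility g χ n l ϑ lam
        (sgn ϑ • κ l, fun i => sgn (lam i).2 • κ (lam i).1) *
      tripleConv (y (lam 0).1 (lam 0).2) (y (lam 1).1 (lam 1).2) (y (lam 2).1 (lam 2).2) η := by
  simp only [approxSusceptibility, if_true, add_zero]
  rw [integral_const_mul, mul_left_comm]
  congr 2
  show ∫ q : Fin 2 → Wavevec d, _ = _
  congr 1
  funext q
  rw [Fin.prod_univ_three]
  have e0 : convFreqs 3 η q 0 = q 0 := rfl
  have e1 : convFreqs 3 η q 1 = q 1 := rfl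
  have e2 : convFreqs 3 η q 2 = η - q 0 - q 1 := by
    show η - ∑ j : Fin 2, q j = _
    rw [Fin.sum_univ_two, sub_sub]
  rw [e0, e1, e2]

/-- Sign patterns of the cubic strings in resonance with a given component. -/
theorem cubic_patterns : ∀ (ϑ : ℤˣ) (f₀ f₁ f₂ : Bool × ℤˣ),
    ((if f₀.1 then (f₀.2 : ℤ) else 0) + (if f₁.1 then (f₁.2 : ℤ) else 0) +
      (if f₂.1 then (f₂.2 : ℤ) else 0) = ϑ) →
    ((if f₀.1 then 0 else (f₀.2 : ℤ)) + (if f₁.1 then 0 else (f₁.2 : ℤ)) +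
      (if f₂.1 then 0 else (f₂.2 : ℤ)) = 0) →
    ((f₀, f₁, f₂) ∈ [((true, ϑ), (true, ϑ), (true, -ϑ)), ((true, ϑ), (true, -ϑ), (true, ϑ)),
      ((true, -ϑ), (true, ϑ), (true, ϑ))]) ∨
    ((f₀, f₁, f₂) ∈ [((false, ϑ), (false, -ϑ), (true, ϑ)), ((false, -ϑ), (false, ϑ), (true, ϑ)),
      ((false, ϑ), (true, ϑ), (false, -ϑ)), ((false, -ϑ), (true, ϑ), (false, ϑ)),
      ((true, ϑ), (false, ϑ), (false, -ϑ)), ((true, ϑ), (false, -ϑ), (false, ϑ))]) := by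
  decide

/-- The Boolean records whether a factor belongs to the distinguished wavepacket. Given the two
signed counts, the convolution depends only on whether all three factors belong to it, because the
admissible patterns of each kind are permutations of one another. -/
theorem tripleConv_pattern (Y : Bool → ℤˣ → Wavevec d → ℂ) (η : Wavevec d) {ϑ : ℤˣ}
    {f₀ f₁ f₂ : Bool × ℤˣ}
    (h1 : (if f₀.1 then (f₀.2 : ℤ) else 0) + (if f₁.1 then (f₁.2 : ℤ) else 0) +
      (if f₂.1 then (f₂.2 : ℤ) else 0) = ϑ)
    (h2 : (if f₀.1 then 0 else (f₀.2 : ℤ)) + (if f₁.1 then 0 else (f₁.2 : ℤ)) +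
      (if f₂.1 then 0 else (f₂.2 : ℤ)) = 0) :
    tripleConv (Y f₀.1 f₀.2) (Y f₁.1 f₁.2) (Y f₂.1 f₂.2) η =
      if f₀.1 && f₁.1 && f₂.1 then tripleConv (Y true ϑ) (Y true (-ϑ)) (Y true ϑ) η
      else tripleConv (Y false ϑ) (Y false (-ϑ)) (Y true ϑ) η := by
  have hs := fun u v w => tripleConv_swap (d := d) u v w η
  have hr := fun u v w => tripleConv_swap_right (d := d) u v w η
  rcases cubic_patterns ϑ f₀ f₁ f₂ h1 h2 with h | h
  · simp only [List.mem_cons, Prod.mk.injEq, List.not_mem_nil, or_false] at h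
    rcases h with ⟨rfl, rfl, rfl⟩ | ⟨rfl, rfl, rfl⟩ | ⟨rfl, rfl, rfl⟩
    · simpa using hr _ _ _
    · simp
    · simpa using hs _ _ _
  · simp only [List.mem_cons, Prod.mk.injEq, List.not_mem_nil, or_false] at h
    rcases h with ⟨rfl, rfl, rfl⟩ | ⟨rfl, rfl, rfl⟩ | ⟨rfl, rfl, rfl⟩ | ⟨rfl, rfl, rfl⟩ |
      ⟨rfl, rfl, rfl⟩ | ⟨rfl, rfl, rfl⟩
    · simp
    · simpa using hs _ _ _
    · simpa using hr _ _ _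
    · simpa using (hr _ _ _).trans (hs _ _ _)
    · simpa using (hs _ _ _).trans (hr _ _ _)
    · simpa using (hs _ _ _).trans ((hr _ _ _).trans (hs _ _ _))

/-- With one wavepacket the frequency condition is
$(\zeta_0+\zeta_1+\zeta_2)\,\omega=\vartheta\omega$, and $\omega>0$ fixes the sum of the signs. -/
theorem envelopeNonlinearity_nls {L : Wavevec d → (Field2J J →L[ℂ] Field2J J)}
    (hL : LinearCondition L ω g) (hκ : ∀ l (ζ : ℤˣ), sgn ζ • κ l ∉ bandCrossing L ω)
    (hN : N = 1) (hM : M = {3}) (l : Fin N) (ϑ : ℤˣ) :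
    ∃ b : ℂ, ∀ (β : ℝ) (y : Fin N → ℤˣ → Wavevec d → ℂ) (η : Wavevec d),
      envelopeNonlinearity ω g M χ n κ 0 β y l ϑ η =
        b * tripleConv (y l ϑ) (y l ϑ) (y l (-ϑ)) η := by
  subst hN hM
  refine ⟨∑ lam ∈ resonantStrings ω n κ l ϑ 3, scalarSusceptibility g χ n l ϑ lam
        (sgn ϑ • κ l, fun i => sgn (lam i).2 • κ (lam i).1), fun β y η => ?_⟩
  rw [envelopeNonlinearity, Finset.sum_singleton, Finset.sum_mul]
  refine Finset.sum_congr rfl fun lam hlam => ?_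
  rw [integral_string_three]
  congr 1
  have hl : ∀ i, i = l := fun i => Subsingleton.elim _ _
  obtain ⟨-, h⟩ := mem_resonantStrings.1 hlam
  have hpos : 0 < ω (n l) 1 (κ l) := omega_pos hL (by simpa [sgn] using hκ l 1) _
  simp only [hl, Fin.sum_univ_three] at h ⊢
  have h' : sgn (lam 0).2 + sgn (lam 1).2 + sgn (lam 2).2 = sgn ϑ := by
    apply mul_right_cancel₀ hpos.ne'
    linarith
  have hz : (((lam 0).2 : ℤ) + ((lam 1).2 : ℤ) + ((lam 2).2 : ℤ)) = (ϑ : ℤ) := by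
    simp only [sgn] at h'
    exact_mod_cast h'
  have := tripleConv_pattern (fun _ => y l) η (ϑ := ϑ) (f₀ := (true, (lam 0).2))
    (f₁ := (true, (lam 1).2)) (f₂ := (true, (lam 2).2)) (by simpa using hz) (by simp)
  simp only [Bool.and_self, if_true] at this
  rw [this]
  exact tripleConv_swap_right _ _ _ _

/-- Let $a$ and $b$ be the signed numbers of factors from $l$ and $l'$. Since $\mathbf
k_{*l'}=-\mathbf k_{*l}\ne0$, the wavevector condition says $a-b=\vartheta$. Inserting this in
$a\omega_l+b\omega_{l'}=\vartheta\omega_l$ gives $b(\omega_l+\omega_{l'})=0$, so $b=0$ and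
$a=\vartheta$ by positivity. -/
theorem envelopeNonlinearity_coupled {L : Wavevec d → (Field2J J →L[ℂ] Field2J J)}
    (hL : LinearCondition L ω g) (hκ : ∀ l (ζ : ℤˣ), sgn ζ • κ l ∉ bandCrossing L ω)
    (hN : N = 2) (hM : M = {3}) (l l' : Fin N) (hll : l ≠ l') (hneg : κ l' = -κ l)
    (h0 : κ l ≠ 0) (ϑ : ℤˣ) :
    ∃ b b' : ℂ, ∀ (β : ℝ) (y : Fin N → ℤˣ → Wavevec d → ℂ) (η : Wavevec d),
      envelopeNonlinearity ω g M χ n κ 0 β y l ϑ η =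
        b * tripleConv (y l ϑ) (y l (-ϑ)) (y l ϑ) η +
          b' * tripleConv (y l' ϑ) (y l' (-ϑ)) (y l ϑ) η := by
  subst hN hM
  -- The predicate selects self-interactions, whose susceptibilities add up to $b$; the remaining
  -- strings give the cross coefficient $b'$.
  let A : (Fin 3 → Fin 2 × ℤˣ) → Prop := fun lam =>
    (decide ((lam 0).1 = l) && decide ((lam 1).1 = l) && decide ((lam 2).1 = l)) = true
  refine ⟨∑ lam ∈ resonantStrings ω n κ l ϑ 3 with A lam, scalarSusceptibility g χ n l ϑ lam
        (sgn ϑ • κ l, fun i => sgn (lam i).2 • κ (lam i).1),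
    ∑ lam ∈ resonantStrings ω n κ l ϑ 3 with ¬ A lam, scalarSusceptibility g χ n l ϑ lam
        (sgn ϑ • κ l, fun i => sgn (lam i).2 • κ (lam i).1), fun β y η => ?_⟩
  have hl : ∀ i, i ≠ l → i = l' := by
    intro i hi
    omega
  have hposl : 0 < ω (n l) 1 (κ l) := omega_pos hL (by simpa [sgn] using hκ l 1) _
  have hposl' : 0 < ω (n l') 1 (κ l') := omega_pos hL (by simpa [sgn] using hκ l' 1) _
  have key : ∀ lam ∈ resonantStrings ω n κ l ϑ 3,
      tripleConv (y (lam 0).1 (lam 0).2) (y (lam 1).1 (lam 1).2) (y (lam 2).1 (lam 2).2) η =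
      if A lam then tripleConv (y l ϑ) (y l (-ϑ)) (y l ϑ) η
      else tripleConv (y l' ϑ) (y l' (-ϑ)) (y l ϑ) η := by
    intro lam hlam
    obtain ⟨h1, h2⟩ := mem_resonantStrings.1 hlam
    let a : Fin 3 → ℤ := fun j => if decide ((lam j).1 = l) then ((lam j).2 : ℤ) else 0
    let b : Fin 3 → ℤ := fun j => if decide ((lam j).1 = l) then 0 else ((lam j).2 : ℤ)
    have e1 : ∀ j, sgn (lam j).2 • κ (lam j).1 = ((a j : ℝ) - b j) • κ l := by
      intro j
      by_cases h : (lam j).1 = l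
      · simp [a, b, h, sgn]
      · simp [a, b, hl _ h, hneg, sgn, hll.symm]
    have e2 : ∀ j, sgn (lam j).2 * ω (n (lam j).1) 1 (κ (lam j).1) =
        a j * ω (n l) 1 (κ l) + b j * ω (n l') 1 (κ l') := by
      intro j
      by_cases h : (lam j).1 = l
      · simp [a, b, h, sgn]
      · simp [a, b, hl _ h, sgn, hll.symm]
    simp only [e1, e2, ← Finset.sum_smul, Finset.sum_add_distrib, ← Finset.sum_mul,
      Finset.sum_sub_distrib] at h1 h2
    have h3 := smul_left_injective ℝ h0 h1
    have hb : ∑ j, (b j : ℝ) = 0 := by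
      have : (∑ j, (b j : ℝ)) * (ω (n l) 1 (κ l) + ω (n l') 1 (κ l')) = 0 := by
        rw [← h3] at h2
        linarith
      exact (mul_eq_zero.1 this).resolve_right (by positivity)
    have ha : ∑ j, (a j : ℝ) = sgn ϑ := by linarith
    have hbz : ∑ j, b j = 0 := by exact_mod_cast hb
    have haz : ∑ j, a j = (ϑ : ℤ) := by
      simp only [sgn] at ha
      exact_mod_cast ha
    rw [Fin.sum_univ_three] at haz hbz
    have hp := tripleConv_pattern (fun i => if i then y l else y l') η (ϑ := ϑ)
      (f₀ := (decide ((lam 0).1 = l), (lam 0).2)) (f₁ := (decide ((lam 1).1 = l), (lam 1).2))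
      (f₂ := (decide ((lam 2).1 = l), (lam 2).2)) haz hbz
    have hy : ∀ j, (if decide ((lam j).1 = l) = true then y l else y l') = y (lam j).1 := by
      intro j
      by_cases h : (lam j).1 = l
      · simp [h]
      · simp [hl _ h, hll.symm]
    simp only [hy] at hp
    rw [hp]
    simp [A]
  rw [envelopeNonlinearity, Finset.sum_singleton, Finset.sum_mul, Finset.sum_mul,
    ← Finset.sum_filter_add_sum_filter_not (resonantStrings ω n κ l ϑ 3) A]
  congr 1
  · refine Finset.sum_congr rfl fun lam hlam => ?_
    rw [Finset.mem_filter] at hlam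
    rw [integral_string_three, key lam hlam.1, if_pos hlam.2]
  · refine Finset.sum_congr rfl fun lam hlam => ?_
    rw [Finset.mem_filter] at hlam
    rw [integral_string_three, key lam hlam.1, if_neg hlam.2]

end Universality

/-! ### Existence, uniqueness and stability for integral equations in a Banach space. -/

section IntegralEquation

variable {X : Type*} [NormedAddCommGroup X] [NormedSpace ℝ X] [CompleteSpace X]

/-- Extending `G` by its endpoint values makes it continuous on the line, so its primitive is
differentiable everywhere and no one-sided derivatives are needed at the ends of the interval. -/
theorem exists_hasDerivAt_extension {G : ℝ → X} {T : ℝ} (hT : 0 ≤ T)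
    (hG : ContinuousOn G (Icc 0 T)) (h : X) :
    ∃ u G' : ℝ → X, Continuous G' ∧ (∀ t, HasDerivAt u (G' t) t) ∧
      (∀ t ∈ Icc 0 T, u t = (∫ s in (0 : ℝ)..t, G s) + h) ∧ EqOn G' G (Icc 0 T) ∧
      ∀ t, ∃ s ∈ Icc 0 T, G' t = G s := by
  have hc : Continuous (IccExtend hT ((Icc 0 T).domRestrict G)) :=
    (continuousOn_iff_continuous_domRestrict.1 hG).Icc_extend'
  have heq : EqOn (IccExtend hT ((Icc 0 T).domRestrict G)) G (Icc 0 T) := fun t ht => by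
    rw [IccExtend_of_mem _ _ ht]; rfl
  refine ⟨fun t => (∫ s in (0 : ℝ)..t, IccExtend hT ((Icc 0 T).domRestrict G) s) + h, _, hc,
    fun t => ?_, fun t ht => ?_, heq, fun t => ⟨projIcc 0 T hT t, (projIcc 0 T hT t).2, rfl⟩⟩
  · exact (intervalIntegral.integral_hasDerivAt_right (hc.intervalIntegrable _ _)
      (hc.stronglyMeasurableAtFilter _ _) hc.continuousAt).add_const h
  · simp only
    congr 1
    refine intervalIntegral.integral_congr fun s hs => heq ?_
    rw [uIcc_of_le ht.1] at hs
    exact ⟨hs.1, hs.2.trans ht.2⟩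

/-- Grönwall stability of an integral equation with respect to the initial data and to a
perturbation `E - P` of the vector field whose time integral is small. -/
theorem gronwall_stability {u v A E P : ℝ → X} {T K ε₁ ε₂ : ℝ} {h h' : X} (hK : 0 < K)
    (hA : ContinuousOn A (Icc 0 T)) (hE : ContinuousOn E (Icc 0 T))
    (hP : ContinuousOn P (Icc 0 T))
    (hu : ∀ t ∈ Icc 0 T, u t = (∫ s in (0 : ℝ)..t, A s) + h)
    (hv : ∀ t ∈ Icc 0 T, v t = (∫ s in (0 : ℝ)..t, E s) + h')
    (hAP : ∀ t ∈ Icc 0 T, ‖A t - P t‖ ≤ K * ‖u t - v t‖)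
    (hε₁ : ∀ t ∈ Icc 0 T, ‖∫ s in (0 : ℝ)..t, (E s - P s)‖ ≤ ε₁) (hε₂ : ‖h - h'‖ ≤ ε₂) :
    ∀ t ∈ Icc 0 T, ‖u t - v t‖ ≤ (ε₁ + ε₂) * Real.exp (K * T) := by
  intro t ht
  have hT : 0 ≤ T := ht.1.trans ht.2
  -- Here $w=\int(A-P)+h-h'$, so that $u-v=w-\int(E-P)$ and $\|u-v\|\le\|w\|+\varepsilon_1$.
  -- Grönwall is applied to $w$, whose derivative satisfies $\|w'\|\le K(\|w\|+\varepsilon_1)$; only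
  -- the primitive of $E-P$ has to be small.
  obtain ⟨w, W, hWc, hw, hwe, hWe, -⟩ := exists_hasDerivAt_extension hT (hA.sub hP) (h - h')
  have hint : ∀ {f : ℝ → X}, ContinuousOn f (Icc 0 T) → ∀ s ∈ Icc 0 T,
      IntervalIntegrable f volume 0 s := fun hf s hs => by
    refine ContinuousOn.intervalIntegrable (hf.mono ?_)
    rw [uIcc_of_le hs.1]
    exact Icc_subset_Icc_right hs.2
  have hrel : ∀ s ∈ Icc 0 T, u s - v s = w s - ∫ r in (0 : ℝ)..s, (E r - P r) := by
    intro s hs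
    rw [hu s hs, hv s hs, hwe s hs]
    simp only [Pi.sub_apply]
    rw [intervalIntegral.integral_sub (hint hA s hs) (hint hP s hs),
      intervalIntegral.integral_sub (hint hE s hs) (hint hP s hs)]
    abel
  have hε₁0 : 0 ≤ ε₁ := (norm_nonneg _).trans (hε₁ t ht)
  have hle : ∀ s ∈ Icc 0 T, ‖u s - v s‖ ≤ ‖w s‖ + ε₁ := fun s hs => by
    rw [hrel s hs]
    exact (norm_sub_le _ _).trans (by gcongr; exact hε₁ s hs)
  have hg := norm_le_gronwallBound_of_norm_deriv_right_le (f := w) (f' := W) (δ := ε₂) (K := K)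
    (ε := K * ε₁) (a := 0) (b := T) (fun s _ => (hw s).continuousAt.continuousWithinAt)
    (fun s _ => (hw s).hasDerivWithinAt) (by
      rw [hwe 0 ⟨le_rfl, hT⟩]
      simpa using hε₂) (fun s hs => by
      have hs' : s ∈ Icc 0 T := ⟨hs.1, hs.2.le⟩
      rw [hWe hs']
      refine (hAP s hs').trans ?_
      rw [← mul_add]
      gcongr
      exact hle s hs') t ht
  rw [gronwallBound_of_K_ne_0 hK.ne'] at hg
  have hε₂0 : 0 ≤ ε₂ := (norm_nonneg _).trans hε₂
  have h1 : K * ε₁ / K = ε₁ := by field_simp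
  have hexp : Real.exp (K * t) ≤ Real.exp (K * T) := by
    gcongr
    exact ht.2
  calc ‖u t - v t‖ ≤ ‖w t‖ + ε₁ := hle t ht
    _ ≤ (ε₂ * Real.exp (K * (t - 0)) + K * ε₁ / K * (Real.exp (K * (t - 0)) - 1)) + ε₁ := by
        gcongr
    _ = (ε₁ + ε₂) * Real.exp (K * t) := by rw [h1, sub_zero]; ring
    _ ≤ _ := by gcongr

/-- A time-dependent vector field which is continuous along continuous curves, and bounded and
Lipschitz on balls uniformly in time. -/
structure IsRegularField (V : ℝ → X → X) (B K : ℝ → ℝ) : Prop where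
  continuous_comp : ∀ x : ℝ → X, Continuous x → Continuous fun t => V t (x t)
  bound : ∀ r t x, ‖x‖ ≤ r → ‖V t x‖ ≤ B r
  lipschitz : ∀ r t x y, ‖x‖ ≤ r → ‖y‖ ≤ r → ‖V t x - V t y‖ ≤ K r * ‖x - y‖

/-- Solutions in `C([0,T], X)` of the integral equation of a vector field. -/
def IsIntegralSolution (V : ℝ → X → X) (T : ℝ) (h : X) (u : ℝ → X) : Prop :=
  ContinuousOn u (Icc 0 T) ∧ ∀ t ∈ Icc 0 T, u t = (∫ s in (0 : ℝ)..t, V s (u s)) + h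

theorem IsRegularField.continuousOn_comp {V : ℝ → X → X} {B K : ℝ → ℝ} (hV : IsRegularField V B K)
    {T : ℝ} {u : ℝ → X} (hu : ContinuousOn u (Icc 0 T)) :
    ContinuousOn (fun t => V t (u t)) (Icc 0 T) := by
  by_cases hT : 0 ≤ T
  · have hc : Continuous (IccExtend hT ((Icc 0 T).domRestrict u)) :=
      (continuousOn_iff_continuous_domRestrict.1 hu).Icc_extend'
    refine (hV.continuous_comp _ hc).continuousOn.congr fun t ht => ?_
    simp only
    rw [IccExtend_of_mem _ _ ht]; rfl
  · rw [Icc_eq_empty hT]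
    exact continuousOn_empty _

/-- Both trajectories are bounded on the compact interval, and the Lipschitz constant of a common
ball enters Grönwall. No smallness of the time is required. -/
theorem IsIntegralSolution.eqOn {V : ℝ → X → X} {B K : ℝ → ℝ} (hV : IsRegularField V B K)
    {T : ℝ} {h : X} {u v : ℝ → X} (hu : IsIntegralSolution V T h u)
    (hv : IsIntegralSolution V T h v) : EqOn u v (Icc 0 T) := by
  obtain ⟨r, hr⟩ := isCompact_Icc.exists_bound_of_continuousOn hu.1
  obtain ⟨r', hr'⟩ := isCompact_Icc.exists_bound_of_continuousOn hv.1
  intro t ht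
  have := gronwall_stability (u := u) (v := v) (T := T) (K := max (K (max r r')) 1) (ε₁ := 0)
    (ε₂ := 0) (h := h) (h' := h) (by positivity) (hV.continuousOn_comp hu.1)
    (hV.continuousOn_comp hv.1) (hV.continuousOn_comp hv.1) hu.2 hv.2 (fun s hs => by
      refine (hV.lipschitz (max r r') s _ _ ((hr s hs).trans (le_max_left _ _))
        ((hr' s hs).trans (le_max_right _ _))).trans ?_
      gcongr
      exact le_max_left _ _) (by simp) (by simp) t ht
  rw [add_zero, zero_mul] at this
  exact sub_eq_zero.1 (norm_le_zero_iff.1 this)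

/-- Picard iteration in a ball centred at $0$ rather than at the data, so that one existence time
serves all data of norm at most `ρ`. The bound by `r` comes with the solution. -/
theorem IsRegularField.exists_isIntegralSolution {V : ℝ → X → X} {B K : ℝ → ℝ}
    (hV : IsRegularField V B K) {T ρ r : ℝ} {h : X} (hT : 0 ≤ T) (hρ : 0 ≤ ρ) (hh : ‖h‖ ≤ ρ)
    (hr : B r * T ≤ r - ρ) (hρr : ρ ≤ r) :
    ∃ u : ℝ → X, IsIntegralSolution V T h u ∧ ∀ t, ‖u t‖ ≤ r := by
  have hr0 : 0 ≤ r := hρ.trans hρr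
  have hB : 0 ≤ B r := (norm_nonneg _).trans (hV.bound r 0 0 (by simpa using hr0))
  obtain ⟨b, hb⟩ : ∃ b : NNReal, (b : ℝ) = B r := ⟨⟨B r, hB⟩, rfl⟩
  lift r to NNReal using hr0
  lift ρ to NNReal using hρ
  have hpl : IsPicardLindelof V (⟨0, left_mem_Icc.2 hT⟩ : Icc (0 : ℝ) T) 0 r ρ b
      (K r).toNNReal := by
    refine ⟨fun t _ => ?_, fun x _ => ?_, fun t _ x hx => ?_, ?_⟩
    · refine LipschitzOnWith.of_dist_le_mul fun x hx y hy => ?_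
      rw [dist_eq_norm, dist_eq_norm]
      refine (hV.lipschitz r t x y (by simpa using hx) (by simpa using hy)).trans ?_
      gcongr
      exact Real.le_coe_toNNReal _
    · exact (hV.continuous_comp _ continuous_const).continuousOn
    · rw [hb]
      exact hV.bound r t x (by simpa using hx)
    · simpa [hT, hb] using hr
  have hx : h ∈ Metric.closedBall (0 : X) ρ := by simpa using hh
  obtain ⟨α, hα⟩ := ODE.FunSpace.exists_isFixedPt_next hpl hx
  refine ⟨(ODE.FunSpace.next hpl hx α).compProj,
    ⟨(ODE.FunSpace.continuous_compProj _).continuousOn, fun t ht => ?_⟩, fun t => ?_⟩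
  · rw [ODE.FunSpace.compProj_apply, ODE.FunSpace.next_apply, hα, projIcc_of_mem _ ht,
      ODE.picard_apply, add_comm]
  · simpa using ODE.FunSpace.compProj_mem_closedBall (ODE.FunSpace.next hpl hx α) hpl.mul_max_le (t := t)

end IntegralEquation

/-! ### Taylor expansion with remainder bounds. -/

section Taylor

variable {E F : Type*} [NormedAddCommGroup E] [NormedSpace ℝ E] [NormedAddCommGroup F]
  [NormedSpace ℝ F]

/-- The derivative telescopes: differentiating the coefficient of one term cancels the derivative of
$\varphi_j$ in the preceding one. -/
theorem hasDerivAt_taylor_sum {φ : ℕ → ℝ → F} {p : ℕ} {t : ℝ}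
    (h : ∀ j ≤ p, HasDerivAt (φ j) (φ (j + 1) t) t) :
    HasDerivAt (fun t => ∑ j ∈ Finset.range (p + 1), ((1 - t) ^ j / (j.factorial : ℝ)) • φ j t)
      (((1 - t) ^ p / (p.factorial : ℝ)) • φ (p + 1) t) t := by
  induction p with
  | zero => simpa using h 0 le_rfl
  | succ p ih =>
    have h1 := ih fun j hj => h j (by omega)
    have h2 : HasDerivAt (fun t : ℝ => (1 - t) ^ (p + 1) / ((p + 1).factorial : ℝ))
        (-((1 - t) ^ p / (p.factorial : ℝ))) t := by
      have := (((hasDerivAt_id t).const_sub 1).pow (p + 1)).div_const ((p + 1).factorial : ℝ)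
      refine this.congr_deriv ?_
      have h0 : (p.factorial : ℝ) ≠ 0 := by positivity
      have h3 : ((p : ℝ) + 1) ≠ 0 := by positivity
      rw [Nat.factorial_succ, Nat.add_sub_cancel]
      push_cast
      simp only [id]
      field_simp
    have h3 := h1.add (h2.smul (h (p + 1) le_rfl))
    have hfun : (fun t => ∑ j ∈ Finset.range (p + 1 + 1), ((1 - t) ^ j / (j.factorial : ℝ)) • φ j t) =
        (fun t => ∑ j ∈ Finset.range (p + 1), ((1 - t) ^ j / (j.factorial : ℝ)) • φ j t) +
        ((fun t : ℝ => (1 - t) ^ (p + 1) / ((p + 1).factorial : ℝ)) • φ (p + 1)) := by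
      funext t
      simp [Finset.sum_range_succ _ (p + 1)]
    rw [hfun]
    convert h3 using 1
    rw [neg_smul]
    abel

/-- Taylor's theorem with a polynomial bound of the remainder, for maps between normed spaces. -/
theorem exists_taylor_bound {f : E → F} {x : E} {p : ℕ} (hf : ContDiffAt ℝ (p + 1 : ℕ) f x) :
    ∃ C, 0 ≤ C ∧ ∃ δ > 0, ∀ v, ‖v‖ ≤ δ →
      ‖f (x + v) - ∑ j ∈ Finset.range (p + 1),
        ((j.factorial : ℝ))⁻¹ • iteratedFDeriv ℝ j f x (fun _ => v)‖ ≤ C * ‖v‖ ^ (p + 1) := by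
  have hev : ∀ᶠ y in 𝓝 x, ContDiffAt ℝ (p + 1 : ℕ) f y := hf.eventually (by simp)
  have hb : ∀ᶠ y in 𝓝 x, ‖iteratedFDeriv ℝ (p + 1) f y‖ < ‖iteratedFDeriv ℝ (p + 1) f x‖ + 1 := by
    have : ContinuousAt (iteratedFDeriv ℝ (p + 1) f) x := hf.continuousAt_iteratedFDeriv le_rfl
    exact this.norm.eventually_lt_const (lt_add_one _)
  obtain ⟨δ, hδ, hball⟩ := Metric.eventually_nhds_iff_ball.1 (hev.and hb)
  refine ⟨‖iteratedFDeriv ℝ (p + 1) f x‖ + 1, by positivity, δ / 2, by positivity, fun v hv => ?_⟩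
  set C := ‖iteratedFDeriv ℝ (p + 1) f x‖ + 1
  have hmem : ∀ t ∈ Icc (0 : ℝ) 1, x + t • v ∈ Metric.ball x δ := by
    intro t ht
    rw [Metric.mem_ball, dist_eq_norm, add_sub_cancel_left, norm_smul, Real.norm_of_nonneg ht.1]
    have : t * ‖v‖ ≤ 1 * ‖v‖ := by gcongr; exact ht.2
    linarith
  set φ : ℕ → ℝ → F := fun j t => iteratedFDeriv ℝ j f (x + t • v) (fun _ => v)
  have hφ : ∀ t ∈ Icc (0 : ℝ) 1, ∀ j ≤ p, HasDerivAt (φ j) (φ (j + 1) t) t := by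
    intro t ht j hj
    have hd : DifferentiableAt ℝ (iteratedFDeriv ℝ j f) (x + t • v) :=
      (hball _ (hmem t ht)).1.differentiableAt_iteratedFDeriv (by exact_mod_cast Nat.lt_succ_of_le hj)
    have hl : HasDerivAt (fun t : ℝ => x + t • v) v t := by
      simpa using ((hasDerivAt_id t).smul_const v).const_add x
    have h1 := hd.hasFDerivAt.comp_hasDerivAt t hl
    have h2 := (ContinuousMultilinearMap.apply ℝ (fun _ : Fin j => E) F
      (fun _ => v)).hasFDerivAt.comp_hasDerivAt t h1
    exact h2
  -- The telescoping sum runs from the Taylor polynomial at $t=0$ to $f(x+v)$ at $t=1$, where only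
  -- $j=0$ survives. The mean value inequality then bounds the remainder by the supremum of the last
  -- derivative on the segment.
  have hmv := norm_image_sub_le_of_norm_deriv_le_segment_01'
    (f := fun t => ∑ j ∈ Finset.range (p + 1), ((1 - t) ^ j / (j.factorial : ℝ)) • φ j t)
    (f' := fun t => ((1 - t) ^ p / (p.factorial : ℝ)) • φ (p + 1) t) (C := C * ‖v‖ ^ (p + 1))
    (fun t ht => (hasDerivAt_taylor_sum (hφ t ht)).hasDerivWithinAt) (fun t ht => by
      have ht' : t ∈ Icc (0 : ℝ) 1 := ⟨ht.1, ht.2.le⟩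
      rw [norm_smul, Real.norm_of_nonneg (div_nonneg (pow_nonneg (by linarith [ht.2]) _)
        (by positivity))]
      have h1 : (1 - t) ^ p / (p.factorial : ℝ) ≤ 1 := by
        rw [div_le_one (by positivity)]
        refine (pow_le_one₀ (by linarith [ht.2]) (by linarith [ht.1])).trans ?_
        exact_mod_cast Nat.succ_le_of_lt p.factorial_pos
      have h2 : ‖φ (p + 1) t‖ ≤ C * ‖v‖ ^ (p + 1) := by
        refine ((iteratedFDeriv ℝ (p + 1) f (x + t • v)).le_opNorm _).trans ?_
        simp only [Finset.prod_const, Finset.card_univ, Fintype.card_fin]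
        gcongr
        exact (hball _ (hmem t ht')).2.le
      calc _ ≤ 1 * ‖φ (p + 1) t‖ := by gcongr
        _ ≤ _ := by rwa [one_mul])
  refine le_trans (le_of_eq ?_) hmv
  congr 1
  have e1 : ∑ j ∈ Finset.range (p + 1), ((1 - (1 : ℝ)) ^ j / (j.factorial : ℝ)) • φ j 1 =
      f (x + v) := by
    rw [Finset.sum_range_succ']
    simp [φ]
  rw [e1]
  simp [φ, div_eq_mul_inv]

theorem exists_linear_taylor_bound {f : E → F} {x : E} (hf : ContDiffAt ℝ 2 f x) :
    ∃ C, 0 ≤ C ∧ ∃ δ > 0, ∀ v, ‖v‖ ≤ δ → ‖f (x + v) - (f x + fderiv ℝ f x v)‖ ≤ C * ‖v‖ ^ 2 := by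
  obtain ⟨C, hC, δ, hδ, h⟩ := exists_taylor_bound (p := 1) (f := f) (x := x) (by exact_mod_cast hf)
  refine ⟨C, hC, δ, hδ, fun v hv => ?_⟩
  simpa [Finset.sum_range_succ, iteratedFDeriv_one_apply] using h v hv

theorem exists_constant_taylor_bound {f : E → F} {x : E} (hf : ContDiffAt ℝ 1 f x) :
    ∃ C, 0 ≤ C ∧ ∃ δ > 0, ∀ v, ‖v‖ ≤ δ → ‖f (x + v) - f x‖ ≤ C * ‖v‖ := by
  obtain ⟨C, hC, δ, hδ, h⟩ := exists_taylor_bound (p := 0) (f := f) (x := x) (by exact_mod_cast hf)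
  refine ⟨C, hC, δ, hδ, fun v hv => ?_⟩
  simpa using h v hv

end Taylor

/-! ### Smoothness of eigenvalues and scalar susceptibilities. -/

section Smooth

variable {d J N : ℕ} {L : Wavevec d → (Field2J J →L[ℂ] Field2J J)}
  {ω : Fin J → ℤˣ → Wavevec d → ℝ} {g : Fin J → ℤˣ → Wavevec d → Field2J J} {M : Finset ℕ}
  {χ : (m : ℕ) → Wavevec d → (Fin m → Wavevec d) →
      ContinuousMultilinearMap ℂ (fun _ : Fin m => Field2J J) (Field2J J)}
  {n : Fin N → Fin J} {κ : Fin N → Wavevec d}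

/-- Expansion of the arguments in the standard basis writes evaluation as a finite sum of products
of coordinates with evaluations at fixed basis vectors. -/
theorem contDiff_multilinear_eval {m : ℕ} {r : WithTop ℕ∞} :
    ContDiff ℝ r fun p : ContinuousMultilinearMap ℂ (fun _ : Fin m => Field2J J) (Field2J J) ×
      (Fin m → Field2J J) => p.1 p.2 := by
  have h : (fun p : ContinuousMultilinearMap ℂ (fun _ : Fin m => Field2J J) (Field2J J) ×
      (Fin m → Field2J J) => p.1 p.2) = fun p => ∑ i : Fin m → Fin (2 * J),
        (∏ j, p.2 j (i j)) • p.1 fun j => EuclideanSpace.single (i j) (1 : ℂ) := by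
    funext p
    have h1 : p.2 = fun j => ∑ i, p.2 j i • EuclideanSpace.single i (1 : ℂ) := by
      funext j
      ext i
      simp [Pi.single_apply]
    conv_lhs => rw [h1]
    rw [p.1.map_sum]
    simp_rw [p.1.map_smul_univ]
  rw [h]
  refine ContDiff.sum fun i _ => ContDiff.fun_smul ?_ ?_
  · refine contDiff_prod fun j _ => ?_
    exact ((EuclideanSpace.proj (𝕜 := ℂ) (i j)).restrictScalars ℝ).contDiff.comp
      (contDiff_pi.1 contDiff_snd j)
  · exact ((ContinuousMultilinearMap.apply ℂ (fun _ : Fin m => Field2J J) (Field2J J)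
      (fun j => EuclideanSpace.single (i j) (1 : ℂ))).restrictScalars ℝ).contDiff.comp contDiff_fst

theorem isOpen_compl_crossing (hL : LinearCondition L ω g) : IsOpen (bandCrossing L ω)ᶜ :=
  hL.crossing_closed.isOpen_compl

theorem contDiffAt_symbol (hL : LinearCondition L ω g) {k : Wavevec d}
    (hk : k ∉ bandCrossing L ω) : ContDiffAt ℝ (⊤ : ℕ∞) L k :=
  hL.smooth.contDiffAt ((isOpen_compl_crossing hL).mem_nhds hk)

theorem omega_eq_inner (hL : LinearCondition L ω g) {k : Wavevec d}
    (hk : k ∉ bandCrossing L ω) (a : Fin J) (ζ : ℤˣ) :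
    (ω a ζ k : ℂ) = inner ℂ (g a ζ k) (L k (g a ζ k)) := by
  rw [hL.eigen k hk, inner_smul_right, inner_self_eq_norm_sq_to_K, hL.unit k hk]
  simp

/-- No regularity of $\omega$ is assumed; it is inherited from the symbol and the eigenvector
through the Rayleigh quotient. -/
theorem contDiffAt_omega (hL : LinearCondition L ω g) {k : Wavevec d}
    (hk : k ∉ bandCrossing L ω) {a : Fin J} {ζ : ℤˣ} (hg : ContDiffAt ℝ (⊤ : ℕ∞) (g a ζ) k) :
    ContDiffAt ℝ (⊤ : ℕ∞) (ω a ζ) k := by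
  have h1 : ContDiffAt ℝ (⊤ : ℕ∞) (fun k => inner ℂ (g a ζ k) (L k (g a ζ k))) k := by
    refine ContDiffAt.inner ℂ hg ?_
    have h2 : ContDiffAt ℝ (⊤ : ℕ∞) (fun k => (L k).restrictScalars ℝ) k :=
      (ContinuousLinearMap.restrictScalarsL ℂ (Field2J J) (Field2J J) ℝ ℝ).contDiff.contDiffAt.comp k
        (contDiffAt_symbol hL hk)
    exact h2.clm_apply hg
  have h2 : ContDiffAt ℝ (⊤ : ℕ∞) (fun k => (inner ℂ (g a ζ k) (L k (g a ζ k))).re) k :=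
    Complex.reCLM.contDiff.contDiffAt.comp k h1
  refine h2.congr_of_eventuallyEq ?_
  filter_upwards [(isOpen_compl_crossing hL).mem_nhds hk] with k' hk'
  rw [← omega_eq_inner hL hk', Complex.ofReal_re]

theorem contDiffAt_scalarSusceptibility (hL : LinearCondition L ω g)
    (hχ : NonlinearCondition (bandCrossing L ω) M χ) (hS : SpectrumCondition L ω g M n κ)
    {m : ℕ} (hm : m ∈ M) (l : Fin N) (ϑ : ℤˣ) (lam : Fin m → Fin N × ℤˣ) :
    ContDiffAt ℝ (⊤ : ℕ∞) (scalarSusceptibility g χ n l ϑ lam)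
      (sgn ϑ • κ l, fun i => sgn (lam i).2 • κ (lam i).1) := by
  set x : Wavevec d × (Fin m → Wavevec d) := (sgn ϑ • κ l, fun i => sgn (lam i).2 • κ (lam i).1)
  have hopen : IsOpen {p : Wavevec d × (Fin m → Wavevec d) |
      p.1 ∉ bandCrossing L ω ∧ ∀ i, p.2 i ∉ bandCrossing L ω} := by
    have : {p : Wavevec d × (Fin m → Wavevec d) |
      p.1 ∉ bandCrossing L ω ∧ ∀ i, p.2 i ∉ bandCrossing L ω} =
      (Prod.fst ⁻¹' (bandCrossing L ω)ᶜ) ∩ ⋂ i, (fun p : Wavevec d × (Fin m → Wavevec d) =>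
        p.2 i) ⁻¹' (bandCrossing L ω)ᶜ := by
      ext p; simp
    rw [this]
    have ho := isOpen_compl_crossing hL
    exact (ho.preimage continuous_fst).inter (isOpen_iInter_of_finite fun i =>
      ho.preimage ((continuous_apply i).comp continuous_snd))
  have h1 : ContDiffAt ℝ (⊤ : ℕ∞) (fun p : Wavevec d × (Fin m → Wavevec d) => χ m p.1 p.2) x :=
    (hχ.smooth m hm).contDiffAt (hopen.mem_nhds
      ⟨hS.noncrossing l ϑ, fun i => hS.noncrossing _ _⟩)
  have h2 : ContDiffAt ℝ (⊤ : ℕ∞) (fun p : Wavevec d × (Fin m → Wavevec d) =>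
      fun i => g (n (lam i).1) (lam i).2 (p.2 i)) x := by
    refine contDiffAt_pi.2 fun i => ?_
    have := hS.eigenvector_smooth (lam i).1 (lam i).2
    exact ContDiffAt.comp x (f := fun p : Wavevec d × (Fin m → Wavevec d) => p.2 i) this
      (contDiff_pi.1 contDiff_snd i).contDiffAt
  have h3 : ContDiffAt ℝ (⊤ : ℕ∞) (fun p : Wavevec d × (Fin m → Wavevec d) =>
      g (n l) ϑ p.1) x :=
    ContDiffAt.comp x (hS.eigenvector_smooth l ϑ) contDiffAt_fst
  exact h3.inner ℂ (contDiff_multilinear_eval.contDiffAt.comp x (h1.prodMk h2))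

end Smooth

/-! ### The unitary group of a bounded self-adjoint operator. -/

section UnitaryGroup

variable {V : Type*} [NormedAddCommGroup V] [InnerProductSpace ℂ V] [CompleteSpace V]

/-- The unitary group `e^{itA}`. -/
def expI (A : V →L[ℂ] V) (t : ℝ) : V →L[ℂ] V := NormedSpace.exp ((Complex.I * (t : ℂ)) • A)

variable {A : V →L[ℂ] V}

theorem hasDerivAt_expI (t : ℝ) : HasDerivAt (expI A) ((Complex.I • A) * expI A t) t := by
  have h := hasDerivAt_exp_smul_const' (𝕂 := ℝ) (𝔸 := V →L[ℂ] V) (Complex.I • A) t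
  have he : ∀ t : ℝ, expI A t = NormedSpace.exp (t • (Complex.I • A)) := fun t => by
    rw [expI, mul_comm, mul_smul, Complex.coe_smul]
  have he' : expI A = fun t : ℝ => NormedSpace.exp (t • (Complex.I • A)) := funext he
  rw [he']
  exact h

theorem continuous_expI : Continuous (expI A) := by
  rw [continuous_iff_continuousAt]
  intro t
  have h : HasDerivAt (expI A) ((Complex.I • A) * expI A t) t := hasDerivAt_expI t
  exact h.continuousAt

theorem star_expI (hA : IsSelfAdjoint A) (t : ℝ) : star (expI A t) = expI A (-t) := by
  rw [expI, expI, NormedSpace.star_exp, star_smul, hA.star_eq]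
  congr 2
  simp

theorem expI_neg_mul (t : ℝ) : expI A (-t) * expI A t = 1 := by
  rw [expI, expI, ← NormedSpace.exp_add_of_commute_of_mem_ball (𝕂 := ℂ)]
  · rw [← add_smul, Complex.ofReal_neg, mul_neg, neg_add_cancel, zero_smul, NormedSpace.exp_zero]
  · exact ((Commute.refl A).smul_left _).smul_right _
  · rw [NormedSpace.expSeries_radius_eq_top]; simp
  · rw [NormedSpace.expSeries_radius_eq_top]; simp

theorem norm_expI_apply (hA : IsSelfAdjoint A) (t : ℝ) (w : V) : ‖expI A t w‖ = ‖w‖ := by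
  have h : inner ℂ (expI A t w) (expI A t w) = inner ℂ w w := by
    rw [← ContinuousLinearMap.adjoint_inner_right, ← ContinuousLinearMap.star_eq_adjoint,
      star_expI hA, ← mul_apply_eq_comp, expI_neg_mul, one_apply_eq_self]
  rw [inner_self_eq_norm_sq_to_K, inner_self_eq_norm_sq_to_K] at h
  have h2 : ‖expI A t w‖ ^ 2 = ‖w‖ ^ 2 := by exact_mod_cast h
  exact (sq_eq_sq₀ (norm_nonneg _) (norm_nonneg _)).1 h2

/-- Termwise in the exponential series, each power of the operator acts on the eigenvector as a
power of the scalar. -/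
theorem expI_eigenvector {t c : ℝ} {v : V} (hv : A v = (c : ℂ) • v) :
    expI A t v = Complex.exp (Complex.I * ((t * c : ℝ) : ℂ)) • v := by
  have hpow : ∀ j : ℕ, (((Complex.I * (t : ℂ)) • A) ^ j) v = (Complex.I * (t : ℂ) * c) ^ j • v := by
    intro j
    induction j with
    | zero => simp
    | succ j ih => rw [pow_succ, mul_apply_eq_comp, smul_apply, hv, smul_smul, map_smul, ih,
        smul_smul, pow_succ, mul_comm]
  have h1 := NormedSpace.exp_series_hasSum_exp' (𝕂 := ℂ) ((Complex.I * (t : ℂ)) • A)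
  have h2 := (ContinuousLinearMap.apply ℂ V v).hasSum h1
  have h3 := (NormedSpace.exp_series_hasSum_exp' (𝕂 := ℂ) (Complex.I * (t : ℂ) * c)).smul_const v
  have h4 : (fun j : ℕ => (ContinuousLinearMap.apply ℂ V v)
      (((j.factorial : ℂ))⁻¹ • ((Complex.I * (t : ℂ)) • A) ^ j)) =
      fun j : ℕ => (((j.factorial : ℂ))⁻¹ • (Complex.I * (t : ℂ) * c) ^ j) • v := by
    funext j
    rw [ContinuousLinearMap.apply_apply, smul_apply, hpow, smul_smul, smul_eq_mul]
  rw [h4] at h2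
  have h5 := h2.unique h3
  rw [ContinuousLinearMap.apply_apply, ← Complex.exp_eq_exp_ℂ] at h5
  rw [expI, h5]
  congr 2
  push_cast
  ring

theorem inner_expI_eigenvector (hA : IsSelfAdjoint A) {t c : ℝ} {v : V}
    (hv : A v = (c : ℂ) • v) (w : V) :
    inner ℂ v (expI A t w) = Complex.exp (Complex.I * ((t * c : ℝ) : ℂ)) * inner ℂ v w := by
  rw [← ContinuousLinearMap.adjoint_inner_left, ← ContinuousLinearMap.star_eq_adjoint,
    star_expI hA, expI_eigenvector hv, inner_smul_left, ← Complex.exp_conj]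
  congr 2
  simp

theorem continuous_expI_operator (t : ℝ) : Continuous fun A : V →L[ℂ] V => expI A t := by
  have h1 : Continuous (NormedSpace.exp : (V →L[ℂ] V) → (V →L[ℂ] V)) :=
    continuous_iff_continuousAt.2 fun x => (NormedSpace.exp_analytic (𝕂 := ℂ) x).continuousAt
  exact h1.comp (continuous_const_smul _)

end UnitaryGroup

/-! ### The propagator as a measurable multiplier. -/

section Propagator

variable {d J : ℕ} {L : Wavevec d → (Field2J J →L[ℂ] Field2J J)}
  {ω : Fin J → ℤˣ → Wavevec d → ℝ} {g : Fin J → ℤˣ → Wavevec d → Field2J J}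

theorem propagator_eq_expI (t : ℝ) (k : Wavevec d) : propagator L t k = expI (L k) t := rfl

theorem continuous_propagator (k : Wavevec d) : Continuous fun t => propagator L t k :=
  continuous_expI

theorem norm_propagator_apply (hL : ∀ k, IsSelfAdjoint (L k)) (t : ℝ) (k : Wavevec d)
    (w : Field2J J) : ‖propagator L t k w‖ = ‖w‖ :=
  norm_expI_apply (hL k) t w

theorem norm_propagator_le (hL : ∀ k, IsSelfAdjoint (L k)) (t : ℝ) (k : Wavevec d) :
    ‖propagator L t k‖ ≤ 1 :=
  ContinuousLinearMap.opNorm_le_bound _ zero_le_one fun w => by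
    rw [norm_propagator_apply hL, one_mul]

theorem aestronglyMeasurable_symbol (hL : LinearCondition L ω g) :
    AEStronglyMeasurable L volume := by
  have h1 : AEStronglyMeasurable L (volume.restrict (bandCrossing L ω)ᶜ) :=
    hL.smooth.continuousOn.aestronglyMeasurable hL.crossing_closed.measurableSet.compl
  rwa [Measure.restrict_eq_self_of_ae_mem] at h1
  exact compl_mem_ae_iff.2 hL.crossing_null

theorem ae_noncrossing (hL : LinearCondition L ω g) :
    ∀ᵐ k : Wavevec d, k ∉ bandCrossing L ω :=
  compl_mem_ae_iff.2 hL.crossing_null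

theorem aestronglyMeasurable_propagator (hL : LinearCondition L ω g) (t : ℝ) :
    AEStronglyMeasurable (propagator L t) volume :=
  (continuous_expI_operator t).comp_aestronglyMeasurable (aestronglyMeasurable_symbol hL)

theorem essBdd_propagator (hL : LinearCondition L ω g) (t : ℝ) :
    EssBdd (propagator L t) volume :=
  ⟨aestronglyMeasurable_propagator hL t, 1,
    Eventually.of_forall fun k => norm_propagator_le hL.hermitian t k⟩

end Propagator

/-! ### The eigenbasis at a noncrossing point and invertibility modulo a line. -/

section Eigenbasis

variable {d J : ℕ} {L : Wavevec d → (Field2J J →L[ℂ] Field2J J)}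
  {ω : Fin J → ℤˣ → Wavevec d → ℝ} {g : Fin J → ℤˣ → Wavevec d → Field2J J}

theorem inner_eigenvectors (hL : LinearCondition L ω g) {k : Wavevec d}
    (hk : k ∉ bandCrossing L ω) {a b : Fin J} {ζ ξ : ℤˣ} (h : ¬ (a = b ∧ ζ = ξ)) :
    inner ℂ (g a ζ k) (g b ξ k) = (0 : ℂ) := by
  have h1 : inner ℂ (L k (g a ζ k)) (g b ξ k) = inner ℂ (g a ζ k) (L k (g b ξ k)) := by
    have := ContinuousLinearMap.adjoint_inner_left (L k) (g b ξ k) (g a ζ k)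
    rwa [← ContinuousLinearMap.star_eq_adjoint, (hL.hermitian k).star_eq] at this
  rw [hL.eigen k hk, hL.eigen k hk, inner_smul_left, inner_smul_right, Complex.conj_ofReal] at h1
  have h2 : ((ω a ζ k : ℂ) - ω b ξ k) * inner ℂ (g a ζ k) (g b ξ k) = 0 := by
    rw [sub_mul, h1, sub_self]
  refine (mul_eq_zero.1 h2).resolve_left fun h3 => h ?_
  have h4 : ω a ζ k = ω b ξ k := by exact_mod_cast sub_eq_zero.1 h3
  exact omega_injective hL hk h4

/-- Eigenvectors of distinct eigenvalues are orthogonal, and $2J$ orthonormal vectors span a space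
of dimension $2J$. -/
theorem eq_zero_of_inner_eigenvectors (hL : LinearCondition L ω g) {k : Wavevec d}
    (hk : k ∉ bandCrossing L ω) {w : Field2J J} (h : ∀ a ζ, inner ℂ (g a ζ k) w = (0 : ℂ)) :
    w = 0 := by
  have ho : Orthonormal ℂ fun p : Fin J × ℤˣ => g p.1 p.2 k := by
    refine ⟨fun p => hL.unit k hk _ _, fun p q hpq => inner_eigenvectors hL hk ?_⟩
    rintro ⟨h1, h2⟩
    exact hpq (Prod.ext h1 h2)
  have hcard : Fintype.card (Fin J × ℤˣ) = Module.finrank ℂ (Field2J J) := by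
    simp [mul_comm]
  have hspan : (⊤ : Submodule ℂ (Field2J J)) ≤
      Submodule.span ℂ (Set.range fun p : Fin J × ℤˣ => g p.1 p.2 k) :=
    (ho.linearIndependent.span_eq_top_of_card_eq_finrank' hcard).ge
  have hw : w ∈ Submodule.span ℂ (Set.range fun p : Fin J × ℤˣ => g p.1 p.2 k) :=
    hspan Submodule.mem_top
  have : ∀ v ∈ Submodule.span ℂ (Set.range fun p : Fin J × ℤˣ => g p.1 p.2 k),
      inner ℂ v w = (0 : ℂ) := by
    intro v hv
    induction hv using Submodule.span_induction with
    | mem x hx => obtain ⟨p, rfl⟩ := hx; exact h _ _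
    | zero => simp
    | add x y _ _ hx hy => rw [inner_add_left, hx, hy, add_zero]
    | smul a x _ hx => rw [inner_smul_left, hx, mul_zero]
  exact inner_self_eq_zero.1 (this w hw)

/-- The orthogonal projection onto the line of a unit vector. -/
def lineProj (v : Field2J J) : Field2J J →L[ℂ] Field2J J := (innerSL ℂ v).smulRight v

theorem lineProj_apply (v w : Field2J J) : lineProj v w = inner ℂ v w • v := rfl

/-- In the eigenbasis the operator is diagonal with entries $\omega_{b,\xi}-s$. At most one entry
vanishes because the spectrum is simple, and then `P` puts $1$ in its place. In finite dimension
injectivity is enough. -/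
theorem isUnit_symbol_sub (hL : LinearCondition L ω g) {k : Wavevec d}
    (hk : k ∉ bandCrossing L ω) {s : ℝ} {P : Field2J J →L[ℂ] Field2J J}
    (h : ((∀ a ζ, ω a ζ k ≠ s) ∧ P = 0) ∨ ∃ a ζ, ω a ζ k = s ∧ P = lineProj (g a ζ k)) :
    IsUnit (L k - (s : ℂ) • (1 : Field2J J →L[ℂ] Field2J J) + P) := by
  rw [ContinuousLinearMap.isUnit_iff_bijective]
  have hinj : Function.Injective (L k - (s : ℂ) • (1 : Field2J J →L[ℂ] Field2J J) + P) := by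
    rw [injective_iff_map_eq_zero]
    intro w hw
    refine eq_zero_of_inner_eigenvectors hL hk fun b ξ => ?_
    have h0 : inner ℂ (g b ξ k) ((L k - (s : ℂ) • (1 : Field2J J →L[ℂ] Field2J J) + P) w) =
        (0 : ℂ) := by rw [hw, inner_zero_right]
    have h1 : inner ℂ (g b ξ k) (L k w) = (ω b ξ k : ℂ) * inner ℂ (g b ξ k) w := by
      have := ContinuousLinearMap.adjoint_inner_left (L k) w (g b ξ k)
      rw [← ContinuousLinearMap.star_eq_adjoint, (hL.hermitian k).star_eq] at this
      rw [← this, hL.eigen k hk, inner_smul_left, Complex.conj_ofReal]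
    have h2 : ((ω b ξ k : ℂ) - s) * inner ℂ (g b ξ k) w + inner ℂ (g b ξ k) (P w) = 0 := by
      rw [← h0]
      simp only [add_apply, sub_apply, smul_apply, one_apply_eq_self, inner_add_right, inner_sub_right,
        inner_smul_right, h1]
      ring
    rcases h with ⟨hne, rfl⟩ | ⟨a, ζ, has, rfl⟩
    · simp only [zero_apply, inner_zero_right, add_zero] at h2
      refine (mul_eq_zero.1 h2).resolve_left fun h3 => hne b ξ ?_
      exact_mod_cast sub_eq_zero.1 h3
    · rw [lineProj_apply, inner_smul_right] at h2
      by_cases hab : b = a ∧ ξ = ζ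
      · obtain ⟨rfl, rfl⟩ := hab
        rw [has, sub_self, zero_mul, zero_add, inner_self_eq_norm_sq_to_K, hL.unit k hk] at h2
        simpa using h2
      · rw [inner_eigenvectors hL hk hab, mul_zero, add_zero] at h2
        refine (mul_eq_zero.1 h2).resolve_left fun h3 => hab ?_
        have h4 : ω b ξ k = ω a ζ k := by
          rw [has]
          exact_mod_cast sub_eq_zero.1 h3
        exact omega_injective hL hk h4
  exact ⟨hinj, LinearMap.injective_iff_surjective (f := ((L k - (s : ℂ) • (1 : Field2J J →L[ℂ] Field2J J) + P :
    Field2J J →L[ℂ] Field2J J) : Field2J J →ₗ[ℂ] Field2J J)).1 hinj⟩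

end Eigenbasis

/-! ### Polynomial maps conjugated by groups of contractions. -/

section BallRegular

variable {X Y Z : Type*} [NormedAddCommGroup X] [NormedSpace ℂ X] [NormedAddCommGroup Y]
  [NormedSpace ℂ Y] [NormedAddCommGroup Z] [NormedSpace ℂ Z]

/-- Maps which are bounded and Lipschitz on balls. -/
structure BallRegular (F : X → Y) (B K : ℝ → ℝ) : Prop where
  bound : ∀ r x, ‖x‖ ≤ r → ‖F x‖ ≤ B r
  lipschitz : ∀ r x y, ‖x‖ ≤ r → ‖y‖ ≤ r → ‖F x - F y‖ ≤ K r * ‖x - y‖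

theorem BallRegular.sum {ι : Type*} {s : Finset ι} {F : ι → X → Y} {B K : ι → ℝ → ℝ}
    (h : ∀ i ∈ s, BallRegular (F i) (B i) (K i)) :
    BallRegular (fun x => ∑ i ∈ s, F i x) (fun r => ∑ i ∈ s, B i r) fun r => ∑ i ∈ s, K i r := by
  refine ⟨fun r x hx => norm_sum_le_of_le _ fun i hi => (h i hi).bound r x hx,
    fun r x y hx hy => ?_⟩
  rw [← Finset.sum_sub_distrib, Finset.sum_mul]
  exact norm_sum_le_of_le _ fun i hi => (h i hi).lipschitz r x y hx hy

theorem BallRegular.clm_comp {F : X → Y} {B K : ℝ → ℝ} (h : BallRegular F B K) {A : Y →L[ℂ] Z}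
    {C : ℝ} (hC : ∀ y, ‖A y‖ ≤ C * ‖y‖) (hC0 : 0 ≤ C) :
    BallRegular (fun x => A (F x)) (fun r => C * B r) fun r => C * K r := by
  refine ⟨fun r x hx => (hC _).trans (by gcongr; exact h.bound r x hx), fun r x y hx hy => ?_⟩
  rw [← map_sub, mul_assoc]
  exact (hC _).trans (by gcongr; exact h.lipschitz r x y hx hy)

theorem ballRegular_multilinear {m : ℕ} {T : ContinuousMultilinearMap ℂ (fun _ : Fin m => Y) Z}
    {C : ℝ} (hT : ‖T‖ ≤ C) {ℓ : Fin m → X →L[ℂ] Y} (hℓ : ∀ j x, ‖ℓ j x‖ ≤ ‖x‖) :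
    BallRegular (fun x => T fun j => ℓ j x) (fun r => C * r ^ m)
      fun r => C * m * r ^ (m - 1) := by
  have hC : 0 ≤ C := (norm_nonneg _).trans hT
  have hpi : ∀ x, ‖fun j => ℓ j x‖ ≤ ‖x‖ := fun x =>
    (pi_norm_le_iff_of_nonneg (norm_nonneg _)).2 fun j => hℓ j x
  refine ⟨fun r x hx => ?_, fun r x y hx hy => ?_⟩
  · refine (T.le_opNorm _).trans ?_
    refine mul_le_mul hT ?_ (by positivity) hC
    refine (Finset.prod_le_prod (fun _ _ => norm_nonneg _)
      (fun j _ => (hℓ j x).trans hx)).trans ?_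
    simp [Finset.prod_const]
  · refine (T.norm_image_sub_le _ _).trans ?_
    rw [Fintype.card_fin]
    have h1 : max ‖fun j => ℓ j x‖ ‖fun j => ℓ j y‖ ≤ r :=
      max_le ((hpi x).trans hx) ((hpi y).trans hy)
    have h2 : ‖(fun j => ℓ j x) - fun j => ℓ j y‖ ≤ ‖x - y‖ := by
      have : (fun j => ℓ j x) - (fun j => ℓ j y) = fun j => ℓ j (x - y) := by
        funext j
        simp
      rw [this]
      exact hpi _
    have hr : 0 ≤ r := (norm_nonneg _).trans hx
    gcongr

theorem BallRegular.pi {ι : Type*} [Fintype ι] {F : ι → X → Y} {B K : ι → ℝ → ℝ}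
    (h : ∀ i, BallRegular (F i) (B i) (K i)) (hB : ∀ i r, 0 ≤ r → 0 ≤ B i r)
    (hK : ∀ i r, 0 ≤ r → 0 ≤ K i r) :
    BallRegular (fun x i => F i x) (fun r => ∑ i, B i r) fun r => ∑ i, K i r := by
  refine ⟨fun r x hx => ?_, fun r x y hx hy => ?_⟩
  · have hr : 0 ≤ r := (norm_nonneg _).trans hx
    refine (pi_norm_le_iff_of_nonneg (Finset.sum_nonneg fun i _ => hB i r hr)).2 fun i => ?_
    exact ((h i).bound r x hx).trans
      (Finset.single_le_sum (f := fun i => B i r) (fun i _ => hB i r hr) (Finset.mem_univ i))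
  · have hr : 0 ≤ r := (norm_nonneg _).trans hx
    have h0 := Finset.sum_nonneg fun i (_ : i ∈ Finset.univ) => hK i r hr
    refine (pi_norm_le_iff_of_nonneg (by positivity)).2 fun i => ?_
    refine ((h i).lipschitz r x y hx hy).trans ?_
    gcongr
    exact Finset.single_le_sum (f := fun i => K i r) (fun i _ => hK i r hr) (Finset.mem_univ i)

theorem BallRegular.continuous {F : X → Y} {B K : ℝ → ℝ} (h : BallRegular F B K) :
    Continuous F := by
  rw [continuous_iff_continuousAt]
  intro x
  have hK : ∀ᶠ y in 𝓝 x, ‖F y - F x‖ ≤ |K (‖x‖ + 1)| * ‖y - x‖ := by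
    filter_upwards [Metric.ball_mem_nhds x one_pos] with y hy
    have hy' : ‖y‖ ≤ ‖x‖ + 1 := by
      have : ‖y‖ ≤ ‖x‖ + ‖y - x‖ := by simpa using norm_add_le x (y - x)
      rw [Metric.mem_ball, dist_eq_norm] at hy
      linarith
    refine (h.lipschitz (‖x‖ + 1) y x hy' (by linarith)).trans ?_
    gcongr
    exact le_abs_self _
  rw [ContinuousAt, tendsto_iff_norm_sub_tendsto_zero]
  refine squeeze_zero' (Eventually.of_forall fun _ => norm_nonneg _) hK ?_
  have : Continuous fun y => |K (‖x‖ + 1)| * ‖y - x‖ := by fun_prop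
  simpa using this.tendsto x

/-- Since the symbol need not be bounded, the groups on $L^1$ are only strongly continuous. Uniform
bounds compensate for this along continuous curves. -/
theorem continuous_apply_of_bounded {U : ℝ → Y →L[ℂ] Z} {C : ℝ} (hU : ∀ t x, ‖U t x‖ ≤ C * ‖x‖)
    (hUc : ∀ x, Continuous fun t => U t x) {x : ℝ → Y} (hx : Continuous x) :
    Continuous fun t => U t (x t) := by
  rw [continuous_iff_continuousAt]
  intro t₀
  rw [ContinuousAt, tendsto_iff_norm_sub_tendsto_zero]
  have h1 : Continuous fun t => C * ‖x t - x t₀‖ + ‖U t (x t₀) - U t₀ (x t₀)‖ := by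
    have := hUc (x t₀)
    fun_prop
  refine squeeze_zero (fun _ => norm_nonneg _) (fun t => ?_) (by simpa using h1.tendsto t₀)
  have : U t (x t) - U t₀ (x t₀) = U t (x t - x t₀) + (U t (x t₀) - U t₀ (x t₀)) := by
    rw [map_sub]; abel
  rw [this]
  exact (norm_add_le _ _).trans (by gcongr; exact hU _ _)

theorem continuous_apply_of_strongly_continuous {U : ℝ → Y →L[ℂ] Z} (hU : ∀ t x, ‖U t x‖ ≤ ‖x‖)
    (hUc : ∀ x, Continuous fun t => U t x) {x : ℝ → Y} (hx : Continuous x) :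
    Continuous fun t => U t (x t) :=
  continuous_apply_of_bounded (C := 1) (by simpa using hU) hUc hx

/-- The field of the slow variables: a nonlinearity conjugated by a group of contractions. -/
theorem BallRegular.isRegularField {F : X → X} {B K : ℝ → ℝ} (h : BallRegular F B K)
    {U : ℝ → X →L[ℂ] X} (hU : ∀ t x, ‖U t x‖ ≤ ‖x‖) (hUc : ∀ x, Continuous fun t => U t x) (ϱ : ℝ) :
    IsRegularField (fun t x => U (t / ϱ) (F (U (-(t / ϱ)) x))) B K := by
  refine ⟨fun x hx => ?_, fun r t x hx => ?_, fun r t x y hx hy => ?_⟩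
  · refine continuous_apply_of_strongly_continuous (fun t => hU _)
      (fun x => (hUc x).comp (continuous_id.div_const ϱ)) (h.continuous.comp ?_)
    exact continuous_apply_of_strongly_continuous (fun t => hU _)
      (fun x => (hUc x).comp (continuous_id.div_const ϱ).neg) hx
  · exact (hU _ _).trans (h.bound r _ ((hU _ _).trans hx))
  · rw [← map_sub]
    refine (hU _ _).trans ((h.lipschitz r _ _ ((hU _ _).trans hx) ((hU _ _).trans hy)).trans ?_)
    rw [← map_sub]
    have hr : 0 ≤ r := (norm_nonneg _).trans hx
    by_cases hxy : x = y
    · simp [hxy]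
    -- The sign of `K r` is not part of `BallRegular`; it is read off from the Lipschitz inequality
    -- at two distinct points.
    · have hK : 0 ≤ K r := by
        have h1 := (norm_nonneg _).trans (h.lipschitz r x y hx hy)
        have h2 : 0 < ‖x - y‖ := norm_pos_iff.2 (sub_ne_zero.2 hxy)
        exact nonneg_of_mul_nonneg_left h1 h2
      gcongr
      exact hU _ _

end BallRegular

/-! ### The evolution equation as an integral equation in $L^1$. -/

section FieldEquation

variable {d J : ℕ} {L : Wavevec d → (Field2J J →L[ℂ] Field2J J)}
  {ω : Fin J → ℤˣ → Wavevec d → ℝ} {g : Fin J → ℤˣ → Wavevec d → Field2J J} {M : Finset ℕ}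
  {χ : (m : ℕ) → Wavevec d → (Fin m → Wavevec d) →
      ContinuousMultilinearMap ℂ (fun _ : Fin m => Field2J J) (Field2J J)}

theorem ae_noncrossing_pi (hL : LinearCondition L ω g) {m : ℕ} (hm : 1 ≤ m) :
    ∀ᵐ κ : Fin m → Wavevec d, ∑ j, κ j ∉ bandCrossing L ω ∧ ∀ j, κ j ∉ bandCrossing L ω :=
  (ae_sum hm (ae_noncrossing hL)).and (ae_apply (ae_noncrossing hL))

theorem isOpen_noncrossing_pi (hL : LinearCondition L ω g) (m : ℕ) :
    IsOpen {κ : Fin m → Wavevec d | ∑ j, κ j ∉ bandCrossing L ω ∧ ∀ j, κ j ∉ bandCrossing L ω} := by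
  have ho := isOpen_compl_crossing hL
  have : {κ : Fin m → Wavevec d | ∑ j, κ j ∉ bandCrossing L ω ∧ ∀ j, κ j ∉ bandCrossing L ω} =
      ((fun κ : Fin m → Wavevec d => ∑ j, κ j) ⁻¹' (bandCrossing L ω)ᶜ) ∩
        ⋂ i, (fun κ : Fin m → Wavevec d => κ i) ⁻¹' (bandCrossing L ω)ᶜ := by
    ext κ; simp
  rw [this]
  exact (ho.preimage (by fun_prop)).inter (isOpen_iInter_of_finite fun i =>
    ho.preimage (continuous_apply i))

/-- The tuples for which neither an argument nor the sum is a band-crossing point form an open set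
of full measure. Continuity there gives measurability. -/
theorem essBdd_susceptibility (hL : LinearCondition L ω g)
    (hχ : NonlinearCondition (bandCrossing L ω) M χ) {m : ℕ} (hm : m ∈ M) :
    EssBdd (fun κ : Fin m → Wavevec d => χ m (∑ j, κ j) κ) volume := by
  have hm1 : 1 ≤ m := by have := hχ.two_le m hm; omega
  obtain ⟨C, hC⟩ := hχ.bounded
  refine ⟨?_, C, ?_⟩
  · have ho := isOpen_noncrossing_pi (m := m) hL
    have h1 : ContinuousOn (fun κ : Fin m → Wavevec d => χ m (∑ j, κ j) κ)
        {κ | ∑ j, κ j ∉ bandCrossing L ω ∧ ∀ j, κ j ∉ bandCrossing L ω} :=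
      (hχ.smooth m hm).continuousOn.comp
        (f := fun κ : Fin m → Wavevec d => (∑ j, κ j, κ)) (by fun_prop) fun κ hκ => hκ
    have h2 := h1.aestronglyMeasurable (μ := volume) ho.measurableSet
    have h3 : volume.restrict {κ : Fin m → Wavevec d | ∑ j, κ j ∉ bandCrossing L ω ∧
        ∀ j, κ j ∉ bandCrossing L ω} = volume :=
      Measure.restrict_eq_self_of_ae_mem (ae_noncrossing_pi hL hm1)
    rwa [h3] at h2
  · filter_upwards [ae_noncrossing_pi hL hm1] with κ hκ
    exact hC m hm _ _ hκ.1 hκ.2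

/-- The nonlinearity `F̂` as a polynomial map on `L¹`. -/
def fieldMap (M : Finset ℕ) (χ : (m : ℕ) → Wavevec d → (Fin m → Wavevec d) →
      ContinuousMultilinearMap ℂ (fun _ : Fin m => Field2J J) (Field2J J))
    (u : LOne d (Field2J J)) : LOne d (Field2J J) :=
  ∑ m ∈ M, (convFactor d m : ℂ) • fiberOp d m (Field2J J)
    (tensorOp (fun κ : Fin m → Wavevec d => χ m (∑ j, κ j) κ) fun _ => u)

/-- Almost every fibre meets the exceptional null set in a null set, so the pointwise formula is
insensitive to the representative `U`. This allows `U` to be the propagated field. -/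
theorem fieldMap_coe (hL : LinearCondition L ω g)
    (hχ : NonlinearCondition (bandCrossing L ω) M χ) {u : LOne d (Field2J J)}
    {U : Wavevec d → Field2J J} (hu : u =ᵐ[volume] U) :
    fieldMap M χ u =ᵐ[volume] nonlinearity M χ U := by
  have h1 : ∀ m ∈ M, ((convFactor d m : ℂ) • fiberOp d m (Field2J J)
      (tensorOp (fun κ : Fin m → Wavevec d => χ m (∑ j, κ j) κ) fun _ => u) :
      LOne d (Field2J J)) =ᵐ[volume] fun k => convFactor d m •
    ∫ q : Fin (m - 1) → Wavevec d, χ m k (convFreqs m k q) (fun i => U (convFreqs m k q i)) := by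
    intro m hm
    have hm1 : 1 ≤ m := by have := hχ.two_le m hm; omega
    filter_upwards [Lp.coeFn_smul (convFactor d m : ℂ) (fiberOp d m (Field2J J)
      (tensorOp (fun κ : Fin m → Wavevec d => χ m (∑ j, κ j) κ) fun _ => u)),
      fiberOp_coe hm1 (tensorOp (fun κ : Fin m → Wavevec d => χ m (∑ j, κ j) κ) fun _ => u),
      ae_ae_convFreqs hm1 (tensorOp_coe (essBdd_susceptibility hL hχ hm) fun _ => u),
      ae_ae_convFreqs hm1 (ae_apply hu)] with k a b c e
    rw [a, Pi.smul_apply, b, Complex.coe_smul]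
    congr 1
    refine integral_congr_ae ?_
    filter_upwards [c, e] with q c e
    rw [c, sum_convFreqs hm1]
    simp_rw [e]
  filter_upwards [Lp.coeFn_finsetSum M fun m => (convFactor d m : ℂ) • fiberOp d m (Field2J J)
      (tensorOp (fun κ : Fin m → Wavevec d => χ m (∑ j, κ j) κ) fun _ => u),
    (Finset.eventually_all M).2 h1] with k a b
  rw [fieldMap, a, Finset.sum_apply, nonlinearity]
  exact Finset.sum_congr rfl fun m hm => b m hm

theorem convFactor_pos (d m : ℕ) : 0 < convFactor d m := by
  unfold convFactor
  positivity

theorem exists_ballRegular_fieldMap (hχ : NonlinearCondition (bandCrossing L ω) M χ)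
    (hL : LinearCondition L ω g) :
    ∃ B K : ℝ → ℝ, BallRegular (fieldMap (d := d) M χ) B K := by
  obtain ⟨C, hC⟩ := hχ.bounded
  have h1 : ∀ m ∈ M, BallRegular (fun u : LOne d (Field2J J) => (convFactor d m : ℂ) •
      fiberOp d m (Field2J J) (tensorOp (fun κ : Fin m → Wavevec d => χ m (∑ j, κ j) κ)
        fun _ => u)) (fun r => convFactor d m * (|C| * r ^ m))
        fun r => convFactor d m * (|C| * m * r ^ (m - 1)) := by
    intro m hm
    have hm1 : 1 ≤ m := by have := hχ.two_le m hm; omega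
    have hT : ‖tensorOp (fun κ : Fin m → Wavevec d => χ m (∑ j, κ j) κ)‖ ≤ |C| := by
      refine norm_tensorOp_le (abs_nonneg C) ?_
      filter_upwards [ae_noncrossing_pi hL hm1] with κ hκ
      exact (hC m hm _ _ hκ.1 hκ.2).trans (le_abs_self C)
    have h2 := ballRegular_multilinear hT (ℓ := fun _ => ContinuousLinearMap.id ℂ _)
      (fun j x => le_rfl)
    refine h2.clm_comp (A := (convFactor d m : ℂ) • fiberOp d m (Field2J J)) (fun y => ?_)
      (convFactor_pos d m).le
    rw [smul_apply, norm_smul, Complex.norm_real, Real.norm_of_nonneg (convFactor_pos d m).le]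
    gcongr
    · exact (convFactor_pos d m).le
    · exact norm_fiberOp_apply_le y
  exact ⟨_, _, BallRegular.sum h1⟩

/-- The unitary group on `L¹`. -/
def groupOp (L : Wavevec d → (Field2J J →L[ℂ] Field2J J)) (t : ℝ) :
    LOne d (Field2J J) →L[ℂ] LOne d (Field2J J) := mulOp volume (propagator L t)

theorem norm_groupOp_apply_le (hL : LinearCondition L ω g) (t : ℝ) (u : LOne d (Field2J J)) :
    ‖groupOp L t u‖ ≤ ‖u‖ := by
  have := norm_mulOp_apply_le zero_le_one
    (Eventually.of_forall fun k => norm_propagator_le hL.hermitian t k) u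
  rwa [one_mul] at this

theorem continuous_groupOp_apply (hL : LinearCondition L ω g) (u : LOne d (Field2J J)) :
    Continuous fun t => groupOp L t u :=
  continuous_mulOp_apply (C := 1) (fun t => aestronglyMeasurable_propagator hL t)
    (fun t => Eventually.of_forall fun k => norm_propagator_le hL.hermitian t k)
    (Eventually.of_forall fun k => continuous_propagator k) u

/-- The vector field of the evolution equation for the slow variable. -/
def fieldVF (L : Wavevec d → (Field2J J →L[ℂ] Field2J J)) (M : Finset ℕ)
    (χ : (m : ℕ) → Wavevec d → (Fin m → Wavevec d) →
      ContinuousMultilinearMap ℂ (fun _ : Fin m => Field2J J) (Field2J J))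
    (ϱ t : ℝ) (u : LOne d (Field2J J)) : LOne d (Field2J J) :=
  groupOp L (t / ϱ) (fieldMap M χ (groupOp L (-(t / ϱ)) u))

theorem fieldVF_coe (hL : LinearCondition L ω g)
    (hχ : NonlinearCondition (bandCrossing L ω) M χ) (ϱ t : ℝ) (u : LOne d (Field2J J)) :
    fieldVF L M χ ϱ t u =ᵐ[volume] fun k => propagator L (t / ϱ) k
      (nonlinearity M χ (fun k' => propagator L (-(t / ϱ)) k' (u k')) k) := by
  filter_upwards [mulOp_coe (essBdd_propagator hL (t / ϱ))
    (fieldMap M χ (groupOp L (-(t / ϱ)) u)), fieldMap_coe hL hχ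
    (mulOp_coe (essBdd_propagator hL (-(t / ϱ))) u)] with k a b
  rw [fieldVF, groupOp, a]
  congr 1

/-- The integrand of `IsSolution` is determined as an element of $L^1$ by its almost-everywhere
formula, so it must be the vector field along the solution. -/
theorem isSolution_iff (hL : LinearCondition L ω g)
    (hχ : NonlinearCondition (bandCrossing L ω) M χ) {B K : ℝ → ℝ} {ϱ T : ℝ}
    (hV : IsRegularField (fieldVF L M χ ϱ) B K) {h : LOne d (Field2J J)}
    {u : ℝ → LOne d (Field2J J)} :
    IsSolution L M χ ϱ T h u ↔ IsIntegralSolution (fieldVF L M χ ϱ) T h u := by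
  constructor
  · rintro ⟨hc, G, hG, hGe, hu⟩
    refine ⟨hc, fun t ht => ?_⟩
    rw [hu t ht]
    congr 1
    refine intervalIntegral.integral_congr fun s hs => ?_
    rw [uIcc_of_le ht.1] at hs
    have hs' : s ∈ Icc 0 T := ⟨hs.1, hs.2.trans ht.2⟩
    exact Lp.ext ((hGe s hs').trans (fieldVF_coe hL hχ ϱ s (u s)).symm)
  · rintro ⟨hc, hu⟩
    exact ⟨hc, fun t => fieldVF L M χ ϱ t (u t), hV.continuousOn_comp hc,
      fun t _ => fieldVF_coe hL hχ ϱ t (u t), hu⟩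

end FieldEquation

/-! ### The envelope system as an integral equation in $(L^1)^{2N}$. -/

section EnvelopeEquation

variable {d J N : ℕ} {L : Wavevec d → (Field2J J →L[ℂ] Field2J J)}
  {ω : Fin J → ℤˣ → Wavevec d → ℝ} {g : Fin J → ℤˣ → Wavevec d → Field2J J} {M : Finset ℕ}
  {χ : (m : ℕ) → Wavevec d → (Fin m → Wavevec d) →
      ContinuousMultilinearMap ℂ (fun _ : Fin m => Field2J J) (Field2J J)}
  {n : Fin N → Fin J} {κ : Fin N → Wavevec d}

/-- The space of `2N` envelopes. -/
abbrev Envelopes (d N : ℕ) : Type := Fin N × ℤˣ → LOne d ℂ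

/-- A bound of the approximate susceptibilities. -/
def susceptibilityBound (g : Fin J → ℤˣ → Wavevec d → Field2J J)
    (χ : (m : ℕ) → Wavevec d → (Fin m → Wavevec d) →
      ContinuousMultilinearMap ℂ (fun _ : Fin m => Field2J J) (Field2J J))
    (n : Fin N → Fin J) (κ : Fin N → Wavevec d) (p : Fin N × ℤˣ) {m : ℕ}
    (lam : Fin m → Fin N × ℤˣ) : ℝ :=
  ‖scalarSusceptibility g χ n p.1 p.2 lam
    (sgn p.2 • κ p.1, fun i => sgn (lam i).2 • κ (lam i).1)‖ +
  ∑ j : Fin m, ∑ i : Fin d, ‖fderiv ℝ (scalarSusceptibility g χ n p.1 p.2 lam)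
    (sgn p.2 • κ p.1, fun i => sgn (lam i).2 • κ (lam i).1)
    (EuclideanSpace.single i 1, Pi.single j (EuclideanSpace.single i 1))‖

theorem susceptibilityBound_nonneg (p : Fin N × ℤˣ) {m : ℕ} (lam : Fin m → Fin N × ℤˣ) :
    0 ≤ susceptibilityBound g χ n κ p lam := by
  unfold susceptibilityBound
  positivity

/-- This is the purpose of the sines: the first-order correction stays bounded in $\eta$, uniformly
in $\beta$, whereas a linear term would in general act as an unbounded multiplier. -/
theorem norm_approxSusceptibility_le (ν : ℕ) (β : ℝ) (p : Fin N × ℤˣ) {m : ℕ}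
    (lam : Fin m → Fin N × ℤˣ) (η : Fin m → Wavevec d) :
    ‖approxSusceptibility g χ n κ ν β p.1 p.2 lam η‖ ≤ susceptibilityBound g χ n κ p lam := by
  refine (norm_add_le _ _).trans (add_le_add le_rfl ?_)
  split_ifs
  · rw [norm_zero]
    positivity
  · refine norm_sum_le_of_le _ fun j _ => norm_sum_le_of_le _ fun i _ => ?_
    rw [norm_mul, Complex.norm_real]
    exact mul_le_of_le_one_left (norm_nonneg _) (Real.abs_sin_le_one _)

theorem continuous_approxSusceptibility (ν : ℕ) (β : ℝ) (p : Fin N × ℤˣ) {m : ℕ}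
    (lam : Fin m → Fin N × ℤˣ) :
    Continuous (approxSusceptibility g χ n κ ν β p.1 p.2 lam) := by
  unfold approxSusceptibility
  split_ifs
  · fun_prop
  · refine continuous_const.add ?_
    refine continuous_finsetSum _ fun j _ => continuous_finsetSum _ fun i _ => ?_
    refine Continuous.mul (Complex.continuous_ofReal.comp (Real.continuous_sin.comp ?_))
      continuous_const
    fun_prop

theorem essBdd_approxSusceptibility (ν : ℕ) (β : ℝ) (p : Fin N × ℤˣ) {m : ℕ}
    (lam : Fin m → Fin N × ℤˣ) :
    EssBdd (approxSusceptibility g χ n κ ν β p.1 p.2 lam) volume :=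
  ⟨(continuous_approxSusceptibility ν β p lam).aestronglyMeasurable, _,
    Eventually.of_forall fun η => norm_approxSusceptibility_le ν β p lam η⟩

theorem continuous_envelopeSymbol (μ : ℕ) (β : ℝ) (l : Fin N) (ϑ : ℤˣ) :
    Continuous (envelopeSymbol (d := d) ω n κ μ β l ϑ) := by
  unfold envelopeSymbol taylorPoly
  refine continuous_const.mul (continuous_finsetSum _ fun j _ => continuous_const.mul ?_)
  exact (iteratedFDeriv ℝ j (ω (n l) 1) (κ l)).cont.comp (by fun_prop)

theorem norm_exp_I_mul (x : ℝ) : ‖Complex.exp (Complex.I * (x : ℂ))‖ = 1 := by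
  rw [mul_comm, Complex.norm_exp_ofReal_mul_I]

/-- One term of the envelope nonlinearity. -/
def envelopeTerm (g : Fin J → ℤˣ → Wavevec d → Field2J J)
    (χ : (m : ℕ) → Wavevec d → (Fin m → Wavevec d) →
      ContinuousMultilinearMap ℂ (fun _ : Fin m => Field2J J) (Field2J J))
    (n : Fin N → Fin J) (κ : Fin N → Wavevec d) (ν : ℕ) (β : ℝ) (p : Fin N × ℤˣ) {m : ℕ}
    (lam : Fin m → Fin N × ℤˣ) (x : Envelopes d N) : LOne d ℂ :=
  (convFactor d m : ℂ) • fiberOp d m ℂ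
    (vMul volume (approxSusceptibility g χ n κ ν β p.1 p.2 lam) (tens d m fun j => x (lam j)))

/-- The envelope nonlinearity as a polynomial map on `(L¹)^{2N}`. -/
def envelopeMap (ω : Fin J → ℤˣ → Wavevec d → ℝ)
    (g : Fin J → ℤˣ → Wavevec d → Field2J J) (M : Finset ℕ)
    (χ : (m : ℕ) → Wavevec d → (Fin m → Wavevec d) →
      ContinuousMultilinearMap ℂ (fun _ : Fin m => Field2J J) (Field2J J))
    (n : Fin N → Fin J) (κ : Fin N → Wavevec d) (ν : ℕ) (β : ℝ) (x : Envelopes d N) :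
    Envelopes d N := fun p =>
  ∑ m ∈ M, ∑ lam ∈ resonantStrings ω n κ p.1 p.2 m, envelopeTerm g χ n κ ν β p lam x

theorem envelopeTerm_coe (hM : ∀ m ∈ M, 2 ≤ m) (ν : ℕ) (β : ℝ) {x : Envelopes d N}
    {y : Fin N → ℤˣ → Wavevec d → ℂ} (hxy : ∀ p, x p =ᵐ[volume] y p.1 p.2) (p : Fin N × ℤˣ)
    {m : ℕ} (hm : m ∈ M) (lam : Fin m → Fin N × ℤˣ) :
    envelopeTerm g χ n κ ν β p lam x =ᵐ[volume] fun η => (convFactor d m : ℂ) *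
      ∫ q : Fin (m - 1) → Wavevec d,
        approxSusceptibility g χ n κ ν β p.1 p.2 lam (convFreqs m η q) *
          ∏ i, y (lam i).1 (lam i).2 (convFreqs m η q i) := by
  have hm1 : 1 ≤ m := by have := hM m hm; omega
  have he := essBdd_approxSusceptibility (g := g) (χ := χ) (n := n) (κ := κ) ν β p lam
  set Φ := vMul volume (approxSusceptibility g χ n κ ν β p.1 p.2 lam)
    (tens d m fun j => x (lam j)) with hΦ
  filter_upwards [Lp.coeFn_smul (convFactor d m : ℂ) (fiberOp d m ℂ Φ), fiberOp_coe hm1 Φ,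
    ae_ae_convFreqs hm1 (vMul_coe he (tens d m fun j => x (lam j))),
    ae_ae_convFreqs hm1 (tens_coe fun j => x (lam j)),
    ae_ae_convFreqs hm1 (ae_all_iff.2 fun j => (quasiMeasurePreserving_apply j).ae
      (hxy (lam j)))] with η a b c e f
  rw [envelopeTerm, ← hΦ, a, Pi.smul_apply, b, smul_eq_mul]
  congr 1
  refine integral_congr_ae ?_
  filter_upwards [c, e, f] with q c e f
  rw [hΦ, c, e, smul_eq_mul, mul_comm]
  simp_rw [f]

theorem envelopeMap_coe (hM : ∀ m ∈ M, 2 ≤ m) (ν : ℕ) (β : ℝ) {x : Envelopes d N}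
    {y : Fin N → ℤˣ → Wavevec d → ℂ} (hxy : ∀ p, x p =ᵐ[volume] y p.1 p.2) (p : Fin N × ℤˣ) :
    envelopeMap ω g M χ n κ ν β x p =ᵐ[volume]
      envelopeNonlinearity ω g M χ n κ ν β y p.1 p.2 := by
  have h1 : ∀ m ∈ M, ∀ᵐ η, (∑ lam ∈ resonantStrings ω n κ p.1 p.2 m,
      envelopeTerm g χ n κ ν β p lam x : LOne d ℂ) η =
      ∑ lam ∈ resonantStrings ω n κ p.1 p.2 m, (convFactor d m : ℂ) *
      ∫ q : Fin (m - 1) → Wavevec d,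
        approxSusceptibility g χ n κ ν β p.1 p.2 lam (convFreqs m η q) *
          ∏ i, y (lam i).1 (lam i).2 (convFreqs m η q i) := by
    intro m hm
    filter_upwards [Lp.coeFn_finsetSum (resonantStrings ω n κ p.1 p.2 m) fun lam =>
      envelopeTerm g χ n κ ν β p lam x, (Finset.eventually_all _).2 fun lam
        (_ : lam ∈ resonantStrings ω n κ p.1 p.2 m) =>
          envelopeTerm_coe hM ν β hxy p hm lam] with η a b
    rw [a, Finset.sum_apply]
    exact Finset.sum_congr rfl b
  filter_upwards [Lp.coeFn_finsetSum M fun m => ∑ lam ∈ resonantStrings ω n κ p.1 p.2 m,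
      envelopeTerm g χ n κ ν β p lam x, (Finset.eventually_all M).2 h1] with η a b
  rw [envelopeMap, a, Finset.sum_apply, envelopeNonlinearity]
  exact Finset.sum_congr rfl b

theorem ballRegular_envelopeTerm (ν : ℕ) (β : ℝ) (p : Fin N × ℤˣ) {m : ℕ}
    (lam : Fin m → Fin N × ℤˣ) :
    BallRegular (envelopeTerm (d := d) g χ n κ ν β p lam)
      (fun r => convFactor d m * susceptibilityBound g χ n κ p lam * (1 * r ^ m))
      fun r => convFactor d m * susceptibilityBound g χ n κ p lam * (1 * m * r ^ (m - 1)) := by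
  have h2 := ballRegular_multilinear (X := Envelopes d N) (norm_tens_le (d := d) (m := m))
    (ℓ := fun j => ContinuousLinearMap.proj (φ := fun _ : Fin N × ℤˣ => LOne d ℂ) (lam j))
    fun j x => norm_le_pi_norm x (lam j)
  refine h2.clm_comp (Z := LOne d ℂ) (A := ((convFactor d m : ℂ) • fiberOp d m ℂ).comp
    (vMul volume (approxSusceptibility g χ n κ ν β p.1 p.2 lam))) (fun y => ?_)
    (mul_nonneg (convFactor_pos d m).le (susceptibilityBound_nonneg p lam))
  rw [ContinuousLinearMap.comp_apply, smul_apply, norm_smul, Complex.norm_real,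
    Real.norm_of_nonneg (convFactor_pos d m).le, mul_assoc]
  refine mul_le_mul_of_nonneg_left ?_ (convFactor_pos d m).le
  exact (norm_fiberOp_apply_le _).trans (norm_vMul_apply_le (susceptibilityBound_nonneg p lam)
    (Eventually.of_forall fun η => norm_approxSusceptibility_le ν β p lam η) y)

/-- The uniformity in `ν` and `β` is the point; it yields an existence time for the envelope system
that does not shrink with $\beta$. -/
theorem exists_ballRegular_envelopeMap (ω : Fin J → ℤˣ → Wavevec d → ℝ)
    (g : Fin J → ℤˣ → Wavevec d → Field2J J) (M : Finset ℕ)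
    (χ : (m : ℕ) → Wavevec d → (Fin m → Wavevec d) →
      ContinuousMultilinearMap ℂ (fun _ : Fin m => Field2J J) (Field2J J))
    (n : Fin N → Fin J) (κ : Fin N → Wavevec d) :
    ∃ B K : ℝ → ℝ, ∀ ν β, BallRegular (envelopeMap (d := d) ω g M χ n κ ν β) B K := by
  have h : ∀ ν β p, BallRegular (fun x : Envelopes d N => envelopeMap (d := d) ω g M χ n κ ν β x p)
      (fun r => ∑ m ∈ M, ∑ lam ∈ resonantStrings ω n κ p.1 p.2 m,
        convFactor d m * susceptibilityBound g χ n κ p lam * (1 * r ^ m))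
      fun r => ∑ m ∈ M, ∑ lam ∈ resonantStrings ω n κ p.1 p.2 m,
        convFactor d m * susceptibilityBound g χ n κ p lam * (1 * m * r ^ (m - 1)) :=
    fun ν β p => BallRegular.sum fun m _ => BallRegular.sum fun lam _ =>
      ballRegular_envelopeTerm ν β p lam
  refine ⟨_, _, fun ν β => BallRegular.pi (h ν β) (fun p r hr => ?_) fun p r hr => ?_⟩
  all_goals
    refine Finset.sum_nonneg fun m _ => Finset.sum_nonneg fun lam _ => ?_
    have := (convFactor_pos d m).le
    have := susceptibilityBound_nonneg (g := g) (χ := χ) (n := n) (κ := κ) p lam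
    positivity

/-- The unitary group of the envelope system. -/
def phaseOp (ω : Fin J → ℤˣ → Wavevec d → ℝ) (n : Fin N → Fin J) (κ : Fin N → Wavevec d) (μ : ℕ)
    (β t : ℝ) : Envelopes d N →L[ℂ] Envelopes d N :=
  ContinuousLinearMap.pi fun p => (vMul volume fun η => Complex.exp (Complex.I *
    ((t * envelopeSymbol ω n κ μ β p.1 p.2 η : ℝ) : ℂ))).comp (ContinuousLinearMap.proj p)

theorem essBdd_phase (μ : ℕ) (β t : ℝ) (p : Fin N × ℤˣ) :
    EssBdd (fun η => Complex.exp (Complex.I *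
      ((t * envelopeSymbol (d := d) ω n κ μ β p.1 p.2 η : ℝ) : ℂ))) volume := by
  refine ⟨Continuous.aestronglyMeasurable ?_, 1, Eventually.of_forall fun η =>
    (norm_exp_I_mul _).le⟩
  have := continuous_envelopeSymbol (ω := ω) (n := n) (κ := κ) μ β p.1 p.2
  fun_prop

theorem phaseOp_coe (μ : ℕ) (β t : ℝ) (x : Envelopes d N) (p : Fin N × ℤˣ) :
    phaseOp ω n κ μ β t x p =ᵐ[volume] fun η => Complex.exp (Complex.I *
      ((t * envelopeSymbol ω n κ μ β p.1 p.2 η : ℝ) : ℂ)) * x p η := by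
  refine (vMul_coe (essBdd_phase μ β t p) (x p)).trans (Eventually.of_forall fun η => ?_)
  exact mul_comm _ _

theorem norm_phaseOp_apply_apply_le (μ : ℕ) (β t : ℝ) (x : Envelopes d N) (p : Fin N × ℤˣ) :
    ‖phaseOp ω n κ μ β t x p‖ ≤ ‖x p‖ := by
  have := norm_vMul_apply_le (μ := volume) zero_le_one
    (Eventually.of_forall fun η => (norm_exp_I_mul
      (t * envelopeSymbol (d := d) ω n κ μ β p.1 p.2 η)).le) (x p)
  rwa [one_mul] at this

theorem norm_phaseOp_apply_le (μ : ℕ) (β t : ℝ) (x : Envelopes d N) :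
    ‖phaseOp ω n κ μ β t x‖ ≤ ‖x‖ :=
  (pi_norm_le_iff_of_nonneg (norm_nonneg _)).2 fun p =>
    (norm_phaseOp_apply_apply_le μ β t x p).trans (norm_le_pi_norm x p)

theorem continuous_phaseOp_apply (μ : ℕ) (β : ℝ) (x : Envelopes d N) :
    Continuous fun t => phaseOp ω n κ μ β t x := by
  refine continuous_pi fun p => ?_
  refine continuous_vMul_apply (C := 1) (fun t => (essBdd_phase μ β t p).1)
    (fun t => Eventually.of_forall fun η => (norm_exp_I_mul _).le)
    (Eventually.of_forall fun η => ?_) (x p)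
  fun_prop

/-- The vector field of the envelope system for the slow variables. -/
def envelopeVF (ω : Fin J → ℤˣ → Wavevec d → ℝ)
    (g : Fin J → ℤˣ → Wavevec d → Field2J J) (M : Finset ℕ)
    (χ : (m : ℕ) → Wavevec d → (Fin m → Wavevec d) →
      ContinuousMultilinearMap ℂ (fun _ : Fin m => Field2J J) (Field2J J))
    (n : Fin N → Fin J) (κ : Fin N → Wavevec d) (μ ν : ℕ) (β ϱ t : ℝ) (x : Envelopes d N) :
    Envelopes d N :=
  phaseOp ω n κ μ β (t / ϱ) (envelopeMap ω g M χ n κ ν β (phaseOp ω n κ μ β (-(t / ϱ)) x))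

theorem envelopeVF_coe (hM : ∀ m ∈ M, 2 ≤ m) (μ ν : ℕ) (β ϱ t : ℝ) (x : Envelopes d N)
    (p : Fin N × ℤˣ) :
    envelopeVF ω g M χ n κ μ ν β ϱ t x p =ᵐ[volume] fun η =>
      Complex.exp (Complex.I * ((t / ϱ * envelopeSymbol ω n κ μ β p.1 p.2 η : ℝ) : ℂ)) *
        envelopeNonlinearity ω g M χ n κ ν β
          (fun l' ζ η' =>
            Complex.exp (-Complex.I * ((t / ϱ * envelopeSymbol ω n κ μ β l' ζ η' : ℝ) : ℂ)) *
              x (l', ζ) η') p.1 p.2 η := by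
  have h : ∀ q, phaseOp ω n κ μ β (-(t / ϱ)) x q =ᵐ[volume] fun η' =>
      Complex.exp (-Complex.I * ((t / ϱ * envelopeSymbol ω n κ μ β q.1 q.2 η' : ℝ) : ℂ)) *
        x (q.1, q.2) η' := fun q => by
    refine (phaseOp_coe μ β (-(t / ϱ)) x q).trans (Eventually.of_forall fun η => ?_)
    simp only
    congr 2
    push_cast
    ring_nf
  filter_upwards [phaseOp_coe μ β (t / ϱ) (envelopeMap ω g M χ n κ ν β
    (phaseOp ω n κ μ β (-(t / ϱ)) x)) p, envelopeMap_coe (ω := ω) (g := g) (χ := χ) (n := n)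
    (κ := κ) hM ν β (y := fun l' ζ η' =>
      Complex.exp (-Complex.I * ((t / ϱ * envelopeSymbol ω n κ μ β l' ζ η' : ℝ) : ℂ)) *
        x (l', ζ) η') h p] with η a b
  rw [envelopeVF, a, b]

theorem isEnvelopeSolution_iff (hM : ∀ m ∈ M, 2 ≤ m) {B K : ℝ → ℝ} {μ ν : ℕ} {β ϱ T : ℝ}
    (hV : IsRegularField (envelopeVF ω g M χ n κ μ ν β ϱ) B K) {H : Fin N → ℤˣ → LOne d ℂ}
    {z : Fin N → ℤˣ → ℝ → LOne d ℂ} :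
    IsEnvelopeSolution ω g M χ n κ μ ν β ϱ T H z ↔
      IsIntegralSolution (envelopeVF ω g M χ n κ μ ν β ϱ) T (fun p => H p.1 p.2)
        fun t p => z p.1 p.2 t := by
  have hproj : ∀ {f : ℝ → Envelopes d N} {t : ℝ}, t ∈ Icc 0 T → ContinuousOn f (Icc 0 T) →
      ∀ p, (∫ s in (0 : ℝ)..t, f s) p = ∫ s in (0 : ℝ)..t, f s p := fun {f t} ht hf p => by
    have hi : IntervalIntegrable f volume 0 t := (hf.mono fun s hs => by
      rw [uIcc_of_le ht.1] at hs; exact ⟨hs.1, hs.2.trans ht.2⟩).intervalIntegrable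
    exact ((ContinuousLinearMap.proj (R := ℝ) (φ := fun _ : Fin N × ℤˣ => LOne d ℂ)
      p).intervalIntegral_comp_comm hi).symm
  constructor
  · intro h
    have hc : ContinuousOn (fun t (p : Fin N × ℤˣ) => z p.1 p.2 t) (Icc 0 T) :=
      continuousOn_pi.2 fun p => (h p.1 p.2).1
    refine ⟨hc, fun t ht => ?_⟩
    funext p
    obtain ⟨-, G, hG, hGe, hz⟩ := h p.1 p.2
    simp only
    rw [hz t ht, Pi.add_apply, hproj ht (hV.continuousOn_comp hc)]
    congr 1
    refine intervalIntegral.integral_congr fun s hs => ?_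
    rw [uIcc_of_le ht.1] at hs
    have hs' : s ∈ Icc 0 T := ⟨hs.1, hs.2.trans ht.2⟩
    have h5 := envelopeVF_coe (ω := ω) (g := g) (χ := χ) (n := n) (κ := κ) hM μ ν β ϱ s
      (fun p => z p.1 p.2 s) p
    exact Lp.ext ((hGe s hs').trans h5.symm)
  · rintro ⟨hc, hu⟩ l ϑ
    have hV' := hV.continuousOn_comp hc
    have h1 : ContinuousOn (fun t => envelopeVF ω g M χ n κ μ ν β ϱ t
      (fun p => z p.1 p.2 t) (l, ϑ)) (Icc 0 T) := continuousOn_pi.1 hV' (l, ϑ)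
    have h2 : ContinuousOn (z l ϑ) (Icc 0 T) := continuousOn_pi.1 hc (l, ϑ)
    refine ⟨h2, fun t => envelopeVF ω g M χ n κ μ ν β ϱ t
      (fun p => z p.1 p.2 t) (l, ϑ), h1,
      fun t _ => envelopeVF_coe (ω := ω) (g := g) (χ := χ) (n := n) (κ := κ) hM μ ν β ϱ t
        (fun p => z p.1 p.2 t) (l, ϑ), fun t ht => ?_⟩
    have h3 := hproj ht hV' (l, ϑ)
    have h4 := congrFun (hu t ht) (l, ϑ)
    rw [Pi.add_apply, h3] at h4
    exact h4

end EnvelopeEquation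

/-! ### Truncated polynomial weights and tensor products. -/

section Weight

variable {d : ℕ}

/-- The truncated polynomial weight. -/
def weight (a b : ℝ) (η : Wavevec d) : ℝ := (min (1 + ‖η‖) b) ^ a

theorem one_le_weight {a b : ℝ} (ha : 0 ≤ a) (hb : 1 ≤ b) (η : Wavevec d) : 1 ≤ weight a b η :=
  Real.one_le_rpow (le_min (by linarith [norm_nonneg η]) hb) ha

theorem weight_le {a b : ℝ} (ha : 0 ≤ a) (hb : 1 ≤ b) (η : Wavevec d) : weight a b η ≤ b ^ a :=
  Real.rpow_le_rpow (le_min (by positivity) (by linarith)) (min_le_right _ _) ha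

theorem weight_le_rpow {a b : ℝ} (ha : 0 ≤ a) (hb : 1 ≤ b) (η : Wavevec d) :
    weight a b η ≤ (1 + ‖η‖) ^ a :=
  Real.rpow_le_rpow (le_min (by positivity) (by linarith)) (min_le_left _ _) ha

theorem continuous_weight {a b : ℝ} (ha : 0 ≤ a) :
    Continuous (weight (d := d) a b) := by
  unfold weight
  exact Continuous.rpow_const (by fun_prop) fun _ => Or.inr ha

/-- If $\kappa_i$ has the largest norm, then $1+|\sum_j\kappa_j|\le m(1+|\kappa_i|)$. Truncation at
$b$ preserves the inequality since $m\ge1$. -/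
theorem weight_sum_le {a b : ℝ} (ha : 0 ≤ a) (hb : 1 ≤ b) {m : ℕ} (hm : 1 ≤ m)
    (κ : Fin m → Wavevec d) : weight a b (∑ j, κ j) ≤ (m : ℝ) ^ a * ∑ j, weight a b (κ j) := by
  have hne : (Finset.univ : Finset (Fin m)).Nonempty := ⟨⟨0, hm⟩, Finset.mem_univ _⟩
  obtain ⟨i, -, hi⟩ := Finset.exists_max_image Finset.univ (fun j => ‖κ j‖) hne
  have h0 : 0 ≤ min (1 + ‖κ i‖) b := le_min (by positivity) (by linarith)
  have hm' : (1 : ℝ) ≤ m := by exact_mod_cast hm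
  have h2 : ‖∑ j, κ j‖ ≤ m * ‖κ i‖ := by
    have h2 : ‖∑ j, κ j‖ ≤ ∑ _j : Fin m, ‖κ i‖ := norm_sum_le_of_le _ hi
    simpa using h2
  have h1 : min (1 + ‖∑ j, κ j‖) b ≤ m * min (1 + ‖κ i‖) b := by
    rcases le_total (1 + ‖κ i‖) b with h | h
    · rw [min_eq_left h]
      refine (min_le_left _ _).trans ?_
      linarith
    · rw [min_eq_right h]
      refine (min_le_right _ _).trans ?_
      nlinarith
  calc weight a b (∑ j, κ j) ≤ (m * min (1 + ‖κ i‖) b) ^ a :=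
        Real.rpow_le_rpow (le_min (by positivity) (by linarith)) h1 ha
    _ = (m : ℝ) ^ a * weight a b (κ i) := Real.mul_rpow (by positivity) h0
    _ ≤ _ := by
        gcongr
        exact Finset.single_le_sum (f := fun j => weight a b (κ j))
          (fun j _ => zero_le_one.trans (one_le_weight ha hb _)) (Finset.mem_univ i)

theorem essBdd_weight {a b : ℝ} (ha : 0 ≤ a) (hb : 1 ≤ b) :
    EssBdd (fun η : Wavevec d => (weight a b η : ℂ)) volume := by
  refine ⟨(Complex.continuous_ofReal.comp (continuous_weight ha)).aestronglyMeasurable, b ^ a,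
    Eventually.of_forall fun η => ?_⟩
  rw [Complex.norm_real, Real.norm_of_nonneg (zero_le_one.trans (one_le_weight ha hb η))]
  exact weight_le ha hb η

/-- The truncated weight is dominated by the full one, so the bound does not depend on the
truncation level. -/
theorem norm_vMul_weight_le {a b R : ℝ} (ha : 0 ≤ a) (hb : 1 ≤ b) (hR : 0 ≤ R) {f : LOne d ℂ}
    (hf : weightedNorm a f ≤ ENNReal.ofReal R) :
    ‖vMul volume (fun η : Wavevec d => (weight a b η : ℂ)) f‖ ≤ R := by
  rw [Lp.norm_def, eLpNorm_one_eq_lintegral_enorm]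
  refine ENNReal.toReal_le_of_le_ofReal hR (le_trans ?_ hf)
  refine lintegral_mono_ae ?_
  filter_upwards [vMul_coe (essBdd_weight ha hb) f] with η h
  rw [h, smul_eq_mul, enorm_mul, mul_comm]
  gcongr
  rw [← ofReal_norm, Complex.norm_real,
    Real.norm_of_nonneg (zero_le_one.trans (one_le_weight ha hb η))]
  exact ENNReal.ofReal_le_ofReal (weight_le_rpow ha hb η)

theorem norm_le_of_weightedNorm_le {a R : ℝ} (ha : 0 ≤ a) (hR : 0 ≤ R) {f : LOne d ℂ}
    (hf : weightedNorm a f ≤ ENNReal.ofReal R) : ‖f‖ ≤ R := by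
  rw [Lp.norm_def, eLpNorm_one_eq_lintegral_enorm]
  refine ENNReal.toReal_le_of_le_ofReal hR (le_trans ?_ hf)
  refine lintegral_mono fun η => le_mul_of_one_le_left (by positivity) ?_
  rw [ENNReal.one_le_ofReal]
  exact Real.one_le_rpow (by linarith [norm_nonneg η]) ha

theorem l1_norm_le_sum {α ι E F : Type*} [MeasurableSpace α] {μ : Measure α} [NormedAddCommGroup E]
    [NormedAddCommGroup F] {f : Lp E 1 μ} {s : Finset ι} {f' : ι → Lp F 1 μ} {C : ℝ}
    (h : ∀ᵐ x ∂μ, ‖f x‖ ≤ C * ∑ i ∈ s, ‖f' i x‖) : ‖f‖ ≤ C * ∑ i ∈ s, ‖f' i‖ := by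
  simp_rw [L1.norm_eq_integral_norm]
  rw [← integral_finsetSum _ fun i _ => (L1.integrable_coeFn (f' i)).norm, ← integral_const_mul]
  exact integral_mono_ae (L1.integrable_coeFn f).norm
    ((integrable_finsetSum _ fun i _ => (L1.integrable_coeFn (f' i)).norm).const_mul C) h

/-- Multiplying a tensor product by $W(\kappa_j)$ is the same as multiplying its $j$-th factor by
$W$. A kernel dominated by $\sum_jW(\kappa_j)$ therefore loads one factor at a time. -/
theorem norm_vMul_tens_le {m : ℕ} {W : Wavevec d → ℂ} (hW : EssBdd W volume)
    {Q : (Fin m → Wavevec d) → ℂ} (hQ : EssBdd Q volume) {C : ℝ}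
    (hC : ∀ κ, ‖Q κ‖ ≤ C * ∑ j, ‖W (κ j)‖) (u : Fin m → LOne d ℂ) :
    ‖vMul volume Q (tens d m u)‖ ≤
      C * ∑ j, ‖tens d m (Function.update u j (vMul volume W (u j)))‖ := by
  refine l1_norm_le_sum ?_
  have h1 : ∀ j, tens d m (Function.update u j (vMul volume W (u j))) =
      vMul volume (fun κ : Fin m → Wavevec d => W (κ j)) (tens d m u) := by
    intro j
    have h2 := tens_vMul (φ := Function.update (fun _ _ => 1) j W) (fun i => by
      by_cases hi : i = j
      · subst hi; simpa using hW
      · simpa [hi] using essBdd_const (1 : ℂ)) u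
    have h3 : (fun κ : Fin m → Wavevec d => ∏ i, Function.update (fun _ _ => (1 : ℂ)) j W i (κ i)) =
        fun κ : Fin m → Wavevec d => W (κ j) := by
      funext κ
      rw [Finset.prod_eq_single j (fun i _ hi => by simp [hi]) (by simp)]
      simp
    have h4 : (fun i => vMul volume (Function.update (fun _ _ => (1 : ℂ)) j W i) (u i)) =
        Function.update u j (vMul volume W (u j)) := by
      funext i
      by_cases hi : i = j
      · subst hi; simp
      · simp only [Function.update_of_ne hi]
        apply Lp.ext
        filter_upwards [vMul_coe (essBdd_const (μ := volume) (1 : ℂ)) (u i)] with x hx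
        rw [hx, smul_eq_mul, mul_one]
    rw [h3, h4] at h2
    exact h2
  simp_rw [h1]
  filter_upwards [vMul_coe hQ (tens d m u), ae_all_iff.2 fun j => vMul_coe
    (hW.comp_quasi (quasiMeasurePreserving_apply j)) (tens d m u)] with κ b c
  rw [b, norm_smul]
  simp_rw [c, norm_smul]
  rw [← Finset.mul_sum, mul_left_comm]
  exact mul_le_mul_of_nonneg_left (hC κ) (norm_nonneg _)

end Weight

/-! ### Propagation of weighted norms and truncation of the envelopes. -/

section WeightedEnvelopes

variable {d J N : ℕ} {L : Wavevec d → (Field2J J →L[ℂ] Field2J J)}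
  {ω : Fin J → ℤˣ → Wavevec d → ℝ} {g : Fin J → ℤˣ → Wavevec d → Field2J J} {M : Finset ℕ}
  {χ : (m : ℕ) → Wavevec d → (Fin m → Wavevec d) →
      ContinuousMultilinearMap ℂ (fun _ : Fin m => Field2J J) (Field2J J)}
  {n : Fin N → Fin J} {κ : Fin N → Wavevec d}

/-- Multiplication of all envelopes by a scalar function. -/
def scaleOp (d N : ℕ) (W : Wavevec d → ℂ) : Envelopes d N →L[ℂ] Envelopes d N :=
  ContinuousLinearMap.pi fun p => (vMul volume W).comp (ContinuousLinearMap.proj p)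

theorem scaleOp_apply (W : Wavevec d → ℂ) (x : Envelopes d N) (p : Fin N × ℤˣ) :
    scaleOp d N W x p = vMul volume W (x p) := rfl

/-- The weight of the output falls on one factor, while the other $m-1$ factors are measured in
unweighted $L^1$, hence by $r$. The estimate is linear in the weighted norm, so controlling that
norm does not shorten the time interval. -/
theorem norm_vMul_envelopeTerm_le {a b r : ℝ} (ha : 0 ≤ a) (hb : 1 ≤ b) (ν : ℕ) (β : ℝ)
    (p : Fin N × ℤˣ) {m : ℕ} (hm : 1 ≤ m) (lam : Fin m → Fin N × ℤˣ) {x : Envelopes d N}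
    (hx : ‖x‖ ≤ r) :
    ‖vMul volume (fun η : Wavevec d => (weight a b η : ℂ)) (envelopeTerm g χ n κ ν β p lam x)‖ ≤
      convFactor d m * (susceptibilityBound g χ n κ p lam * (m : ℝ) ^ a * (m * r ^ (m - 1))) *
        ‖scaleOp d N (fun η => (weight a b η : ℂ)) x‖ := by
  have hW := essBdd_weight (d := d) ha hb
  have hQ := essBdd_approxSusceptibility (g := g) (χ := χ) (n := n) (κ := κ) ν β p lam
  have hr : 0 ≤ r := (norm_nonneg _).trans hx
  rw [envelopeTerm, map_smul, vMul_fiberOp hm hW, vMul_vMul (hW.comp_sum hm) hQ, norm_smul,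
    Complex.norm_real, Real.norm_of_nonneg (convFactor_pos d m).le, mul_assoc]
  refine mul_le_mul_of_nonneg_left ?_ (convFactor_pos d m).le
  refine (norm_fiberOp_apply_le _).trans ?_
  refine (norm_vMul_tens_le hW (hQ.smul (hW.comp_sum hm))
    (C := susceptibilityBound g χ n κ p lam * (m : ℝ) ^ a) (fun η => ?_) _).trans ?_
  · have hn : ∀ η : Wavevec d, ‖(weight a b η : ℂ)‖ = weight a b η := fun η => by
      rw [Complex.norm_real, Real.norm_of_nonneg (zero_le_one.trans (one_le_weight ha hb η))]
    simp_rw [norm_smul, hn]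
    rw [mul_assoc]
    exact mul_le_mul (norm_approxSusceptibility_le ν β p lam η) (weight_sum_le ha hb hm η)
      (zero_le_one.trans (one_le_weight ha hb _)) (susceptibilityBound_nonneg p lam)
  · have h0 := susceptibilityBound_nonneg (g := g) (χ := χ) (n := n) (κ := κ) p lam
    rw [mul_assoc _ ((m : ℝ) * _)]
    refine mul_le_mul_of_nonneg_left ?_ (by positivity)
    have : ∀ j, ‖tens d m (Function.update (fun j => x (lam j)) j
        (vMul volume (fun η => (weight a b η : ℂ)) (x (lam j))))‖ ≤
        r ^ (m - 1) * ‖scaleOp d N (fun η => (weight a b η : ℂ)) x‖ := by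
      intro j
      refine (norm_tens_apply_le _).trans ?_
      rw [← Finset.mul_prod_erase _ _ (Finset.mem_univ j), mul_comm]
      refine mul_le_mul ?_ ?_ (norm_nonneg _) (by positivity)
      · refine (Finset.prod_le_prod (g := fun _ => r) (fun _ _ => norm_nonneg _)
          (fun i hi => ?_)).trans ?_
        · rw [Function.update_of_ne (Finset.ne_of_mem_erase hi)]
          exact (norm_le_pi_norm x (lam i)).trans hx
        · simp [Finset.prod_const, Finset.card_erase_of_mem]
      · rw [Function.update_self]
        exact norm_le_pi_norm (scaleOp d N (fun η => (weight a b η : ℂ)) x) (lam j)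
    refine (Finset.sum_le_sum fun j _ => this j).trans ?_
    simp [mul_assoc]

theorem norm_vMul_phaseOp_le {W : Wavevec d → ℂ} (hW : EssBdd W volume) (μ : ℕ) (β t : ℝ)
    (x : Envelopes d N) (p : Fin N × ℤˣ) :
    ‖vMul volume W (phaseOp ω n κ μ β t x p)‖ ≤ ‖vMul volume W (x p)‖ := by
  rw [← one_mul ‖vMul volume W (x p)‖]
  refine l1_norm_le_of_ae_le ?_
  filter_upwards [vMul_coe hW (phaseOp ω n κ μ β t x p), vMul_coe hW (x p),
    phaseOp_coe μ β t x p] with η a b c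
  rw [a, b, c, norm_smul, norm_smul, norm_mul, norm_exp_I_mul, one_mul, one_mul]

theorem exists_weighted_bound (hM : ∀ m ∈ M, 2 ≤ m) {a r : ℝ} (ha : 0 ≤ a) (hr : 0 ≤ r) :
    ∃ C, 0 < C ∧ ∀ (b : ℝ), 1 ≤ b → ∀ (μ ν : ℕ) (β ϱ t : ℝ) (x : Envelopes d N), ‖x‖ ≤ r →
      ‖scaleOp d N (fun η => (weight a b η : ℂ)) (envelopeVF ω g M χ n κ μ ν β ϱ t x)‖ ≤
        C * ‖scaleOp d N (fun η => (weight a b η : ℂ)) x‖ := by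
  set c : Fin N × ℤˣ → ℝ := fun p => ∑ m ∈ M, ∑ lam ∈ resonantStrings ω n κ p.1 p.2 m,
    convFactor d m * (susceptibilityBound g χ n κ p lam * (m : ℝ) ^ a * (m * r ^ (m - 1))) with hc
  have hc0 : ∀ p, 0 ≤ c p := fun p => Finset.sum_nonneg fun m _ => Finset.sum_nonneg fun lam _ => by
    have := (convFactor_pos d m).le
    have := susceptibilityBound_nonneg (g := g) (χ := χ) (n := n) (κ := κ) p lam
    positivity
  have hc1 := Finset.sum_nonneg fun p (_ : p ∈ Finset.univ) => hc0 p
  -- The summand $1$ makes the constant strictly positive, as `gronwall_stability` requires.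
  refine ⟨∑ p, c p + 1, by positivity, fun b hb μ ν β ϱ t x hx => ?_⟩
  have hW := essBdd_weight (d := d) ha hb
  refine (pi_norm_le_iff_of_nonneg (by positivity)).2 fun p => ?_
  rw [scaleOp_apply, envelopeVF]
  refine (norm_vMul_phaseOp_le hW _ _ _ _ p).trans ?_
  have h1 : ‖scaleOp d N (fun η => (weight a b η : ℂ)) (phaseOp ω n κ μ β (-(t / ϱ)) x)‖ ≤
      ‖scaleOp d N (fun η => (weight a b η : ℂ)) x‖ :=
    (pi_norm_le_iff_of_nonneg (norm_nonneg _)).2 fun q =>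
      (norm_vMul_phaseOp_le hW _ _ _ _ q).trans
        (norm_le_pi_norm (scaleOp d N (fun η => (weight a b η : ℂ)) x) q)
  have h2 : ‖vMul volume (fun η : Wavevec d => (weight a b η : ℂ))
      (envelopeMap ω g M χ n κ ν β (phaseOp ω n κ μ β (-(t / ϱ)) x) p)‖ ≤
      c p * ‖scaleOp d N (fun η => (weight a b η : ℂ)) (phaseOp ω n κ μ β (-(t / ϱ)) x)‖ := by
    rw [envelopeMap, map_sum, hc, Finset.sum_mul]
    refine norm_sum_le_of_le _ fun m hm => ?_
    rw [map_sum, Finset.sum_mul]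
    refine norm_sum_le_of_le _ fun lam _ => ?_
    have hm1 : 1 ≤ m := by have := hM m hm; omega
    exact norm_vMul_envelopeTerm_le ha hb ν β p hm1 lam ((norm_phaseOp_apply_le _ _ _ _).trans hx)
  refine h2.trans (mul_le_mul ?_ h1 (norm_nonneg _) (by positivity))
  have := Finset.single_le_sum (f := c) (fun p _ => hc0 p) (Finset.mem_univ p)
  linarith

/-- The cutoff of the envelopes to the ball of radius `β^{-ε}`. -/
def envelopeCutoff (d N : ℕ) (β ε : ℝ) : Envelopes d N →L[ℂ] Envelopes d N :=
  scaleOp d N fun η => (cutoff β ε 0 (β • η) : ℂ)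

theorem cutoff_eq_zero_or_one (β ε : ℝ) (c k : Wavevec d) :
    cutoff β ε c k = 0 ∨ cutoff β ε c k = 1 := by
  unfold cutoff
  split_ifs
  · exact Or.inr rfl
  · exact Or.inl rfl

theorem measurable_cutoff (β ε : ℝ) (c : Wavevec d) : Measurable (cutoff β ε c) := by
  unfold cutoff
  refine Measurable.ite ?_ measurable_const measurable_const
  exact measurableSet_le (by fun_prop) measurable_const

theorem essBdd_envelopeCutoff (β ε : ℝ) :
    EssBdd (fun η : Wavevec d => (cutoff β ε 0 (β • η) : ℂ)) volume := by
  refine ⟨(Complex.measurable_ofReal.comp ((measurable_cutoff β ε 0).comp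
    (measurable_const_smul β))).aestronglyMeasurable, 1,
    Eventually.of_forall fun k => ?_⟩
  rcases cutoff_eq_zero_or_one β ε 0 (β • k) with h | h <;> simp [h]

theorem norm_le_of_cutoff_ne_zero {β ε : ℝ} (hβ : 0 < β) {c k : Wavevec d}
    (h : cutoff β ε c k ≠ 0) : ‖k - c‖ ≤ β ^ (1 - ε) := by
  unfold cutoff at h
  split_ifs at h with h1
  · have h2 : 0 < β ^ (1 - ε) := Real.rpow_pos_of_pos hβ _
    rw [norm_smul, norm_inv, Real.norm_of_nonneg h2.le, inv_mul_le_iff₀ h2, mul_one] at h1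
    exact h1
  · exact absurd rfl h

theorem lt_norm_of_cutoff_eq_zero {β ε : ℝ} (hβ : 0 < β) {c k : Wavevec d}
    (h : cutoff β ε c k = 0) : β ^ (1 - ε) < ‖k - c‖ := by
  unfold cutoff at h
  split_ifs at h with h1
  · exact absurd h one_ne_zero
  · have h2 : 0 < β ^ (1 - ε) := Real.rpow_pos_of_pos hβ _
    rw [norm_smul, norm_inv, Real.norm_of_nonneg h2.le, inv_mul_le_iff₀ h2, mul_one] at h1
    exact not_le.1 h1

/-- Where the cutoff vanishes, $|\eta|>\beta^{-\epsilon}$ and the truncated weight has saturated at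
$\beta^{-\epsilon a}$; this converts the weighted norm into the factor $\beta^{\epsilon a}$. -/
theorem norm_sub_envelopeCutoff_le {a β ε : ℝ} (ha : 0 ≤ a) (hε : 0 ≤ ε) (hβ : 0 < β) (hβ1 : β ≤ 1)
    (x : Envelopes d N) :
    ‖x - envelopeCutoff d N β ε x‖ ≤
      β ^ (ε * a) * ‖scaleOp d N (fun η => (weight a (β ^ (-ε)) η : ℂ)) x‖ := by
  have hb : 1 ≤ β ^ (-ε) := Real.one_le_rpow_of_pos_of_le_one_of_nonpos hβ hβ1 (by linarith)
  refine (pi_norm_le_iff_of_nonneg (by positivity)).2 fun p => ?_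
  have h1 : ‖x p - envelopeCutoff d N β ε x p‖ ≤ β ^ (ε * a) *
      ‖scaleOp d N (fun η => (weight a (β ^ (-ε)) η : ℂ)) x p‖ := by
    refine l1_norm_le_of_ae_le ?_
    filter_upwards [Lp.coeFn_sub (x p) (envelopeCutoff d N β ε x p),
      vMul_coe (essBdd_envelopeCutoff β ε) (x p), vMul_coe (essBdd_weight ha hb) (x p)]
      with η e f h
    rw [e, Pi.sub_apply, scaleOp_apply, h, envelopeCutoff, scaleOp_apply, f, norm_smul,
      Complex.norm_real, Real.norm_of_nonneg (zero_le_one.trans (one_le_weight ha hb η))]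
    rcases cutoff_eq_zero_or_one β ε 0 (β • η) with hc | hc
    · have h3 := lt_norm_of_cutoff_eq_zero hβ hc
      rw [sub_zero, norm_smul, Real.norm_of_nonneg hβ.le, sub_eq_add_neg, Real.rpow_add hβ,
        Real.rpow_one] at h3
      have h4 : β ^ (-ε) < ‖η‖ := lt_of_mul_lt_mul_left h3 hβ.le
      have h5 : weight a (β ^ (-ε)) η = β ^ (-(ε * a)) := by
        rw [weight, min_eq_right (by linarith), ← Real.rpow_mul hβ.le]
        ring_nf
      rw [h5, hc, mul_left_comm, ← Real.rpow_add hβ]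
      simp
    · rw [hc]
      simp only [Complex.ofReal_one, smul_eq_mul, mul_one, sub_self, norm_zero]
      have := one_le_weight ha hb η
      positivity
  refine h1.trans ?_
  gcongr
  exact norm_le_pi_norm (scaleOp d N (fun η => (weight a (β ^ (-ε)) η : ℂ)) x) p

/-- The weight truncated at $\beta^{-\epsilon}$ acts boundedly on $L^1$, so it can be applied to the
integral equation without knowing that the solution stays in $L^{1,a}$. The Grönwall constant does
not see the truncation level, and $\epsilon a>s$ gives the rate. -/
theorem exists_tail_bound (hM : ∀ m ∈ M, 2 ≤ m) {a r R T s ε : ℝ} (ha : 0 < a) (hr : 0 ≤ r)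
    (hR : 0 ≤ R) (hε : 0 < ε) (hs : s / ε < a) (B K : ℝ → ℝ) :
    ∃ C, 0 ≤ C ∧ ∀ (μ ν : ℕ) (β ϱ : ℝ) (H : Envelopes d N) (x : ℝ → Envelopes d N),
      0 < β → β ≤ 1 → IsRegularField (envelopeVF ω g M χ n κ μ ν β ϱ) B K →
      IsIntegralSolution (envelopeVF ω g M χ n κ μ ν β ϱ) T H x →
      (∀ t ∈ Icc 0 T, ‖x t‖ ≤ r) → (∀ p, weightedNorm a (H p) ≤ ENNReal.ofReal R) →
      ∀ t ∈ Icc 0 T, ‖x t - envelopeCutoff d N β ε (x t)‖ ≤ C * β ^ s := by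
  obtain ⟨K₁, hK₁, hK⟩ := exists_weighted_bound (ω := ω) (g := g) (χ := χ) (n := n) (κ := κ)
    hM ha.le hr
  refine ⟨R * Real.exp (K₁ * T), by positivity, fun μ ν β ϱ H x hβ hβ1 hV hx hxr hH t ht => ?_⟩
  have hb : 1 ≤ β ^ (-ε) := Real.one_le_rpow_of_pos_of_le_one_of_nonpos hβ hβ1 (by linarith)
  set S := scaleOp d N (fun η => (weight a (β ^ (-ε)) η : ℂ)) with hS
  have hVc := hV.continuousOn_comp hx.1
  -- Stability with respect to the zero solution is the ordinary linear Grönwall inequality for the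
  -- weighted envelopes.
  have h1 := gronwall_stability (u := fun t => S (x t)) (v := fun _ => 0) (T := T)
    (A := fun t => S (envelopeVF ω g M χ n κ μ ν β ϱ t (x t))) (E := fun _ => 0)
    (P := fun _ => 0) (K := K₁) (ε₁ := 0) (ε₂ := R) (h := S H) (h' := 0) hK₁
    (S.continuous.comp_continuousOn hVc) continuousOn_const continuousOn_const
    (fun t ht => by
      have hi : IntervalIntegrable (fun t => envelopeVF ω g M χ n κ μ ν β ϱ t (x t)) volume 0 t :=
        (hVc.mono fun s hs => by
          rw [uIcc_of_le ht.1] at hs; exact ⟨hs.1, hs.2.trans ht.2⟩).intervalIntegrable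
      rw [S.intervalIntegral_comp_comm hi, ← map_add, ← hx.2 t ht])
    (by simp) (fun t ht => by simpa using hK _ hb μ ν β ϱ t (x t) (hxr t ht)) (by simp)
    (by
      rw [sub_zero]
      exact (pi_norm_le_iff_of_nonneg hR).2 fun p => norm_vMul_weight_le ha.le hb hR (hH p)) t ht
  rw [sub_zero, zero_add] at h1
  refine (norm_sub_envelopeCutoff_le ha.le hε.le hβ hβ1 (x t)).trans ?_
  rw [mul_comm]
  refine mul_le_mul h1 ?_ (Real.rpow_nonneg hβ.le _) (by positivity)
  refine Real.rpow_le_rpow_of_exponent_ge hβ hβ1 ?_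
  rw [div_lt_iff₀ hε] at hs
  linarith

end WeightedEnvelopes

/-! ### Both vector fields as sums over strings of kernels. -/

section WaveOp

variable {d J N : ℕ} {L : Wavevec d → (Field2J J →L[ℂ] Field2J J)}
  {ω : Fin J → ℤˣ → Wavevec d → ℝ} {g : Fin J → ℤˣ → Wavevec d → Field2J J} {M : Finset ℕ}
  {χ : (m : ℕ) → Wavevec d → (Fin m → Wavevec d) →
      ContinuousMultilinearMap ℂ (fun _ : Fin m => Field2J J) (Field2J J)}
  {n : Fin N → Fin J} {κ : Fin N → Wavevec d}

/-- The centre of a component of the multi-wavepacket. -/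
def center (κ : Fin N → Wavevec d) (p : Fin N × ℤˣ) : Wavevec d := sgn p.2 • κ p.1

/-- The eigenvector of a component of the multi-wavepacket. -/
def mode (g : Fin J → ℤˣ → Wavevec d → Field2J J) (n : Fin N → Fin J) (p : Fin N × ℤˣ)
    (k : Wavevec d) : Field2J J := g (n p.1) p.2 k

/-- The dispersion relation of a component of the multi-wavepacket. -/
def freq (ω : Fin J → ℤˣ → Wavevec d → ℝ) (n : Fin N → Fin J) (p : Fin N × ℤˣ)
    (k : Wavevec d) : ℝ := ω (n p.1) p.2 k

theorem essBdd_mode (hL : LinearCondition L ω g) (hS : SpectrumCondition L ω g M n κ)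
    (p : Fin N × ℤˣ) : EssBdd (mode g n p) volume := by
  refine ⟨hS.eigenvector_meas p.1 p.2, 1, ?_⟩
  filter_upwards [ae_noncrossing hL] with k hk
  exact (hL.unit k hk _ _).le

/-- The field assembled from the envelopes. -/
def waveOp (g : Fin J → ℤˣ → Wavevec d → Field2J J) (n : Fin N → Fin J) (κ : Fin N → Wavevec d)
    (β : ℝ) : Envelopes d N →L[ℂ] LOne d (Field2J J) :=
  ∑ p, ((vMul volume (mode g n p)).comp (rescaleOp β (center κ p))).comp
    (ContinuousLinearMap.proj p)

theorem waveOp_apply (β : ℝ) (x : Envelopes d N) :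
    waveOp g n κ β x = ∑ p, vMul volume (mode g n p) (rescaleOp β (center κ p) (x p)) := by
  rw [waveOp, sum_apply]
  rfl

theorem waveOp_coe (hL : LinearCondition L ω g) (hS : SpectrumCondition L ω g M n κ) {β : ℝ}
    (hβ : 0 < β) (x : Envelopes d N) :
    waveOp g n κ β x =ᵐ[volume] fun k => ∑ p, rescale β (center κ p) (x p) k • mode g n p k := by
  filter_upwards [Lp.coeFn_finsetSum Finset.univ fun p =>
      vMul volume (mode g n p) (rescaleOp β (center κ p) (x p)),
    ae_all_iff.2 fun p => vMul_coe (essBdd_mode hL hS p) (rescaleOp β (center κ p) (x p)),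
    ae_all_iff.2 fun p => rescaleOp_coe hβ (center κ p) (x p)] with k a b c
  rw [waveOp_apply, a, Finset.sum_apply]
  simp_rw [b, c]

theorem norm_waveOp_apply_le (hL : LinearCondition L ω g) (β : ℝ) (x : Envelopes d N) :
    ‖waveOp g n κ β x‖ ≤ 2 * N * ‖x‖ := by
  rw [waveOp_apply]
  have h : ∀ p, ‖vMul volume (mode g n p) (rescaleOp β (center κ p) (x p))‖ ≤ ‖x‖ := by
    intro p
    refine (norm_vMul_apply_le zero_le_one ?_ _).trans ?_
    · filter_upwards [ae_noncrossing hL] with k hk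
      exact (hL.unit k hk _ _).le
    · rw [one_mul]
      exact (norm_rescaleOp_apply_le _ _ _).trans (norm_le_pi_norm x p)
  refine (norm_sum_le_of_le _ fun p _ => h p).trans (le_of_eq ?_)
  simp [mul_comm (N : ℝ)]

/-- The kernel of a term of the nonlinearity acting on a string of modes. -/
def fieldKernel (L : Wavevec d → (Field2J J →L[ℂ] Field2J J))
    (g : Fin J → ℤˣ → Wavevec d → Field2J J)
    (χ : (m : ℕ) → Wavevec d → (Fin m → Wavevec d) →
      ContinuousMultilinearMap ℂ (fun _ : Fin m => Field2J J) (Field2J J))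
    (n : Fin N → Fin J) {m : ℕ} (lam : Fin m → Fin N × ℤˣ) (τ : ℝ) (k : Fin m → Wavevec d) :
    Field2J J :=
  propagator L τ (∑ j, k j) (χ m (∑ j, k j) k fun j => propagator L (-τ) (k j)
    (mode g n (lam j) (k j)))

/-- The kernel of a term of the envelope nonlinearity in the original variables. -/
def envelopeKernel (ω : Fin J → ℤˣ → Wavevec d → ℝ) (g : Fin J → ℤˣ → Wavevec d → Field2J J)
    (χ : (m : ℕ) → Wavevec d → (Fin m → Wavevec d) →
      ContinuousMultilinearMap ℂ (fun _ : Fin m => Field2J J) (Field2J J))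
    (n : Fin N → Fin J) (κ : Fin N → Wavevec d) (μ ν : ℕ) (β : ℝ) (p : Fin N × ℤˣ) {m : ℕ}
    (lam : Fin m → Fin N × ℤˣ) (τ : ℝ) (k : Fin m → Wavevec d) : Field2J J :=
  (Complex.exp (Complex.I * ((τ * envelopeSymbol ω n κ μ β p.1 p.2
      (∑ j, β⁻¹ • (k j - center κ (lam j))) : ℝ) : ℂ)) *
    ((∏ j, Complex.exp (Complex.I * ((-τ * envelopeSymbol ω n κ μ β (lam j).1 (lam j).2
      (β⁻¹ • (k j - center κ (lam j))) : ℝ) : ℂ))) *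
    approxSusceptibility g χ n κ ν β p.1 p.2 lam fun j => β⁻¹ • (k j - center κ (lam j)))) •
    mode g n p (∑ j, k j)

/-- The tensor product of the rescaled envelopes along a string. -/
def stringTens (κ : Fin N → Wavevec d) (β : ℝ) {m : ℕ} (lam : Fin m → Fin N × ℤˣ)
    (x : Envelopes d N) : Lp ℂ 1 (volume : Measure (Fin m → Wavevec d)) :=
  tens d m fun j => rescaleOp β (center κ (lam j)) (x (lam j))

theorem essBdd_fieldKernel (hL : LinearCondition L ω g)
    (hχ : NonlinearCondition (bandCrossing L ω) M χ) (hS : SpectrumCondition L ω g M n κ) {m : ℕ}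
    (hm : m ∈ M) (lam : Fin m → Fin N × ℤˣ) (τ : ℝ) :
    EssBdd (fieldKernel L g χ n lam τ) volume := by
  have hm1 : 1 ≤ m := by have := hχ.two_le m hm; omega
  exact ((essBdd_propagator hL τ).comp_sum hm1).clm_apply
    ((essBdd_susceptibility hL hχ hm).multilinear_apply fun j =>
      ((essBdd_propagator hL (-τ)).clm_apply (essBdd_mode hL hS (lam j))).comp_quasi
        (quasiMeasurePreserving_apply j))

/-- Multilinearity expands the nonlinearity over all strings of modes, and the commutation rules
collect propagators, susceptibility and eigenvectors into one kernel on a scalar tensor product. -/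
theorem fieldVF_waveOp (hL : LinearCondition L ω g)
    (hχ : NonlinearCondition (bandCrossing L ω) M χ) (hS : SpectrumCondition L ω g M n κ)
    (β ϱ t : ℝ) (x : Envelopes d N) :
    fieldVF L M χ ϱ t (waveOp g n κ β x) = ∑ m ∈ M, ∑ lam : Fin m → Fin N × ℤˣ,
      (convFactor d m : ℂ) • fiberOp d m (Field2J J)
        (vMul volume (fieldKernel L g χ n lam (t / ϱ)) (stringTens κ β lam x)) := by
  have h1 : groupOp L (-(t / ϱ)) (waveOp g n κ β x) =
      ∑ p, vMul volume (fun k => propagator L (-(t / ϱ)) k (mode g n p k))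
        (rescaleOp β (center κ p) (x p)) := by
    rw [waveOp_apply, map_sum]
    exact Finset.sum_congr rfl fun p _ =>
      mulOp_vMul (essBdd_propagator hL _) (essBdd_mode hL hS p) _
  rw [fieldVF, fieldMap, h1, map_sum]
  refine Finset.sum_congr rfl fun m hm => ?_
  have hm1 : 1 ≤ m := by have := hχ.two_le m hm; omega
  rw [ContinuousMultilinearMap.map_sum, map_smul, map_sum, map_sum, Finset.smul_sum]
  refine Finset.sum_congr rfl fun lam _ => ?_
  have hmode : ∀ p, EssBdd (fun k => propagator L (-(t / ϱ)) k (mode g n p k)) volume := fun p =>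
    (essBdd_propagator hL _).clm_apply (essBdd_mode hL hS p)
  rw [tensorOp_vMul (essBdd_susceptibility hL hχ hm)
    (φ := fun j k => propagator L (-(t / ϱ)) k (mode g n (lam j) k)) (fun j => hmode (lam j)),
    groupOp, mulOp_fiberOp hm1 (essBdd_propagator hL _),
    mulOp_vMul ((essBdd_propagator hL _).comp_sum hm1)
      ((essBdd_susceptibility hL hχ hm).multilinear_apply fun j =>
        (hmode (lam j)).comp_quasi (quasiMeasurePreserving_apply j))]
  rfl

theorem essBdd_rescaled_phase (μ : ℕ) (β τ : ℝ)
    {m : ℕ} (lam : Fin m → Fin N × ℤˣ) :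
    EssBdd (fun k : Fin m → Wavevec d => ∏ j, Complex.exp (Complex.I *
      ((-τ * envelopeSymbol ω n κ μ β (lam j).1 (lam j).2 (k j) : ℝ) : ℂ))) volume := by
  refine ⟨Continuous.aestronglyMeasurable ?_, 1, Eventually.of_forall fun k => ?_⟩
  · refine continuous_finsetProd _ fun j _ => ?_
    have := continuous_envelopeSymbol (ω := ω) (n := n) (κ := κ) μ β (lam j).1 (lam j).2
    fun_prop
  · rw [norm_prod]
    simp_rw [norm_exp_I_mul]
    simp

theorem essBdd_envelopeKernel (hL : LinearCondition L ω g) (hM : ∀ m ∈ M, 2 ≤ m)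
    (hS : SpectrumCondition L ω g M n κ) {β : ℝ} (hβ : 0 < β) (μ ν : ℕ) (p : Fin N × ℤˣ) {m : ℕ}
    (hm : m ∈ M) (lam : Fin m → Fin N × ℤˣ) (τ : ℝ) :
    EssBdd (envelopeKernel ω g χ n κ μ ν β p lam τ) volume := by
  have hm1 : 1 ≤ m := by have := hM m hm; omega
  refine EssBdd.smul (ψ := fun k => _) ?_ ((essBdd_mode hL hS p).comp_sum hm1)
  have h := (((essBdd_phase (ω := ω) (n := n) (κ := κ) μ β τ p).comp_sum hm1).smul
    ((essBdd_rescaled_phase (ω := ω) (n := n) (κ := κ) μ β τ lam).smul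
      (essBdd_approxSusceptibility (g := g) (χ := χ) (n := n) (κ := κ) ν β p lam))).comp_quasi
      (quasiMeasurePreserving_rescale_pi hβ fun j => center κ (lam j))
  simpa [smul_eq_mul] using h

/-- The output is rescaled about its own centre, the factors about theirs; these fit together
because the wavevector part of the resonance makes the output centre the sum of the factor centres.
-/
theorem vMul_mode_envelopeTerm (hL : LinearCondition L ω g) (hM : ∀ m ∈ M, 2 ≤ m)
    (hS : SpectrumCondition L ω g M n κ) {β : ℝ} (hβ : 0 < β) (μ ν : ℕ) (τ : ℝ)
    (p : Fin N × ℤˣ) {m : ℕ} (hm : m ∈ M) {lam : Fin m → Fin N × ℤˣ}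
    (hlam : lam ∈ resonantStrings ω n κ p.1 p.2 m) (x : Envelopes d N) :
    vMul volume (mode g n p) (rescaleOp β (center κ p) (vMul volume (fun η =>
      Complex.exp (Complex.I * ((τ * envelopeSymbol ω n κ μ β p.1 p.2 η : ℝ) : ℂ)))
      (envelopeTerm g χ n κ ν β p lam (phaseOp ω n κ μ β (-τ) x)))) =
    (convFactor d m : ℂ) • fiberOp d m (Field2J J)
      (vMul volume (envelopeKernel ω g χ n κ μ ν β p lam τ) (stringTens κ β lam x)) := by
  have hm1 : 1 ≤ m := by have := hM m hm; omega
  have hc : center κ p = ∑ j, center κ (lam j) := ((mem_resonantStrings.1 hlam).1).symm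
  have hph := essBdd_phase (ω := ω) (n := n) (κ := κ) μ β τ p
  have hph' := essBdd_rescaled_phase (ω := ω) (n := n) (κ := κ) μ β τ lam
  have hQ := essBdd_approxSusceptibility (g := g) (χ := χ) (n := n) (κ := κ) ν β p lam
  have h1 : (tens d m fun j => phaseOp ω n κ μ β (-τ) x (lam j)) =
      vMul volume (fun k : Fin m → Wavevec d => ∏ j, Complex.exp (Complex.I *
      ((-τ * envelopeSymbol ω n κ μ β (lam j).1 (lam j).2 (k j) : ℝ) : ℂ)))
      (tens d m fun j => x (lam j)) :=
    tens_vMul (φ := fun j η => Complex.exp (Complex.I *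
      ((-τ * envelopeSymbol ω n κ μ β (lam j).1 (lam j).2 η : ℝ) : ℂ)))
      (fun j => essBdd_phase μ β (-τ) (lam j)) fun j => x (lam j)
  rw [envelopeTerm, h1, map_smul, map_smul, map_smul, vMul_vMul hQ hph', vMul_fiberOp hm1 hph,
    vMul_vMul (hph.comp_sum hm1) (hph'.smul hQ), hc,
    rescaleOp_fiberOp hm1 hβ (fun j => center κ (lam j)) ((hph'.smul hQ).smul (hph.comp_sum hm1)),
    vMul_fiberOp hm1 (essBdd_mode hL hS p), vMul_vMul ((essBdd_mode hL hS p).comp_sum hm1)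
      (((hph'.smul hQ).smul (hph.comp_sum hm1)).comp_quasi
        (quasiMeasurePreserving_rescale_pi hβ fun j => center κ (lam j)))]
  congr 3
  refine congrArg (vMul volume) (funext fun k => ?_)
  simp only [envelopeKernel, smul_eq_mul]
  congr 1
  ring

/-- The sum is reorganized by strings instead of output components, in order to match
`fieldVF_waveOp` term by term. -/
theorem waveOp_envelopeVF (hL : LinearCondition L ω g) (hM : ∀ m ∈ M, 2 ≤ m)
    (hS : SpectrumCondition L ω g M n κ) {β : ℝ} (hβ : 0 < β) (μ ν : ℕ) (ϱ t : ℝ)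
    (x : Envelopes d N) :
    waveOp g n κ β (envelopeVF ω g M χ n κ μ ν β ϱ t x) =
      ∑ m ∈ M, ∑ lam : Fin m → Fin N × ℤˣ, (convFactor d m : ℂ) • fiberOp d m (Field2J J)
        (vMul volume (fun k => ∑ p with lam ∈ resonantStrings ω n κ p.1 p.2 m,
          envelopeKernel ω g χ n κ μ ν β p lam (t / ϱ) k) (stringTens κ β lam x)) := by
  have h1 : waveOp g n κ β (envelopeVF ω g M χ n κ μ ν β ϱ t x) =
      ∑ p, ∑ m ∈ M, ∑ lam ∈ resonantStrings ω n κ p.1 p.2 m,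
        (convFactor d m : ℂ) • fiberOp d m (Field2J J)
        (vMul volume (envelopeKernel ω g χ n κ μ ν β p lam (t / ϱ)) (stringTens κ β lam x)) := by
    rw [waveOp_apply]
    refine Finset.sum_congr rfl fun p _ => ?_
    have h2 : envelopeVF ω g M χ n κ μ ν β ϱ t x p = vMul volume (fun η =>
      Complex.exp (Complex.I * ((t / ϱ * envelopeSymbol ω n κ μ β p.1 p.2 η : ℝ) : ℂ)))
      (∑ m ∈ M, ∑ lam ∈ resonantStrings ω n κ p.1 p.2 m,
        envelopeTerm g χ n κ ν β p lam (phaseOp ω n κ μ β (-(t / ϱ)) x)) := rfl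
    rw [h2]
    simp only [map_sum]
    refine Finset.sum_congr rfl fun m hm => Finset.sum_congr rfl fun lam hlam => ?_
    exact vMul_mode_envelopeTerm hL hM hS hβ μ ν (t / ϱ) p hm hlam x
  rw [h1, Finset.sum_comm]
  refine Finset.sum_congr rfl fun m hm => ?_
  have h3 : ∀ p : Fin N × ℤˣ, ∀ f : (Fin m → Fin N × ℤˣ) → LOne d (Field2J J),
      ∑ lam ∈ resonantStrings ω n κ p.1 p.2 m, f lam =
        ∑ lam, if lam ∈ resonantStrings ω n κ p.1 p.2 m then f lam else 0 := fun p f => by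
    rw [← Finset.sum_filter, Finset.filter_mem_eq_inter, Finset.univ_inter]
  simp_rw [h3]
  rw [Finset.sum_comm]
  refine Finset.sum_congr rfl fun lam _ => ?_
  rw [← Finset.sum_filter, vMul_sum fun p _ => essBdd_envelopeKernel hL hM hS hβ μ ν p hm lam _,
    map_sum, Finset.smul_sum]

end WaveOp

/-! ### First- and second-order bounds for contractive one-parameter groups. -/

section Oscillatory

variable {V : Type*} [NormedAddCommGroup V] [InnerProductSpace ℂ V] [CompleteSpace V]

theorem norm_expI_le {A : V →L[ℂ] V} (hA : IsSelfAdjoint A) (t : ℝ) : ‖expI A t‖ ≤ 1 :=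
  ContinuousLinearMap.opNorm_le_bound _ zero_le_one fun w => by rw [norm_expI_apply hA, one_mul]

end Oscillatory

section Exponential

variable {𝔸 : Type*} [NormedRing 𝔸] [NormedAlgebra ℝ 𝔸] {e : ℝ → 𝔸} {a : 𝔸}

theorem norm_sub_le_of_hasDerivAt_mul (he : ∀ t, HasDerivAt e (a * e t) t) (he1 : ∀ t, ‖e t‖ ≤ 1)
    (s t : ℝ) : ‖e s - e t‖ ≤ ‖a‖ * |s - t| := by
  refine (convex_univ (𝕜 := ℝ)).norm_image_sub_le_of_norm_hasDerivWithin_le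
    (fun x _ => (he x).hasDerivWithinAt) (fun x _ => ?_) (mem_univ t) (mem_univ s)
  exact (norm_mul_le _ _).trans (mul_le_of_le_one_right (norm_nonneg _) (he1 x))

/-- The mean value inequality is used for $e(x)-(x-t)\,a\,e(t)$, whose derivative $a(e(x)-e(t))$ is
controlled by the first-order bound. -/
theorem norm_remainder_le_of_hasDerivAt_mul (he : ∀ t, HasDerivAt e (a * e t) t)
    (he1 : ∀ t, ‖e t‖ ≤ 1) (s t : ℝ) :
    ‖e s - e t - (s - t) • (a * e t)‖ ≤ ‖a‖ ^ 2 * |s - t| ^ 2 := by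
  have h := (convex_uIcc t s).norm_image_sub_le_of_norm_hasDerivWithin_le
    (f := fun x => e x - (x - t) • (a * e t)) (f' := fun x => a * e x - a * e t)
    (C := ‖a‖ ^ 2 * |s - t|) (fun x _ => ?_) (fun x hx => ?_) left_mem_uIcc right_mem_uIcc
  · rw [sub_self, zero_smul, sub_zero, Real.norm_eq_abs] at h
    rw [pow_two |s - t|, ← mul_assoc]
    refine le_trans (le_of_eq ?_) h
    congr 1
    abel
  · refine HasDerivAt.hasDerivWithinAt ((he x).sub ?_)
    simpa using ((hasDerivAt_id x).sub_const t).smul_const (a * e t)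
  · rw [← mul_sub]
    refine (norm_mul_le _ _).trans ?_
    rw [pow_two, mul_assoc]
    refine mul_le_mul_of_nonneg_left ((norm_sub_le_of_hasDerivAt_mul he he1 x t).trans ?_)
      (norm_nonneg _)
    exact mul_le_mul_of_nonneg_left (abs_sub_left_of_mem_uIcc hx) (norm_nonneg _)

end Exponential

section Oscillatory

variable {V : Type*} [NormedAddCommGroup V] [InnerProductSpace ℂ V] [CompleteSpace V]

theorem norm_I_smul (A : V →L[ℂ] V) : ‖Complex.I • A‖ = ‖A‖ := by
  rw [norm_smul, Complex.norm_I, one_mul]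

theorem norm_expI_sub_le {A : V →L[ℂ] V} (hA : IsSelfAdjoint A) (s t : ℝ) :
    ‖expI A s - expI A t‖ ≤ ‖A‖ * |s - t| := by
  have := norm_sub_le_of_hasDerivAt_mul (fun t => hasDerivAt_expI (A := A) t) (norm_expI_le hA) s t
  rwa [norm_I_smul] at this

theorem norm_expI_remainder_le {A : V →L[ℂ] V} (hA : IsSelfAdjoint A) (s t : ℝ) :
    ‖expI A s - expI A t - ((s - t : ℝ) : ℂ) • ((Complex.I • A) * expI A t)‖ ≤
      ‖A‖ ^ 2 * |s - t| ^ 2 := by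
  have := norm_remainder_le_of_hasDerivAt_mul (fun t => hasDerivAt_expI (A := A) t)
    (norm_expI_le hA) s t
  rw [norm_I_smul] at this
  rwa [Complex.coe_smul]

end Oscillatory

/-! ### Gain of a factor $\varrho$ by integration by parts in time. -/

section IntegrationByParts

section Abstract

variable {X Y : Type*} [NormedAddCommGroup X] [NormedSpace ℂ X] [NormedAddCommGroup Y]
  [NormedSpace ℂ Y] [CompleteSpace Y]

/-- Integration by parts in an oscillatory integral. -/
theorem norm_integral_clm_apply_le {Φ K : ℝ → X →L[ℂ] Y} {C : ℝ} (hC0 : 0 ≤ C)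
    (hΦ : ∀ τ, HasDerivAt Φ (K τ) τ) (hΦn : ∀ τ f, ‖Φ τ f‖ ≤ C * ‖f‖) (hKc : Continuous K)
    {r r' T ϱ : ℝ} (hϱ : 0 < ϱ) {y y' : ℝ → X}
    (hy : ∀ t, HasDerivAt y (y' t) t) (hy' : Continuous y') (hyr : ∀ t ∈ Icc 0 T, ‖y t‖ ≤ r)
    (hyr' : ∀ t ∈ Icc 0 T, ‖y' t‖ ≤ r') {t : ℝ} (ht : t ∈ Icc 0 T) :
    ‖∫ s in (0 : ℝ)..t, K (s / ϱ) (y s)‖ ≤ ϱ * (C * (2 * r + T * r')) := by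
  have hΦc : Continuous Φ := continuous_iff_continuousAt.2 fun τ => (hΦ τ).continuousAt
  have hyc : Continuous y := continuous_iff_continuousAt.2 fun t => (hy t).continuousAt
  -- The fast time $s/\varrho$ puts $\varrho^{-1}$ in front of the oscillating term, so its integral
  -- is $\varrho$ times boundary values and an integral of the slow derivative.
  have hG : ∀ s, HasDerivAt (fun s => Φ (s / ϱ) (y s))
      (ϱ⁻¹ • K (s / ϱ) (y s) + Φ (s / ϱ) (y' s)) s := by
    intro s
    have h1 : HasDerivAt (fun s => Φ (s / ϱ)) (ϱ⁻¹ • K (s / ϱ)) s := by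
      have h2 : HasDerivAt (fun s : ℝ => s / ϱ) ϱ⁻¹ s := by
        simpa using (hasDerivAt_id s).div_const ϱ
      exact (hΦ (s / ϱ)).scomp s h2
    exact ((ContinuousLinearMap.restrictScalarsL ℂ (X) (Y) ℝ
      ℝ).hasFDerivAt.comp_hasDerivAt s h1).clm_apply (hy s)
  have hKi : Continuous fun s => K (s / ϱ) (y s) :=
    (hKc.comp (continuous_id.div_const ϱ)).clm_apply hyc
  have hΦi : Continuous fun s => Φ (s / ϱ) (y' s) :=
    (hΦc.comp (continuous_id.div_const ϱ)).clm_apply hy'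
  have hKi' : Continuous fun s => ϱ⁻¹ • K (s / ϱ) (y s) := hKi.const_smul _
  have hFTC := intervalIntegral.integral_eq_sub_of_hasDerivAt (a := 0) (b := t)
    (fun s _ => hG s) ((hKi'.add hΦi).intervalIntegrable _ _)
  rw [intervalIntegral.integral_add (hKi'.intervalIntegrable _ _)
    (hΦi.intervalIntegrable _ _), intervalIntegral.integral_smul] at hFTC
  have h0 : (0 : ℝ) ∈ Icc 0 T := ⟨le_rfl, ht.1.trans ht.2⟩
  have hr' : 0 ≤ r' := (norm_nonneg _).trans (hyr' 0 h0)
  have h5 : ‖∫ s in (0 : ℝ)..t, Φ (s / ϱ) (y' s)‖ ≤ C * r' * T := by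
    refine (intervalIntegral.norm_integral_le_of_norm_le_const (C := C * r')
      fun s hs => ?_).trans ?_
    · rw [uIoc_of_le ht.1] at hs
      exact (hΦn _ _).trans (mul_le_mul_of_nonneg_left (hyr' s ⟨hs.1.le, hs.2.trans ht.2⟩) hC0)
    · rw [sub_zero, abs_of_nonneg ht.1]
      exact mul_le_mul_of_nonneg_left ht.2 (by positivity)
  have h6 : ‖ϱ⁻¹ • ∫ s in (0 : ℝ)..t, K (s / ϱ) (y s)‖ ≤ C * (2 * r + T * r') := by
    rw [eq_sub_of_add_eq hFTC]
    refine (norm_sub_le _ _).trans ((add_le_add ((norm_sub_le _ _).trans (add_le_add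
      ((hΦn _ _).trans (mul_le_mul_of_nonneg_left (hyr t ht) hC0))
      ((hΦn _ _).trans (mul_le_mul_of_nonneg_left (hyr 0 h0) hC0)))) h5).trans (le_of_eq ?_))
    ring
  rw [norm_smul, norm_inv, Real.norm_of_nonneg hϱ.le, inv_mul_le_iff₀ hϱ] at h6
  exact h6

end Abstract

variable {α F : Type*} [MeasurableSpace α] {μ : Measure α} [NormedAddCommGroup F] [NormedSpace ℂ F]
  [CompleteSpace F]

/-- The quadratic remainder makes the antiderivative differentiable in operator norm, and the
Lipschitz condition makes its derivative continuous. The constants $C_1$, $C_2$ serve only this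
purpose and do not enter the estimate. -/
theorem norm_integral_vMul_le {φ ψ : ℝ → α → F} (hφ : ∀ τ, EssBdd (φ τ) μ)
    (hψ : ∀ τ, EssBdd (ψ τ) μ) {C C₁ C₂ : ℝ} (hC0 : 0 ≤ C) (hC₁ : 0 ≤ C₁) (hC₂ : 0 ≤ C₂)
    (hC : ∀ τ, ∀ᵐ x ∂μ, ‖φ τ x‖ ≤ C)
    (hφ' : ∀ t s, ∀ᵐ x ∂μ, ‖φ s x - φ t x - ((s - t : ℝ) : ℂ) • ψ t x‖ ≤ C₁ * |s - t| ^ 2)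
    (hψ' : ∀ t s, ∀ᵐ x ∂μ, ‖ψ s x - ψ t x‖ ≤ C₂ * |s - t|)
    {r r' T ϱ : ℝ} (hϱ : 0 < ϱ) {y y' : ℝ → Lp ℂ 1 μ}
    (hy : ∀ t, HasDerivAt y (y' t) t) (hy' : Continuous y') (hyr : ∀ t ∈ Icc 0 T, ‖y t‖ ≤ r)
    (hyr' : ∀ t ∈ Icc 0 T, ‖y' t‖ ≤ r') {t : ℝ} (ht : t ∈ Icc 0 T) :
    ‖∫ s in (0 : ℝ)..t, vMul μ (ψ (s / ϱ)) (y s)‖ ≤ ϱ * (C * (2 * r + T * r')) := by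
  set Φ : ℝ → Lp ℂ 1 μ →L[ℂ] Lp F 1 μ := fun τ => vMul μ (φ τ) with hΦdef
  set K : ℝ → Lp ℂ 1 μ →L[ℂ] Lp F 1 μ := fun τ => vMul μ (ψ τ) with hKdef
  have hΦ : ∀ τ, HasDerivAt Φ (K τ) τ := hasDerivAt_vMul hφ hψ hC₁ fun t s => by
    filter_upwards [hφ' t s] with x hx
    rwa [← Complex.coe_smul]
  have hΦn : ∀ τ f, ‖Φ τ f‖ ≤ C * ‖f‖ := fun τ f => norm_vMul_apply_le hC0 (hC τ) f
  have hKn : ∀ s t, ‖K s - K t‖ ≤ C₂ * |s - t| := fun s t => by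
    have h1 : K s - K t = vMul μ fun x => ψ s x - ψ t x := by
      refine ContinuousLinearMap.ext fun f => ?_
      rw [vMul_sub (hψ s) (hψ t)]
      rfl
    rw [h1]
    exact norm_vMul_le (by positivity) (hψ' t s)
  have hKc : Continuous K := by
    refine continuous_iff_continuousAt.2 fun t => ?_
    rw [ContinuousAt, tendsto_iff_norm_sub_tendsto_zero]
    have h2 : Continuous fun s : ℝ => C₂ * |s - t| := by fun_prop
    exact squeeze_zero (fun _ => norm_nonneg _) (fun s => hKn s t) (by simpa using h2.tendsto t)
  exact norm_integral_clm_apply_le hC0 hΦ hΦn hKc hϱ hy hy' hyr hyr' ht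

end IntegrationByParts

/-! ### Nonresonant oscillatory integrals. -/

section Oscillatory

variable {V : Type*} [NormedAddCommGroup V] [InnerProductSpace ℂ V] [CompleteSpace V]
  {α : Type*} [MeasurableSpace α] {μ : Measure α} {A B P : α → V →L[ℂ] V} {w : α → V}

theorem essBdd_expI_apply (hA : AEStronglyMeasurable A μ) (hA' : ∀ᵐ x ∂μ, IsSelfAdjoint (A x))
    (hw : EssBdd w μ) (τ : ℝ) : EssBdd (fun x => expI (A x) τ (w x)) μ := by
  refine EssBdd.clm_apply ⟨(continuous_expI_operator τ).comp_aestronglyMeasurable hA, 1, ?_⟩ hw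
  filter_upwards [hA'] with x hx
  exact norm_expI_le hx τ

theorem EssBdd.mul {R : Type*} [NormedRing R] {f g : α → R} (hf : EssBdd f μ) (hg : EssBdd g μ) :
    EssBdd (fun x => f x * g x) μ := by
  refine ⟨continuous_mul.comp_aestronglyMeasurable (hf.1.prodMk hg.1), ?_⟩
  obtain ⟨C₁, hC₁⟩ := hf.2
  obtain ⟨C₂, hC₂⟩ := hg.2
  refine ⟨C₁ * C₂, ?_⟩
  filter_upwards [hC₁, hC₂] with x a b
  exact (norm_mul_le _ _).trans (mul_le_mul a b (norm_nonneg _) ((norm_nonneg _).trans a))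

/-- Nonresonant oscillatory integrals are small: `P` is the projection onto the kernel of `A` and
`B` inverts `A + P`. -/
theorem norm_integral_oscillatory_le (hA : EssBdd A μ) (hA' : ∀ᵐ x ∂μ, IsSelfAdjoint (A x))
    (hB : EssBdd B μ) (hP : EssBdd P μ) (hw : EssBdd w μ)
    (hPA : ∀ᵐ x ∂μ, w x ≠ 0 → P x * P x = P x ∧ P x * A x = A x * P x ∧ B x * (A x + P x) = 1)
    {C r r' T ϱ : ℝ} (hϱ : 0 < ϱ) (hC0 : 0 ≤ C)
    (hC : ∀ᵐ x ∂μ, ‖B x‖ * ‖1 - P x‖ * ‖w x‖ ≤ C) {y y' : ℝ → Lp ℂ 1 μ}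
    (hy : ∀ t, HasDerivAt y (y' t) t) (hy' : Continuous y') (hyr : ∀ t ∈ Icc 0 T, ‖y t‖ ≤ r)
    (hyr' : ∀ t ∈ Icc 0 T, ‖y' t‖ ≤ r') {t : ℝ} (ht : t ∈ Icc 0 T) :
    ‖∫ s in (0 : ℝ)..t, vMul μ (fun x => (1 - P x) (expI (A x) (s / ϱ) (w x))) (y s)‖ ≤
      ϱ * (C * (2 * r + T * r')) := by
  have he := essBdd_expI_apply hA.1 hA' hw
  have h1P : EssBdd (fun x => 1 - P x) μ := (essBdd_const (1 : V →L[ℂ] V)).sub hP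
  obtain ⟨CA, hCA⟩ := hA.2
  obtain ⟨CP, hCP⟩ := h1P.2
  obtain ⟨Cw, hCw⟩ := hw.2
  -- The antiderivative of $(1-P)e^{i\tau A}w$ in $\tau$ is $-iB(1-P)e^{i\tau A}w$, because
  -- $B(1-P)A=1-P$.
  have key := norm_integral_vMul_le (μ := μ)
    (φ := fun τ x => (-Complex.I) • (B x * (1 - P x)) (expI (A x) τ (w x)))
    (ψ := fun τ x => (1 - P x) (expI (A x) τ (w x))) (C := C) (C₁ := C * |CA| ^ 2)
    (C₂ := |CP| * (|CA| * |Cw|))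
    (fun τ => ((hB.mul h1P).clm_apply (he τ)).const_smul _) (fun τ => h1P.clm_apply (he τ))
    hC0 (by positivity) (by positivity) (fun τ => ?_) (fun t s => ?_) (fun t s => ?_) hϱ hy hy'
    hyr hyr' ht
  · exact key
  · filter_upwards [hC, hA'] with x a b
    rw [norm_smul, norm_neg, Complex.norm_I, one_mul]
    refine (ContinuousLinearMap.le_opNorm _ _).trans ?_
    rw [norm_expI_apply b]
    exact (mul_le_mul_of_nonneg_right (norm_mul_le _ _) (norm_nonneg _)).trans a
  · filter_upwards [hC, hA', hCA, hPA] with x a b c e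
    have h3 : (1 - P x) (expI (A x) t (w x)) = (-Complex.I) • (B x * (1 - P x))
        (((Complex.I • A x) * expI (A x) t) (w x)) := by
      by_cases hx : w x = 0
      · simp [hx]
      · obtain ⟨e1, e2, e3⟩ := e hx
        -- Since $P$ is idempotent and commutes with $A$, $(1-P)A=(A+P)(1-P)$, and $B$ inverts
        -- $A+P$.
        have h2 : B x * (1 - P x) * A x = 1 - P x := by
          calc B x * (1 - P x) * A x = B x * (A x + P x) * (1 - P x) := by
                rw [mul_assoc, mul_assoc]
                congr 1
                rw [sub_mul, add_mul, mul_sub, mul_sub, e1, e2]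
                simp
            _ = 1 - P x := by rw [e3, one_mul]
        rw [mul_apply_eq_comp (Complex.I • A x), smul_apply, map_smul, smul_smul, neg_mul,
          Complex.I_mul_I, neg_neg, one_smul, ← mul_apply_eq_comp (B x * (1 - P x)) (A x), h2]
    rw [h3, ← smul_sub, smul_comm, ← smul_sub, norm_smul, norm_neg, Complex.norm_I, one_mul,
      ← map_smul, ← map_sub, ← map_sub]
    have h4 := norm_expI_remainder_le b s t
    have h5 : expI (A x) s (w x) - expI (A x) t (w x) -
        ((s - t : ℝ) : ℂ) • ((Complex.I • A x) * expI (A x) t) (w x) =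
        (expI (A x) s - expI (A x) t - ((s - t : ℝ) : ℂ) • ((Complex.I • A x) * expI (A x) t))
          (w x) := rfl
    rw [h5]
    have h9 : ‖A x‖ ^ 2 ≤ |CA| ^ 2 := by gcongr; exact c.trans (le_abs_self _)
    calc _ ≤ ‖B x‖ * ‖1 - P x‖ * ((|CA| ^ 2 * |s - t| ^ 2) * ‖w x‖) := by
          refine (ContinuousLinearMap.le_opNorm _ _).trans (mul_le_mul (norm_mul_le _ _)
            ((ContinuousLinearMap.le_opNorm _ _).trans ?_) (norm_nonneg _) (by positivity))
          gcongr
          exact h4.trans (by gcongr)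
      _ = ‖B x‖ * ‖1 - P x‖ * ‖w x‖ * (|CA| ^ 2 * |s - t| ^ 2) := by ring
      _ ≤ C * (|CA| ^ 2 * |s - t| ^ 2) := by gcongr
      _ = _ := by ring
  · filter_upwards [hA', hCA, hCP, hCw] with x a b c e
    rw [← map_sub]
    calc _ ≤ |CP| * (|CA| * |s - t| * |Cw|) := by
          refine (ContinuousLinearMap.le_opNorm _ _).trans (mul_le_mul (c.trans (le_abs_self _))
            ?_ (norm_nonneg _) (abs_nonneg _))
          refine (ContinuousLinearMap.le_opNorm (expI (A x) s - expI (A x) t) (w x)).trans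
            (mul_le_mul ((norm_expI_sub_le a s t).trans ?_) (e.trans (le_abs_self _))
              (norm_nonneg _) (by positivity))
          gcongr
          exact b.trans (le_abs_self _)
      _ = _ := by ring

end Oscillatory

/-! ### Subtraction of a scalar frequency in the unitary group. -/

section ExponentialShift

variable {V : Type*} [NormedAddCommGroup V] [InnerProductSpace ℂ V] [CompleteSpace V]

theorem expI_sub_smul (A : V →L[ℂ] V) (s τ : ℝ) :
    expI (A - (s : ℂ) • (1 : V →L[ℂ] V)) τ =
      Complex.exp (Complex.I * ((-(τ * s) : ℝ) : ℂ)) • expI A τ := by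
  have h1 : (Complex.I * (τ : ℂ)) • (A - (s : ℂ) • (1 : V →L[ℂ] V)) =
      (algebraMap ℂ (V →L[ℂ] V) (Complex.I * ((-(τ * s) : ℝ) : ℂ))) + (Complex.I * (τ : ℂ)) • A := by
    rw [Algebra.algebraMap_eq_smul_one, smul_sub, smul_smul, sub_eq_neg_add, ← neg_smul]
    congr 2
    push_cast
    ring
  have h2 : NormedSpace.exp (algebraMap ℂ (V →L[ℂ] V) (Complex.I * ((-(τ * s) : ℝ) : ℂ))) =
      Complex.exp (Complex.I * ((-(τ * s) : ℝ) : ℂ)) • (1 : V →L[ℂ] V) := by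
    rw [← NormedSpace.algebraMap_exp_comm (𝕂 := ℂ), Algebra.algebraMap_eq_smul_one,
      Complex.exp_eq_exp_ℂ]
  rw [expI, expI, h1, NormedSpace.exp_add_of_commute_of_mem_ball (𝕂 := ℂ), h2, smul_mul_assoc,
    one_mul]
  · exact Algebra.commutes _ _
  · rw [NormedSpace.expSeries_radius_eq_top]; simp
  · rw [NormedSpace.expSeries_radius_eq_top]; simp

theorem isSelfAdjoint_sub_smul {A : V →L[ℂ] V} (hA : IsSelfAdjoint A) (s : ℝ) :
    IsSelfAdjoint (A - (s : ℂ) • (1 : V →L[ℂ] V)) := by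
  rw [IsSelfAdjoint, star_sub, hA.star_eq, star_smul, star_one, Complex.star_def,
    Complex.conj_ofReal]

end ExponentialShift

/-! ### Detuning operators and resonance of strings. -/

section StringOperators

variable {d J N : ℕ} {L : Wavevec d → (Field2J J →L[ℂ] Field2J J)}
  {ω : Fin J → ℤˣ → Wavevec d → ℝ} {g : Fin J → ℤˣ → Wavevec d → Field2J J} {M : Finset ℕ}
  {χ : (m : ℕ) → Wavevec d → (Fin m → Wavevec d) →
      ContinuousMultilinearMap ℂ (fun _ : Fin m => Field2J J) (Field2J J)}
  {n : Fin N → Fin J} {κ : Fin N → Wavevec d} {m : ℕ} {lam : Fin m → Fin N × ℤˣ}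

/-- The centre of a string. -/
def stringCenter (κ : Fin N → Wavevec d) (lam : Fin m → Fin N × ℤˣ) : Fin m → Wavevec d :=
  fun j => center κ (lam j)

/-- The total frequency of a string. -/
def stringFreq (ω : Fin J → ℤˣ → Wavevec d → ℝ) (n : Fin N → Fin J) (lam : Fin m → Fin N × ℤˣ)
    (k : Fin m → Wavevec d) : ℝ := ∑ j, freq ω n (lam j) (k j)

/-- The detuning operator of a string. -/
def stringOp (L : Wavevec d → (Field2J J →L[ℂ] Field2J J)) (ω : Fin J → ℤˣ → Wavevec d → ℝ)
    (n : Fin N → Fin J) (lam : Fin m → Fin N × ℤˣ) (k : Fin m → Wavevec d) :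
    Field2J J →L[ℂ] Field2J J :=
  L (∑ j, k j) - (stringFreq ω n lam k : ℂ) • (1 : Field2J J →L[ℂ] Field2J J)

/-- The output of a string of modes. -/
def stringSource (g : Fin J → ℤˣ → Wavevec d → Field2J J)
    (χ : (m : ℕ) → Wavevec d → (Fin m → Wavevec d) →
      ContinuousMultilinearMap ℂ (fun _ : Fin m => Field2J J) (Field2J J))
    (n : Fin N → Fin J) (lam : Fin m → Fin N × ℤˣ) (k : Fin m → Wavevec d) : Field2J J :=
  χ m (∑ j, k j) k fun j => mode g n (lam j) (k j)

open Classical in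
/-- The projection onto the components in resonance with a string. -/
def resonantProj (ω : Fin J → ℤˣ → Wavevec d → ℝ) (g : Fin J → ℤˣ → Wavevec d → Field2J J)
    (n : Fin N → Fin J) (κ : Fin N → Wavevec d) (lam : Fin m → Fin N × ℤˣ)
    (k : Fin m → Wavevec d) : Field2J J →L[ℂ] Field2J J :=
  ∑ p with lam ∈ resonantStrings ω n κ p.1 p.2 m, lineProj (mode g n p (∑ j, k j))

theorem isSelfAdjoint_stringOp (hL : LinearCondition L ω g) (k : Fin m → Wavevec d) :
    IsSelfAdjoint (stringOp L ω n lam k) :=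
  isSelfAdjoint_sub_smul (hL.hermitian _) _

/-- The inner propagators act on eigenvectors, hence as phases. Multilinearity collects these into
$e^{-i\tau\sum_j\omega(k_j)}$, which shifts the generator of the outer propagator. -/
theorem fieldKernel_eq_expI (hL : LinearCondition L ω g) (τ : ℝ) {k : Fin m → Wavevec d}
    (hk : ∀ j, k j ∉ bandCrossing L ω) :
    fieldKernel L g χ n lam τ k = expI (stringOp L ω n lam k) τ (stringSource g χ n lam k) := by
  have h1 : ∀ j, propagator L (-τ) (k j) (mode g n (lam j) (k j)) =
      Complex.exp (Complex.I * ((-τ * freq ω n (lam j) (k j) : ℝ) : ℂ)) •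
        mode g n (lam j) (k j) := fun j =>
    expI_eigenvector (hL.eigen (k j) (hk j) _ _)
  rw [fieldKernel]
  simp_rw [h1]
  rw [ContinuousMultilinearMap.map_smul_univ, map_smul, stringOp, expI_sub_smul, smul_apply,
    propagator_eq_expI, ← Complex.exp_sum, stringSource]
  congr 2
  rw [← Finset.mul_sum, ← Complex.ofReal_sum, ← Finset.mul_sum, stringFreq, neg_mul]

theorem freq_center (hL : LinearCondition L ω g) (hS : SpectrumCondition L ω g M n κ)
    (p : Fin N × ℤˣ) : freq ω n p (center κ p) = sgn p.2 * ω (n p.1) 1 (κ p.1) := by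
  have h1 : center κ p ∉ bandCrossing L ω := hS.noncrossing p.1 p.2
  have h2 : sgn p.2 • sgn p.2 • κ p.1 = κ p.1 := by
    rcases Int.units_eq_one_or p.2 with h | h <;> simp [h, sgn]
  have h3 : sgn p.2 • center κ p ∉ bandCrossing L ω := by
    rw [center, h2]
    simpa [sgn] using hS.noncrossing p.1 1
  rw [freq, omega_eq_sgn hL h1 _ _ h3, center, h2]

theorem mem_resonantStrings_iff (hL : LinearCondition L ω g) (hS : SpectrumCondition L ω g M n κ)
    (p : Fin N × ℤˣ) : lam ∈ resonantStrings ω n κ p.1 p.2 m ↔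
      ∑ j, stringCenter κ lam j = center κ p ∧
        stringFreq ω n lam (stringCenter κ lam) = freq ω n p (center κ p) := by
  rw [mem_resonantStrings, freq_center hL hS]
  simp only [stringFreq, stringCenter, freq_center hL hS]
  rfl

/-- Two components in resonance with one string share the centre and the frequency. Simplicity of
the spectrum identifies band and sign, and distinctness of the pairs identifies the index. Thus
`resonantProj` is a projection onto a line, or zero. -/
theorem eq_of_mem_resonantStrings (hL : LinearCondition L ω g)
    (hS : SpectrumCondition L ω g M n κ) {p q : Fin N × ℤˣ}
    (hp : lam ∈ resonantStrings ω n κ p.1 p.2 m) (hq : lam ∈ resonantStrings ω n κ q.1 q.2 m) :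
    p = q := by
  obtain ⟨h1, h2⟩ := (mem_resonantStrings_iff hL hS p).1 hp
  obtain ⟨h3, h4⟩ := (mem_resonantStrings_iff hL hS q).1 hq
  have h5 : center κ p = center κ q := h1.symm.trans h3
  have h6 : freq ω n p (center κ p) = freq ω n q (center κ p) := by
    rw [h2.symm.trans h4, h5]
  obtain ⟨h7, h8⟩ := omega_injective hL (hS.noncrossing p.1 p.2) h6
  have h9 : κ p.1 = κ q.1 := by
    have h10 := congrArg (sgn p.2 • ·) h5
    simp only [center, h8] at h10
    rcases Int.units_eq_one_or q.2 with h | h <;> simpa [h, sgn] using h10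
  exact Prod.ext (hS.distinct (Prod.ext h7 h9)) h8

theorem resonantProj_eq (hL : LinearCondition L ω g) (hS : SpectrumCondition L ω g M n κ)
    {p : Fin N × ℤˣ} (hp : lam ∈ resonantStrings ω n κ p.1 p.2 m) (k : Fin m → Wavevec d) :
    resonantProj ω g n κ lam k = lineProj (mode g n p (∑ j, k j)) := by
  rw [resonantProj, Finset.sum_eq_single_of_mem p (by simpa using hp)]
  intro q hq hqp
  exact absurd (eq_of_mem_resonantStrings hL hS (by simpa using hq) hp) hqp

theorem resonantProj_eq_zero (h : ∀ p : Fin N × ℤˣ, lam ∉ resonantStrings ω n κ p.1 p.2 m)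
    (k : Fin m → Wavevec d) : resonantProj ω g n κ lam k = 0 := by
  rw [resonantProj, Finset.filter_false_of_mem fun p _ => h p, Finset.sum_empty]

/-- Resonance invariance enters here: an eigenvalue of $L$ at the output centre that equals the
total frequency of the string comes from an element of the spectrum, so the string is resonant with
it. Hence `resonantProj` covers the whole null space of the detuning operator. -/
theorem isUnit_stringOp_center (hL : LinearCondition L ω g) (hS : SpectrumCondition L ω g M n κ)
    (hm : m ∈ M) : IsUnit (stringOp L ω n lam (stringCenter κ lam) +
      resonantProj ω g n κ lam (stringCenter κ lam)) := by
  have hk : ∑ j, stringCenter κ lam j ∉ bandCrossing L ω := hS.output_noncrossing m hm lam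
  refine isUnit_symbol_sub hL hk ?_
  by_cases h : ∃ p : Fin N × ℤˣ, lam ∈ resonantStrings ω n κ p.1 p.2 m
  · obtain ⟨p, hp⟩ := h
    obtain ⟨h1, h2⟩ := (mem_resonantStrings_iff hL hS p).1 hp
    exact Or.inr ⟨n p.1, p.2, by rw [h2, h1]; rfl, resonantProj_eq hL hS hp _⟩
  · push Not at h
    refine Or.inl ⟨fun a ζ hω => ?_, resonantProj_eq_zero h _⟩
    -- The reflected output is the output of the string with all signs multiplied by `ζ`, hence not
    -- a crossing point either.
    have hk' : sgn ζ • ∑ j, stringCenter κ lam j ∉ bandCrossing L ω := by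
      have h1 := hS.output_noncrossing m hm fun j => ((lam j).1, ζ * (lam j).2)
      have h2 : ∑ j, sgn (ζ * (lam j).2) • κ (lam j).1 =
          sgn ζ • ∑ j, stringCenter κ lam j := by
        rw [Finset.smul_sum]
        refine Finset.sum_congr rfl fun j _ => ?_
        simp [stringCenter, center, sgn, smul_smul]
      rwa [← h2]
    rw [omega_eq_sgn hL hk a ζ hk'] at hω
    have hs : stringFreq ω n lam (stringCenter κ lam) =
        ∑ j, sgn (lam j).2 * ω (n (lam j).1) 1 (κ (lam j).1) :=
      Finset.sum_congr rfl fun j _ => freq_center hL hS (lam j)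
    obtain ⟨l, hl, hκ⟩ := hS.resonance m hm ζ a lam (by
      rw [← hs, ← hω]
      exact neg_add_cancel _)
    refine h (l, ζ) (mem_resonantStrings.2 ⟨?_, ?_⟩)
    · rw [hκ, smul_smul]
      rcases Int.units_eq_one_or ζ with h | h <;> simp [h, sgn]
    · rw [← hs, ← hω, hl, hκ]
      rfl

theorem lineProj_mul_self {v : Field2J J} (hv : ‖v‖ = 1) :
    lineProj v * lineProj v = lineProj v := by
  ext1 w
  have h : inner ℂ v v = (1 : ℂ) := by rw [inner_self_eq_norm_sq_to_K, hv]; simp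
  rw [mul_apply_eq_comp, lineProj_apply, lineProj_apply, inner_smul_right, h, mul_one]

theorem lineProj_commute {A : Field2J J →L[ℂ] Field2J J} (hA : IsSelfAdjoint A) {c : ℝ}
    {v : Field2J J} (hv : A v = (c : ℂ) • v) : lineProj v * A = A * lineProj v := by
  ext1 w
  rw [mul_apply_eq_comp, mul_apply_eq_comp, lineProj_apply, lineProj_apply, map_smul, hv,
    ← ContinuousLinearMap.adjoint_inner_left, ← ContinuousLinearMap.star_eq_adjoint, hA.star_eq,
    hv, inner_smul_left, Complex.conj_ofReal, smul_smul, mul_comm (c : ℂ)]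

theorem resonantProj_stringOp (hL : LinearCondition L ω g) (hS : SpectrumCondition L ω g M n κ)
    {k : Fin m → Wavevec d} (hk : ∑ j, k j ∉ bandCrossing L ω) :
    resonantProj ω g n κ lam k * resonantProj ω g n κ lam k = resonantProj ω g n κ lam k ∧
      resonantProj ω g n κ lam k * stringOp L ω n lam k =
        stringOp L ω n lam k * resonantProj ω g n κ lam k := by
  by_cases h : ∃ p : Fin N × ℤˣ, lam ∈ resonantStrings ω n κ p.1 p.2 m
  · obtain ⟨p, hp⟩ := h
    rw [resonantProj_eq hL hS hp]
    refine ⟨lineProj_mul_self (hL.unit _ hk _ _), lineProj_commute (isSelfAdjoint_stringOp hL k)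
      (c := freq ω n p (∑ j, k j) - stringFreq ω n lam k) ?_⟩
    rw [stringOp, sub_apply, mode, hL.eigen _ hk, smul_apply, one_apply_eq_self, ← sub_smul,
      ← Complex.ofReal_sub]
    rfl
  · push Not at h
    simp [resonantProj_eq_zero h]

/-- The mode at the output frequency is an eigenvector of the detuning operator, so projecting onto
it turns the unitary group into a scalar phase and the source into the scalar susceptibility. -/
theorem lineProj_fieldKernel (hL : LinearCondition L ω g) (p : Fin N × ℤˣ) (τ : ℝ)
    {k : Fin m → Wavevec d} (hk : ∀ j, k j ∉ bandCrossing L ω)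
    (hk' : ∑ j, k j ∉ bandCrossing L ω) :
    lineProj (mode g n p (∑ j, k j)) (fieldKernel L g χ n lam τ k) =
      (Complex.exp (Complex.I * ((τ * (freq ω n p (∑ j, k j) - stringFreq ω n lam k) : ℝ) : ℂ)) *
        scalarSusceptibility g χ n p.1 p.2 lam (∑ j, k j, k)) • mode g n p (∑ j, k j) := by
  have h : stringOp L ω n lam k (mode g n p (∑ j, k j)) =
      ((freq ω n p (∑ j, k j) - stringFreq ω n lam k : ℝ) : ℂ) • mode g n p (∑ j, k j) := by
    rw [stringOp, sub_apply, mode, hL.eigen _ hk', smul_apply, one_apply_eq_self, ← sub_smul,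
      ← Complex.ofReal_sub]
    rfl
  rw [lineProj_apply, fieldKernel_eq_expI hL τ hk,
    inner_expI_eigenvector (isSelfAdjoint_stringOp hL k) h]
  rfl

end StringOperators

/-! ### Local regularity and Taylor estimates near the centre of a string. -/

section LocalAnalysis

variable {d J N : ℕ} {L : Wavevec d → (Field2J J →L[ℂ] Field2J J)}
  {ω : Fin J → ℤˣ → Wavevec d → ℝ} {g : Fin J → ℤˣ → Wavevec d → Field2J J} {M : Finset ℕ}
  {χ : (m : ℕ) → Wavevec d → (Fin m → Wavevec d) →
      ContinuousMultilinearMap ℂ (fun _ : Fin m => Field2J J) (Field2J J)}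
  {n : Fin N → Fin J} {κ : Fin N → Wavevec d} {m : ℕ} {lam : Fin m → Fin N × ℤˣ}

theorem center_noncrossing (hS : SpectrumCondition L ω g M n κ) (p : Fin N × ℤˣ) :
    center κ p ∉ bandCrossing L ω := hS.noncrossing p.1 p.2

theorem eventually_continuousAt_mode (hS : SpectrumCondition L ω g M n κ) (p : Fin N × ℤˣ) :
    ∀ᶠ k in 𝓝 (center κ p), ContinuousAt (mode g n p) k := by
  have h : ContDiffAt ℝ 1 (mode g n p) (center κ p) :=
    (hS.eigenvector_smooth p.1 p.2).of_le (by exact_mod_cast le_top)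
  filter_upwards [h.eventually (by simp)] with k hk
  exact hk.continuousAt

theorem eventually_continuousAt_freq (hL : LinearCondition L ω g)
    (hS : SpectrumCondition L ω g M n κ) (p : Fin N × ℤˣ) :
    ∀ᶠ k in 𝓝 (center κ p), ContinuousAt (freq ω n p) k := by
  have h : ContDiffAt ℝ 1 (freq ω n p) (center κ p) :=
    (contDiffAt_omega hL (center_noncrossing hS p) (hS.eigenvector_smooth p.1 p.2)).of_le
      (by exact_mod_cast le_top)
  filter_upwards [h.eventually (by simp)] with k hk
  exact hk.continuousAt

theorem eventually_noncrossing_pi (hL : LinearCondition L ω g)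
    (hS : SpectrumCondition L ω g M n κ) (hm : m ∈ M) :
    ∀ᶠ k in 𝓝 (stringCenter κ lam), ∑ j, k j ∉ bandCrossing L ω ∧ ∀ j, k j ∉ bandCrossing L ω :=
  (isOpen_noncrossing_pi hL m).mem_nhds
    ⟨hS.output_noncrossing m hm lam, fun j => center_noncrossing hS (lam j)⟩

theorem eventually_continuousAt_stringSource (hL : LinearCondition L ω g)
    (hχ : NonlinearCondition (bandCrossing L ω) M χ) (hS : SpectrumCondition L ω g M n κ)
    (hm : m ∈ M) :
    ∀ᶠ k in 𝓝 (stringCenter κ lam), ContinuousAt (stringSource g χ n lam) k := by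
  have h1 : ∀ j, ∀ᶠ k in 𝓝 (stringCenter κ lam), ContinuousAt (mode g n (lam j)) (k j) := fun j =>
    (continuous_apply j).continuousAt.eventually (eventually_continuousAt_mode hS (lam j))
  filter_upwards [eventually_all.2 h1, eventually_noncrossing_pi hL hS hm] with k hk hk'
  have h2 : ContinuousAt (fun k : Fin m → Wavevec d => χ m (∑ j, k j) k) k := by
    have h3 : ContinuousOn (fun κ : Fin m → Wavevec d => χ m (∑ j, κ j) κ)
        {κ | ∑ j, κ j ∉ bandCrossing L ω ∧ ∀ j, κ j ∉ bandCrossing L ω} :=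
      (hχ.smooth m hm).continuousOn.comp
        (f := fun κ : Fin m → Wavevec d => (∑ j, κ j, κ)) (by fun_prop) fun κ hκ => hκ
    exact h3.continuousAt ((isOpen_noncrossing_pi hL m).mem_nhds hk')
  refine continuous_multilinear_eval.continuousAt.comp (h2.prodMk ?_)
  exact continuousAt_pi.2 fun j =>
    ContinuousAt.comp (f := fun k : Fin m → Wavevec d => k j) (hk j) (continuous_apply j).continuousAt

theorem eventually_continuousAt_stringOp (hL : LinearCondition L ω g)
    (hS : SpectrumCondition L ω g M n κ) (hm : m ∈ M) :
    ∀ᶠ k in 𝓝 (stringCenter κ lam), ContinuousAt (stringOp L ω n lam) k := by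
  have h1 : ∀ j, ∀ᶠ k in 𝓝 (stringCenter κ lam), ContinuousAt (freq ω n (lam j)) (k j) := fun j =>
    (continuous_apply j).continuousAt.eventually (eventually_continuousAt_freq hL hS (lam j))
  filter_upwards [eventually_all.2 h1, eventually_noncrossing_pi hL hS hm] with k hk hk'
  have h2 : ContinuousAt (fun k : Fin m → Wavevec d => L (∑ j, k j)) k :=
    ContinuousAt.comp (f := fun k : Fin m → Wavevec d => ∑ j, k j)
      (contDiffAt_symbol hL hk'.1).continuousAt (by fun_prop)
  have h3 : ContinuousAt (stringFreq ω n lam) k := by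
    unfold stringFreq
    exact tendsto_finsetSum _ fun j _ =>
      ContinuousAt.comp (f := fun k : Fin m → Wavevec d => k j) (hk j) (continuous_apply j).continuousAt
  exact h2.sub ((Complex.continuous_ofReal.continuousAt.comp h3).smul continuousAt_const)

theorem continuous_lineProj : Continuous (lineProj (J := J)) := by
  have h : Continuous fun v : Field2J J => innerSL ℂ v := (innerSL ℂ).continuous
  unfold lineProj
  exact (ContinuousLinearMap.smulRightL ℂ (Field2J J) (Field2J J)).continuous₂.comp
    (h.prodMk continuous_id)

theorem eventually_continuousAt_resonantProj (hL : LinearCondition L ω g)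
    (hS : SpectrumCondition L ω g M n κ) :
    ∀ᶠ k in 𝓝 (stringCenter κ lam), ContinuousAt (resonantProj ω g n κ lam) k := by
  by_cases h : ∃ p : Fin N × ℤˣ, lam ∈ resonantStrings ω n κ p.1 p.2 m
  · obtain ⟨p, hp⟩ := h
    have h1 : resonantProj ω g n κ lam =
        fun k : Fin m → Wavevec d => lineProj (mode g n p (∑ j, k j)) :=
      funext fun k => resonantProj_eq hL hS hp k
    have h2 := ((mem_resonantStrings_iff hL hS p).1 hp).1
    have h3 : Continuous fun k : Fin m → Wavevec d => ∑ j, k j := by fun_prop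
    have h4 := eventually_continuousAt_mode hS p
    rw [← h2] at h4
    filter_upwards [h3.continuousAt.eventually h4] with k hk
    rw [h1]
    exact continuous_lineProj.continuousAt.comp
      (ContinuousAt.comp (f := fun k : Fin m → Wavevec d => ∑ j, k j) hk h3.continuousAt)
  · push Not at h
    have h1 : resonantProj ω g n κ lam = fun k : Fin m → Wavevec d => 0 :=
      funext fun k => resonantProj_eq_zero h k
    rw [h1]
    exact Eventually.of_forall fun _ => continuousAt_const

/-- A closed ball around the centre of a string in which the detuning operator is invertible
modulo the resonant projection. -/
theorem exists_local_nonresonance (hL : LinearCondition L ω g)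
    (hχ : NonlinearCondition (bandCrossing L ω) M χ) (hS : SpectrumCondition L ω g M n κ)
    (hm : m ∈ M) (lam : Fin m → Fin N × ℤˣ) :
    ∃ δ > 0, (∀ k ∈ Metric.closedBall (stringCenter κ lam) δ,
        (∑ j, k j ∉ bandCrossing L ω ∧ ∀ j, k j ∉ bandCrossing L ω) ∧
        IsUnit (stringOp L ω n lam k + resonantProj ω g n κ lam k)) ∧
      ContinuousOn (stringSource g χ n lam) (Metric.closedBall (stringCenter κ lam) δ) ∧
      ContinuousOn (stringOp L ω n lam) (Metric.closedBall (stringCenter κ lam) δ) ∧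
      ContinuousOn (resonantProj ω g n κ lam) (Metric.closedBall (stringCenter κ lam) δ) ∧
      ContinuousOn (fun k => Ring.inverse (stringOp L ω n lam k + resonantProj ω g n κ lam k))
        (Metric.closedBall (stringCenter κ lam) δ) := by
  have hunit : ∀ᶠ k in 𝓝 (stringCenter κ lam),
      IsUnit (stringOp L ω n lam k + resonantProj ω g n κ lam k) := by
    have h1 := (eventually_continuousAt_stringOp (lam := lam) hL hS hm).self_of_nhds
    have h2 := (eventually_continuousAt_resonantProj (lam := lam) hL hS).self_of_nhds
    exact (h1.add h2).eventually (Units.isOpen.mem_nhds (isUnit_stringOp_center hL hS hm))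
  obtain ⟨δ, hδ, h⟩ := Metric.nhds_basis_closedBall.eventually_iff.1
    ((eventually_noncrossing_pi (lam := lam) hL hS hm).and <| hunit.and <|
      (eventually_continuousAt_stringSource (lam := lam) hL hχ hS hm).and <|
      (eventually_continuousAt_stringOp (lam := lam) hL hS hm).and
      (eventually_continuousAt_resonantProj (lam := lam) hL hS))
  refine ⟨δ, hδ, fun k hk => ⟨(h hk).1, (h hk).2.1⟩,
    fun k hk => (h hk).2.2.1.continuousWithinAt, fun k hk => (h hk).2.2.2.1.continuousWithinAt,
    fun k hk => (h hk).2.2.2.2.continuousWithinAt, fun k hk => ?_⟩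
  obtain ⟨u, hu⟩ := (h hk).2.1
  have h3 : ContinuousAt Ring.inverse (stringOp L ω n lam k + resonantProj ω g n κ lam k) := by
    rw [← hu]
    exact NormedRing.inverse_continuousAt u
  exact (ContinuousAt.comp (f := fun k => stringOp L ω n lam k + resonantProj ω g n κ lam k) h3
    ((h hk).2.2.2.1.add (h hk).2.2.2.2)).continuousWithinAt

theorem sgn_mul_self (ζ : ℤˣ) : sgn ζ * sgn ζ = 1 := by
  rcases Int.units_eq_one_or ζ with h | h <;> simp [h, sgn]

theorem abs_sgn (ζ : ℤˣ) : |sgn ζ| = 1 := by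
  rcases Int.units_eq_one_or ζ with h | h <;> simp [h, sgn]

/-- Symmetry reduces the sign `ζ` to the expansion of $\omega_{n,+}$ at $\mathbf k_{*l}$. The factor
$\beta$ in the symbol cancels against the rescaled argument, so the bound is free of $\beta$. -/
theorem exists_freq_taylor_bound (hL : LinearCondition L ω g)
    (hS : SpectrumCondition L ω g M n κ) (μ : ℕ) (p : Fin N × ℤˣ) :
    ∃ C, 0 ≤ C ∧ ∃ δ > 0, ∀ v, ‖v‖ ≤ δ → ∀ β : ℝ, 0 < β →
      |freq ω n p (center κ p + v) - envelopeSymbol ω n κ μ β p.1 p.2 (β⁻¹ • v)| ≤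
        C * ‖v‖ ^ (μ + 1) := by
  have h1 : κ p.1 ∉ bandCrossing L ω := by simpa [sgn] using hS.noncrossing p.1 1
  have hg : ContDiffAt ℝ (⊤ : ℕ∞) (g (n p.1) 1) (κ p.1) := by
    simpa [sgn] using hS.eigenvector_smooth p.1 1
  obtain ⟨C, hC, δ, hδ, h⟩ := exists_taylor_bound (p := μ)
    ((contDiffAt_omega hL h1 hg).of_le (by exact_mod_cast le_top))
  have h2 : ∀ᶠ k in 𝓝 (center κ p), k ∉ bandCrossing L ω :=
    (isOpen_compl_crossing hL).mem_nhds (center_noncrossing hS p)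
  have h3 : ∀ᶠ k in 𝓝 (center κ p), sgn p.2 • k ∉ bandCrossing L ω := by
    refine (continuous_const_smul (sgn p.2)).continuousAt.eventually
      ((isOpen_compl_crossing hL).mem_nhds ?_)
    have h3 : sgn p.2 • center κ p = κ p.1 := by
      rw [center, smul_smul, sgn_mul_self, one_smul]
    simpa only [h3, mem_compl_iff] using h1
  -- The second radius keeps both the point and its reflection away from crossings, as the symmetry
  -- relation demands.
  obtain ⟨δ', hδ', h4⟩ := Metric.nhds_basis_closedBall.eventually_iff.1 (h2.and h3)
  refine ⟨C, hC, min δ δ', lt_min hδ hδ', fun v hv β hβ => ?_⟩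
  have hv' : center κ p + v ∈ Metric.closedBall (center κ p) δ' := by
    simpa using hv.trans (min_le_right _ _)
  have hn : ‖sgn p.2 • v‖ = ‖v‖ := by rw [norm_smul, Real.norm_eq_abs, abs_sgn, one_mul]
  have h5 := h (sgn p.2 • v) (by rw [hn]; exact hv.trans (min_le_left _ _))
  rw [hn, Real.norm_eq_abs] at h5
  have h6 : freq ω n p (center κ p + v) = sgn p.2 * ω (n p.1) 1 (κ p.1 + sgn p.2 • v) := by
    rw [freq, omega_eq_sgn hL (h4 hv').1 _ _ (h4 hv').2, smul_add, center, smul_smul,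
      sgn_mul_self, one_smul]
  have h7 : envelopeSymbol ω n κ μ β p.1 p.2 (β⁻¹ • v) = sgn p.2 *
      ∑ j ∈ Finset.range (μ + 1), ((j.factorial : ℝ))⁻¹ •
        iteratedFDeriv ℝ j (ω (n p.1) 1) (κ p.1) (fun _ => sgn p.2 • v) := by
    rw [envelopeSymbol, taylorPoly, smul_smul, mul_assoc, mul_inv_cancel₀ hβ.ne', mul_one]
    rfl
  rw [h6, h7, ← mul_sub, abs_mul, abs_sgn, one_mul]
  exact h5

theorem exists_sin_bound : ∃ C, 0 ≤ C ∧ ∃ δ > 0, ∀ v : ℝ, ‖v‖ ≤ δ →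
    |v - Real.sin v| ≤ C * ‖v‖ ^ 2 := by
  obtain ⟨C, hC, δ, hδ, h⟩ := exists_linear_taylor_bound (f := Real.sin) (x := 0)
    Real.contDiff_sin.contDiffAt
  refine ⟨C, hC, δ, hδ, fun v hv => ?_⟩
  have := h v hv
  rw [fderiv_eq_smul_deriv] at this
  simp only [zero_add, Real.sin_zero, Real.deriv_sin, Real.cos_zero, smul_eq_mul, mul_one] at this
  rwa [← Real.norm_eq_abs, norm_sub_rev]

/-- For $\nu=1$ two quadratic errors occur: the Taylor remainder of $Q_\lambda$, and the replacement
of linear terms by sines. -/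
theorem exists_susceptibility_taylor_bound (hL : LinearCondition L ω g)
    (hχ : NonlinearCondition (bandCrossing L ω) M χ) (hS : SpectrumCondition L ω g M n κ)
    (hm : m ∈ M) {ν : ℕ} (hν : ν ≤ 1) (lam : Fin m → Fin N × ℤˣ) (p : Fin N × ℤˣ) :
    ∃ C, 0 ≤ C ∧ ∃ δ > 0, ∀ v : Fin m → Wavevec d, ‖v‖ ≤ δ → ∀ β : ℝ, 0 < β →
      ‖scalarSusceptibility g χ n p.1 p.2 lam (center κ p + ∑ j, v j, stringCenter κ lam + v) -
        approxSusceptibility g χ n κ ν β p.1 p.2 lam (fun j => β⁻¹ • v j)‖ ≤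
          C * ‖v‖ ^ (ν + 1) := by
  have hQ := contDiffAt_scalarSusceptibility hL hχ hS hm p.1 p.2 lam
  set x : Wavevec d × (Fin m → Wavevec d) := (center κ p, stringCenter κ lam) with hx
  have hsum : ∀ v : Fin m → Wavevec d, ‖∑ j, v j‖ ≤ m * ‖v‖ := fun v => by
    simpa using norm_sum_le_of_le Finset.univ fun j _ => norm_le_pi_norm v j
  -- $A$ bounds the norm of $v\mapsto(\sum_jv_j,v)$, which couples the output increment to the
  -- inputs.
  set A : ℝ := m + 1 with hA
  have hA0 : 0 < A := by positivity
  have hpair : ∀ v : Fin m → Wavevec d,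
      ‖((∑ j, v j, v) : Wavevec d × (Fin m → Wavevec d))‖ ≤ A * ‖v‖ := fun v => by
    rw [Prod.norm_def]
    refine max_le ((hsum v).trans ?_) ?_ <;> simp only [hA] <;> nlinarith [norm_nonneg v]
  interval_cases ν
  · obtain ⟨C, hC, δ, hδ, h⟩ := exists_constant_taylor_bound
      (hQ.of_le (m := 1) (by exact_mod_cast le_top))
    refine ⟨C * A, by positivity, δ / A, by positivity, fun v hv β hβ => ?_⟩
    have h1 := h (∑ j, v j, v) ((hpair v).trans (by rwa [le_div_iff₀ hA0, mul_comm] at hv))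
    rw [approxSusceptibility, if_pos rfl, add_zero, zero_add, pow_one]
    refine h1.trans ?_
    rw [mul_assoc]
    exact mul_le_mul_of_nonneg_left (hpair v) hC
  · obtain ⟨C, hC, δ, hδ, h⟩ := exists_linear_taylor_bound
      (hQ.of_le (show ((2 : ℕ∞) : WithTop ℕ∞) ≤ _ from WithTop.coe_le_coe.2 le_top))
    obtain ⟨C', hC', δ', hδ', h'⟩ := exists_sin_bound
    set D := fderiv ℝ (scalarSusceptibility g χ n p.1 p.2 lam) x with hD
    set q : Fin m → Fin d → ℂ := fun j i => D (EuclideanSpace.single i 1,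
      Pi.single j (EuclideanSpace.single i 1)) with hq
    -- The differential is expanded in the coordinates of each frequency, with the output increment
    -- included, exactly as in the definition of `approxSusceptibility`.
    have hlin : ∀ v : Fin m → Wavevec d, D (∑ j, v j, v) = ∑ j, ∑ i, (v j i : ℂ) * q j i := by
      intro v
      have h1 : ((∑ j, v j, v) : Wavevec d × (Fin m → Wavevec d)) =
          ∑ j, ∑ i, v j i • ((EuclideanSpace.single i (1 : ℝ) : Wavevec d),
            (Pi.single j (EuclideanSpace.single i (1 : ℝ)) : Fin m → Wavevec d)) := by
        have h2 : ∀ w : Wavevec d, w = ∑ i, w i • EuclideanSpace.single i (1 : ℝ) := by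
          intro w
          ext i
          simp [Finset.sum_apply, Pi.single_apply]
        refine Prod.ext ?_ ?_
        · simp only [Prod.fst_sum, Prod.smul_fst]
          exact Finset.sum_congr rfl fun j _ => h2 (v j)
        · simp only [Prod.snd_sum, Prod.smul_snd]
          rw [← Finset.univ_sum_single v]
          refine Finset.sum_congr rfl fun j _ => ?_
          conv_lhs => rw [h2 (v j)]
          funext a
          by_cases ha : a = j
          · subst ha; simp
          · simp [ha]
      rw [h1, map_sum]
      simp_rw [map_sum, map_smul]
      simp [hq]
    refine ⟨C * A ^ 2 + ∑ j, ∑ i, C' * ‖q j i‖, by positivity, min (δ / A) δ', by positivity,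
      fun v hv β hβ => ?_⟩
    have h1 := h (∑ j, v j, v) ((hpair v).trans (by
      have := hv.trans (min_le_left _ _)
      rwa [le_div_iff₀ hA0, mul_comm] at this))
    rw [approxSusceptibility, if_neg one_ne_zero]
    have hvi : ∀ j i, ‖v j i‖ ≤ ‖v‖ := fun j i =>
      (PiLp.norm_apply_le (v j) i).trans (norm_le_pi_norm v j)
    have h2 : ‖D (∑ j, v j, v) - ∑ j, ∑ i, (Real.sin (β * (β⁻¹ • v j) i) : ℂ) * q j i‖ ≤
        (∑ j, ∑ i, C' * ‖q j i‖) * ‖v‖ ^ 2 := by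
      rw [hlin, ← Finset.sum_sub_distrib, Finset.sum_mul]
      refine norm_sum_le_of_le _ fun j _ => ?_
      rw [← Finset.sum_sub_distrib, Finset.sum_mul]
      refine norm_sum_le_of_le _ fun i _ => ?_
      have h3 : β * (β⁻¹ • v j) i = v j i := by
        rw [PiLp.smul_apply, smul_eq_mul, mul_inv_cancel_left₀ hβ.ne']
      rw [h3, ← sub_mul, ← Complex.ofReal_sub, norm_mul, Complex.norm_real, Real.norm_eq_abs]
      have h4 := h' (v j i) ((hvi j i).trans (hv.trans (min_le_right _ _)))
      calc _ ≤ C' * ‖v j i‖ ^ 2 * ‖q j i‖ := by gcongr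
        _ ≤ C' * ‖v‖ ^ 2 * ‖q j i‖ := by gcongr; exact hvi j i
        _ = _ := by ring
    have h5 : scalarSusceptibility g χ n p.1 p.2 lam (center κ p + ∑ j, v j,
        stringCenter κ lam + v) - (scalarSusceptibility g χ n p.1 p.2 lam x +
        ∑ j, ∑ i, (Real.sin (β * (β⁻¹ • v j) i) : ℂ) * q j i) =
        (scalarSusceptibility g χ n p.1 p.2 lam (x + (∑ j, v j, v)) -
          (scalarSusceptibility g χ n p.1 p.2 lam x + D (∑ j, v j, v))) +
        (D (∑ j, v j, v) - ∑ j, ∑ i, (Real.sin (β * (β⁻¹ • v j) i) : ℂ) * q j i) := by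
      rw [hx, Prod.mk_add_mk]
      ring
    refine (le_of_eq (congrArg norm h5)).trans ((norm_add_le _ _).trans ?_)
    rw [add_mul]
    refine add_le_add (h1.trans ?_) h2
    rw [mul_assoc, ← mul_pow]
    gcongr
    exact hpair v

theorem norm_exp_I_sub_le (a b : ℝ) :
    ‖Complex.exp (Complex.I * (a : ℂ)) - Complex.exp (Complex.I * (b : ℂ))‖ ≤ |a - b| := by
  have h : Complex.exp (Complex.I * (a : ℂ)) - Complex.exp (Complex.I * (b : ℂ)) =
      Complex.exp (Complex.I * (b : ℂ)) * (Complex.exp (Complex.I * ((a - b : ℝ) : ℂ)) - 1) := by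
    rw [mul_sub, mul_one, ← Complex.exp_add]
    congr 2
    push_cast
    ring
  rw [h, norm_mul, norm_exp_I_mul, one_mul]
  exact Real.norm_exp_I_mul_ofReal_sub_one_le

/-- Both kernels are a phase times an amplitude times the same unit vector. Since
$|e^{ia}-e^{ib}|\le|a-b|$, phase errors grow only linearly in $\tau$, while amplitude errors do not
grow. -/
theorem exists_kernel_bound (hL : LinearCondition L ω g)
    (hχ : NonlinearCondition (bandCrossing L ω) M χ) (hS : SpectrumCondition L ω g M n κ)
    (hm : m ∈ M) (μ : ℕ) {ν : ℕ} (hν : ν ≤ 1) {lam : Fin m → Fin N × ℤˣ} {p : Fin N × ℤˣ}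
    (hp : lam ∈ resonantStrings ω n κ p.1 p.2 m) :
    ∃ C, 0 ≤ C ∧ ∃ δ > 0, ∀ r ≤ δ, ∀ k : Fin m → Wavevec d, ‖k - stringCenter κ lam‖ ≤ r →
      ∑ j, k j ∉ bandCrossing L ω → (∀ j, k j ∉ bandCrossing L ω) → ∀ (β τ : ℝ), 0 < β →
      ‖lineProj (mode g n p (∑ j, k j)) (fieldKernel L g χ n lam τ k) -
        envelopeKernel ω g χ n κ μ ν β p lam τ k‖ ≤ C * (|τ| * r ^ (μ + 1) + r ^ (ν + 1)) := by
  obtain ⟨Cp, hCp, δp, hδp, hfp⟩ := exists_freq_taylor_bound hL hS μ p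
  choose Cj hCj δj hδj hfj using fun j => exists_freq_taylor_bound hL hS μ (lam j)
  obtain ⟨CQ, hCQ, δQ, hδQ, hQ⟩ := exists_susceptibility_taylor_bound hL hχ hS hm hν lam p
  have hc := ((mem_resonantStrings_iff hL hS p).1 hp).1
  set qb := susceptibilityBound g χ n κ p lam with hqb
  have hqb0 : 0 ≤ qb := susceptibilityBound_nonneg p lam
  obtain ⟨δ₁, hδ₁, hδ₁'⟩ : ∃ δ₁ > 0, ∀ j, δ₁ ≤ δj j := by
    rcases isEmpty_or_nonempty (Fin m) with h | h
    · exact ⟨1, one_pos, fun j => h.elim j⟩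
    · exact ⟨Finset.univ.inf' Finset.univ_nonempty δj,
        (Finset.lt_inf'_iff _).2 fun j _ => hδj j, fun j => Finset.inf'_le _ (Finset.mem_univ j)⟩
  set A : ℝ := m + 1 with hA
  have hA0 : 0 < A := by positivity
  refine ⟨(Cp * A ^ (μ + 1) + ∑ j, Cj j) * qb + CQ, by
    have := Finset.sum_nonneg fun j (_ : j ∈ Finset.univ) => hCj j
    positivity, min (min (δp / A) δ₁) δQ, by positivity, fun r hr k hk hk1 hk2 β τ hβ => ?_⟩
  set v := k - stringCenter κ lam with hv
  have hr0 : 0 ≤ r := (norm_nonneg _).trans hk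
  have hkv : ∀ j, k j = center κ (lam j) + v j := fun j => by simp [hv, stringCenter]
  -- The wavevector resonance makes the total deviation of the factors the deviation of the output
  -- from its own centre, so the output frequency can be expanded as well.
  have hksum : ∑ j, k j = center κ p + ∑ j, v j := by
    rw [← hc, hv]
    simp
  have hvj : ∀ j, ‖v j‖ ≤ r := fun j => (norm_le_pi_norm v j).trans hk
  have hvs : ‖∑ j, v j‖ ≤ A * r := by
    have h1 : ‖∑ j, v j‖ ≤ m * r := by
      simpa using norm_sum_le_of_le Finset.univ fun j _ => hvj j
    refine h1.trans ?_
    rw [hA]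
    nlinarith
  have hr1 : A * r ≤ δp := by
    have := hr.trans ((min_le_left _ _).trans (min_le_left _ _))
    rwa [le_div_iff₀ hA0, mul_comm] at this
  have e1 := hfp (∑ j, v j) (hvs.trans hr1) β hβ
  have e2 := fun j => hfj j (v j) ((hvj j).trans
    ((hr.trans ((min_le_left _ _).trans (min_le_right _ _))).trans (hδ₁' j))) β hβ
  have e3 := hQ v (hk.trans (hr.trans (min_le_right _ _))) β hβ
  have hkeq : stringCenter κ lam + v = k := by simp [hv]
  rw [← hksum, hkeq] at e3
  rw [← hksum] at e1
  simp_rw [← hkv] at e2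
  set Q₁ := scalarSusceptibility g χ n p.1 p.2 lam (∑ j, k j, k) with hQ₁
  set Q₂ := approxSusceptibility g χ n κ ν β p.1 p.2 lam (fun j => β⁻¹ • v j) with hQ₂
  set a : ℝ := τ * (freq ω n p (∑ j, k j) - stringFreq ω n lam k) with ha
  set b : ℝ := τ * (envelopeSymbol ω n κ μ β p.1 p.2 (β⁻¹ • ∑ j, v j) -
    ∑ j, envelopeSymbol ω n κ μ β (lam j).1 (lam j).2 (β⁻¹ • v j)) with hb
  have hE : envelopeKernel ω g χ n κ μ ν β p lam τ k =
      (Complex.exp (Complex.I * (b : ℂ)) * Q₂) • mode g n p (∑ j, k j) := by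
    rw [envelopeKernel, ← Complex.exp_sum, ← mul_assoc, ← Complex.exp_add]
    congr 3
    rw [hb, ← Finset.mul_sum, ← mul_add, ← Complex.ofReal_sum, ← Complex.ofReal_add,
      ← Finset.mul_sum, ← Finset.smul_sum, neg_mul, ← sub_eq_add_neg, ← mul_sub]
    rfl
  rw [lineProj_fieldKernel hL p τ hk2 hk1, hE, ← sub_smul, norm_smul]
  have hunit : ‖mode g n p (∑ j, k j)‖ = 1 := hL.unit _ hk1 _ _
  rw [hunit, mul_one]
  have hsplit : Complex.exp (Complex.I * (a : ℂ)) * Q₁ - Complex.exp (Complex.I * (b : ℂ)) * Q₂ =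
      Complex.exp (Complex.I * (a : ℂ)) * (Q₁ - Q₂) +
      (Complex.exp (Complex.I * (a : ℂ)) - Complex.exp (Complex.I * (b : ℂ))) * Q₂ := by ring
  rw [hsplit]
  refine (norm_add_le _ _).trans ?_
  rw [norm_mul, norm_mul, norm_exp_I_mul, one_mul]
  have f1 : ‖Q₁ - Q₂‖ ≤ CQ * r ^ (ν + 1) := e3.trans (by gcongr)
  have f2 : ‖Q₂‖ ≤ qb := norm_approxSusceptibility_le ν β p lam _
  have f3 : |a - b| ≤ |τ| * ((Cp * A ^ (μ + 1) + ∑ j, Cj j) * r ^ (μ + 1)) := by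
    rw [ha, hb, ← mul_sub, abs_mul]
    refine mul_le_mul_of_nonneg_left ?_ (abs_nonneg _)
    have g1 : freq ω n p (∑ j, k j) - stringFreq ω n lam k -
        (envelopeSymbol ω n κ μ β p.1 p.2 (β⁻¹ • ∑ j, v j) -
          ∑ j, envelopeSymbol ω n κ μ β (lam j).1 (lam j).2 (β⁻¹ • v j)) =
        (freq ω n p (∑ j, k j) - envelopeSymbol ω n κ μ β p.1 p.2 (β⁻¹ • ∑ j, v j)) -
        ∑ j, (freq ω n (lam j) (k j) -
          envelopeSymbol ω n κ μ β (lam j).1 (lam j).2 (β⁻¹ • v j)) := by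
      rw [Finset.sum_sub_distrib, stringFreq]
      ring
    rw [g1, add_mul, Finset.sum_mul]
    refine (abs_sub _ _).trans (add_le_add ?_ ?_)
    · refine e1.trans ?_
      rw [mul_assoc, ← mul_pow]
      gcongr
    · refine (Finset.abs_sum_le_sum_abs _ _).trans (Finset.sum_le_sum fun j _ => ?_)
      refine (e2 j).trans ?_
      have := hCj j
      gcongr
      exact hvj j
  have f4 := (norm_exp_I_sub_le a b).trans f3
  have hS0 : 0 ≤ (Cp * A ^ (μ + 1) + ∑ j, Cj j) * qb := by
    have := Finset.sum_nonneg fun j (_ : j ∈ Finset.univ) => hCj j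
    positivity
  have f5 := mul_le_mul f4 f2 (norm_nonneg _) ((norm_nonneg _).trans f4)
  have hp1 : 0 ≤ |τ| * r ^ (μ + 1) := by positivity
  have hp2 : 0 ≤ r ^ (ν + 1) := by positivity
  nlinarith [mul_nonneg hCQ hp1, mul_nonneg hS0 hp2]

end LocalAnalysis

/-! ### Localization of the kernels and separation of the nonresonant part. -/

section Localization

variable {X E : Type*} [TopologicalSpace X] [MeasurableSpace X] [OpensMeasurableSpace X]
  [SecondCountableTopology X] [NormedAddCommGroup E] {μ : Measure X}

/-- Symbols, modes and inverses are controlled only near a centre. Cutting to a compact ball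
produces multipliers that are essentially bounded on the whole space. -/
theorem essBdd_indicator_of_continuousOn {f : X → E} {s : Set X} (hs : IsCompact s)
    (hsm : MeasurableSet s) (hf : ContinuousOn f s) : EssBdd (s.indicator f) μ := by
  obtain ⟨C, hC⟩ := hs.exists_bound_of_continuousOn hf
  refine ⟨(aestronglyMeasurable_indicator_iff hsm).2 (hf.aestronglyMeasurable hsm), max C 0,
    Eventually.of_forall fun x => ?_⟩
  by_cases hx : x ∈ s
  · rw [indicator_of_mem hx]
    exact (hC x hx).trans (le_max_left _ _)
  · rw [indicator_of_notMem hx, norm_zero]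
    exact le_max_right _ _

end Localization

section NonresonantPart

variable {d J N : ℕ} {L : Wavevec d → (Field2J J →L[ℂ] Field2J J)}
  {ω : Fin J → ℤˣ → Wavevec d → ℝ} {g : Fin J → ℤˣ → Wavevec d → Field2J J} {M : Finset ℕ}
  {χ : (m : ℕ) → Wavevec d → (Fin m → Wavevec d) →
      ContinuousMultilinearMap ℂ (fun _ : Fin m => Field2J J) (Field2J J)}
  {n : Fin N → Fin J} {κ : Fin N → Wavevec d} {m : ℕ}

/-- All data of the oscillatory estimate are cut to a closed ball on which $A+P$ is invertible.
There the detuning operator is bounded, as norm differentiability requires; outside, the source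
vanishes and nothing has to be inverted. The resulting kernel is the true nonresonant part near the
centre, where the truncated envelopes live for small $\beta$. -/
theorem exists_nonresonant_part (hL : LinearCondition L ω g)
    (hχ : NonlinearCondition (bandCrossing L ω) M χ) (hS : SpectrumCondition L ω g M n κ)
    (hm : m ∈ M) (lam : Fin m → Fin N × ℤˣ) :
    ∃ (C : ℝ) (K : ℝ → (Fin m → Wavevec d) → Field2J J), 0 ≤ C ∧ (∀ τ, EssBdd (K τ) volume) ∧
      (∀ (ϱ : ℝ) (y : ℝ → Lp ℂ 1 (volume : Measure (Fin m → Wavevec d))), Continuous y →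
        Continuous fun s => vMul volume (K (s / ϱ)) (y s)) ∧
      (∀ (r r' T ϱ : ℝ) (y y' : ℝ → Lp ℂ 1 (volume : Measure (Fin m → Wavevec d))), 0 < ϱ →
        (∀ t, HasDerivAt y (y' t) t) → Continuous y' → (∀ t ∈ Icc 0 T, ‖y t‖ ≤ r) →
        (∀ t ∈ Icc 0 T, ‖y' t‖ ≤ r') → ∀ t ∈ Icc 0 T,
        ‖∫ s in (0 : ℝ)..t, vMul volume (K (s / ϱ)) (y s)‖ ≤ ϱ * (C * (2 * r + T * r'))) ∧
      ∀ᶠ k in 𝓝 (stringCenter κ lam), ∀ τ,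
        K τ k = (1 - resonantProj ω g n κ lam k) (fieldKernel L g χ n lam τ k) := by
  obtain ⟨δ, hδ, hb, hw, hA, hP, hB⟩ := exists_local_nonresonance hL hχ hS hm lam
  set s := Metric.closedBall (stringCenter κ lam) δ with hs
  have hsc : IsCompact s := isCompact_closedBall _ _
  have hsm : MeasurableSet s := Metric.isClosed_closedBall.measurableSet
  set w' := s.indicator (stringSource g χ n lam) with hw'
  set A' := s.indicator (stringOp L ω n lam) with hA'
  set P' := s.indicator (resonantProj ω g n κ lam) with hP'
  set B' := s.indicator (fun k => Ring.inverse (stringOp L ω n lam k + resonantProj ω g n κ lam k))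
    with hB'
  have ew : EssBdd w' volume := essBdd_indicator_of_continuousOn hsc hsm hw
  have eA : EssBdd A' volume := essBdd_indicator_of_continuousOn hsc hsm hA
  have eP : EssBdd P' volume := essBdd_indicator_of_continuousOn hsc hsm hP
  have eB : EssBdd B' volume := essBdd_indicator_of_continuousOn hsc hsm hB
  have hAsa : ∀ k, IsSelfAdjoint (A' k) := fun k => by
    by_cases hk : k ∈ s
    · rw [hA', indicator_of_mem hk]
      exact isSelfAdjoint_stringOp hL k
    · rw [hA', indicator_of_notMem hk]
      exact IsSelfAdjoint.zero (Field2J J →L[ℂ] Field2J J)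
  have e1P : EssBdd (fun k => 1 - P' k) volume :=
    (essBdd_const (1 : Field2J J →L[ℂ] Field2J J)).sub eP
  obtain ⟨CB, hCB⟩ := eB.2
  obtain ⟨CP, hCP⟩ := e1P.2
  obtain ⟨Cw, hCw⟩ := ew.2
  have eK : ∀ τ, EssBdd (fun k => (1 - P' k) (expI (A' k) τ (w' k))) volume := fun τ =>
    e1P.clm_apply (essBdd_expI_apply eA.1 (Eventually.of_forall hAsa) ew τ)
  refine ⟨|CB| * |CP| * |Cw|, fun τ k => (1 - P' k) (expI (A' k) τ (w' k)), by positivity, eK,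
    fun ϱ y hy => ?_, fun r r' T ϱ y y' hϱ hy hy' hyr hyr' t ht => ?_, ?_⟩
  · have hbd : ∀ τ, ∀ᵐ k, ‖(1 - P' k) (expI (A' k) τ (w' k))‖ ≤ |CP| * |Cw| := fun τ => by
      filter_upwards [hCP, hCw] with k a b
      refine (ContinuousLinearMap.le_opNorm _ _).trans (mul_le_mul (a.trans (le_abs_self _)) ?_
        (norm_nonneg _) (abs_nonneg _))
      rw [norm_expI_apply (hAsa k)]
      exact b.trans (le_abs_self _)
    refine continuous_apply_of_bounded (C := |CP| * |Cw|) (fun t x => norm_vMul_apply_le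
      (by positivity) (hbd _) x) (fun x => ?_) hy
    refine continuous_vMul_apply (C := |CP| * |Cw|) (fun t => (eK _).1) (fun t => hbd _)
      (Eventually.of_forall fun k => ?_) x
    have h1 : Continuous fun t : ℝ => expI (A' k) (t / ϱ) :=
      continuous_expI.comp (continuous_id.div_const ϱ)
    exact (1 - P' k).continuous.comp (h1.clm_apply continuous_const)
  · refine norm_integral_oscillatory_le eA (Eventually.of_forall hAsa) eB eP ew
      (Eventually.of_forall fun k hk => ?_) hϱ (by positivity) ?_ hy hy' hyr hyr' ht
    · have hks : k ∈ s := mem_of_indicator_ne_zero hk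
      obtain ⟨⟨h1, h2⟩, h3⟩ := hb k hks
      simp only [hP', hA', hB', indicator_of_mem hks]
      obtain ⟨h4, h5⟩ := resonantProj_stringOp (lam := lam) hL hS h1
      exact ⟨h4, h5, Ring.inverse_mul_cancel _ h3⟩
    · filter_upwards [hCB, hCP, hCw] with k a b c
      have a' := a.trans (le_abs_self _)
      have b' := b.trans (le_abs_self _)
      have c' := c.trans (le_abs_self _)
      gcongr
  · filter_upwards [Metric.closedBall_mem_nhds _ hδ] with k hk τ
    have hks : k ∈ s := hk
    simp only [hP', hA', hw', indicator_of_mem hks]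
    rw [fieldKernel_eq_expI hL τ (hb k hks).1.2]

/-- At most one component resonates with a string, so either one projection is compared with one
envelope kernel, or both sides vanish. -/
theorem exists_resonant_kernel_bound (hL : LinearCondition L ω g)
    (hχ : NonlinearCondition (bandCrossing L ω) M χ) (hS : SpectrumCondition L ω g M n κ)
    (hm : m ∈ M) (μ : ℕ) {ν : ℕ} (hν : ν ≤ 1) (lam : Fin m → Fin N × ℤˣ) :
    ∃ C, 0 ≤ C ∧ ∃ δ > 0, ∀ r ≤ δ, ∀ k : Fin m → Wavevec d, 0 ≤ r →
      ‖k - stringCenter κ lam‖ ≤ r →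
      ∑ j, k j ∉ bandCrossing L ω → (∀ j, k j ∉ bandCrossing L ω) → ∀ (β τ : ℝ), 0 < β →
      ‖resonantProj ω g n κ lam k (fieldKernel L g χ n lam τ k) -
        ∑ p with lam ∈ resonantStrings ω n κ p.1 p.2 m,
          envelopeKernel ω g χ n κ μ ν β p lam τ k‖ ≤ C * (|τ| * r ^ (μ + 1) + r ^ (ν + 1)) := by
  by_cases h : ∃ p : Fin N × ℤˣ, lam ∈ resonantStrings ω n κ p.1 p.2 m
  · obtain ⟨p, hp⟩ := h
    obtain ⟨C, hC, δ, hδ, hb⟩ := exists_kernel_bound hL hχ hS hm μ hν hp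
    refine ⟨C, hC, δ, hδ, fun r hr k _ hk h1 h2 β τ hβ => ?_⟩
    rw [resonantProj_eq hL hS hp, Finset.sum_eq_single_of_mem p (by simpa using hp)]
    · exact hb r hr k hk h1 h2 β τ hβ
    · intro q hq hqp
      exact absurd (eq_of_mem_resonantStrings hL hS (by simpa using hq) hp) hqp
  · push Not at h
    refine ⟨0, le_rfl, 1, one_pos, fun r hr k _ hk h1 h2 β τ hβ => ?_⟩
    rw [resonantProj_eq_zero h, Finset.filter_false_of_mem fun p _ => h p]
    simp

end NonresonantPart

/-! ### The residual of a single string. -/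

section MultilinearDerivative

variable {Y Z : Type*} [NormedAddCommGroup Y] [NormedSpace ℂ Y] [NormedSpace ℝ Y]
  [IsScalarTower ℝ ℂ Y] [NormedAddCommGroup Z] [NormedSpace ℂ Z] [NormedSpace ℝ Z]
  [IsScalarTower ℝ ℂ Z] {m : ℕ}

theorem hasDerivAt_multilinear (T : ContinuousMultilinearMap ℂ (fun _ : Fin m => Y) Z)
    {u u' : ℝ → Fin m → Y} {t : ℝ} (hu : ∀ j, HasDerivAt (fun t => u t j) (u' t j) t) :
    HasDerivAt (fun t => T (u t)) (∑ j, T (Function.update (u t) j (u' t j))) t := by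
  have h1 : HasDerivAt u (u' t) t := hasDerivAt_pi.2 hu
  have h2 := (T.hasFDerivAt (x := u t)).restrictScalars ℝ
  have h3 := h2.comp_hasDerivAt t h1
  have h4 : (T.linearDeriv (u t)).restrictScalars ℝ (u' t) =
      ∑ j, T (Function.update (u t) j (u' t j)) := by
    rw [ContinuousLinearMap.coe_restrictScalars', ContinuousMultilinearMap.linearDeriv_apply]
  rw [← h4]
  exact h3

end MultilinearDerivative

section Residual

variable {d J N : ℕ} {L : Wavevec d → (Field2J J →L[ℂ] Field2J J)}
  {ω : Fin J → ℤˣ → Wavevec d → ℝ} {g : Fin J → ℤˣ → Wavevec d → Field2J J} {M : Finset ℕ}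
  {χ : (m : ℕ) → Wavevec d → (Fin m → Wavevec d) →
      ContinuousMultilinearMap ℂ (fun _ : Fin m => Field2J J) (Field2J J)}
  {n : Fin N → Fin J} {κ : Fin N → Wavevec d} {m : ℕ}

/-- Truncation to $|\eta|\le\beta^{-\epsilon}$ becomes, after rescaling, the cutoff at distance
$\beta^{1-\epsilon}$ used for data and components. -/
theorem rescaleOp_envelopeCutoff {β : ℝ} (hβ : 0 < β) (ε : ℝ) (x : Envelopes d N)
    (p : Fin N × ℤˣ) (c : Wavevec d) :
    rescaleOp β c (envelopeCutoff d N β ε x p) =ᵐ[volume]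
      fun k => (cutoff β ε c k : ℂ) * rescale β c (x p) k := by
  have h1 := (quasiMeasurePreserving_rescale hβ c).ae (vMul_coe (essBdd_envelopeCutoff β ε) (x p))
  filter_upwards [rescaleOp_coe hβ c (envelopeCutoff d N β ε x p), h1] with k a b
  rw [a, rescale, envelopeCutoff, scaleOp_apply, b, rescale, smul_eq_mul, smul_inv_smul₀ hβ.ne']
  have h2 : cutoff β ε 0 (k - c) = cutoff β ε c k := by simp [cutoff]
  rw [h2]
  ring

theorem norm_envelopeCutoff_apply_le (β ε : ℝ) (x : Envelopes d N) :
    ‖envelopeCutoff d N β ε x‖ ≤ ‖x‖ := by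
  refine (pi_norm_le_iff_of_nonneg (norm_nonneg _)).2 fun p => ?_
  refine le_trans ?_ (norm_le_pi_norm x p)
  have h := norm_vMul_apply_le (μ := volume) (φ := fun η : Wavevec d => (cutoff β ε 0 (β • η) : ℂ))
    zero_le_one (Eventually.of_forall fun η => ?_) (x p)
  · rwa [one_mul] at h
  · rcases cutoff_eq_zero_or_one β ε 0 (β • η) with h | h <;> simp [h]

/-- This lets a kernel estimate valid only near the centre act as a multiplier bound on truncated
envelopes. -/
theorem stringTens_envelopeCutoff_support {β : ℝ} (hβ : 0 < β) (ε : ℝ)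
    (lam : Fin m → Fin N × ℤˣ) (x : Envelopes d N) :
    ∀ᵐ k, stringTens κ β lam (envelopeCutoff d N β ε x) k ≠ 0 →
      ‖k - stringCenter κ lam‖ ≤ β ^ (1 - ε) := by
  have h1 : ∀ j, ∀ᵐ k : Fin m → Wavevec d, rescaleOp β (center κ (lam j))
      (envelopeCutoff d N β ε x (lam j)) (k j) =
      (cutoff β ε (center κ (lam j)) (k j) : ℂ) *
        rescale β (center κ (lam j)) (x (lam j)) (k j) := fun j =>
    (quasiMeasurePreserving_apply j).ae (rescaleOp_envelopeCutoff hβ ε x (lam j) _)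
  filter_upwards [tens_coe fun j => rescaleOp β (center κ (lam j))
    (envelopeCutoff d N β ε x (lam j)), ae_all_iff.2 h1] with k a b hk
  rw [stringTens, a, Finset.prod_ne_zero_iff] at hk
  refine (pi_norm_le_iff_of_nonneg (Real.rpow_nonneg hβ.le _)).2 fun j => ?_
  have h2 := hk j (Finset.mem_univ j)
  rw [b j] at h2
  refine norm_le_of_cutoff_ne_zero hβ (c := center κ (lam j)) (k := k j) fun h3 => h2 ?_
  rw [h3]
  simp

theorem norm_stringTens_le (β : ℝ) (lam : Fin m → Fin N × ℤˣ) {x : Envelopes d N} {ρ : ℝ}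
    (hx : ‖x‖ ≤ ρ) : ‖stringTens κ β lam x‖ ≤ ρ ^ m := by
  refine (norm_tens_apply_le _).trans ?_
  have h : ∏ j : Fin m, ‖rescaleOp β (center κ (lam j)) (x (lam j))‖ ≤ ∏ _j : Fin m, ρ :=
    Finset.prod_le_prod (fun _ _ => norm_nonneg _) fun j _ =>
      (norm_rescaleOp_apply_le _ _ _).trans ((norm_le_pi_norm x _).trans hx)
  simpa using h

theorem continuous_stringTens (β : ℝ) (lam : Fin m → Fin N × ℤˣ) {x : ℝ → Envelopes d N}
    (hx : Continuous x) : Continuous fun t => stringTens κ β lam (x t) := by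
  refine (tens d m).cont.comp (continuous_pi fun j => ?_)
  exact (rescaleOp β (center κ (lam j))).continuous.comp ((continuous_apply (lam j)).comp hx)

theorem exists_hasDerivAt_stringTens (β : ℝ) (lam : Fin m → Fin N × ℤˣ)
    {x x' : ℝ → Envelopes d N} (hx : ∀ t, HasDerivAt x (x' t) t) (hx' : Continuous x') :
    ∃ y' : ℝ → Lp ℂ 1 (volume : Measure (Fin m → Wavevec d)),
      (∀ t, HasDerivAt (fun t => stringTens κ β lam (x t)) (y' t) t) ∧ Continuous y' ∧
      ∀ ρ t, ‖x t‖ ≤ ρ → ‖x' t‖ ≤ ρ → ‖y' t‖ ≤ m * ρ ^ m := by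
  have hxc : Continuous x := continuous_iff_continuousAt.2 fun t => (hx t).continuousAt
  have hc : ∀ {z : ℝ → Envelopes d N}, Continuous z → ∀ j,
      Continuous fun t => rescaleOp β (center κ (lam j)) (z t (lam j)) := fun hz j =>
    (rescaleOp β (center κ (lam j))).continuous.comp ((continuous_apply (lam j)).comp hz)
  refine ⟨fun t => ∑ j, tens d m (Function.update
      (fun j => rescaleOp β (center κ (lam j)) (x t (lam j))) j
      (rescaleOp β (center κ (lam j)) (x' t (lam j)))), fun t => ?_, ?_, fun ρ t h h' => ?_⟩
  · refine hasDerivAt_multilinear (tens d m)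
      (u := fun t j => rescaleOp β (center κ (lam j)) (x t (lam j)))
      (u' := fun t j => rescaleOp β (center κ (lam j)) (x' t (lam j))) fun j => ?_
    exact ((rescaleOp β (center κ (lam j))).restrictScalars ℝ).hasFDerivAt.comp_hasDerivAt t
      (hasDerivAt_pi.1 (hx t) (lam j))
  · exact continuous_finsetSum _ fun j _ => (tens d m).cont.comp
      ((continuous_pi fun i => hc hxc i).update j (hc hx' j))
  · have h1 : ∀ j ∈ (Finset.univ : Finset (Fin m)), ‖tens d m (Function.update
        (fun j => rescaleOp β (center κ (lam j)) (x t (lam j))) j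
        (rescaleOp β (center κ (lam j)) (x' t (lam j))))‖ ≤ ρ ^ m := by
      intro j _
      refine (norm_tens_apply_le _).trans ?_
      have h2 : ∏ i : Fin m, ‖Function.update
          (fun j => rescaleOp β (center κ (lam j)) (x t (lam j))) j
          (rescaleOp β (center κ (lam j)) (x' t (lam j))) i‖ ≤ ∏ _i : Fin m, ρ := by
        refine Finset.prod_le_prod (fun _ _ => norm_nonneg _) fun i _ => ?_
        by_cases hi : i = j
        · subst hi
          rw [Function.update_self]
          exact (norm_rescaleOp_apply_le _ _ _).trans ((norm_le_pi_norm (x' t) _).trans h')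
        · rw [Function.update_of_ne hi]
          exact (norm_rescaleOp_apply_le _ _ _).trans ((norm_le_pi_norm (x t) _).trans h)
      simpa using h2
    simpa using norm_sum_le_of_le _ h1

/-- Up to a small error, the residual of a string is an oscillating term of vanishing average. -/
theorem exists_string_residual (hL : LinearCondition L ω g)
    (hχ : NonlinearCondition (bandCrossing L ω) M χ) (hS : SpectrumCondition L ω g M n κ)
    (hm : m ∈ M) (μ : ℕ) {ν : ℕ} (hν : ν ≤ 1) {ρ T : ℝ} (hρ : 0 ≤ ρ) (hT : 0 ≤ T)
    (lam : Fin m → Fin N × ℤˣ) :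
    ∃ (C : ℝ) (δ : ℝ) (K : ℝ → (Fin m → Wavevec d) → Field2J J), 0 ≤ C ∧ 0 < δ ∧
      (∀ (β ϱ : ℝ) (x : ℝ → Envelopes d N), Continuous x →
        Continuous fun s => vMul volume (K (s / ϱ)) (stringTens κ β lam (x s))) ∧
      (∀ (β ϱ : ℝ) (x x' : ℝ → Envelopes d N), 0 < ϱ → (∀ t, HasDerivAt x (x' t) t) →
        Continuous x' → (∀ t ∈ Icc 0 T, ‖x t‖ ≤ ρ) → (∀ t ∈ Icc 0 T, ‖x' t‖ ≤ ρ) →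
        ∀ t ∈ Icc 0 T,
        ‖∫ s in (0 : ℝ)..t, vMul volume (K (s / ϱ)) (stringTens κ β lam (x s))‖ ≤ C * ϱ) ∧
      ∀ (β ε τ : ℝ) (x : Envelopes d N), 0 < β → β ^ (1 - ε) ≤ δ → ‖x‖ ≤ ρ →
        ‖vMul volume (fun k => ∑ p with lam ∈ resonantStrings ω n κ p.1 p.2 m,
            envelopeKernel ω g χ n κ μ ν β p lam τ k)
            (stringTens κ β lam (envelopeCutoff d N β ε x)) -
          vMul volume (fieldKernel L g χ n lam τ)
            (stringTens κ β lam (envelopeCutoff d N β ε x)) +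
          vMul volume (K τ) (stringTens κ β lam (envelopeCutoff d N β ε x))‖ ≤
        C * (|τ| * (β ^ (1 - ε)) ^ (μ + 1) + (β ^ (1 - ε)) ^ (ν + 1)) := by
  have hm1 : 1 ≤ m := by have := hχ.two_le m hm; omega
  obtain ⟨C₁, K, hC₁, hK, hKc, hKi, hKe⟩ := exists_nonresonant_part hL hχ hS hm lam
  obtain ⟨C₂, hC₂, δ₂, hδ₂, hb⟩ := exists_resonant_kernel_bound hL hχ hS hm μ hν lam
  obtain ⟨δ₁, hδ₁, hball⟩ := Metric.nhds_basis_closedBall.eventually_iff.1 hKe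
  have hCa : 0 ≤ C₁ * (2 * ρ ^ m + T * (m * ρ ^ m)) := by positivity
  have hCb : 0 ≤ C₂ * ρ ^ m := by positivity
  -- The tensor product is bounded by $\rho^m$ and its time derivative by $m\rho^m$. These give the
  -- constant of the integration by parts and the factor of the kernel bound.
  refine ⟨C₁ * (2 * ρ ^ m + T * (m * ρ ^ m)) + C₂ * ρ ^ m, min δ₁ δ₂, K, by positivity,
    lt_min hδ₁ hδ₂, fun β ϱ x hx => hKc ϱ _ (continuous_stringTens β lam hx),
    fun β ϱ x x' hϱ hx hx' hxr hxr' t ht => ?_, fun β ε τ x hβ hβδ hx => ?_⟩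
  · obtain ⟨y', hy, hy', hyb⟩ := exists_hasDerivAt_stringTens (κ := κ) β lam hx hx'
    refine (hKi (ρ ^ m) (m * ρ ^ m) T ϱ _ y' hϱ hy hy'
      (fun t ht => norm_stringTens_le β lam (hxr t ht))
      (fun t ht => hyb ρ t (hxr t ht) (hxr' t ht)) t ht).trans ?_
    rw [mul_comm ϱ]
    gcongr
    linarith
  · set y := stringTens κ β lam (envelopeCutoff d N β ε x) with hy
    set r := β ^ (1 - ε) with hr
    have hr0 : 0 ≤ r := Real.rpow_nonneg hβ.le _
    have hE : EssBdd (fun k => ∑ p with lam ∈ resonantStrings ω n κ p.1 p.2 m,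
        envelopeKernel ω g χ n κ μ ν β p lam τ k) volume :=
      EssBdd.sum fun p _ => essBdd_envelopeKernel hL hχ.two_le hS hβ μ ν p hm lam τ
    have hF := essBdd_fieldKernel hL hχ hS hm lam τ
    set Q := C₂ * (|τ| * r ^ (μ + 1) + r ^ (ν + 1)) with hQ
    have hQ0 : 0 ≤ Q := by positivity
    have h1 : vMul volume (fun k => ∑ p with lam ∈ resonantStrings ω n κ p.1 p.2 m,
            envelopeKernel ω g χ n κ μ ν β p lam τ k) y -
          vMul volume (fieldKernel L g χ n lam τ) y + vMul volume (K τ) y =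
        vMul volume (fun k => (∑ p with lam ∈ resonantStrings ω n κ p.1 p.2 m,
            envelopeKernel ω g χ n κ μ ν β p lam τ k) -
            (fieldKernel L g χ n lam τ k - K τ k)) y := by
      rw [vMul_sub hE (hF.sub (hK τ)), vMul_sub hF (hK τ)]
      abel
    have h2 : ‖vMul volume (fun k => (∑ p with lam ∈ resonantStrings ω n κ p.1 p.2 m,
            envelopeKernel ω g χ n κ μ ν β p lam τ k) -
            (fieldKernel L g χ n lam τ k - K τ k)) y‖ ≤ Q * ‖y‖ := by
      refine norm_vMul_apply_le_of_ae hQ0 ?_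
      filter_upwards [stringTens_envelopeCutoff_support (κ := κ) hβ ε lam x, ae_noncrossing_pi hL hm1]
        with k h3 h4 h5
      have h6 := h3 h5
      have h7 : K τ k = (1 - resonantProj ω g n κ lam k) (fieldKernel L g χ n lam τ k) :=
        hball (by rw [Metric.mem_closedBall, dist_eq_norm]
                  exact h6.trans (hβδ.trans (min_le_left _ _))) τ
      -- With the nonresonant part removed, what remains of the field kernel is its resonant
      -- projection.
      rw [h7, sub_apply, one_apply_eq_self, sub_sub_cancel, norm_sub_rev]
      exact hb r (hβδ.trans (min_le_right _ _)) k hr0 h6 h4.1 h4.2 β τ hβ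
    rw [h1]
    refine h2.trans ?_
    have h8 : ‖y‖ ≤ ρ ^ m :=
      norm_stringTens_le β lam ((norm_envelopeCutoff_apply_le β ε x).trans hx)
    calc Q * ‖y‖ ≤ Q * ρ ^ m := by gcongr
      _ = C₂ * ρ ^ m * (|τ| * r ^ (μ + 1) + r ^ (ν + 1)) := by rw [hQ]; ring
      _ ≤ _ := by gcongr; linarith

end Residual

/-! ### The time-integrated residual of the truncated envelopes. -/

section TotalResidual

variable {d J N : ℕ} {L : Wavevec d → (Field2J J →L[ℂ] Field2J J)}
  {ω : Fin J → ℤˣ → Wavevec d → ℝ} {g : Fin J → ℤˣ → Wavevec d → Field2J J} {M : Finset ℕ}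
  {χ : (m : ℕ) → Wavevec d → (Fin m → Wavevec d) →
      ContinuousMultilinearMap ℂ (fun _ : Fin m => Field2J J) (Field2J J)}
  {n : Fin N → Fin J} {κ : Fin N → Wavevec d} {m : ℕ}

theorem exists_pos_forall_le {ι : Type*} (s : Finset ι) {δ : ι → ℝ} (h : ∀ i ∈ s, 0 < δ i) :
    ∃ δ₀ > 0, ∀ i ∈ s, δ₀ ≤ δ i := by
  have h1 : ∀ᶠ x : ℝ in 𝓝[>] 0, ∀ i ∈ s, x ≤ δ i :=
    (Finset.eventually_all s).2 fun i hi =>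
      mem_nhdsWithin_of_mem_nhds (Iic_mem_nhds (h i hi))
  obtain ⟨x, hx, hx0⟩ := (h1.and self_mem_nhdsWithin).exists
  exact ⟨x, hx0, hx⟩

theorem norm_fiberOp_smul_le {m : ℕ}
    (f : Lp (Field2J J) 1 (volume : Measure (Fin m → Wavevec d))) :
    ‖(convFactor d m : ℂ) • fiberOp d m (Field2J J) f‖ ≤ convFactor d m * ‖f‖ := by
  rw [norm_smul, Complex.norm_real, Real.norm_of_nonneg (convFactor_pos d m).le]
  exact mul_le_mul_of_nonneg_left (norm_fiberOp_apply_le f) (convFactor_pos d m).le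

-- With `F` the residual and `G` the sum of the nonresonant oscillations, $F+G$ is small at each
-- time and the integral of `G` is $O(\varrho)$. Finitely many strings permit common constants, and
-- $|s/\varrho|\le T/\varrho$ explains the division by $\varrho$ in the dispersive error.
set_option maxHeartbeats 800000 in
theorem exists_residual_bound (hL : LinearCondition L ω g)
    (hχ : NonlinearCondition (bandCrossing L ω) M χ) (hS : SpectrumCondition L ω g M n κ)
    (μ : ℕ) {ν : ℕ} (hν : ν ≤ 1) {ρ T : ℝ} (hρ : 0 ≤ ρ) (hT : 0 ≤ T) :
    ∃ C δ : ℝ, 0 ≤ C ∧ 0 < δ ∧ ∀ (β ε ϱ : ℝ) (x x' : ℝ → Envelopes d N) (B K B' K' : ℝ → ℝ),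
      0 < β → β ^ (1 - ε) ≤ δ → 0 < ϱ → (∀ t, HasDerivAt x (x' t) t) → Continuous x' →
      (∀ t ∈ Icc 0 T, ‖x t‖ ≤ ρ) → (∀ t ∈ Icc 0 T, ‖x' t‖ ≤ ρ) →
      IsRegularField (envelopeVF ω g M χ n κ μ ν β ϱ) B K →
      IsRegularField (fieldVF L M χ ϱ) B' K' → ∀ t ∈ Icc 0 T,
      ‖∫ s in (0 : ℝ)..t,
          (waveOp g n κ β (envelopeVF ω g M χ n κ μ ν β ϱ s (envelopeCutoff d N β ε (x s))) -
            fieldVF L M χ ϱ s (waveOp g n κ β (envelopeCutoff d N β ε (x s))))‖ ≤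
        C * (ϱ + (β ^ (1 - ε)) ^ (μ + 1) / ϱ + (β ^ (1 - ε)) ^ (ν + 1)) := by
  have hex : ∀ (m : ℕ) (lam : Fin m → Fin N × ℤˣ), ∃ (C : ℝ) (δ : ℝ)
      (K : ℝ → (Fin m → Wavevec d) → Field2J J), m ∈ M → 0 ≤ C ∧ 0 < δ ∧
      (∀ (β ϱ : ℝ) (x : ℝ → Envelopes d N), Continuous x →
        Continuous fun s => vMul volume (K (s / ϱ)) (stringTens κ β lam (x s))) ∧
      (∀ (β ϱ : ℝ) (x x' : ℝ → Envelopes d N), 0 < ϱ → (∀ t, HasDerivAt x (x' t) t) →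
        Continuous x' → (∀ t ∈ Icc 0 T, ‖x t‖ ≤ ρ) → (∀ t ∈ Icc 0 T, ‖x' t‖ ≤ ρ) →
        ∀ t ∈ Icc 0 T,
        ‖∫ s in (0 : ℝ)..t, vMul volume (K (s / ϱ)) (stringTens κ β lam (x s))‖ ≤ C * ϱ) ∧
      ∀ (β ε τ : ℝ) (x : Envelopes d N), 0 < β → β ^ (1 - ε) ≤ δ → ‖x‖ ≤ ρ →
        ‖vMul volume (fun k => ∑ p with lam ∈ resonantStrings ω n κ p.1 p.2 m,
            envelopeKernel ω g χ n κ μ ν β p lam τ k)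
            (stringTens κ β lam (envelopeCutoff d N β ε x)) -
          vMul volume (fieldKernel L g χ n lam τ)
            (stringTens κ β lam (envelopeCutoff d N β ε x)) +
          vMul volume (K τ) (stringTens κ β lam (envelopeCutoff d N β ε x))‖ ≤
        C * (|τ| * (β ^ (1 - ε)) ^ (μ + 1) + (β ^ (1 - ε)) ^ (ν + 1)) := by
    intro m lam
    by_cases hm : m ∈ M
    · obtain ⟨C, δ, K, h⟩ := exists_string_residual hL hχ hS hm μ hν hρ hT lam
      exact ⟨C, δ, K, fun _ => h⟩
    · exact ⟨0, 0, fun _ _ => 0, fun h => absurd h hm⟩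
  choose C δ K hCδK using hex
  obtain ⟨δ₀, hδ₀, hδ⟩ := exists_pos_forall_le (M.sigma fun m => (Finset.univ : Finset (Fin m → Fin N × ℤˣ)))
    (δ := fun i => δ i.1 i.2) fun i hi => (hCδK i.1 i.2 (Finset.mem_sigma.1 hi).1).2.1
  set A := ∑ m ∈ M, ∑ lam : Fin m → Fin N × ℤˣ, convFactor d m * C m lam with hA
  have hA0 : 0 ≤ A := Finset.sum_nonneg fun m hm => Finset.sum_nonneg fun lam _ =>
    mul_nonneg (convFactor_pos d m).le (hCδK m lam hm).1
  -- The three error terms arise with coefficients $1$ (for $\varrho$), $T^2$ (dispersive) and $T$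
  -- (susceptibility), times $A$; one constant covers all.
  refine ⟨A * (1 + T + T * T), δ₀, by positivity, hδ₀,
    fun β ε ϱ x x' B K' B' K'' hβ hβδ hϱ hx hx' hxr hxr' hVe hVf t ht => ?_⟩
  have hδ' : ∀ m ∈ M, ∀ lam : Fin m → Fin N × ℤˣ, β ^ (1 - ε) ≤ δ m lam := fun m hm lam =>
    hβδ.trans (hδ ⟨m, lam⟩ (Finset.mem_sigma.2 ⟨hm, Finset.mem_univ _⟩))
  set r := β ^ (1 - ε) with hr
  have hr0 : 0 ≤ r := Real.rpow_nonneg hβ.le _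
  set Θ := envelopeCutoff d N β ε with hΘ
  have hΘx : ∀ t, HasDerivAt (fun t => Θ (x t)) (Θ (x' t)) t := fun t =>
    (Θ.restrictScalars ℝ).hasFDerivAt.comp_hasDerivAt t (hx t)
  have hxc : Continuous x := continuous_iff_continuousAt.2 fun t => (hx t).continuousAt
  have hΘc : Continuous fun t => Θ (x t) := Θ.continuous.comp hxc
  have hΘr : ∀ t ∈ Icc 0 T, ‖Θ (x t)‖ ≤ ρ := fun t ht =>
    (norm_envelopeCutoff_apply_le β ε _).trans (hxr t ht)
  have hΘr' : ∀ t ∈ Icc 0 T, ‖Θ (x' t)‖ ≤ ρ := fun t ht =>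
    (norm_envelopeCutoff_apply_le β ε _).trans (hxr' t ht)
  set F : ℝ → LOne d (Field2J J) := fun s => waveOp g n κ β (envelopeVF ω g M χ n κ μ ν β ϱ s (Θ (x s))) -
    fieldVF L M χ ϱ s (waveOp g n κ β (Θ (x s))) with hF
  set G : ℝ → LOne d (Field2J J) := fun s => ∑ m ∈ M, ∑ lam : Fin m → Fin N × ℤˣ, (convFactor d m : ℂ) •
    fiberOp d m (Field2J J) (vMul volume (K m lam (s / ϱ)) (stringTens κ β lam (Θ (x s)))) with hG
  have hFc : Continuous F :=
    ((waveOp g n κ β).continuous.comp (hVe.continuous_comp _ hΘc)).sub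
      (hVf.continuous_comp _ ((waveOp g n κ β).continuous.comp hΘc))
  have hKc : ∀ m ∈ M, ∀ lam : Fin m → Fin N × ℤˣ, Continuous fun s =>
      (convFactor d m : ℂ) • fiberOp d m (Field2J J)
        (vMul volume (K m lam (s / ϱ)) (stringTens κ β lam (Θ (x s)))) := fun m hm lam =>
    ((convFactor d m : ℂ) • fiberOp d m (Field2J J)).continuous.comp
      ((hCδK m lam hm).2.2.1 β ϱ _ hΘc)
  have hGc : Continuous G := continuous_finsetSum _ fun m hm =>
    continuous_finsetSum _ fun lam _ => hKc m hm lam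
  have hGi : ‖∫ s in (0 : ℝ)..t, G s‖ ≤ A * ϱ := by
    have h1 : ∫ s in (0 : ℝ)..t, G s = ∑ m ∈ M, ∑ lam : Fin m → Fin N × ℤˣ, (convFactor d m : ℂ) •
        fiberOp d m (Field2J J) (∫ s in (0 : ℝ)..t,
          vMul volume (K m lam (s / ϱ)) (stringTens κ β lam (Θ (x s)))) := by
      rw [hG, intervalIntegral.integral_finsetSum fun m hm => (continuous_finsetSum _
        fun lam _ => hKc m hm lam).intervalIntegrable 0 t]
      refine Finset.sum_congr rfl fun m hm => ?_
      rw [intervalIntegral.integral_finsetSum fun lam _ => (hKc m hm lam).intervalIntegrable 0 t]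
      refine Finset.sum_congr rfl fun lam _ => ?_
      rw [intervalIntegral.integral_smul]
      congr 1
      exact ((fiberOp d m (Field2J J)).restrictScalars ℝ).intervalIntegral_comp_comm
        (((hCδK m lam hm).2.2.1 β ϱ _ hΘc).intervalIntegrable 0 t)
    rw [h1, hA, Finset.sum_mul]
    refine norm_sum_le_of_le _ fun m hm => ?_
    rw [Finset.sum_mul]
    refine norm_sum_le_of_le _ fun lam _ => ?_
    refine (norm_fiberOp_smul_le _).trans ?_
    rw [mul_assoc]
    exact mul_le_mul_of_nonneg_left ((hCδK m lam hm).2.2.2.1 β ϱ _ _ hϱ hΘx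
      (Θ.continuous.comp hx') hΘr hΘr' t ht) (convFactor_pos d m).le
  have hFG : ∀ s ∈ Icc 0 T, ‖F s + G s‖ ≤ A * (T / ϱ * r ^ (μ + 1) + r ^ (ν + 1)) := by
    intro s hs
    have h1 : F s + G s = ∑ m ∈ M, ∑ lam : Fin m → Fin N × ℤˣ, (convFactor d m : ℂ) •
        fiberOp d m (Field2J J)
          (vMul volume (fun k => ∑ p with lam ∈ resonantStrings ω n κ p.1 p.2 m,
            envelopeKernel ω g χ n κ μ ν β p lam (s / ϱ) k) (stringTens κ β lam (Θ (x s))) -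
          vMul volume (fieldKernel L g χ n lam (s / ϱ)) (stringTens κ β lam (Θ (x s))) +
          vMul volume (K m lam (s / ϱ)) (stringTens κ β lam (Θ (x s)))) := by
      simp only [hF, hG]
      rw [waveOp_envelopeVF hL hχ.two_le hS hβ, fieldVF_waveOp hL hχ hS]
      rw [← Finset.sum_sub_distrib, ← Finset.sum_add_distrib]
      refine Finset.sum_congr rfl fun m _ => ?_
      rw [← Finset.sum_sub_distrib, ← Finset.sum_add_distrib]
      refine Finset.sum_congr rfl fun lam _ => ?_
      rw [map_add, map_sub, smul_add, smul_sub]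
    rw [h1, hA, Finset.sum_mul]
    refine norm_sum_le_of_le _ fun m hm => ?_
    rw [Finset.sum_mul]
    refine norm_sum_le_of_le _ fun lam _ => ?_
    refine (norm_fiberOp_smul_le _).trans ?_
    rw [mul_assoc]
    refine mul_le_mul_of_nonneg_left (((hCδK m lam hm).2.2.2.2 β ε (s / ϱ) (x s) hβ
      (hδ' m hm lam) (hxr s hs)).trans ?_) (convFactor_pos d m).le
    refine mul_le_mul_of_nonneg_left ?_ (hCδK m lam hm).1
    have h2 : |s / ϱ| ≤ T / ϱ := by
      rw [abs_of_nonneg (div_nonneg hs.1 hϱ.le)]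
      exact div_le_div_of_nonneg_right hs.2 hϱ.le
    gcongr
  have hFGi : ‖∫ s in (0 : ℝ)..t, (F s + G s)‖ ≤
      A * (T / ϱ * r ^ (μ + 1) + r ^ (ν + 1)) * T := by
    have h1 := intervalIntegral.norm_integral_le_of_norm_le_const (a := 0) (b := t)
      (f := fun s => F s + G s) (C := A * (T / ϱ * r ^ (μ + 1) + r ^ (ν + 1))) fun s hs => by
        rw [uIoc_of_le ht.1] at hs
        exact hFG s ⟨hs.1.le, hs.2.trans ht.2⟩
    rw [sub_zero, abs_of_nonneg ht.1] at h1
    refine h1.trans (mul_le_mul_of_nonneg_left ht.2 (by positivity))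
  have hsplit : ∫ s in (0 : ℝ)..t, F s =
      (∫ s in (0 : ℝ)..t, (F s + G s)) - ∫ s in (0 : ℝ)..t, G s := by
    rw [intervalIntegral.integral_add (hFc.intervalIntegrable 0 t) (hGc.intervalIntegrable 0 t)]
    abel
  rw [hsplit]
  refine (norm_sub_le _ _).trans ((add_le_add hFGi hGi).trans ?_)
  have e1 : 0 ≤ A * ϱ := by positivity
  have e2 : 0 ≤ A * (r ^ (μ + 1) / ϱ) := by positivity
  have e3 : 0 ≤ A * r ^ (ν + 1) := by positivity
  have e4 : A * (T / ϱ * r ^ (μ + 1) + r ^ (ν + 1)) * T + A * ϱ =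
      A * ϱ + (T * T) * (A * (r ^ (μ + 1) / ϱ)) + T * (A * r ^ (ν + 1)) := by ring
  rw [e4]
  have e5 : 0 ≤ (T + T * T) * (A * ϱ) + (1 + T) * (A * (r ^ (μ + 1) / ϱ)) +
    (1 + T * T) * (A * r ^ (ν + 1)) := by positivity
  linarith

end TotalResidual

/-! ### Comparison of the exact field with the assembled envelopes. -/

section Approximation

variable {d J N : ℕ} {L : Wavevec d → (Field2J J →L[ℂ] Field2J J)}
  {ω : Fin J → ℤˣ → Wavevec d → ℝ} {g : Fin J → ℤˣ → Wavevec d → Field2J J} {M : Finset ℕ}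
  {χ : (m : ℕ) → Wavevec d → (Fin m → Wavevec d) →
      ContinuousMultilinearMap ℂ (fun _ : Fin m => Field2J J) (Field2J J)}
  {n : Fin N → Fin J} {κ : Fin N → Wavevec d} {m : ℕ}

theorem exists_rpow_le {ε δ : ℝ} (hε : ε < 1) (hδ : 0 < δ) :
    ∃ β₀ > 0, β₀ ≤ 1 ∧ ∀ β, 0 < β → β ≤ β₀ → β ^ (1 - ε) ≤ δ := by
  have h1 : 0 < 1 - ε := by linarith
  refine ⟨min 1 (δ ^ (1 - ε)⁻¹), lt_min one_pos (Real.rpow_pos_of_pos hδ _), min_le_left _ _,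
    fun β hβ hβ' => ?_⟩
  calc β ^ (1 - ε) ≤ (δ ^ (1 - ε)⁻¹) ^ (1 - ε) :=
        Real.rpow_le_rpow hβ.le (hβ'.trans (min_le_right _ _)) h1.le
    _ = δ := Real.rpow_inv_rpow hδ.le h1.ne'

theorem errorRate_eq {β : ℝ} (hβ : 0 < β) (μ ν : ℕ) (s ε ϱ : ℝ) :
    errorRate μ ν s ε β ϱ =
      ϱ + (β ^ (1 - ε)) ^ (μ + 1) / ϱ + (β ^ (1 - ε)) ^ (ν + 1) + β ^ s := by
  have h : ∀ j : ℕ, β ^ (((j : ℝ) + 1) * (1 - ε)) = (β ^ (1 - ε)) ^ (j + 1) := fun j => by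
    rw [mul_comm ((j : ℝ) + 1), Real.rpow_mul hβ.le, ← Real.rpow_natCast]
    norm_cast
  rw [errorRate, h, h]

theorem errorRate_nonneg {β ϱ : ℝ} (hβ : 0 < β) (hϱ : 0 < ϱ) (μ ν : ℕ) (s ε : ℝ) :
    0 ≤ errorRate μ ν s ε β ϱ := by
  unfold errorRate
  positivity

theorem rpow_le_errorRate {β ϱ : ℝ} (hβ : 0 < β) (hϱ : 0 < ϱ) (μ ν : ℕ) (s ε : ℝ) :
    β ^ s ≤ errorRate μ ν s ε β ϱ := by
  unfold errorRate
  have : 0 ≤ ϱ + β ^ (((μ : ℝ) + 1) * (1 - ε)) / ϱ + β ^ (((ν : ℝ) + 1) * (1 - ε)) := by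
    positivity
  linarith

theorem IsIntegralSolution.apply_zero {X : Type*} [NormedAddCommGroup X] [NormedSpace ℝ X]
    {V : ℝ → X → X} {T : ℝ} {h : X} {u : ℝ → X} (hu : IsIntegralSolution V T h u) (hT : 0 ≤ T) :
    u 0 = h := by
  simpa using hu.2 0 (left_mem_Icc.2 hT)

-- Grönwall compares the exact field with the full envelope wave. The residual estimate holds only
-- for truncated envelopes, so Lipschitz continuity of both fields transfers it at the cost of a
-- multiple of the tail $\beta^s$.
set_option maxHeartbeats 400000 in
theorem exists_approximation_bound (hL : LinearCondition L ω g)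
    (hχ : NonlinearCondition (bandCrossing L ω) M χ) (hS : SpectrumCondition L ω g M n κ)
    (μ : ℕ) {ν : ℕ} (hν : ν ≤ 1) {T rX rY R C' s ε a : ℝ} (hT : 0 ≤ T) (hrX : 0 ≤ rX)
    (hR : 0 ≤ R) (hC' : 0 ≤ C') (hs : 0 < s) (hε : 0 < ε) (hε1 : ε < 1) (ha : s / ε < a)
    {BX KX BY KY : ℝ → ℝ}
    (hVe : ∀ β ϱ, IsRegularField (envelopeVF ω g M χ n κ μ ν β ϱ) BX KX)
    (hVf : ∀ ϱ, IsRegularField (fieldVF L M χ ϱ) BY KY) :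
    ∃ C β₀ : ℝ, 0 ≤ C ∧ 0 < β₀ ∧ ∀ (β ϱ : ℝ) (H : Envelopes d N) (h D : LOne d (Field2J J))
      (u : ℝ → LOne d (Field2J J)) (x : ℝ → Envelopes d N), 0 < β → β ≤ β₀ → 0 < ϱ →
      (∀ p, weightedNorm a (H p) ≤ ENNReal.ofReal R) →
      h = waveOp g n κ β (envelopeCutoff d N β ε H) + D → ‖D‖ ≤ C' * β ^ s →
      IsIntegralSolution (fieldVF L M χ ϱ) T h u →
      IsIntegralSolution (envelopeVF ω g M χ n κ μ ν β ϱ) T H x →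
      (∀ t ∈ Icc 0 T, ‖u t‖ ≤ rY) → (∀ t ∈ Icc 0 T, ‖x t‖ ≤ rX) →
      ∀ t ∈ Icc 0 T, ‖u t - waveOp g n κ β (x t)‖ ≤ C * errorRate μ ν s ε β ϱ := by
  have ha0 : 0 < a := (div_pos hs hε).trans ha
  -- One radius for the envelopes and their time derivatives, the latter being values of the
  -- envelope field.
  set ρ := max rX (BX rX) with hρ
  obtain ⟨C₁, δ, hC₁, hδ, hres⟩ := exists_residual_bound hL hχ hS μ hν
    (hrX.trans (le_max_left rX (BX rX))) hT
  obtain ⟨C₂, hC₂, htail⟩ := exists_tail_bound (ω := ω) (g := g) (χ := χ) (n := n) (κ := κ)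
    hχ.two_le (T := T) ha0 hrX hR hε ha BX KX
  obtain ⟨β₀, hβ₀, hβ₀1, hβδ⟩ := exists_rpow_le hε1 hδ
  set N2 : ℝ := 2 * N with hN2
  have hN20 : 0 ≤ N2 := by positivity
  set C₃ := N2 * (|KX rX| * C₂) + |KY (N2 * rX)| * (N2 * C₂) with hC₃
  have hC₃0 : 0 ≤ C₃ := by positivity
  set K := max (KY (max rY (N2 * rX))) 1 with hK
  have hV : ∀ (β : ℝ) (x : Envelopes d N), ‖waveOp g n κ β x‖ ≤ N2 * ‖x‖ := fun β x =>
    norm_waveOp_apply_le hL β x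
  refine ⟨(C₁ + C₃ * T + N2 * C₂ + C') * Real.exp (K * T), β₀, by positivity, hβ₀,
    fun β ϱ H h D u x hβ hββ₀ hϱ hH hh hD hu hx hur hxr => ?_⟩
  have htx := htail μ ν β ϱ H x hβ (hββ₀.trans hβ₀1) (hVe β ϱ) hx hxr hH
  set Θ := envelopeCutoff d N β ε with hΘ
  set V := waveOp g n κ β with hVdef
  set r := β ^ (1 - ε) with hr
  have hbs : 0 ≤ β ^ s := Real.rpow_nonneg hβ.le _
  have hGc := (hVe β ϱ).continuousOn_comp hx.1
  -- The integration by parts needs a curve differentiable on the whole line; this one agrees with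
  -- the envelope solution on the interval.
  obtain ⟨y, y', hy'c, hy, hyx, hyG, -⟩ := exists_hasDerivAt_extension hT hGc H
  have hyx' : ∀ t ∈ Icc 0 T, y t = x t := fun t ht => (hyx t ht).trans (hx.2 t ht).symm
  have hxΘr : ∀ t ∈ Icc 0 T, ‖Θ (x t)‖ ≤ rX := fun t ht =>
    (norm_envelopeCutoff_apply_le β ε _).trans (hxr t ht)
  have hres' := hres β ε ϱ y y' BX KX BY KY hβ (hβδ β hβ hββ₀) hϱ hy hy'c
    (fun t ht => by rw [hyx' t ht]; exact (hxr t ht).trans (le_max_left _ _))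
    (fun t ht => by
      rw [hyG ht]
      exact ((hVe β ϱ).bound rX t _ (hxr t ht)).trans (le_max_right _ _)) (hVe β ϱ) (hVf ϱ)
  set A : ℝ → LOne d (Field2J J) := fun s => fieldVF L M χ ϱ s (u s) with hA
  set E : ℝ → LOne d (Field2J J) := fun s => V (envelopeVF ω g M χ n κ μ ν β ϱ s (x s)) with hE
  set P : ℝ → LOne d (Field2J J) := fun s => fieldVF L M χ ϱ s (V (x s)) with hP
  set E' : ℝ → LOne d (Field2J J) := fun s => V (envelopeVF ω g M χ n κ μ ν β ϱ s (Θ (x s)))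
    with hE'
  set P' : ℝ → LOne d (Field2J J) := fun s => fieldVF L M χ ϱ s (V (Θ (x s))) with hP'
  have hAc : ContinuousOn A (Icc 0 T) := (hVf ϱ).continuousOn_comp hu.1
  have hEc : ContinuousOn E (Icc 0 T) := V.continuous.comp_continuousOn hGc
  have hPc : ContinuousOn P (Icc 0 T) :=
    (hVf ϱ).continuousOn_comp (V.continuous.comp_continuousOn hx.1)
  have hEc' : ContinuousOn E' (Icc 0 T) := V.continuous.comp_continuousOn
    ((hVe β ϱ).continuousOn_comp (Θ.continuous.comp_continuousOn hx.1))
  have hPc' : ContinuousOn P' (Icc 0 T) :=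
    (hVf ϱ).continuousOn_comp (V.continuous.comp_continuousOn (Θ.continuous.comp_continuousOn hx.1))
  have hint : ∀ {X : Type} [NormedAddCommGroup X] {f : ℝ → X}, ContinuousOn f (Icc 0 T) →
      ∀ t ∈ Icc 0 T, IntervalIntegrable f volume 0 t := fun hf t ht => by
    refine ContinuousOn.intervalIntegrable (hf.mono ?_)
    rw [uIcc_of_le ht.1]
    exact Icc_subset_Icc_right ht.2
  have hv : ∀ t ∈ Icc 0 T, V (x t) = (∫ s in (0 : ℝ)..t, E s) + V H := fun t ht => by
    rw [hx.2 t ht, map_add]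
    congr 1
    exact ((V.restrictScalars ℝ).intervalIntegral_comp_comm (hint hGc t ht)).symm
  have hVx : ∀ τ ∈ Icc 0 T, ‖V (x τ)‖ ≤ N2 * rX := fun τ hτ =>
    (hV β _).trans (mul_le_mul_of_nonneg_left (hxr τ hτ) hN20)
  have hVΘx : ∀ τ ∈ Icc 0 T, ‖V (Θ (x τ))‖ ≤ N2 * rX := fun τ hτ =>
    (hV β _).trans (mul_le_mul_of_nonneg_left (hxΘr τ hτ) hN20)
  have hVtail : ∀ τ ∈ Icc 0 T, ‖V (x τ) - V (Θ (x τ))‖ ≤ N2 * (C₂ * β ^ s) := fun τ hτ => by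
    rw [← map_sub]
    exact (hV β _).trans (mul_le_mul_of_nonneg_left (htx τ hτ) hN20)
  have hdiff : ∀ τ ∈ Icc 0 T, ‖(E τ - P τ) - (E' τ - P' τ)‖ ≤ C₃ * β ^ s := by
    intro τ hτ
    have h1 : ‖E τ - E' τ‖ ≤ N2 * (|KX rX| * (C₂ * β ^ s)) := by
      simp only [hE, hE']
      rw [← map_sub]
      refine (hV β _).trans (mul_le_mul_of_nonneg_left ?_ hN20)
      refine ((hVe β ϱ).lipschitz rX τ _ _ (hxr τ hτ) (hxΘr τ hτ)).trans ?_
      exact mul_le_mul (le_abs_self _) (htx τ hτ) (norm_nonneg _) (abs_nonneg _)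
    have h2 : ‖P τ - P' τ‖ ≤ |KY (N2 * rX)| * (N2 * (C₂ * β ^ s)) := by
      refine ((hVf ϱ).lipschitz (N2 * rX) τ _ _ (hVx τ hτ) (hVΘx τ hτ)).trans ?_
      exact mul_le_mul (le_abs_self _) (hVtail τ hτ) (norm_nonneg _) (abs_nonneg _)
    have h3 : (E τ - P τ) - (E' τ - P' τ) = (E τ - E' τ) - (P τ - P' τ) := by abel
    rw [h3]
    refine (norm_sub_le _ _).trans ((add_le_add h1 h2).trans (le_of_eq ?_))
    rw [hC₃]
    ring
  set Q := ϱ + r ^ (μ + 1) / ϱ + r ^ (ν + 1) with hQ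
  have hε₁ : ∀ t ∈ Icc 0 T, ‖∫ τ in (0 : ℝ)..t, (E τ - P τ)‖ ≤
      C₁ * Q + C₃ * β ^ s * T := by
    intro t ht
    have h1 : ∫ τ in (0 : ℝ)..t, (E τ - P τ) = (∫ τ in (0 : ℝ)..t, (E' τ - P' τ)) +
        ∫ τ in (0 : ℝ)..t, ((E τ - P τ) - (E' τ - P' τ)) := by
      rw [intervalIntegral.integral_sub (f := fun τ => E τ - P τ) (g := fun τ => E' τ - P' τ)
        (hint (hEc.sub hPc) t ht) (hint (hEc'.sub hPc') t ht)]
      abel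
    have h2 : ∫ τ in (0 : ℝ)..t, (E' τ - P' τ) = ∫ τ in (0 : ℝ)..t,
        (V (envelopeVF ω g M χ n κ μ ν β ϱ τ (Θ (y τ))) - fieldVF L M χ ϱ τ (V (Θ (y τ)))) := by
      refine intervalIntegral.integral_congr fun τ hτ => ?_
      rw [uIcc_of_le ht.1] at hτ
      simp only [hE', hP', hyx' τ ⟨hτ.1, hτ.2.trans ht.2⟩]
    have h3 := intervalIntegral.norm_integral_le_of_norm_le_const (a := 0) (b := t)
      (f := fun τ => (E τ - P τ) - (E' τ - P' τ)) (C := C₃ * β ^ s) fun τ hτ => by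
        rw [uIoc_of_le ht.1] at hτ
        exact hdiff τ ⟨hτ.1.le, hτ.2.trans ht.2⟩
    rw [sub_zero, abs_of_nonneg ht.1] at h3
    rw [h1, h2]
    exact (norm_add_le _ _).trans (add_le_add (hres' t ht)
      (h3.trans (mul_le_mul_of_nonneg_left ht.2 (by positivity))))
  have hε₂ : ‖h - V H‖ ≤ N2 * (C₂ * β ^ s) + C' * β ^ s := by
    have h1 : h - V H = D - (V H - V (Θ H)) := by rw [hh]; abel
    have h2 := hVtail 0 (left_mem_Icc.2 hT)
    rw [hx.apply_zero hT] at h2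
    rw [h1, add_comm]
    exact (norm_sub_le _ _).trans (add_le_add hD h2)
  have hAP : ∀ t ∈ Icc 0 T, ‖A t - P t‖ ≤ K * ‖u t - V (x t)‖ := fun t ht =>
    ((hVf ϱ).lipschitz (max rY (N2 * rX)) t _ _ ((hur t ht).trans (le_max_left _ _))
      ((hVx t ht).trans (le_max_right _ _))).trans
      (mul_le_mul_of_nonneg_right (le_max_left _ _) (norm_nonneg _))
  intro t ht
  refine (gronwall_stability (lt_of_lt_of_le one_pos (le_max_right _ _)) hAc hEc hPc hu.2 hv hAP
    hε₁ hε₂ t ht).trans ?_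
  have hr0 : 0 ≤ r := Real.rpow_nonneg hβ.le _
  have hQ0 : 0 ≤ Q := by positivity
  rw [errorRate_eq hβ, ← hr, ← hQ]
  have h5 : C₁ * Q + C₃ * β ^ s * T + (N2 * (C₂ * β ^ s) + C' * β ^ s) ≤
      (C₁ + C₃ * T + N2 * C₂ + C') * (Q + β ^ s) := by
    have h6 : 0 ≤ (C₃ * T + N2 * C₂ + C') * Q + C₁ * β ^ s := by positivity
    linarith
  calc _ ≤ (C₁ + C₃ * T + N2 * C₂ + C') * (Q + β ^ s) * Real.exp (K * T) :=
        mul_le_mul_of_nonneg_right h5 (Real.exp_pos _).le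
    _ = _ := by ring

end Approximation

/-! ### Extraction of the individual wavepackets. -/

section Components

variable {d J N : ℕ} {L : Wavevec d → (Field2J J →L[ℂ] Field2J J)}
  {ω : Fin J → ℤˣ → Wavevec d → ℝ} {g : Fin J → ℤˣ → Wavevec d → Field2J J} {M : Finset ℕ}
  {χ : (m : ℕ) → Wavevec d → (Fin m → Wavevec d) →
      ContinuousMultilinearMap ℂ (fun _ : Fin m => Field2J J) (Field2J J)}
  {n : Fin N → Fin J} {κ : Fin N → Wavevec d} {m : ℕ}

theorem lintegral_enorm_le_of_ae {α ι E F G : Type*} [MeasurableSpace α] {μ : Measure α}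
    [NormedAddCommGroup E] [NormedAddCommGroup F] [NormedAddCommGroup G] {f : α → E}
    {e : Lp F 1 μ} {s : Finset ι} {w : ι → Lp G 1 μ} {C : ℝ} (hC : 0 ≤ C)
    (h : ∀ᵐ k ∂μ, ‖f k‖ ≤ C * (‖e k‖ + ∑ i ∈ s, ‖w i k‖)) :
    ∫⁻ k, ‖f k‖ₑ ∂μ ≤ ENNReal.ofReal (C * (‖e‖ + ∑ i ∈ s, ‖w i‖)) := by
  have hi : Integrable (fun k => C * (‖e k‖ + ∑ i ∈ s, ‖w i k‖)) μ :=
    ((L1.integrable_coeFn e).norm.add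
      (integrable_finsetSum _ fun i _ => (L1.integrable_coeFn (w i)).norm)).const_mul C
  have h1 : C * (‖e‖ + ∑ i ∈ s, ‖w i‖) = ∫ k, C * (‖e k‖ + ∑ i ∈ s, ‖w i k‖) ∂μ := by
    rw [integral_const_mul, integral_add (L1.integrable_coeFn e).norm
      (integrable_finsetSum _ fun i _ => (L1.integrable_coeFn (w i)).norm),
      integral_finsetSum _ fun i _ => (L1.integrable_coeFn (w i)).norm]
    simp_rw [L1.norm_eq_integral_norm]
  rw [h1, ofReal_integral_eq_lintegral_ofReal hi
    (Eventually.of_forall fun k => by positivity)]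
  refine lintegral_mono_ae ?_
  filter_upwards [h] with k hk
  rw [← ofReal_norm]
  exact ENNReal.ofReal_le_ofReal hk

theorem inner_mode_self (hL : LinearCondition L ω g) {k : Wavevec d}
    (hk : k ∉ bandCrossing L ω) (p : Fin N × ℤˣ) :
    inner ℂ (mode g n p k) (mode g n p k) = (1 : ℂ) := by
  rw [inner_self_eq_norm_sq_to_K, mode, hL.unit k hk]
  simp

theorem norm_inner_mode_le (hL : LinearCondition L ω g) {k : Wavevec d}
    (hk : k ∉ bandCrossing L ω) (p : Fin N × ℤˣ) (w : Field2J J) :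
    ‖(inner ℂ (mode g n p k) w : ℂ)‖ ≤ ‖w‖ := by
  refine (norm_inner_le_norm _ _).trans (le_of_eq ?_)
  rw [mode, hL.unit k hk, one_mul]

/-- Distinct components with a common centre must differ in band or sign, as the pairs of the
spectrum are distinct; their modes are then orthogonal. -/
theorem inner_mode_eq_zero (hL : LinearCondition L ω g) (hS : SpectrumCondition L ω g M n κ)
    {k : Wavevec d} (hk : k ∉ bandCrossing L ω) {p q : Fin N × ℤˣ} (hpq : p ≠ q)
    (hc : center κ p = center κ q) : inner ℂ (mode g n p k) (mode g n q k) = (0 : ℂ) := by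
  refine inner_eigenvectors hL hk fun h => hpq ?_
  have h9 : κ p.1 = κ q.1 := by
    simp only [center, h.2] at hc
    rcases Int.units_eq_one_or q.2 with h | h <;> simpa [h, sgn] using hc
  exact Prod.ext (hS.distinct (Prod.ext h.1 h9)) h.2

/-- Finitely many nonzero distances have a positive minimum, which exceeds the diameter of the
cutoffs for small $\beta$. -/
theorem exists_separation (κ : Fin N → Wavevec d) {ε : ℝ} (hε : ε < 1) :
    ∃ β₀ > 0, ∀ β, 0 < β → β ≤ β₀ → ∀ p q : Fin N × ℤˣ, center κ p ≠ center κ q →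
      2 * β ^ (1 - ε) < ‖center κ p - center κ q‖ := by
  obtain ⟨δ, hδ, h⟩ := exists_pos_forall_le
    (Finset.univ.filter fun i : (Fin N × ℤˣ) × (Fin N × ℤˣ) => center κ i.1 - center κ i.2 ≠ 0)
    (δ := fun i => ‖center κ i.1 - center κ i.2‖) fun i hi =>
      norm_pos_iff.2 (Finset.mem_filter.1 hi).2
  obtain ⟨β₀, hβ₀, -, hβ⟩ := exists_rpow_le hε (show 0 < δ / 3 by positivity)
  refine ⟨β₀, hβ₀, fun β hβ0 hβ1 p q hpq => ?_⟩
  have h1 := h (p, q) (Finset.mem_filter.2 ⟨Finset.mem_univ _, sub_ne_zero.2 hpq⟩)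
  have h2 := hβ β hβ0 hβ1
  simp only at h1
  linarith

/-- Away from band crossings, the component of a wave is given by its envelope up to the tails. -/
theorem norm_cutoff_inner_sub_le (hL : LinearCondition L ω g) (hS : SpectrumCondition L ω g M n κ)
    {k : Wavevec d} (hk : k ∉ bandCrossing L ω) {β ε : ℝ} (hβ : 0 < β)
    (hsep : ∀ p q : Fin N × ℤˣ, center κ p ≠ center κ q →
      2 * β ^ (1 - ε) < ‖center κ p - center κ q‖) (Z : Fin N × ℤˣ → ℂ) (p : Fin N × ℤˣ) :
    ‖(cutoff β ε (center κ p) k : ℂ) * inner ℂ (mode g n p k) (∑ q, Z q • mode g n q k) - Z p‖ ≤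
      ∑ q, ‖(1 - (cutoff β ε (center κ q) k : ℂ)) * Z q‖ := by
  have h1 : (cutoff β ε (center κ p) k : ℂ) * inner ℂ (mode g n p k) (∑ q, Z q • mode g n q k) -
      Z p = ∑ q, ((cutoff β ε (center κ p) k : ℂ) * (Z q * inner ℂ (mode g n p k) (mode g n q k)) -
        if q = p then Z q else 0) := by
    rw [Finset.sum_sub_distrib, Finset.sum_ite_eq' Finset.univ p, if_pos (Finset.mem_univ p),
      inner_sum, Finset.mul_sum]
    simp_rw [inner_smul_right]
  rw [h1]
  refine norm_sum_le_of_le _ fun q _ => ?_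
  by_cases hqp : q = p
  · subst hqp
    rw [if_pos rfl, inner_mode_self hL hk, mul_one, ← norm_neg]
    refine le_of_eq (congrArg norm ?_)
    ring
  rw [if_neg hqp, sub_zero]
  rcases cutoff_eq_zero_or_one β ε (center κ p) k with h2 | h2
  · rw [h2, Complex.ofReal_zero, zero_mul, norm_zero]
    exact norm_nonneg _
  rcases cutoff_eq_zero_or_one β ε (center κ q) k with h3 | h3
  · rw [h2, h3, Complex.ofReal_one, Complex.ofReal_zero, one_mul, sub_zero, one_mul, norm_mul]
    refine mul_le_of_le_one_right (norm_nonneg _) ((norm_inner_mode_le hL hk p _).trans ?_)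
    exact (hL.unit k hk _ _).le
  -- If both cutoffs are active at one point, separation forces the centres to coincide, and the
  -- cross term vanishes by orthogonality.
  · have hc : center κ p = center κ q := by
      by_contra hc
      have h4 := norm_le_of_cutoff_ne_zero hβ (c := center κ p) (k := k) (ε := ε) (by simp [h2])
      have h5 := norm_le_of_cutoff_ne_zero hβ (c := center κ q) (k := k) (ε := ε) (by simp [h3])
      have h6 : ‖center κ p - center κ q‖ ≤ ‖k - center κ q‖ + ‖k - center κ p‖ := by
        have := norm_sub_le (k - center κ q) (k - center κ p)
        rwa [sub_sub_sub_cancel_left] at this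
      linarith [hsep p q hc]
    rw [inner_mode_eq_zero hL hS hk (Ne.symm hqp) hc, mul_zero, mul_zero, norm_zero]
    exact norm_nonneg _

/-- Cutoff and projection do not increase the error of the total field; acting on the assembled wave
they return its component up to the truncated tails. The factor $2$ counts the two signs. -/
theorem lintegral_wavepacketPart_sub_le (hL : LinearCondition L ω g)
    (hS : SpectrumCondition L ω g M n κ) {β ε : ℝ} (hβ : 0 < β)
    (hsep : ∀ p q : Fin N × ℤˣ, center κ p ≠ center κ q →
      2 * β ^ (1 - ε) < ‖center κ p - center κ q‖) (u : LOne d (Field2J J)) (x : Envelopes d N)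
    (l : Fin N) :
    ∫⁻ k, ‖wavepacketPart g n κ β ε l u k -
        ∑ ζ : ℤˣ, rescale β (sgn ζ • κ l) (x (l, ζ)) k • g (n l) ζ k‖ₑ ≤
      ENNReal.ofReal (2 * (‖u - waveOp g n κ β x‖ + 2 * N * ‖x - envelopeCutoff d N β ε x‖)) := by
  set w : Fin N × ℤˣ → LOne d ℂ := fun q =>
    rescaleOp β (center κ q) ((x - envelopeCutoff d N β ε x) q) with hw
  have hwn : ∑ q, ‖w q‖ ≤ 2 * N * ‖x - envelopeCutoff d N β ε x‖ := by
    refine (Finset.sum_le_sum fun q _ => (norm_rescaleOp_apply_le _ _ _).trans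
      (norm_le_pi_norm (x - envelopeCutoff d N β ε x) q)).trans (le_of_eq ?_)
    simp [mul_comm (N : ℝ)]
  have hwc : ∀ q, w q =ᵐ[volume] fun k => (1 - (cutoff β ε (center κ q) k : ℂ)) *
      rescale β (center κ q) (x q) k := fun q => by
    have h1 : w q = rescaleOp β (center κ q) (x q) -
        rescaleOp β (center κ q) (envelopeCutoff d N β ε x q) := by
      rw [← map_sub]
      rfl
    filter_upwards [Lp.coeFn_sub (rescaleOp β (center κ q) (x q))
      (rescaleOp β (center κ q) (envelopeCutoff d N β ε x q)), rescaleOp_coe hβ (center κ q) (x q),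
      rescaleOp_envelopeCutoff hβ ε x q (center κ q)] with k a b c
    rw [h1, a, Pi.sub_apply, b, c]
    ring
  refine (lintegral_enorm_le_of_ae (e := u - waveOp g n κ β x) (s := Finset.univ) (w := w)
    zero_le_two ?_).trans (ENNReal.ofReal_le_ofReal (by linarith))
  filter_upwards [ae_all_iff.2 hwc, Lp.coeFn_sub u (waveOp g n κ β x), waveOp_coe hL hS hβ x,
    ae_noncrossing hL] with k a b c hk
  have h2 : ∀ p : Fin N × ℤˣ, ‖(cutoff β ε (center κ p) k : ℂ) * inner ℂ (mode g n p k) (u k) -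
      rescale β (center κ p) (x p) k‖ ≤ ‖(u - waveOp g n κ β x : LOne d (Field2J J)) k‖ +
        ∑ q, ‖w q k‖ := by
    intro p
    set v : Field2J J := ∑ q, rescale β (center κ q) (x q) k • mode g n q k with hv
    have h3 : (cutoff β ε (center κ p) k : ℂ) * inner ℂ (mode g n p k) (u k) -
      rescale β (center κ p) (x p) k =
        (cutoff β ε (center κ p) k : ℂ) * inner ℂ (mode g n p k) (u k - v) +
        ((cutoff β ε (center κ p) k : ℂ) * inner ℂ (mode g n p k) v -
          rescale β (center κ p) (x p) k) := by
      rw [inner_sub_right]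
      ring
    rw [h3]
    refine (norm_add_le _ _).trans (add_le_add ?_ ?_)
    · rw [b, Pi.sub_apply, c, norm_mul]
      refine le_trans ?_ (norm_inner_mode_le (n := n) hL hk p _)
      refine mul_le_of_le_one_left (norm_nonneg _) ?_
      rcases cutoff_eq_zero_or_one β ε (center κ p) k with h | h <;> simp [h]
    · simp_rw [a]
      exact norm_cutoff_inner_sub_le hL hS hk hβ hsep
        (fun q => rescale β (center κ q) (x q) k) p
  have h4 : wavepacketPart g n κ β ε l u k -
      ∑ ζ : ℤˣ, rescale β (sgn ζ • κ l) (x (l, ζ)) k • g (n l) ζ k =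
      ∑ ζ : ℤˣ, ((cutoff β ε (center κ (l, ζ)) k : ℂ) * inner ℂ (mode g n (l, ζ) k) (u k) -
        rescale β (center κ (l, ζ)) (x (l, ζ)) k) • mode g n (l, ζ) k := by
    rw [wavepacketPart, ← Finset.sum_sub_distrib]
    refine Finset.sum_congr rfl fun ζ _ => ?_
    rw [sub_smul, mul_smul, Complex.coe_smul]
    rfl
  rw [h4]
  have h5 : ∀ ζ ∈ (Finset.univ : Finset ℤˣ),
      ‖((cutoff β ε (center κ (l, ζ)) k : ℂ) * inner ℂ (mode g n (l, ζ) k) (u k) -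
        rescale β (center κ (l, ζ)) (x (l, ζ)) k) • mode g n (l, ζ) k‖ ≤
      ‖(u - waveOp g n κ β x : LOne d (Field2J J)) k‖ + ∑ q, ‖w q k‖ := fun ζ _ => by
    have h6 : ‖mode g n (l, ζ) k‖ = 1 := hL.unit k hk _ _
    rw [norm_smul, h6, mul_one]
    exact h2 (l, ζ)
  refine (norm_sum_le_of_le _ h5).trans (le_of_eq ?_)
  have h7 : (Finset.univ : Finset ℤˣ).card = 2 := rfl
  rw [Finset.sum_const, h7, two_smul]
  exact (two_mul _).symm

theorem lintegral_sub_envelopeWave_le (hL : LinearCondition L ω g)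
    (hS : SpectrumCondition L ω g M n κ) {β : ℝ} (hβ : 0 < β) (u : LOne d (Field2J J))
    (x : Envelopes d N) :
    ∫⁻ k, ‖u k - ∑ l, ∑ ζ : ℤˣ, rescale β (sgn ζ • κ l) (x (l, ζ)) k • g (n l) ζ k‖ₑ ≤
      ENNReal.ofReal ‖u - waveOp g n κ β x‖ := by
  have h := lintegral_enorm_le_of_ae (μ := volume) (e := u - waveOp g n κ β x)
    (s := (∅ : Finset ℕ)) (w := fun _ => (0 : LOne d ℂ)) (f := fun k => u k -
      ∑ l, ∑ ζ : ℤˣ, rescale β (sgn ζ • κ l) (x (l, ζ)) k • g (n l) ζ k) zero_le_one ?_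
  · simpa using h
  filter_upwards [Lp.coeFn_sub u (waveOp g n κ β x), waveOp_coe hL hS hβ x] with k b c
  rw [b, Pi.sub_apply, c, Fintype.sum_prod_type]
  simp [center, mode]

theorem waveOp_envelopeCutoff_coe (hL : LinearCondition L ω g)
    (hS : SpectrumCondition L ω g M n κ) {β : ℝ} (hβ : 0 < β) (ε : ℝ) (x : Envelopes d N) :
    waveOp g n κ β (envelopeCutoff d N β ε x) =ᵐ[volume] fun k => ∑ l, ∑ ζ : ℤˣ,
      cutoff β ε (sgn ζ • κ l) k • rescale β (sgn ζ • κ l) (x (l, ζ)) k • g (n l) ζ k := by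
  filter_upwards [Lp.coeFn_finsetSum Finset.univ fun p =>
      vMul volume (mode g n p) (rescaleOp β (center κ p) (envelopeCutoff d N β ε x p)),
    ae_all_iff.2 fun p => vMul_coe (essBdd_mode hL hS p)
      (rescaleOp β (center κ p) (envelopeCutoff d N β ε x p)),
    ae_all_iff.2 fun p => rescaleOp_envelopeCutoff hβ ε x p (center κ p)] with k a b c
  rw [waveOp_apply, a, Finset.sum_apply, Fintype.sum_prod_type]
  simp_rw [b, c, mul_smul, Complex.coe_smul]
  rfl

end Components

/-! ### Choice of the existence time and final estimates. -/

section Conclusion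

variable {d J N : ℕ} {L : Wavevec d → (Field2J J →L[ℂ] Field2J J)}
  {ω : Fin J → ℤˣ → Wavevec d → ℝ} {g : Fin J → ℤˣ → Wavevec d → Field2J J} {M : Finset ℕ}
  {χ : (m : ℕ) → Wavevec d → (Fin m → Wavevec d) →
      ContinuousMultilinearMap ℂ (fun _ : Fin m => Field2J J) (Field2J J)}
  {n : Fin N → Fin J} {κ : Fin N → Wavevec d} {m : ℕ}

theorem exists_isRegularField_fieldVF (hL : LinearCondition L ω g)
    (hχ : NonlinearCondition (bandCrossing L ω) M χ) :
    ∃ B K : ℝ → ℝ, ∀ ϱ, IsRegularField (fieldVF L M χ ϱ) B K := by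
  obtain ⟨B, K, h⟩ := exists_ballRegular_fieldMap hχ hL
  exact ⟨B, K, fun ϱ => h.isRegularField (fun t u => norm_groupOp_apply_le hL t u)
    (continuous_groupOp_apply hL) ϱ⟩

theorem exists_isRegularField_envelopeVF (ω : Fin J → ℤˣ → Wavevec d → ℝ)
    (g : Fin J → ℤˣ → Wavevec d → Field2J J) (M : Finset ℕ)
    (χ : (m : ℕ) → Wavevec d → (Fin m → Wavevec d) →
      ContinuousMultilinearMap ℂ (fun _ : Fin m => Field2J J) (Field2J J))
    (n : Fin N → Fin J) (κ : Fin N → Wavevec d) :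
    ∃ B K : ℝ → ℝ, ∀ μ ν β ϱ, IsRegularField (envelopeVF ω g M χ n κ μ ν β ϱ) B K := by
  obtain ⟨B, K, h⟩ := exists_ballRegular_envelopeMap ω g M χ n κ
  exact ⟨B, K, fun μ ν β ϱ => (h ν β).isRegularField (norm_phaseOp_apply_le μ β)
    (continuous_phaseOp_apply μ β) ϱ⟩

/-- The data are the field of the truncated envelopes, up to a small error. -/
theorem exists_data_decomposition (hL : LinearCondition L ω g)
    (hS : SpectrumCondition L ω g M n κ) {s ε a R : ℝ} {H : ℝ → Fin N → ℤˣ → LOne d ℂ}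
    {h : ℝ → LOne d (Field2J J)} (hh : IsWavepacketData g n κ s ε a R H h) :
    ∃ β₁ C' : ℝ, 0 < β₁ ∧ 0 ≤ C' ∧ ∀ β, 0 < β → β < β₁ →
      (∀ p : Fin N × ℤˣ, weightedNorm a (H β p.1 p.2) ≤ ENNReal.ofReal R) ∧
      ∃ D : LOne d (Field2J J), ‖D‖ ≤ C' * β ^ s ∧
        h β = waveOp g n κ β (envelopeCutoff d N β ε fun p => H β p.1 p.2) + D := by
  obtain ⟨β₁, hβ₁, D, C', hD⟩ := hh
  refine ⟨β₁, N * |C'|, hβ₁, by positivity, fun β hβ hββ₁ => ?_⟩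
  obtain ⟨h1, h2, h3⟩ := hD β hβ hββ₁
  refine ⟨fun p => h1 p.1 p.2, ∑ l, D β l, ?_, ?_⟩
  · have h4 : ∀ l ∈ (Finset.univ : Finset (Fin N)), ‖D β l‖ ≤ |C'| * β ^ s := fun l _ =>
      (h2 l).trans (mul_le_mul_of_nonneg_right (le_abs_self _) (Real.rpow_nonneg hβ.le _))
    refine (norm_sum_le_of_le _ h4).trans (le_of_eq ?_)
    simp [mul_assoc]
  · refine Lp.ext ?_
    filter_upwards [h3, Lp.coeFn_add (waveOp g n κ β (envelopeCutoff d N β ε fun p => H β p.1 p.2))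
      (∑ l, D β l), Lp.coeFn_finsetSum Finset.univ (D β),
      waveOp_envelopeCutoff_coe (ε := ε) hL hS hβ fun p => H β p.1 p.2] with k a b c e
    rw [a, b, Pi.add_apply, c, e, Finset.sum_apply, ← Finset.sum_add_distrib]

theorem normE_le {T C : ℝ} {f : ℝ → Wavevec d → Field2J J}
    (h : ∀ τ ∈ Icc 0 T, ∫⁻ k, ‖f τ k‖ₑ ≤ ENNReal.ofReal C) : normE T f ≤ ENNReal.ofReal C :=
  iSup₂_le h

set_option maxHeartbeats 400000 in
/-- Approximation of a multi-wavepacket solution by the solution of the envelope system. -/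
theorem exists_envelope_approximation (hL : LinearCondition L ω g)
    (hχ : NonlinearCondition (bandCrossing L ω) M χ) (hS : SpectrumCondition L ω g M n κ)
    {R : ℝ} (hR : 0 < R) :
    ∃ T > 0, ∀ (s ε a : ℝ), 0 < s → 0 < ε → ε < 1 → s / ε < a →
      ∀ (H : ℝ → Fin N → ℤˣ → LOne d ℂ) (h : ℝ → LOne d (Field2J J)),
      IsWavepacketData g n κ s ε a R H h →
      ∀ μ, ∀ ν ≤ 1, ∃ β₀ > 0, ∃ C : ℝ, ∀ β, 0 < β → β ≤ β₀ → ∀ ϱ > 0,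
        (∃ u, IsSolution L M χ ϱ T (h β) u ∧
          ∀ u', IsSolution L M χ ϱ T (h β) u' → EqOn u' u (Icc 0 T)) ∧
        (∃ z, IsEnvelopeSolution ω g M χ n κ μ ν β ϱ T (H β) z ∧
          ∀ z', IsEnvelopeSolution ω g M χ n κ μ ν β ϱ T (H β) z' →
            ∀ l ϑ, EqOn (z' l ϑ) (z l ϑ) (Icc 0 T)) ∧
        ∀ u z, IsSolution L M χ ϱ T (h β) u →
          IsEnvelopeSolution ω g M χ n κ μ ν β ϱ T (H β) z →
          normE T (fun τ k => u τ k - ∑ l, envelopeWave g n κ β z l τ k) ≤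
              ENNReal.ofReal (C * errorRate μ ν s ε β ϱ) ∧
          ∑ l, normE T (fun τ k =>
              wavepacketPart g n κ β ε l (u τ) k - envelopeWave g n κ β z l τ k) ≤
            ENNReal.ofReal (C * errorRate μ ν s ε β ϱ) := by
  obtain ⟨BY, KY, hVf⟩ := exists_isRegularField_fieldVF hL hχ
  obtain ⟨BX, KX, hVe⟩ := exists_isRegularField_envelopeVF ω g M χ n κ
  -- The $2N$ envelopes contribute at most $2NR$ to the data; the $1$ absorbs the tails $D$ once
  -- $\beta$ is small.
  set ρY : ℝ := 2 * N * R + 1 with hρY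
  have hρY0 : 0 ≤ ρY := by positivity
  -- Within this time neither solution can leave the ball of radius one larger than its data. The
  -- choice precedes $s,\epsilon,a,\mu,\nu$ and the data, so it depends only on $R$, the equation
  -- and the spectrum.
  set T : ℝ := (|BX (R + 1)| + |BY (ρY + 1)| + 1)⁻¹ with hTdef
  have hT : 0 < T := by positivity
  have hTX : BX (R + 1) * T ≤ R + 1 - R := by
    rw [hTdef, ← div_eq_mul_inv, div_le_iff₀ (by positivity), add_sub_cancel_left, one_mul]
    linarith [le_abs_self (BX (R + 1)), abs_nonneg (BY (ρY + 1))]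
  have hTY : BY (ρY + 1) * T ≤ ρY + 1 - ρY := by
    rw [hTdef, ← div_eq_mul_inv, div_le_iff₀ (by positivity), add_sub_cancel_left, one_mul]
    linarith [le_abs_self (BY (ρY + 1)), abs_nonneg (BX (R + 1))]
  refine ⟨T, hT, fun s ε a hs hε hε1 ha H h hh μ ν hν => ?_⟩
  have ha0 : 0 < a := (div_pos hs hε).trans ha
  obtain ⟨β₁, C', hβ₁, hC', hdata⟩ := exists_data_decomposition hL hS hh
  obtain ⟨C₁, β₂, hC₁, hβ₂, happ⟩ := exists_approximation_bound (rX := R + 1) (rY := ρY + 1)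
    hL hχ hS μ hν hT.le (by positivity) hR.le hC' hs hε hε1 ha (hVe μ ν) hVf
  obtain ⟨C₂, hC₂, htail⟩ := exists_tail_bound (ω := ω) (g := g) (χ := χ) (n := n) (κ := κ)
    hχ.two_le (T := T) ha0 (show 0 ≤ R + 1 by positivity) hR.le hε ha BX KX
  obtain ⟨β₃, hβ₃, hsep⟩ := exists_separation κ hε1
  -- Taking $1-s$ for the parameter turns the exponent into $s$, so that $C'\beta^s\le1$.
  obtain ⟨β₄, hβ₄, hβ₄1, hsmall⟩ := exists_rpow_le (ε := 1 - s) (δ := (C' + 1)⁻¹) (by linarith)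
    (by positivity)
  -- The half is needed because the data are controlled only for $\beta$ strictly below $\beta_1$.
  refine ⟨min (min (β₁ / 2) β₂) (min β₃ β₄), by positivity,
    C₁ + N * (2 * (C₁ + 2 * N * C₂)), fun β hβ hββ ϱ hϱ => ?_⟩
  have hb1 : β < β₁ := by
    have := (hββ.trans (min_le_left _ _)).trans (min_le_left _ _)
    linarith
  have hb2 : β ≤ β₂ := (hββ.trans (min_le_left _ _)).trans (min_le_right _ _)
  have hb3 : β ≤ β₃ := (hββ.trans (min_le_right _ _)).trans (min_le_left _ _)
  have hb4 : β ≤ β₄ := (hββ.trans (min_le_right _ _)).trans (min_le_right _ _)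
  obtain ⟨hH, D, hD, hhD⟩ := hdata β hβ hb1
  set Hβ : Envelopes d N := fun p => H β p.1 p.2 with hHβ
  have hbs := hsmall β hβ hb4
  rw [sub_sub_cancel] at hbs
  have hHn : ‖Hβ‖ ≤ R := (pi_norm_le_iff_of_nonneg hR.le).2 fun p =>
    norm_le_of_weightedNorm_le ha0.le hR.le (hH p)
  have hhn : ‖h β‖ ≤ ρY := by
    have h1 : ‖waveOp g n κ β (envelopeCutoff d N β ε Hβ)‖ ≤ 2 * N * R :=
      (norm_waveOp_apply_le hL β _).trans (mul_le_mul_of_nonneg_left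
        ((norm_envelopeCutoff_apply_le β ε _).trans hHn) (by positivity))
    have h2 : C' * β ^ s ≤ 1 := by
      refine (mul_le_mul_of_nonneg_left hbs hC').trans ?_
      rw [← div_eq_mul_inv]
      exact div_le_one_of_le₀ (by linarith) (by linarith)
    rw [hhD]
    exact (norm_add_le _ _).trans (add_le_add h1 (hD.trans h2))
  obtain ⟨u₀, hu₀, hu₀r⟩ := (hVf ϱ).exists_isIntegralSolution hT.le hρY0 hhn hTY (by linarith)
  obtain ⟨x₀, hx₀, hx₀r⟩ := (hVe μ ν β ϱ).exists_isIntegralSolution hT.le hR.le hHn hTX (by linarith)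
  have hsol : ∀ u, IsSolution L M χ ϱ T (h β) u → EqOn u u₀ (Icc 0 T) := fun u hu =>
    ((isSolution_iff hL hχ (hVf ϱ)).1 hu).eqOn (hVf ϱ) hu₀
  have henv : ∀ z : Fin N → ℤˣ → ℝ → LOne d ℂ,
      IsEnvelopeSolution ω g M χ n κ μ ν β ϱ T (H β) z →
      EqOn (fun t p => z p.1 p.2 t) x₀ (Icc 0 T) := fun z hz =>
    ((isEnvelopeSolution_iff hχ.two_le (hVe μ ν β ϱ)).1 hz).eqOn (hVe μ ν β ϱ) hx₀
  refine ⟨⟨u₀, (isSolution_iff hL hχ (hVf ϱ)).2 hu₀, hsol⟩,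
    ⟨fun l ϑ t => x₀ t (l, ϑ), (isEnvelopeSolution_iff hχ.two_le (hVe μ ν β ϱ)).2 hx₀,
      fun z' hz' l ϑ t ht => congrFun (henv z' hz' ht) (l, ϑ)⟩, fun u z hu hz => ?_⟩
  set x : ℝ → Envelopes d N := fun t p => z p.1 p.2 t with hxdef
  have hu' := (isSolution_iff hL hχ (hVf ϱ)).1 hu
  have hx' : IsIntegralSolution (envelopeVF ω g M χ n κ μ ν β ϱ) T Hβ x :=
    (isEnvelopeSolution_iff hχ.two_le (hVe μ ν β ϱ)).1 hz
  -- An arbitrary solution has no a priori bound; uniqueness identifies it with the Picard solution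
  -- and transfers the bound of the latter.
  have hur : ∀ t ∈ Icc 0 T, ‖u t‖ ≤ ρY + 1 := fun t ht => by rw [hsol u hu ht]; exact hu₀r t
  have hxr : ∀ t ∈ Icc 0 T, ‖x t‖ ≤ R + 1 := fun t ht => by
    have h1 : x t = x₀ t := henv z hz ht
    rw [h1]
    exact hx₀r t
  have hmain := happ β ϱ Hβ (h β) D u x hβ hb2 hϱ hH hhD hD hu' hx' hur hxr
  have htl : ∀ t ∈ Icc 0 T, ‖x t - envelopeCutoff d N β ε (x t)‖ ≤ C₂ * β ^ s :=
    htail μ ν β ϱ Hβ x hβ (hb4.trans hβ₄1) (hVe μ ν β ϱ) hx' hxr hH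
  set Er := errorRate μ ν s ε β ϱ with hEr
  have hEr0 : 0 ≤ Er := errorRate_nonneg hβ hϱ μ ν s ε
  have hsEr : β ^ s ≤ Er := rpow_le_errorRate hβ hϱ μ ν s ε
  have e1 : 0 ≤ C₁ * Er := by positivity
  have e2 : 0 ≤ 2 * (N : ℝ) * (C₂ * Er) := by positivity
  have e3 : 0 ≤ (N : ℝ) * (2 * (C₁ * Er + 2 * N * (C₂ * Er))) := by positivity
  have e4 : (C₁ + N * (2 * (C₁ + 2 * N * C₂))) * Er =
      C₁ * Er + N * (2 * (C₁ * Er + 2 * N * (C₂ * Er))) := by ring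
  rw [e4]
  constructor
  · refine normE_le fun τ hτ => ?_
    refine (lintegral_sub_envelopeWave_le hL hS hβ (u τ) (x τ)).trans (ENNReal.ofReal_le_ofReal ?_)
    linarith [hmain τ hτ]
  · have h1 : ∀ l ∈ (Finset.univ : Finset (Fin N)), normE T (fun τ k =>
        wavepacketPart g n κ β ε l (u τ) k - envelopeWave g n κ β z l τ k) ≤
        ENNReal.ofReal (2 * (C₁ * Er + 2 * N * (C₂ * Er))) := fun l _ => by
      refine normE_le fun τ hτ => ?_
      refine (lintegral_wavepacketPart_sub_le hL hS hβ (hsep β hβ hb3) (u τ) (x τ) l).trans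
        (ENNReal.ofReal_le_ofReal ?_)
      have h2 := hmain τ hτ
      have h3 : ‖x τ - envelopeCutoff d N β ε (x τ)‖ ≤ C₂ * Er :=
        (htl τ hτ).trans (mul_le_mul_of_nonneg_left hsEr hC₂)
      gcongr
    refine (Finset.sum_le_sum h1).trans ?_
    rw [Finset.sum_const, Finset.card_univ, Fintype.card_fin, ← ENNReal.ofReal_nsmul, nsmul_eq_mul]
    exact ENNReal.ofReal_le_ofReal (by linarith)

end Conclusion

end Wavepacket
end

theorem theorem4 {d J N : ℕ}
    (L : Wavevec d → (Field2J J →L[ℂ] Field2J J))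
    (ω : Fin J → ℤˣ → Wavevec d → ℝ)
    (g : Fin J → ℤˣ → Wavevec d → Field2J J)
    (M : Finset ℕ)
    (χ : (m : ℕ) → Wavevec d → (Fin m → Wavevec d) →
      ContinuousMultilinearMap ℂ (fun _ : Fin m => Field2J J) (Field2J J))
    (n : Fin N → Fin J) (κ : Fin N → Wavevec d)
    (hL : LinearCondition L ω g)
    (hχ : NonlinearCondition (bandCrossing L ω) M χ)
    (hS : SpectrumCondition L ω g M n κ) :
    -- the nonlinearity of the envelope system is weakly universal
    (∀ ν ≤ 1, ∀ β : ℝ, WeaklyUniversal (fun l => ω (n l) 1 (κ l))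
      (envelopeNonlinearity ω g M χ n κ ν β)) ∧
    -- a single wavepacket in a cubic medium: the NLS nonlinearity
    (N = 1 → M = {3} → ∀ l ϑ, ∃ b : ℂ, ∀ (β : ℝ) y η,
      envelopeNonlinearity ω g M χ n κ 0 β y l ϑ η =
        b * tripleConv (y l ϑ) (y l ϑ) (y l (-ϑ)) η) ∧
    -- two counterpropagating wavepackets in a cubic medium: the coupled-mode nonlinearity
    (N = 2 → M = {3} → ∀ l l', l ≠ l' → κ l' = -κ l → κ l ≠ 0 → ∀ ϑ, ∃ b b' : ℂ,
      ∀ (β : ℝ) y η, envelopeNonlinearity ω g M χ n κ 0 β y l ϑ η =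
        b * tripleConv (y l ϑ) (y l (-ϑ)) (y l ϑ) η +
          b' * tripleConv (y l' ϑ) (y l' (-ϑ)) (y l ϑ) η) ∧
    -- the approximation
    ∀ R > 0, ∃ T > 0, ∀ (s ε a : ℝ), 0 < s → 0 < ε → ε < 1 → s / ε < a →
      ∀ (H : ℝ → Fin N → ℤˣ → LOne d ℂ) (h : ℝ → LOne d (Field2J J)),
      IsWavepacketData g n κ s ε a R H h →
      ∀ μ ≤ 3, ∀ ν ≤ 1, ∃ β₀ > 0, ∃ C : ℝ, ∀ β, 0 < β → β ≤ β₀ → ∀ ϱ > 0,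
        (∃ u, IsSolution L M χ ϱ T (h β) u ∧
          ∀ u', IsSolution L M χ ϱ T (h β) u' → EqOn u' u (Icc 0 T)) ∧
        (∃ z, IsEnvelopeSolution ω g M χ n κ μ ν β ϱ T (H β) z ∧
          ∀ z', IsEnvelopeSolution ω g M χ n κ μ ν β ϱ T (H β) z' →
            ∀ l ϑ, EqOn (z' l ϑ) (z l ϑ) (Icc 0 T)) ∧
        ∀ u z, IsSolution L M χ ϱ T (h β) u →
          IsEnvelopeSolution ω g M χ n κ μ ν β ϱ T (H β) z →
          normE T (fun τ k => u τ k - ∑ l, envelopeWave g n κ β z l τ k) ≤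
              ENNReal.ofReal (C * errorRate μ ν s ε β ϱ) ∧
          ∑ l, normE T (fun τ k =>
              wavepacketPart g n κ β ε l (u τ) k - envelopeWave g n κ β z l τ k) ≤
            ENNReal.ofReal (C * errorRate μ ν s ε β ϱ) := by
  refine ⟨fun ν _ β => Wavepacket.weaklyUniversal_envelopeNonlinearity ν β,
    Wavepacket.envelopeNonlinearity_nls hL hS.noncrossing,
    Wavepacket.envelopeNonlinearity_coupled hL hS.noncrossing, fun R hR => ?_⟩
  obtain ⟨T, hT, h⟩ := Wavepacket.exists_envelope_approximation hL hχ hS hR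
  exact ⟨T, hT, fun s ε a hs hε hε1 ha H hβ hH μ _ ν hν => h s ε a hs hε hε1 ha H hβ hH μ ν hν⟩
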